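/- Let $a\in(0,2)$ and let $X=L^2(\mathbb R^2;e^{2ax}\,dx\,dy)$ (complex valued). Let $\varphi(x)=2\,\mathrm{sech}^2x$ and $$\mathcal L u=-\partial_x^3u+4\partial_xu-3\partial_x^{-1}\partial_y^2u-6\partial_x(\varphi u),\qquad (\partial_x^{-1}u)(x,y)=-\int_x^\infty u(x_1,y)\,dx_1,$$ be the linearization of the KP-II equation around the line soliton $\varphi(x-4t)$ in the moving frame, understood in the sense of distributions, with domain $\{u\in X:\mathcal Lu\in X\}$. For $\eta\in\mathbb R$ put $\beta(\eta)=\sqrt{1+i\eta}$ (principal branch), $\lambda(\eta)=4i\eta\beta(\eta)$, $\nu(\eta)=\mathrm{Re}\,\beta(\eta)-1$ and, for $\eta\neq0$, $$g(x,\eta)=\frac{-i}{2\eta\beta(\eta)}\partial_x^2\big(e^{-\beta(\eta)x}\,\mathrm{sech}\,x\big),\qquad g^*(x,\eta)=\partial_x\big(e^{\beta(-\eta)x}\,\mathrm{sech}\,x\big),$$ $$g_1(x,\eta)=g(x,\eta)+g(x,-\eta),\qquad g_2(x,\eta)=i\eta\{g(x,\eta)-g(x,-\eta)\},$$ $$g_1^*(x,\eta)=\tfrac12\{g^*(x,\eta)+g^*(x,-\eta)\},\qquad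 g_2^*(x,\eta)=\tfrac{i}{2\eta}\{g^*(x,\eta)-g^*(x,-\eta)\}.$$ Let $\mathcal F_yf(x,\eta)=(2\pi)^{-1/2}\int f(x,y)e^{-iy\eta}\,dy$ (in the $L^2$ sense). For $\eta_0>0$ with $\nu(\eta_0)<a$ define on $X$ $$P_0(\eta_0)f(x,y)=\frac1{2\pi}\sum_{k=1,2}\int_{-\eta_0}^{\eta_0}a_k(\eta)g_k(x,\eta)e^{iy\eta}\,d\eta,\qquad a_k(\eta)=\sqrt{2\pi}\int_{\mathbb R}(\mathcal F_yf)(x,\eta)\overline{g_k^*(x,\eta)}\,dx,$$ let $P_1(0,\infty)$ be the Fourier projection onto the transverse frequencies $0\le|\eta|\le\infty$, and let $P_2(\eta_0,\infty)=P_1(0,\infty)-P_0(\eta_0)$. **Proposition 3.1.** Let $a\in(0,2)$ and let $\eta_1>0$ satisfy $\nu(\eta_1)<a$. Then $\mathcal L$ generates a $C_0$-semigroup $(e^{t\mathcal L})_{t\ge0}$ on $X$, the operators $P_2(\eta_0,\infty)$, $0<\eta_0\le\eta_1$, are bounded on $X$, and there exist positive constants $K$ and $b$ such that for all $\eta_0\in(0,\eta_1]$,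 $f\in X$ and $t\ge0$, $$\|e^{t\mathcal L}P_2(\eta_0,\infty)f\|_X\le K\big(\eta_0^{-1}e^{\mathrm{Re}\,\lambda(\eta_0)t}+e^{-bt}\big)\|f\|_X.$$ -/

import Mathlib

open MeasureTheory Filter Topology
open scoped NNReal ENNReal FourierTransform

noncomputable section

namespace KPII

/-- The measure `e^{2ax} dx dy` on the plane; a point of the plane is a pair `(x, y)`. -/
def weight (a : ℝ) : Measure (ℝ × ℝ) :=
  (volume : Measure (ℝ × ℝ)).withDensity fun z => ENNReal.ofReal (Real.exp (2 * a * z.1))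

/-- The (complex) Hilbert space `X = L²(ℝ²; e^{2ax} dx dy)`. -/
abbrev X (a : ℝ) : Type := Lp ℂ 2 (weight a)

/-- The profile `φ_c(x) = c sech²(√(c/2) x)` of the line soliton `φ_c(x - 2ct)`. -/
def soliton (c x : ℝ) : ℝ := c / Real.cosh (Real.sqrt (c / 2) * x) ^ 2

/-- `β(η) = √(1 + iη)` (principal branch). -/
def beta (η : ℝ) : ℂ := (1 + Complex.I * (η : ℂ)) ^ (1 / 2 : ℂ)

/-- `ν(η) = Re β(η) - 1`. -/
def nu (η : ℝ) : ℝ := (beta η).re - 1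

/-- `λ(η) = 4iη β(η)`. -/
def lam (η : ℝ) : ℂ := 4 * Complex.I * (η : ℂ) * beta η

/-- The resonant mode `g(x,η) = -i/(2ηβ(η)) ∂_x² (e^{-β(η)x} sech x)`, `η ≠ 0`. -/
def mode (x η : ℝ) : ℂ :=
  -Complex.I / (2 * (η : ℂ) * beta η) *
    iteratedDeriv 2 (fun s : ℝ => Complex.exp (-beta η * (s : ℂ)) / (Real.cosh s : ℂ)) x

/-- The adjoint resonant mode `g*(x,η) = ∂_x (e^{β(-η)x} sech x)`. -/
def adjMode (x η : ℝ) : ℂ :=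
  deriv (fun s : ℝ => Complex.exp (beta (-η) * (s : ℂ)) / (Real.cosh s : ℂ)) x

/-- `g₁(x,η) = g(x,η) + g(x,-η)`. -/
def g1 (x η : ℝ) : ℂ := mode x η + mode x (-η)

/-- `g₂(x,η) = iη (g(x,η) - g(x,-η))`. -/
def g2 (x η : ℝ) : ℂ := Complex.I * (η : ℂ) * (mode x η - mode x (-η))

/-- `g₁*(x,η) = (g*(x,η) + g*(x,-η)) / 2`. -/
def g1star (x η : ℝ) : ℂ := (1 / 2) * (adjMode x η + adjMode x (-η))

/-- `g₂*(x,η) = i/(2η) (g*(x,η) - g*(x,-η))`, `η ≠ 0`. -/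
def g2star (x η : ℝ) : ℂ :=
  Complex.I / (2 * (η : ℂ)) * (adjMode x η - adjMode x (-η))

/-- `F = 𝓕_y f` is the partial Fourier transform in `y` of `f`, with
`(𝓕_y f)(x,η) = (2π)^{-1/2} ∫ f(x,y) e^{-iyη} dy` understood in the `L²(ℝ_y)` sense for almost
every `x` (Mathlib's `𝓕` is taken with the kernel `e^{-2πiyξ}`, so `ξ = η/(2π)`).
The function `F` is determined almost everywhere by `f`. -/
def IsPartialFourier (f F : ℝ × ℝ → ℂ) : Prop :=
  AEStronglyMeasurable F volume ∧
  ∀ᵐ x : ℝ, ∃ h : MemLp (fun y : ℝ => f (x, y)) 2 volume,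
    ∀ᵐ η : ℝ, F (x, η) =
      ((Real.sqrt (2 * Real.pi))⁻¹ : ℂ) * (𝓕 (h.toLp (fun y : ℝ => f (x, y)))) (η / (2 * Real.pi))

/-- `P₁(η₁, η₂)`: restriction to the transverse frequencies `η₁ ≤ |η| ≤ η₂`. -/
def IsBandProjection (a η₁ : ℝ) (η₂ : ℝ≥0∞) (P : X a →L[ℂ] X a) : Prop :=
  ∀ f : X a, ∃ F G : ℝ × ℝ → ℂ, IsPartialFourier f F ∧ IsPartialFourier (P f) G ∧
    ∀ᵐ z : ℝ × ℝ,
      G z = Set.indicator {z : ℝ × ℝ | η₁ ≤ |z.2| ∧ ENNReal.ofReal |z.2| ≤ η₂} F z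

/-- The coefficient `√(2π) ∫ (𝓕_y f)(x,η) conj(g*(x,η)) dx`, where `F = 𝓕_y f` and `gs = g*`. -/
def coeff (gs : ℝ → ℝ → ℂ) (F : ℝ × ℝ → ℂ) (η : ℝ) : ℂ :=
  (Real.sqrt (2 * Real.pi) : ℂ) * ∫ x : ℝ, F (x, η) * (starRingEnd ℂ) (gs x η)

/-- `P₀(η₀)`: the projection onto the low frequency resonant modes,
`P₀(η₀) f(x,y) = (2π)⁻¹ ∑_{k=1,2} ∫_{-η₀}^{η₀} a_k(η) g_k(x,η) e^{iyη} dη`, where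
`a_k(η) = √(2π) ∫ (𝓕_y f)(x,η) conj(g_k*(x,η)) dx`. -/
def IsResonantProjection (a η₀ : ℝ) (P : X a →L[ℂ] X a) : Prop :=
  ∀ f : X a, ∃ F : ℝ × ℝ → ℂ, IsPartialFourier f F ∧
    ∀ᵐ z : ℝ × ℝ, P f z = ((2 * Real.pi : ℝ) : ℂ)⁻¹ *
      ((∫ η in (-η₀)..η₀,
          coeff g1star F η * g1 z.1 η * Complex.exp (Complex.I * (z.2 : ℂ) * (η : ℂ))) +
        ∫ η in (-η₀)..η₀,
          coeff g2star F η * g2 z.1 η * Complex.exp (Complex.I * (z.2 : ℂ) * (η : ℂ)))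

/-- `P₂(η₁, η₂) = P₁(0, η₂) - P₀(η₁)`. -/
def IsNonresonantProjection (a η₁ : ℝ) (η₂ : ℝ≥0∞) (P : X a →L[ℂ] X a) : Prop :=
  ∃ P₁ P₀ : X a →L[ℂ] X a,
    IsBandProjection a 0 η₂ P₁ ∧ IsResonantProjection a η₁ P₀ ∧ P = P₁ - P₀

/-- `w = 𝓛u` in the sense of distributions on `ℝ²`, where
`𝓛u = -∂_x³u + 4∂_x u - 3∂_x⁻¹∂_y²u - 6∂_x(φ u)`, `φ = φ_2`, and `∂_x⁻¹∂_y²u` is the distribution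
`ψ ↦ -∫ (∫_x^∞ u(x₁,y) dx₁) ∂_y²ψ(x,y) dx dy`. -/
def IsLinearizedKP (u w : ℝ × ℝ → ℂ) : Prop :=
  ∀ ψ : ℝ × ℝ → ℂ, ContDiff ℝ ((⊤ : ℕ∞) : WithTop ℕ∞) ψ → HasCompactSupport ψ →
    (∫ z : ℝ × ℝ, w z * ψ z) =
      (∫ z : ℝ × ℝ, u z *
        (iteratedDeriv 3 (fun s : ℝ => ψ (s, z.2)) z.1
          - 4 * deriv (fun s : ℝ => ψ (s, z.2)) z.1
          + 6 * (soliton 2 z.1 : ℂ) * deriv (fun s : ℝ => ψ (s, z.2)) z.1))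
      + 3 * ∫ z : ℝ × ℝ, (∫ x₁ in Set.Ioi z.1, u (x₁, z.2)) *
          iteratedDeriv 2 (fun s : ℝ => ψ (z.1, s)) z.2

/-- `S = (e^{t𝓛})_{t ≥ 0}`: a strongly continuous semigroup of bounded operators on `X` whose
infinitesimal generator is `𝓛` with its maximal domain `{u ∈ X | 𝓛u ∈ X}`.
(A strongly continuous semigroup is determined by its generator.) -/
structure IsLinearizedKPSemigroup (a : ℝ) (S : ℝ≥0 → X a →L[ℂ] X a) : Prop where
  map_zero : S 0 = ContinuousLinearMap.id ℂ (X a)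
  map_add : ∀ s t : ℝ≥0, S (s + t) = (S s).comp (S t)
  continuous : ∀ f : X a, Continuous fun t : ℝ≥0 => S t f
  generator : ∀ u w : X a, IsLinearizedKP u w ↔
    Tendsto (fun t : ℝ≥0 => (t : ℝ)⁻¹ • (S t u - u)) (𝓝[>] 0) (𝓝 w)

end KPII

end

noncomputable section

namespace KPII

/-! ### Resolvents and Yosida approximations of quasi-dissipative linear relations. -/

section HilleYosida
variable {E : Type*} [NormedAddCommGroup E] [NormedSpace ℂ E] [CompleteSpace E]

/-! Multiplication by e^{ax} turns X into the unweighted L² of the plane and ∂ₓ into D = ∂ₓ − a,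
whose inverse J (`resD a`) is bounded by 1/a and is the weighted form of −∫_x^∞. A Fourier transform
in y makes 𝓛 a direct integral of one-dimensional operators 𝓛(η) = −D³ + 4D + 3η²J − 6Dφ, whose
graph is parametrized by g = D³u (`fibreGraph`). Each of them generates a semigroup by the
Hille–Yosida theorem, with a growth bound independent of η, so the semigroups can be integrated over
η. The distributional definition of 𝓛 is matched with the fibres in `isLinearizedKP_iff`, and
everything reduces to bounds on the fibres that are uniform in η (`exists_fibre_decay`).

The decay comes from a linearized Miura transformation. With T = tanh x, the bounded operator Γ =
J²(D² + 4TD + 4 + η²J²) intertwines 𝓛(η) with the constant coefficient operator 𝓛₀(η) = −D³ + 4D +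
3η²J (`IsTower.miura_genMap`), and Re⟨V, 𝓛₀V⟩ ≤ −a(4 − a²)‖V‖². Hence Γ decays exponentially along
the semigroup at every frequency, and the question is how much of u is seen by Γu. With β = β(η) and
γ = β(−η) there is the factorization D²Γ = (D + T − β)(D + T − γ)(D + T + β)(D + T + γ)J². The two
factors on the left are bounded below because T ≤ 1 ≤ Re β, Re γ, so Γu controls F = (D + T + β)(D +
T + γ)J²u (`exists_norm_facOf_le`). The kernel of D + T + β is spanned by e^{(a−β)x} sech x, which
is square integrable exactly when |Re β − a| < 1, that is, for 0 < a < 2, when ν(η) < a. Its image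
under D² is a multiple of the weighted resonant mode.

Small frequencies, 0 < |η| ≤ η₁: F controls u modulo the two modes (`exists_sub_modes_le`), so off
the spectral projection onto the modes the semigroup decays (`exists_decay_of_small`). This
projection is bounded uniformly down to η = 0, because the poles of the modes at η = 0 cancel in it.
Under the evolution the modes at ±η carry the different factors e^{λ(±η)t} and the cancellation is
lost: they contribute |η|⁻¹e^{Re λ(η)t}, which for |η| > η₀ is at most η₀⁻¹e^{Re λ(η₀)t} since Re λ
is decreasing in |η|.

Intermediate frequencies, η₁ ≤ |η| ≤ M: the modes may or may not lie in the space, and the threshold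
may be inside the range. The spectral projection is replaced by local functionals, pairings with a
compactly supported multiple of the reciprocal of e^{(a−β)x} sech x. They are eigenfunctionals of
𝓛(η) up to an error O(‖Γu‖), and together with F they control u near the soliton, while away from
the soliton the energy identity is dissipative. A Lyapunov function combining ‖u‖², the functionals
and ‖Γu‖² decays (`exists_lyapunov_decay`).

Large frequencies: the energy identity suffices, because ‖u‖² ≤ 3‖Ju‖‖Du‖ makes the dissipation at
least of order |η| (`re_inner_fibreGraph_le_of_large`). -/

theorem norm_exp_le_exp_norm (x : E →L[ℂ] E) : ‖NormedSpace.exp x‖ ≤ Real.exp ‖x‖ := by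
  by_cases hE : Nontrivial E
  · have h1 := NormedSpace.norm_expSeries_summable' (𝕂 := ℂ) x
    have h2 := (NormedSpace.exp_series_hasSum_exp' (𝕂 := ℂ) x).tsum_eq
    have h3 : HasSum (fun n : ℕ => ‖x‖ ^ n / (n.factorial : ℝ)) (Real.exp ‖x‖) := by
      rw [Real.exp_eq_exp_ℝ]
      exact NormedSpace.expSeries_div_hasSum_exp ‖x‖
    rw [← h2]
    refine tsum_of_norm_bounded h3 fun n => ?_
    rw [norm_smul, norm_inv, div_eq_inv_mul]
    have : ‖((n.factorial : ℕ) : ℂ)‖ = n.factorial := by simp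
    rw [this]
    gcongr
    exact norm_pow_le x n
  · have : Subsingleton (E →L[ℂ] E) := by
      rw [not_nontrivial_iff_subsingleton] at hE
      exact ⟨fun a b => by ext v; exact Subsingleton.elim _ _⟩
    rw [Subsingleton.elim (NormedSpace.exp x) 0, norm_zero]
    positivity

/-- The Yosida approximation `μ²R - μ` built from a resolvent value `R`. -/
def yosida (μ : ℂ) (R : E →L[ℂ] E) : E →L[ℂ] E := (μ ^ 2) • R - μ • (1 : E →L[ℂ] E)

theorem exp_add_clm {A B : E →L[ℂ] E} (h : Commute A B) :
    NormedSpace.exp (A + B) = NormedSpace.exp A * NormedSpace.exp B :=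
  letI : NormedAlgebra ℚ (E →L[ℂ] E) := NormedAlgebra.restrictScalars ℚ ℂ _
  NormedSpace.exp_add_of_commute h

omit [CompleteSpace E] in
theorem commute_exp_right {A B : E →L[ℂ] E} (h : Commute A B) :
    Commute A (NormedSpace.exp B) :=
  letI : NormedAlgebra ℚ (E →L[ℂ] E) := NormedAlgebra.restrictScalars ℚ ℂ _
  h.exp_right

/-- The exponential splits as e^{tμ²R} e^{−tμ}. Since ‖μ²R‖ ≤ μ, the growth of the first factor is
exactly compensated by the second. -/
theorem norm_exp_yosida_le {μ : ℝ} (hμ : 0 < μ) {R : E →L[ℂ] E} (hR : ‖R‖ ≤ 1 / μ) {t : ℝ}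
    (ht : 0 ≤ t) : ‖NormedSpace.exp ((t : ℂ) • yosida μ R)‖ ≤ 1 := by
  have e1 : (t : ℂ) • yosida μ R =
      ((t : ℂ) * μ ^ 2) • R + (-((t : ℂ) * μ)) • (1 : E →L[ℂ] E) := by
    simp only [yosida]
    module
  have hc : Commute (((t : ℂ) * μ ^ 2) • R) ((-((t : ℂ) * μ)) • (1 : E →L[ℂ] E)) :=
    ((Commute.one_right R).smul_left _).smul_right _
  have e2 : NormedSpace.exp ((-((t : ℂ) * μ)) • (1 : E →L[ℂ] E)) =
      Complex.exp (-((t : ℂ) * μ)) • (1 : E →L[ℂ] E) := by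
    have := NormedSpace.algebraMap_exp_comm (𝕂 := ℂ) (𝔸 := E →L[ℂ] E) (-((t : ℂ) * μ))
    rw [Algebra.algebraMap_eq_smul_one, Algebra.algebraMap_eq_smul_one] at this
    rw [← this, Complex.exp_eq_exp_ℂ]
  rw [e1, exp_add_clm hc, e2]
  have h3 : ‖((t : ℂ) * μ ^ 2) • R‖ ≤ t * μ := by
    have : ‖(t : ℂ) * μ ^ 2‖ = t * μ ^ 2 := by
      rw [norm_mul, norm_pow, Complex.norm_of_nonneg ht, Complex.norm_of_nonneg hμ.le]
    rw [norm_smul, this]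
    calc t * μ ^ 2 * ‖R‖ ≤ t * μ ^ 2 * (1 / μ) := by gcongr
      _ = t * μ := by field_simp
  have h4 : ‖Complex.exp (-((t : ℂ) * μ))‖ = Real.exp (-(t * μ)) := by
    rw [Complex.norm_exp]; simp
  calc _ ≤ ‖NormedSpace.exp (((t : ℂ) * μ ^ 2) • R)‖ *
        ‖Complex.exp (-((t : ℂ) * μ)) • (1 : E →L[ℂ] E)‖ := norm_mul_le _ _
    _ ≤ Real.exp (t * μ) * (Real.exp (-(t * μ)) * 1) := by
        gcongr
        · exact (norm_exp_le_exp_norm _).trans (Real.exp_le_exp.2 h3)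
        · rw [norm_smul, h4]
          gcongr
          exact ContinuousLinearMap.norm_id_le
    _ = 1 := by rw [mul_one, ← Real.exp_add]; simp

theorem hasDerivAt_exp_clm (A : E →L[ℂ] E) (x : E) (t : ℝ) :
    HasDerivAt (fun s : ℝ => NormedSpace.exp ((s : ℂ) • A) x)
      (NormedSpace.exp ((t : ℂ) • A) (A x)) t := by
  have h1 := (hasDerivAt_exp_smul_const (𝕂 := ℂ) A (t : ℂ)).scomp t Complex.ofRealCLM.hasDerivAt
  simp only [Complex.ofRealCLM_apply, Complex.ofReal_one, one_smul] at h1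
  exact ((ContinuousLinearMap.apply ℂ E x).restrictScalars ℝ).hasFDerivAt.comp_hasDerivAt t h1

/-- Interpolation along s ↦ e^{sA}e^{(t−s)B}: its derivative is the same contraction applied to (A −
B)x. This is what makes the Yosida exponentials Cauchy on the domain. -/
theorem norm_exp_smul_sub_le {A B : E →L[ℂ] E} (hAB : Commute A B)
    (hA : ∀ t : ℝ, 0 ≤ t → ‖NormedSpace.exp ((t : ℂ) • A)‖ ≤ 1)
    (hB : ∀ t : ℝ, 0 ≤ t → ‖NormedSpace.exp ((t : ℂ) • B)‖ ≤ 1) {t : ℝ} (ht : 0 ≤ t) (x : E) :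
    ‖NormedSpace.exp ((t : ℂ) • A) x - NormedSpace.exp ((t : ℂ) • B) x‖ ≤ t * ‖A x - B x‖ := by
  have key : ∀ s : ℝ, NormedSpace.exp ((s : ℂ) • A) * NormedSpace.exp (((t - s : ℝ) : ℂ) • B) =
      NormedSpace.exp ((s : ℂ) • (A - B)) * NormedSpace.exp ((t : ℂ) • B) := by
    intro s
    rw [← exp_add_clm ((hAB.smul_left _).smul_right _), ← exp_add_clm]
    · congr 1
      push_cast
      module
    · exact (((hAB.sub_left (Commute.refl B)).smul_left _).smul_right _)
  have hd : ∀ s : ℝ, HasDerivAt (fun s : ℝ => (NormedSpace.exp ((s : ℂ) • A) *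
        NormedSpace.exp (((t - s : ℝ) : ℂ) • B)) x)
      ((NormedSpace.exp ((s : ℂ) • A) * NormedSpace.exp (((t - s : ℝ) : ℂ) • B)) (A x - B x)) s := by
    intro s
    simp_rw [key]
    refine (hasDerivAt_exp_clm (A - B) (NormedSpace.exp ((t : ℂ) • B) x) s).congr_deriv ?_
    have hc : Commute (A - B) (NormedSpace.exp ((t : ℂ) • B)) :=
      commute_exp_right ((hAB.sub_left (Commute.refl B)).smul_right _)
    have : (A - B) (NormedSpace.exp ((t : ℂ) • B) x) = NormedSpace.exp ((t : ℂ) • B) ((A - B) x) :=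
      congrArg (fun M : E →L[ℂ] E => M x) hc.eq
    rw [this]; rfl
  have h := norm_image_sub_le_of_norm_deriv_le_segment'
    (f := fun s : ℝ => (NormedSpace.exp ((s : ℂ) • A) *
      NormedSpace.exp (((t - s : ℝ) : ℂ) • B)) x)
    (a := 0) (b := t) (C := ‖A x - B x‖) (fun s _ => (hd s).hasDerivWithinAt) (by
      intro s hs
      calc _ ≤ ‖NormedSpace.exp ((s : ℂ) • A) * NormedSpace.exp (((t - s : ℝ) : ℂ) • B)‖ *
              ‖A x - B x‖ := ContinuousLinearMap.le_opNorm _ _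
        _ ≤ (1 * 1) * ‖A x - B x‖ := by
            gcongr
            exact (norm_mul_le _ _).trans (mul_le_mul (hA s hs.1) (hB _ (by linarith [hs.2]))
              (norm_nonneg _) zero_le_one)
        _ = ‖A x - B x‖ := by ring) t (Set.right_mem_Icc.2 ht)
  simpa [NormedSpace.exp_zero, mul_comm] using h


/-- A linear relation that is quasi-dissipative with constant `ω`, has dense domain, and for which
`l - G` is onto for `l > ω`. -/
structure IsQuasiDissipative (G : Submodule ℂ (E × E)) (ω : ℝ) : Prop where
  bound : ∀ p ∈ G, ∀ l : ℝ, ω < l → (l - ω) * ‖p.1‖ ≤ ‖(l : ℂ) • p.1 - p.2‖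
  surj : ∀ l : ℝ, ω < l → ∀ f : E, ∃ p ∈ G, (l : ℂ) • p.1 - p.2 = f
  dense : Dense (Prod.fst '' (G : Set (E × E)))

namespace IsQuasiDissipative
variable {G : Submodule ℂ (E × E)} {ω : ℝ}

omit [CompleteSpace E] in
theorem unique (hG : IsQuasiDissipative G ω) {l : ℝ} (hl : ω < l) {p q : E × E} (hp : p ∈ G)
    (hq : q ∈ G) (h : (l : ℂ) • p.1 - p.2 = (l : ℂ) • q.1 - q.2) : p.1 = q.1 := by
  have h1 := hG.bound _ (G.sub_mem hp hq) l hl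
  have h2 : (l : ℂ) • (p - q).1 - (p - q).2 = 0 := by
    simp only [Prod.fst_sub, Prod.snd_sub, smul_sub]
    rw [sub_sub_sub_comm, h, sub_self]
  rw [h2, norm_zero] at h1
  have h3 : ‖(p - q).1‖ ≤ 0 := by
    by_contra hc
    push Not at hc
    nlinarith
  exact sub_eq_zero.1 (norm_le_zero_iff.1 h3)

/-- The resolvent `(l - G)⁻¹`. -/
def resolvent (hG : IsQuasiDissipative G ω) {l : ℝ} (hl : ω < l) : E →L[ℂ] E :=
  LinearMap.mkContinuous
    { toFun := fun f => (hG.surj l hl f).choose.1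
      map_add' := fun f g => by
        have hf := (hG.surj l hl f).choose_spec
        have hg := (hG.surj l hl g).choose_spec
        have hfg := (hG.surj l hl (f + g)).choose_spec
        refine hG.unique hl hfg.1 (G.add_mem hf.1 hg.1) ?_
        rw [hfg.2, Prod.fst_add, Prod.snd_add, smul_add, add_sub_add_comm, hf.2, hg.2]
      map_smul' := fun c f => by
        have hf := (hG.surj l hl f).choose_spec
        have hcf := (hG.surj l hl (c • f)).choose_spec
        refine hG.unique hl hcf.1 (G.smul_mem c hf.1) ?_
        rw [hcf.2, Prod.smul_fst, Prod.smul_snd, smul_comm, ← smul_sub, hf.2] }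
    (1 / (l - ω)) (fun f => by
      have hf := (hG.surj l hl f).choose_spec
      have h1 := hG.bound _ hf.1 l hl
      rw [hf.2] at h1
      have : 0 < l - ω := sub_pos.2 hl
      rw [div_mul_eq_mul_div, one_mul, le_div_iff₀ this, mul_comm]
      exact h1)

omit [CompleteSpace E] in
theorem resolvent_mem (hG : IsQuasiDissipative G ω) {l : ℝ} (hl : ω < l) (f : E) :
    (hG.resolvent hl f, (l : ℂ) • hG.resolvent hl f - f) ∈ G := by
  have hf := (hG.surj l hl f).choose_spec
  have e : (l : ℂ) • hG.resolvent hl f - f = (hG.surj l hl f).choose.2 := by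
    exact sub_eq_iff_eq_add'.2 (sub_eq_iff_eq_add.1 hf.2)
  rw [e]
  exact hf.1

omit [CompleteSpace E] in
theorem resolvent_apply (hG : IsQuasiDissipative G ω) {l : ℝ} (hl : ω < l) {u w : E}
    (h : (u, w) ∈ G) : hG.resolvent hl ((l : ℂ) • u - w) = u :=
  hG.unique hl (hG.resolvent_mem hl _) h (by simp)

omit [CompleteSpace E] in
theorem mem_of_resolvent (hG : IsQuasiDissipative G ω) {l : ℝ} (hl : ω < l) {u w : E}
    (h : hG.resolvent hl ((l : ℂ) • u - w) = u) : (u, w) ∈ G := by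
  have := hG.resolvent_mem hl ((l : ℂ) • u - w)
  rw [h] at this
  simpa using this

omit [CompleteSpace E] in
theorem norm_resolvent_le (hG : IsQuasiDissipative G ω) {l : ℝ} (hl : ω < l) :
    ‖hG.resolvent hl‖ ≤ 1 / (l - ω) :=
  LinearMap.mkContinuous_norm_le _ (by have : 0 < l - ω := sub_pos.2 hl; positivity) _

omit [CompleteSpace E] in
-- The resolvent identity is used in both orders; the sum of the two versions is the commutator
-- multiplied by l − m.
theorem resolvent_commute (hG : IsQuasiDissipative G ω) {l m : ℝ} (hl : ω < l) (hm : ω < m) :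
    Commute (hG.resolvent hl) (hG.resolvent hm) := by
  rcases eq_or_ne l m with rfl | hne
  · exact Commute.refl _
  have key : ∀ {l m : ℝ} (hl : ω < l) (hm : ω < m) (f : E), hG.resolvent hm f =
      ((l : ℂ) - m) • hG.resolvent hl (hG.resolvent hm f) + hG.resolvent hl f := by
    intro l m hl hm f
    have h := hG.resolvent_apply hl (hG.resolvent_mem hm f)
    rw [← map_smul, ← map_add]
    conv_lhs => rw [← h]
    congr 1
    module
  ext f
  have h1 := key hl hm f
  have h2 := key hm hl f
  have hne' : (l : ℂ) - m ≠ 0 := sub_ne_zero.2 (by exact_mod_cast hne)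
  have h3 : ((l : ℂ) - m) • (hG.resolvent hl (hG.resolvent hm f)) =
      ((l : ℂ) - m) • (hG.resolvent hm (hG.resolvent hl f)) := by
    linear_combination (norm := module) (-1 : ℂ) • h1 + (-1 : ℂ) • h2
  exact smul_right_injective E hne' h3

theorem lt_shift (ω : ℝ) (n : ℕ) : ω < ω + (n + 1) := by
  have : (0 : ℝ) ≤ n := n.cast_nonneg
  linarith

/-- The `n`-th Yosida approximation of `G - ω`. -/
def approx (hG : IsQuasiDissipative G ω) (n : ℕ) : E →L[ℂ] E :=
  yosida (((n : ℝ) + 1 : ℝ) : ℂ) (hG.resolvent (lt_shift ω n))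

theorem norm_exp_approx_le (hG : IsQuasiDissipative G ω) (n : ℕ) {t : ℝ} (ht : 0 ≤ t) :
    ‖NormedSpace.exp ((t : ℂ) • hG.approx n)‖ ≤ 1 := by
  refine norm_exp_yosida_le (by positivity) ?_ ht
  have := hG.norm_resolvent_le (lt_shift ω n)
  simpa using this

omit [CompleteSpace E] in
theorem approx_commute_resolvent (hG : IsQuasiDissipative G ω) (n : ℕ) {l : ℝ} (hl : ω < l) :
    Commute (hG.approx n) (hG.resolvent hl) := by
  unfold approx yosida
  exact ((hG.resolvent_commute _ hl).smul_left _).sub_left ((Commute.one_left _).smul_left _)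

omit [CompleteSpace E] in
theorem approx_commute (hG : IsQuasiDissipative G ω) (n m : ℕ) :
    Commute (hG.approx n) (hG.approx m) := by
  conv => arg 2; unfold approx yosida
  exact ((hG.approx_commute_resolvent n _).smul_right _).sub_right
    ((Commute.one_right _).smul_right _)

omit [CompleteSpace E] in
-- On the domain, the approximation of G − ω is the bounded family (n + 1)R applied to (G − ω)u.
-- Both the uniform bound and the convergence of the approximations on the domain are read off from
-- this form.
theorem approx_apply (hG : IsQuasiDissipative G ω) (n : ℕ) {u w : E} (h : (u, w) ∈ G) :
    hG.approx n u = (((n : ℝ) + 1 : ℝ) : ℂ) •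
      hG.resolvent (lt_shift ω n) (w - (ω : ℂ) • u) := by
  have h1 := hG.resolvent_apply (lt_shift ω n) h
  have h2 : w - (ω : ℂ) • u = (((n : ℝ) + 1 : ℝ) : ℂ) • u -
      (((ω + (n + 1) : ℝ) : ℂ) • u - w) := by
    push_cast; module
  rw [h2, map_sub, h1, map_smul]
  simp only [approx, yosida, sub_apply, smul_apply,
    one_apply_eq_self, smul_sub, smul_smul, sq]

omit [CompleteSpace E] in
-- For u in the domain the error is R(w − ωu), of size 1/(n + 1). The family is bounded by one, so
-- density of the domain gives the rest.
theorem tendsto_smul_resolvent (hG : IsQuasiDissipative G ω) (x : E) :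
    Tendsto (fun n : ℕ => (((n : ℝ) + 1 : ℝ) : ℂ) • hG.resolvent (lt_shift ω n) x) atTop
      (𝓝 x) := by
  have hb : ∀ n : ℕ, ‖(((n : ℝ) + 1 : ℝ) : ℂ) • hG.resolvent (lt_shift ω n)‖ ≤ 1 := by
    intro n
    have h1 := hG.norm_resolvent_le (lt_shift ω n)
    rw [norm_smul, Complex.norm_of_nonneg (by positivity)]
    have h2 : (0 : ℝ) < n + 1 := by positivity
    calc ((n : ℝ) + 1) * ‖hG.resolvent (lt_shift ω n)‖
        ≤ ((n : ℝ) + 1) * (1 / (n + 1)) := by gcongr; simpa using h1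
      _ = 1 := by field_simp
  have hD : ∀ u ∈ Prod.fst '' (G : Set (E × E)), Tendsto (fun n : ℕ => (((n : ℝ) + 1 : ℝ) : ℂ) •
      hG.resolvent (lt_shift ω n) u) atTop (𝓝 u) := by
    rintro _ ⟨⟨u, w⟩, h, rfl⟩
    rw [tendsto_iff_norm_sub_tendsto_zero]
    have h0 : Tendsto (fun n : ℕ => 1 / ((n : ℝ) + 1) * ‖w - (ω : ℂ) • u‖) atTop (𝓝 0) := by
      simpa using (tendsto_one_div_add_atTop_nhds_zero_nat (𝕜 := ℝ)).mul_const ‖w - (ω : ℂ) • u‖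
    refine squeeze_zero (fun _ => norm_nonneg _) (fun n => ?_) h0
    have h1 := hG.resolvent_apply (lt_shift ω n) h
    have h2 : (((n : ℝ) + 1 : ℝ) : ℂ) • hG.resolvent (lt_shift ω n) u - u =
        hG.resolvent (lt_shift ω n) (w - (ω : ℂ) • u) := by
      nth_rewrite 2 [← h1]
      rw [← map_smul, ← map_sub]
      congr 1
      push_cast; module
    simp only
    rw [h2]
    refine (ContinuousLinearMap.le_opNorm _ _).trans ?_
    gcongr
    have := hG.norm_resolvent_le (lt_shift ω n)
    simpa using this
  rw [Metric.tendsto_atTop]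
  intro ε hε
  obtain ⟨u, hu, hxu⟩ := hG.dense.exists_dist_lt x (show 0 < ε / 3 by positivity)
  obtain ⟨N, hN⟩ := Metric.tendsto_atTop.1 (hD u hu) (ε / 3) (by positivity)
  refine ⟨N, fun n hn => ?_⟩
  have h1 : dist ((((n : ℝ) + 1 : ℝ) : ℂ) • hG.resolvent (lt_shift ω n) x)
      ((((n : ℝ) + 1 : ℝ) : ℂ) • hG.resolvent (lt_shift ω n) u) ≤ dist x u := by
    rw [dist_eq_norm, dist_eq_norm, ← smul_sub, ← map_sub, ← smul_apply]
    refine (ContinuousLinearMap.le_opNorm _ _).trans ?_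
    exact mul_le_of_le_one_left (norm_nonneg _) (hb n)
  have h2 := hN n hn
  rw [dist_comm] at hxu
  calc _ ≤ dist ((((n : ℝ) + 1 : ℝ) : ℂ) • hG.resolvent (lt_shift ω n) x)
        ((((n : ℝ) + 1 : ℝ) : ℂ) • hG.resolvent (lt_shift ω n) u) + dist
        ((((n : ℝ) + 1 : ℝ) : ℂ) • hG.resolvent (lt_shift ω n) u) u + dist u x :=
        dist_triangle4 _ _ _ _
    _ < ε := by rw [dist_comm x u] at h1; linarith

end IsQuasiDissipative
end HilleYosida
end KPII

namespace KPII

/-! ### The generated semigroup, and decay of quadratic forms along it. -/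

section Semigroup
variable {E : Type*} [NormedAddCommGroup E] [NormedSpace ℂ E]

/-- A strongly continuous semigroup whose generator extends `G`, with growth bound `ω`, and which
leaves `G` invariant. -/
structure IsSemigroupOf (G : Submodule ℂ (E × E)) (ω : ℝ) (S : ℝ → E →L[ℂ] E) : Prop where
  zero : S 0 = 1
  add : ∀ s t : ℝ, 0 ≤ s → 0 ≤ t → S (s + t) = S s * S t
  norm_le : ∀ t : ℝ, 0 ≤ t → ‖S t‖ ≤ Real.exp (ω * t)
  cont : ∀ x : E, ContinuousOn (fun t => S t x) (Set.Ici 0)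
  integral : ∀ u w : E, (u, w) ∈ G → ∀ t : ℝ, 0 ≤ t → S t u - u = ∫ s in (0 : ℝ)..t, S s w
  mem : ∀ u w : E, (u, w) ∈ G → ∀ t : ℝ, 0 ≤ t → (S t u, S t w) ∈ G

theorem tendsto_of_dense_of_norm_le {B : ℕ → E →L[ℂ] E} [CompleteSpace E] (hB : ∀ n, ‖B n‖ ≤ 1)
    {D : Set E} (hD : Dense D) (h : ∀ u ∈ D, CauchySeq fun n => B n u) (x : E) :
    CauchySeq fun n => B n x := by
  rw [Metric.cauchySeq_iff]
  intro ε hε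
  obtain ⟨u, hu, hxu⟩ := hD.exists_dist_lt x (show 0 < ε / 3 by positivity)
  obtain ⟨N, hN⟩ := Metric.cauchySeq_iff.1 (h u hu) (ε / 3) (by positivity)
  refine ⟨N, fun m hm n hn => ?_⟩
  have hb : ∀ k, dist (B k x) (B k u) ≤ dist x u := fun k => by
    rw [dist_eq_norm, dist_eq_norm, ← map_sub]
    exact ((B k).le_opNorm _).trans (mul_le_of_le_one_left (norm_nonneg _) (hB k))
  calc dist (B m x) (B n x) ≤ dist (B m x) (B m u) + dist (B m u) (B n u) + dist (B n u) (B n x) :=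
        dist_triangle4 _ _ _ _
    _ < ε := by
        have h1 := hb m
        have h2 := hb n
        have h3 := hN m hm n hn
        rw [dist_comm (B n x)] at h2
        linarith

variable [CompleteSpace E] {G : Submodule ℂ (E × E)} {ω : ℝ}

namespace IsQuasiDissipative

omit [CompleteSpace E] in
theorem approx_tendsto (hG : IsQuasiDissipative G ω) {u w : E} (h : (u, w) ∈ G) :
    Tendsto (fun n => hG.approx n u) atTop (𝓝 (w - (ω : ℂ) • u)) := by
  simp_rw [hG.approx_apply _ h]
  exact hG.tendsto_smul_resolvent _

omit [CompleteSpace E] in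
theorem norm_approx_apply_le (hG : IsQuasiDissipative G ω) {u w : E} (h : (u, w) ∈ G) (n : ℕ) :
    ‖hG.approx n u‖ ≤ ‖w - (ω : ℂ) • u‖ := by
  rw [hG.approx_apply n h, norm_smul, Complex.norm_of_nonneg (by positivity)]
  have h1 := hG.norm_resolvent_le (lt_shift ω n)
  calc ((n : ℝ) + 1) * ‖hG.resolvent (lt_shift ω n) (w - (ω : ℂ) • u)‖
      ≤ ((n : ℝ) + 1) * (1 / (n + 1) * ‖w - (ω : ℂ) • u‖) := by
        gcongr
        refine (ContinuousLinearMap.le_opNorm _ _).trans ?_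
        gcongr
        simpa using h1
    _ = _ := by field_simp

/-- On the domain the difference of two exponentials is at most t‖A_m u − A_n u‖, and A_n u
converges there; contractivity extends the Cauchy property to all vectors. -/
theorem cauchySeq_exp (hG : IsQuasiDissipative G ω) {t : ℝ} (ht : 0 ≤ t) (x : E) :
    CauchySeq fun n => NormedSpace.exp ((t : ℂ) • hG.approx n) x := by
  refine tendsto_of_dense_of_norm_le (fun n => hG.norm_exp_approx_le n ht) hG.dense ?_ x
  rintro _ ⟨⟨u, w⟩, h, rfl⟩
  have hc := (hG.approx_tendsto h).cauchySeq
  rw [Metric.cauchySeq_iff] at hc ⊢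
  intro ε hε
  obtain ⟨N, hN⟩ := hc (ε / (t + 1)) (by positivity)
  refine ⟨N, fun m hm n hn => ?_⟩
  have h1 := norm_exp_smul_sub_le (hG.approx_commute m n) (fun _ => hG.norm_exp_approx_le m)
    (fun _ => hG.norm_exp_approx_le n) ht u
  have h2 := hN m hm n hn
  rw [dist_eq_norm] at h2 ⊢
  refine h1.trans_lt ?_
  calc t * ‖hG.approx m u - hG.approx n u‖ ≤ t * (ε / (t + 1)) := by gcongr
    _ < (t + 1) * (ε / (t + 1)) := by
        have : 0 < ε / (t + 1) := by positivity
        nlinarith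
    _ = ε := by field_simp

theorem tendsto_limUnder (hG : IsQuasiDissipative G ω) {t : ℝ} (ht : 0 ≤ t) (x : E) :
    Tendsto (fun n => NormedSpace.exp ((t : ℂ) • hG.approx n) x) atTop
      (𝓝 (limUnder atTop fun n => NormedSpace.exp ((t : ℂ) • hG.approx n) x)) :=
  tendsto_nhds_limUnder (cauchySeq_tendsto_of_complete (hG.cauchySeq_exp ht x))

/-- The semigroup generated by a quasi-dissipative relation with full range. -/
def semigroup (hG : IsQuasiDissipative G ω) (t : ℝ) : E →L[ℂ] E :=
  if ht : 0 ≤ t then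
    -- The approximations belong to the shifted relation G − ω, for which they are contractions; the
    -- scalar factor undoes the shift.
    (Real.exp (ω * t) : ℂ) • LinearMap.mkContinuous
      { toFun := fun x => limUnder atTop fun n => NormedSpace.exp ((t : ℂ) • hG.approx n) x
        map_add' := fun x y => by
          refine Tendsto.limUnder_eq ?_
          simp_rw [map_add]
          exact (hG.tendsto_limUnder ht x).add (hG.tendsto_limUnder ht y)
        map_smul' := fun c x => by
          refine Tendsto.limUnder_eq ?_
          simp_rw [map_smul]
          exact (hG.tendsto_limUnder ht x).const_smul c } 1 (fun x => by
        rw [one_mul]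
        refine le_of_tendsto (hG.tendsto_limUnder ht x).norm
          (Eventually.of_forall fun n => ?_)
        exact (ContinuousLinearMap.le_opNorm _ _).trans
          (mul_le_of_le_one_left (norm_nonneg _) (hG.norm_exp_approx_le n ht)))
  -- Default value at negative times; only t ≥ 0 is ever used.
  else 0

theorem tendsto_semigroup (hG : IsQuasiDissipative G ω) {t : ℝ} (ht : 0 ≤ t) (x : E) :
    Tendsto (fun n => (Real.exp (ω * t) : ℂ) • NormedSpace.exp ((t : ℂ) • hG.approx n) x) atTop
      (𝓝 (hG.semigroup t x)) := by
  rw [semigroup, dif_pos ht]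
  exact (hG.tendsto_limUnder ht x).const_smul _

theorem norm_semigroup_le (hG : IsQuasiDissipative G ω) {t : ℝ} (ht : 0 ≤ t) :
    ‖hG.semigroup t‖ ≤ Real.exp (ω * t) := by
  refine ContinuousLinearMap.opNorm_le_bound _ (Real.exp_pos _).le fun x => ?_
  refine le_of_tendsto (hG.tendsto_semigroup ht x).norm (Eventually.of_forall fun n => ?_)
  rw [norm_smul, Complex.norm_of_nonneg (Real.exp_pos _).le]
  gcongr
  exact (ContinuousLinearMap.le_opNorm _ _).trans
    (mul_le_of_le_one_left (norm_nonneg _) (hG.norm_exp_approx_le n ht))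

/-- With the factor e^{−ωt} removed one is back at the contraction semigroup of G − ω, whose orbits
in the domain have speed at most ‖(G − ω)u‖. Strong continuity follows by density. -/
theorem semigroup_lipschitz (hG : IsQuasiDissipative G ω) {u w : E} (h : (u, w) ∈ G) {s t : ℝ}
    (hs : 0 ≤ s) (hst : s ≤ t) :
    ‖(Real.exp (-(ω * t)) : ℂ) • hG.semigroup t u - (Real.exp (-(ω * s)) : ℂ) •
      hG.semigroup s u‖ ≤ ‖w - (ω : ℂ) • u‖ * (t - s) := by
  have key : ∀ r : ℝ, 0 ≤ r → Tendsto (fun n => NormedSpace.exp ((r : ℂ) • hG.approx n) u) atTop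
      (𝓝 ((Real.exp (-(ω * r)) : ℂ) • hG.semigroup r u)) := by
    intro r hr
    refine ((hG.tendsto_semigroup hr u).const_smul (Real.exp (-(ω * r)) : ℂ)).congr fun n => ?_
    rw [smul_smul, ← Complex.ofReal_mul, ← Real.exp_add]
    simp
  refine le_of_tendsto ((key t (hs.trans hst)).sub (key s hs)).norm
    (Eventually.of_forall fun n => ?_)
  refine norm_image_sub_le_of_norm_deriv_le_segment'
    (f := fun r : ℝ => NormedSpace.exp ((r : ℂ) • hG.approx n) u)
    (fun r _ => (hasDerivAt_exp_clm _ u r).hasDerivWithinAt) (fun r hr => ?_) t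
    (Set.right_mem_Icc.2 hst)
  exact ((ContinuousLinearMap.le_opNorm _ _).trans (mul_le_of_le_one_left (norm_nonneg _)
    (hG.norm_exp_approx_le n (hs.trans hr.1)))).trans (hG.norm_approx_apply_le h n)

theorem semigroup_continuousOn (hG : IsQuasiDissipative G ω) (x : E) :
    ContinuousOn (fun t => hG.semigroup t x) (Set.Ici 0) := by
  have hD : ∀ u ∈ Prod.fst '' (G : Set (E × E)), ContinuousOn
      (fun t : ℝ => (Real.exp (-(ω * t)) : ℂ) • hG.semigroup t u) (Set.Ici 0) := by
    rintro _ ⟨⟨u, w⟩, h, rfl⟩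
    have : LipschitzOnWith (Real.toNNReal ‖w - (ω : ℂ) • u‖)
        (fun t : ℝ => (Real.exp (-(ω * t)) : ℂ) • hG.semigroup t u) (Set.Ici 0) := by
      refine LipschitzOnWith.of_dist_le_mul fun t ht s hs => ?_
      rw [Real.coe_toNNReal _ (norm_nonneg _)]
      rcases le_total s t with hst | hst
      · rw [dist_eq_norm, Real.dist_eq, abs_of_nonneg (sub_nonneg.2 hst)]
        exact hG.semigroup_lipschitz h hs hst
      · rw [dist_comm, dist_comm t, dist_eq_norm, Real.dist_eq, abs_of_nonneg (sub_nonneg.2 hst)]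
        exact hG.semigroup_lipschitz h ht hst
    exact this.continuousOn
  have hc : ContinuousOn (fun t : ℝ => (Real.exp (-(ω * t)) : ℂ) • hG.semigroup t x)
      (Set.Ici 0) := by
    refine continuousOn_of_uniform_approx_of_continuousOn fun V hV => ?_
    obtain ⟨ε, hε, hεV⟩ := Metric.mem_uniformity_dist.1 hV
    obtain ⟨u, hu, hxu⟩ := hG.dense.exists_dist_lt x hε
    refine ⟨_, hD u hu, fun t ht => hεV ?_⟩
    rw [dist_eq_norm, ← smul_sub, ← map_sub, norm_smul, Complex.norm_of_nonneg (Real.exp_pos _).le]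
    calc Real.exp (-(ω * t)) * ‖hG.semigroup t (x - u)‖
        ≤ Real.exp (-(ω * t)) * (Real.exp (ω * t) * ‖x - u‖) := by
          gcongr
          exact (ContinuousLinearMap.le_opNorm _ _).trans
            (mul_le_mul_of_nonneg_right (hG.norm_semigroup_le ht) (norm_nonneg _))
      _ = ‖x - u‖ := by rw [← mul_assoc, ← Real.exp_add]; simp
      _ < ε := by rwa [← dist_eq_norm]
  have h2 : ContinuousOn (fun t : ℝ => (Real.exp (ω * t) : ℂ)) (Set.Ici 0) := by fun_prop
  refine (h2.smul hc).congr fun t _ => ?_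
  change _ = (Real.exp (ω * t) : ℂ) • ((Real.exp (-(ω * t)) : ℂ) • hG.semigroup t x)
  rw [smul_smul, ← Complex.ofReal_mul, ← Real.exp_add]
  simp

/-- Membership in G can be expressed through the resolvent alone, so this commutation gives the
invariance of G under the semigroup. It is used again to identify the generator on the direct
integral. -/
theorem semigroup_commute_resolvent (hG : IsQuasiDissipative G ω) {l : ℝ} (hl : ω < l) {t : ℝ}
    (ht : 0 ≤ t) (x : E) :
    hG.semigroup t (hG.resolvent hl x) = hG.resolvent hl (hG.semigroup t x) := by
  refine tendsto_nhds_unique (hG.tendsto_semigroup ht _)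
    (((hG.resolvent hl).continuous.tendsto _).comp (hG.tendsto_semigroup ht x) |>.congr fun n => ?_)
  have hc : Commute (hG.resolvent hl) (NormedSpace.exp ((t : ℂ) • hG.approx n)) :=
    commute_exp_right ((hG.approx_commute_resolvent n hl).symm.smul_right _)
  have := congrArg (fun M : E →L[ℂ] E => M x) hc.eq
  simp only [Function.comp_apply, map_smul]
  congr 1

/-- The fundamental theorem of calculus holds for e^{ωs}e^{sA_n}, whose generator is ω + A_n. Since
(ω + A_n)u → w boundedly, dominated convergence passes it to the limit. -/
theorem semigroup_integral (hG : IsQuasiDissipative G ω) {u w : E} (h : (u, w) ∈ G) {t : ℝ}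
    (ht : 0 ≤ t) : hG.semigroup t u - u = ∫ s in (0 : ℝ)..t, hG.semigroup s w := by
  set a : ℝ → ℕ → E → E := fun s n x =>
    (Real.exp (ω * s) : ℂ) • NormedSpace.exp ((s : ℂ) • hG.approx n) x with ha
  have hd : ∀ n s, HasDerivAt (fun s => a s n u) (a s n ((ω : ℂ) • u + hG.approx n u)) s := by
    intro n s
    have h1 : HasDerivAt (fun s : ℝ => (Real.exp (ω * s) : ℂ))
        ((Real.exp (ω * s) : ℂ) * ω) s := by
      have : HasDerivAt (fun s : ℝ => Real.exp (ω * s)) (Real.exp (ω * s) * ω) s := by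
        simpa using ((hasDerivAt_id s).const_mul ω).exp
      exact_mod_cast this.ofReal_comp
    refine (h1.smul (hasDerivAt_exp_clm (hG.approx n) u s)).congr_deriv ?_
    simp only [ha, map_add, map_smul]
    module
  have hcont : ∀ n x, Continuous fun s => a s n x := by
    intro n x
    have h1 : Continuous fun s : ℝ => NormedSpace.exp ((s : ℂ) • hG.approx n) x :=
      continuous_iff_continuousAt.2 fun s => (hasDerivAt_exp_clm _ x s).continuousAt
    have h2 : Continuous fun s : ℝ => (Real.exp (ω * s) : ℂ) := by fun_prop
    exact h2.smul h1
  have hint : ∀ n, a t n u - u = ∫ s in (0 : ℝ)..t, a s n ((ω : ℂ) • u + hG.approx n u) := by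
    intro n
    rw [intervalIntegral.integral_eq_sub_of_hasDerivAt (fun s _ => hd n s)
      ((hcont n _).intervalIntegrable _ _)]
    simp [ha, NormedSpace.exp_zero]
  have hlim : Tendsto (fun n => ∫ s in (0 : ℝ)..t, a s n ((ω : ℂ) • u + hG.approx n u)) atTop
      (𝓝 (∫ s in (0 : ℝ)..t, hG.semigroup s w)) := by
    have hna : ∀ s, 0 ≤ s → ∀ n x, ‖a s n x‖ ≤ Real.exp (ω * s) * ‖x‖ := by
      intro s hs n x
      simp only [ha]
      rw [norm_smul, Complex.norm_of_nonneg (Real.exp_pos _).le]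
      gcongr
      exact (ContinuousLinearMap.le_opNorm _ _).trans
        (mul_le_of_le_one_left (norm_nonneg _) (hG.norm_exp_approx_le n hs))
    refine intervalIntegral.tendsto_integral_filter_of_dominated_convergence
      (fun s => Real.exp (ω * s) * (‖(ω : ℂ) • u‖ + ‖w - (ω : ℂ) • u‖)) ?_ ?_ ?_ ?_
    · exact Eventually.of_forall fun n => (hcont n _).aestronglyMeasurable
    · refine Eventually.of_forall fun n => Eventually.of_forall fun s hs => ?_
      rw [Set.uIoc_of_le ht] at hs
      refine (hna s hs.1.le n _).trans ?_
      gcongr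
      exact (norm_add_le _ _).trans (by gcongr; exact hG.norm_approx_apply_le h n)
    · exact (Continuous.intervalIntegrable (by fun_prop) _ _)
    · refine Eventually.of_forall fun s hs => ?_
      rw [Set.uIoc_of_le ht] at hs
      have h1 : Tendsto (fun n => a s n w) atTop (𝓝 (hG.semigroup s w)) :=
        hG.tendsto_semigroup hs.1.le w
      have h2 : Tendsto (fun n => a s n ((ω : ℂ) • u + hG.approx n u - w)) atTop (𝓝 0) := by
        have h3 : Tendsto (fun n => ((ω : ℂ) • u + hG.approx n u - w)) atTop (𝓝 0) := by
          have := ((hG.approx_tendsto h).const_add ((ω : ℂ) • u)).sub_const w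
          simpa using this
        refine squeeze_zero_norm (fun n => hna s hs.1.le n _) ?_
        simpa using h3.norm.const_mul (Real.exp (ω * s))
      refine (by simpa using h1.add h2 : Tendsto _ _ (𝓝 (hG.semigroup s w))).congr fun n => ?_
      simp only [ha, map_sub, smul_sub]
      abel
  refine tendsto_nhds_unique ?_ hlim
  simp_rw [← hint]
  exact (hG.tendsto_semigroup ht u).sub_const u

theorem isSemigroupOf (hG : IsQuasiDissipative G ω) : IsSemigroupOf G ω hG.semigroup where
  zero := by
    ext x
    refine tendsto_nhds_unique (hG.tendsto_semigroup le_rfl x) ?_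
    simp [NormedSpace.exp_zero]
  add s t hs ht := by
    ext x
    refine tendsto_nhds_unique (hG.tendsto_semigroup (add_nonneg hs ht) x) ?_
    have h1 : Tendsto (fun n => (Real.exp (ω * s) : ℂ) • NormedSpace.exp ((s : ℂ) • hG.approx n)
        (hG.semigroup t x)) atTop (𝓝 (hG.semigroup s (hG.semigroup t x))) :=
      hG.tendsto_semigroup hs _
    have h2 : Tendsto (fun n => (Real.exp (ω * s) : ℂ) • NormedSpace.exp ((s : ℂ) • hG.approx n)
        ((Real.exp (ω * t) : ℂ) • NormedSpace.exp ((t : ℂ) • hG.approx n) x -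
          hG.semigroup t x)) atTop (𝓝 0) := by
      have h3 : Tendsto (fun n => ((Real.exp (ω * t) : ℂ) • NormedSpace.exp ((t : ℂ) • hG.approx n) x
          - hG.semigroup t x)) atTop (𝓝 0) := by
        simpa using (hG.tendsto_semigroup ht x).sub_const (hG.semigroup t x)
      refine squeeze_zero_norm (a := fun n => Real.exp (ω * s) * ‖(Real.exp (ω * t) : ℂ) •
        NormedSpace.exp ((t : ℂ) • hG.approx n) x - hG.semigroup t x‖) (fun n => ?_) ?_
      · rw [norm_smul, Complex.norm_of_nonneg (Real.exp_pos _).le]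
        gcongr
        exact (ContinuousLinearMap.le_opNorm _ _).trans
          (mul_le_of_le_one_left (norm_nonneg _) (hG.norm_exp_approx_le n hs))
      · simpa using h3.norm.const_mul (Real.exp (ω * s))
    have h5 := h1.add h2
    rw [add_zero] at h5
    refine h5.congr fun n => ?_
    have h4 : NormedSpace.exp (((s + t : ℝ) : ℂ) • hG.approx n) =
        NormedSpace.exp ((s : ℂ) • hG.approx n) * NormedSpace.exp ((t : ℂ) • hG.approx n) := by
      rw [← exp_add_clm (((Commute.refl _).smul_left _).smul_right _), ← add_smul]
      push_cast; rfl
    rw [h4, mul_add, Real.exp_add]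
    change _ = _ • (NormedSpace.exp ((s : ℂ) • hG.approx n))
      ((NormedSpace.exp ((t : ℂ) • hG.approx n)) x)
    rw [← smul_add, ← map_add, add_sub_cancel, map_smul, smul_smul, Complex.ofReal_mul]
  norm_le t ht := hG.norm_semigroup_le ht
  cont := hG.semigroup_continuousOn
  integral u w h t ht := hG.semigroup_integral h ht
  mem u w h t ht := by
    have hl : ω < ω + 1 := by linarith
    refine hG.mem_of_resolvent hl ?_
    rw [← map_smul, ← map_sub, ← hG.semigroup_commute_resolvent hl ht, hG.resolvent_apply hl h]

end IsQuasiDissipative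

namespace IsSemigroupOf
variable {S : ℝ → E →L[ℂ] E}

theorem hasDerivWithinAt (hS : IsSemigroupOf G ω S) {u w : E} (h : (u, w) ∈ G) {t : ℝ}
    (ht : 0 ≤ t) : HasDerivWithinAt (fun t => S t u) (S t w) (Set.Ici t) t := by
  have hint : ∀ r, 0 ≤ r → IntervalIntegrable (fun s => S s w) volume 0 r := fun r hr =>
    ContinuousOn.intervalIntegrable ((hS.cont w).mono (by
      rw [Set.uIcc_of_le hr]; exact Set.Icc_subset_Ici_self))
  have hsm : StronglyMeasurableAtFilter (fun s => S s w) (𝓝[>] t) volume :=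
    ⟨Set.Ioi t, self_mem_nhdsWithin, ((hS.cont w).mono fun r hr => ht.trans (le_of_lt hr)
      ).aestronglyMeasurable measurableSet_Ioi⟩
  have h1 := intervalIntegral.integral_hasDerivWithinAt_right (hint t ht) (s := Set.Ici t) hsm
    ((hS.cont w t ht).mono fun r hr => ht.trans (le_of_lt hr))
  refine (h1.add_const u).congr (fun r hr => ?_) ?_
  · rw [← hS.integral u w h r (ht.trans hr)]; abel
  · rw [← hS.integral u w h t ht]; abel

end IsSemigroupOf

/-- Decay of a quadratic form along the semigroup, from a dissipation inequality on the graph. -/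
theorem IsSemigroupOf.quadratic_decay {E : Type*} [NormedAddCommGroup E] [InnerProductSpace ℂ E]
    [CompleteSpace E] {G : Submodule ℂ (E × E)} {ω : ℝ} {S : ℝ → E →L[ℂ] E}
    (hS : IsSemigroupOf G ω S) {P : E →L[ℂ] E} (hP : IsSelfAdjoint P) {b : ℝ}
    (h : ∀ u w, (u, w) ∈ G → (inner ℂ (P u) w).re ≤ -b * (inner ℂ (P u) u).re)
    (hD : Dense (Prod.fst '' (G : Set (E × E)))) {t : ℝ} (ht : 0 ≤ t) (x : E) :
    (inner ℂ (P (S t x)) (S t x)).re ≤ Real.exp (-(2 * b) * t) * (inner ℂ (P x) x).re := by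
  have hcl : IsClosed {x : E | (inner ℂ (P (S t x)) (S t x)).re ≤
      Real.exp (-(2 * b) * t) * (inner ℂ (P x) x).re} := by
    refine isClosed_le ?_ ?_
    · exact Complex.continuous_re.comp (by fun_prop)
    · exact continuous_const.mul (Complex.continuous_re.comp (by fun_prop))
  refine hcl.closure_subset_iff.2 ?_ (hD x)
  rintro _ ⟨⟨u, w⟩, huw, rfl⟩
  have hsymm : ∀ y z : E, (inner ℂ (P y) z).re = (inner ℂ (P z) y).re := by
    intro y z
    rw [← inner_conj_symm, Complex.conj_re]
    exact congrArg Complex.re (hP.isSymmetric z y).symm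
  -- The quantity e^{2bs}⟨P S_s u, S_s u⟩ has nonpositive right derivative: self-adjointness merges
  -- the two halves of the derivative into 2 Re⟨P S_s u, S_s w⟩, and invariance of G makes the
  -- hypothesis available at time s.
  have hderiv : ∀ s ∈ Set.Ico 0 t, HasDerivWithinAt
      (fun s => Real.exp (2 * b * s) * (inner ℂ (P (S s u)) (S s u)).re)
      (Real.exp (2 * b * s) * (2 * b) * (inner ℂ (P (S s u)) (S s u)).re +
        Real.exp (2 * b * s) * (2 * (inner ℂ (P (S s u)) (S s w)).re)) (Set.Ici s) s := by
    intro s hs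
    have h1 := hS.hasDerivWithinAt huw hs.1
    have h2 : HasDerivWithinAt (fun s => P (S s u)) (P (S s w)) (Set.Ici s) s :=
      (P.restrictScalars ℝ).hasFDerivAt.comp_hasDerivWithinAt s h1
    have h3 := HasDerivWithinAt.inner ℂ h2 h1
    have h4 := Complex.reCLM.hasFDerivAt.comp_hasDerivWithinAt s h3
    have h5 : HasDerivWithinAt (fun s => Real.exp (2 * b * s)) (Real.exp (2 * b * s) * (2 * b))
        (Set.Ici s) s := by
      simpa using (((hasDerivAt_id s).const_mul (2 * b)).exp).hasDerivWithinAt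
    refine (h5.mul h4).congr_deriv ?_
    simp only [Complex.reCLM_apply, Complex.add_re, Function.comp_apply]
    rw [hsymm (S s w) (S s u)]
    ring
  have hcont : ContinuousOn (fun s => Real.exp (2 * b * s) * (inner ℂ (P (S s u)) (S s u)).re)
      (Set.Icc 0 t) := by
    have h1 : ContinuousOn (fun s => S s u) (Set.Icc 0 t) :=
      (hS.cont u).mono Set.Icc_subset_Ici_self
    have h2 : ContinuousOn (fun s => inner ℂ (P (S s u)) (S s u)) (Set.Icc 0 t) :=
      (P.continuous.comp_continuousOn h1).inner h1
    exact (Continuous.continuousOn (by fun_prop)).mul (Complex.continuous_re.comp_continuousOn h2)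
  have hle := image_le_of_deriv_right_le_deriv_boundary hcont hderiv
    (B := fun _ => (inner ℂ (P u) u).re) (B' := fun _ => 0) (by simp [hS.zero])
    continuousOn_const (fun s _ => hasDerivWithinAt_const _ _ _) (fun s hs => by
      have := h _ _ (hS.mem u w huw s hs.1)
      have he := Real.exp_pos (2 * b * s)
      nlinarith) (Set.right_mem_Icc.2 ht)
  simp only [Set.mem_ofPred_eq]
  have he : Real.exp (-(2 * b) * t) * Real.exp (2 * b * t) = 1 := by rw [← Real.exp_add]; simp
  calc _ = Real.exp (-(2 * b) * t) * (Real.exp (2 * b * t) * (inner ℂ (P (S t u)) (S t u)).re) := by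
        rw [← mul_assoc, he, one_mul]
    _ ≤ _ := by gcongr

end Semigroup
end KPII

namespace KPII

/-- `L²(ℝ; ℂ)`. -/
abbrev Ltwo : Type := Lp ℂ 2 (volume : Measure ℝ)

instance fact_two_ne_top : Fact ((2 : ℝ≥0∞) ≠ ∞) := ⟨by simp⟩

/-! ### Multiplication operators and Fourier multipliers -/

/-- Bounded measurable functions. -/
def IsBddMul (m : ℝ → ℂ) : Prop :=
  AEStronglyMeasurable m volume ∧ ∃ C, ∀ x, ‖m x‖ ≤ C

theorem IsBddMul.of_continuous {m : ℝ → ℂ} (hm : Continuous m) {C : ℝ} (h : ∀ x, ‖m x‖ ≤ C) :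
    IsBddMul m := ⟨hm.aestronglyMeasurable, C, h⟩

theorem IsBddMul.memLp {m : ℝ → ℂ} (hm : IsBddMul m) : MemLp m ∞ volume :=
  let ⟨_, hC⟩ := hm.2
  memLp_top_of_bound hm.1 _ (Eventually.of_forall hC)

theorem IsBddMul.mul_memLp {m : ℝ → ℂ} (hm : IsBddMul m) {p : ℝ≥0∞} {f : ℝ → ℂ}
    (hf : MemLp f p volume) : MemLp (fun x => m x * f x) p volume :=
  hf.mul hm.memLp

theorem IsBddMul.mul {m m' : ℝ → ℂ} (hm : IsBddMul m) (hm' : IsBddMul m') :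
    IsBddMul fun x => m x * m' x := by
  obtain ⟨C, hC⟩ := hm.2
  obtain ⟨C', hC'⟩ := hm'.2
  refine ⟨hm.1.mul hm'.1, C * C', fun x => ?_⟩
  rw [norm_mul]
  exact mul_le_mul (hC x) (hC' x) (norm_nonneg _) ((norm_nonneg _).trans (hC x))

open Classical in
/-- Multiplication by a bounded function on `L²(ℝ)` (zero for other functions). -/
def mulOp (m : ℝ → ℂ) : Ltwo →L[ℂ] Ltwo :=
  if hm : IsBddMul m then
    LinearMap.mkContinuous
      { toFun := fun f => (hm.mul_memLp (Lp.memLp f)).toLp _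
        map_add' := fun f g => by
          ext1
          filter_upwards [(hm.mul_memLp (Lp.memLp (f + g))).coeFn_toLp, Lp.coeFn_add f g,
            Lp.coeFn_add ((hm.mul_memLp (Lp.memLp f)).toLp _)
              ((hm.mul_memLp (Lp.memLp g)).toLp _),
            (hm.mul_memLp (Lp.memLp f)).coeFn_toLp, (hm.mul_memLp (Lp.memLp g)).coeFn_toLp]
            with x h1 h2 h3 h4 h5
          rw [h1, h3, Pi.add_apply, h4, h5, h2, Pi.add_apply, mul_add]
        map_smul' := fun c f => by
          ext1
          filter_upwards [(hm.mul_memLp (Lp.memLp (c • f))).coeFn_toLp, Lp.coeFn_smul c f,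
            Lp.coeFn_smul c ((hm.mul_memLp (Lp.memLp f)).toLp _),
            (hm.mul_memLp (Lp.memLp f)).coeFn_toLp] with x h1 h2 h3 h4
          simp only [RingHom.id_apply]
          rw [h1, h3, Pi.smul_apply, h4, h2, Pi.smul_apply, smul_eq_mul, smul_eq_mul]
          ring }
      hm.2.choose (fun f => by
        refine Lp.norm_le_mul_norm_of_ae_le_mul ?_
        filter_upwards [(hm.mul_memLp (Lp.memLp f)).coeFn_toLp] with x h1
        simp only [LinearMap.coe_mk, AddHom.coe_mk]
        rw [h1, norm_mul]
        exact mul_le_mul_of_nonneg_right (hm.2.choose_spec x) (norm_nonneg _))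
  else 0

theorem mulOp_coe {m : ℝ → ℂ} (hm : IsBddMul m) (f : Ltwo) :
    mulOp m f =ᵐ[volume] fun x => m x * f x := by
  rw [mulOp, dif_pos hm]
  exact (hm.mul_memLp (Lp.memLp f)).coeFn_toLp

theorem norm_mulOp_apply_le {m : ℝ → ℂ} (hm : IsBddMul m) {C : ℝ} (h : ∀ x, ‖m x‖ ≤ C)
    (f : Ltwo) : ‖mulOp m f‖ ≤ C * ‖f‖ := by
  refine Lp.norm_le_mul_norm_of_ae_le_mul ?_
  filter_upwards [mulOp_coe hm f] with x h1
  rw [h1, norm_mul]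
  exact mul_le_mul_of_nonneg_right (h x) (norm_nonneg _)

theorem norm_mulOp_le {m : ℝ → ℂ} (hm : IsBddMul m) {C : ℝ} (h : ∀ x, ‖m x‖ ≤ C) :
    ‖mulOp m‖ ≤ C :=
  ContinuousLinearMap.opNorm_le_bound _ ((norm_nonneg _).trans (h 0)) (norm_mulOp_apply_le hm h)

theorem mulOp_mulOp {m m' : ℝ → ℂ} (hm : IsBddMul m) (hm' : IsBddMul m') (f : Ltwo) :
    mulOp m (mulOp m' f) = mulOp (fun x => m x * m' x) f := by
  ext1
  filter_upwards [mulOp_coe hm (mulOp m' f), mulOp_coe hm' f, mulOp_coe (hm.mul hm') f]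
    with x h1 h2 h3
  rw [h1, h2, h3, mul_assoc]

theorem inner_mulOp_left {m : ℝ → ℂ} (hm : IsBddMul m) (f g : Ltwo) :
    inner ℂ (mulOp m f) g = inner ℂ f (mulOp (fun x => (starRingEnd ℂ) (m x)) g) := by
  have hm' : IsBddMul fun x => (starRingEnd ℂ) (m x) := by
    obtain ⟨C, hC⟩ := hm.2
    exact ⟨Complex.continuous_conj.comp_aestronglyMeasurable hm.1, C, fun x => by
      simpa using hC x⟩
  rw [L2.inner_def, L2.inner_def]
  refine integral_congr_ae ?_
  filter_upwards [mulOp_coe hm f, mulOp_coe hm' g] with x h1 h2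
  rw [h1, h2, RCLike.inner_apply, RCLike.inner_apply, map_mul]
  ring

/-- The Fourier multiplier with symbol `m`. -/
def fourierMul (m : ℝ → ℂ) : Ltwo →L[ℂ] Ltwo :=
  ((Lp.fourierTransformₗᵢ ℝ ℂ).symm.toContinuousLinearEquiv : Ltwo →L[ℂ] Ltwo) ∘L mulOp m ∘L
    ((Lp.fourierTransformₗᵢ ℝ ℂ).toContinuousLinearEquiv : Ltwo →L[ℂ] Ltwo)

theorem fourier_fourierMul (m : ℝ → ℂ) (f : Ltwo) : 𝓕 (fourierMul m f) = mulOp m (𝓕 f) :=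
  (Lp.fourierTransformₗᵢ ℝ ℂ).apply_symm_apply _

theorem fourier_injective {f g : Ltwo} (h : 𝓕 f = 𝓕 g) : f = g :=
  (Lp.fourierTransformₗᵢ ℝ ℂ).injective h

theorem fourierMul_fourierMul {m m' : ℝ → ℂ} (hm : IsBddMul m) (hm' : IsBddMul m') (f : Ltwo) :
    fourierMul m (fourierMul m' f) = fourierMul (fun x => m x * m' x) f := by
  apply fourier_injective
  rw [fourier_fourierMul, fourier_fourierMul, fourier_fourierMul, mulOp_mulOp hm hm']

theorem norm_fourierMul_apply_le {m : ℝ → ℂ} (hm : IsBddMul m) {C : ℝ} (h : ∀ x, ‖m x‖ ≤ C)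
    (f : Ltwo) : ‖fourierMul m f‖ ≤ C * ‖f‖ := by
  rw [← Lp.norm_fourier_eq, fourier_fourierMul, ← Lp.norm_fourier_eq f]
  exact norm_mulOp_apply_le hm h _

theorem norm_fourierMul_le {m : ℝ → ℂ} (hm : IsBddMul m) {C : ℝ} (h : ∀ x, ‖m x‖ ≤ C) :
    ‖fourierMul m‖ ≤ C :=
  ContinuousLinearMap.opNorm_le_bound _ ((norm_nonneg _).trans (h 0))
    (norm_fourierMul_apply_le hm h)

theorem inner_fourierMul_left {m : ℝ → ℂ} (hm : IsBddMul m) (f g : Ltwo) :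
    inner ℂ (fourierMul m f) g =
      inner ℂ f (fourierMul (fun x => (starRingEnd ℂ) (m x)) g) := by
  rw [← Lp.inner_fourier_eq, fourier_fourierMul, inner_mulOp_left hm, ← fourier_fourierMul,
    Lp.inner_fourier_eq]

/-- The `L²` Fourier transform of an integrable function is given by the Fourier integral. -/
theorem fourier_toLp_ae {f : ℝ → ℂ} (h1 : Integrable f volume) (h2 : MemLp f 2 volume) :
    ((𝓕 (h2.toLp f) : Ltwo) : ℝ → ℂ) =ᵐ[volume] 𝓕 f := by
  have hc : Continuous (𝓕 f) :=
    VectorFourier.fourierIntegral_continuous Real.continuous_fourierChar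
      (by exact continuous_inner) h1
  refine ae_eq_of_integral_contDiff_smul_eq
    ((Lp.memLp (𝓕 (h2.toLp f) : Ltwo)).locallyIntegrable (by norm_num)) hc.locallyIntegrable ?_
  intro g hg hgc
  have hgs : HasCompactSupport fun x => (g x : ℂ) := hgc.comp_left (g := fun r : ℝ => (r : ℂ)) rfl
  have hgd : ContDiff ℝ ((⊤ : ℕ∞) : WithTop ℕ∞) fun x => (g x : ℂ) :=
    Complex.ofRealCLM.contDiff.comp hg
  set G : SchwartzMap ℝ ℂ := hgs.toSchwartzMap hgd with hG
  -- Both candidates are compared as distributions: the L² transform is the distributional one, and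
  -- for the Fourier integral the same duality is Fubini.
  have e1 := congrArg (fun D => D G) (Lp.fourier_toTemperedDistribution_eq (h2.toLp f))
  simp only [TemperedDistribution.fourier_apply, Lp.toTemperedDistribution_apply] at e1
  have e2 : ∫ x, (𝓕 G) x • (h2.toLp f) x = ∫ x, (𝓕 G) x • f x := by
    refine integral_congr_ae ?_
    filter_upwards [h2.coeFn_toLp] with x hx
    rw [hx]
  have e3 : ∫ x, (𝓕 (G : ℝ → ℂ)) x • f x = ∫ x, G x • (𝓕 f) x := by
    have := VectorFourier.integral_fourierIntegral_smul_eq_flip (L := innerₗ ℝ)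
      (μ := (volume : Measure ℝ)) (ν := (volume : Measure ℝ)) Real.continuous_fourierChar
      (by exact continuous_inner) G.integrable h1
    simpa [Real.fourier_eq, flip_innerₗ] using! this
  rw [e2] at e1
  have e4 : ((𝓕 G : SchwartzMap ℝ ℂ) : ℝ → ℂ) = 𝓕 (G : ℝ → ℂ) := SchwartzMap.fourier_coe G
  rw [e4, e3] at e1
  simpa [hG] using! e1.symm

end KPII

namespace KPII

/-! ### The weighted inverse derivative -/

theorem integrable_exp_neg_mul_abs {κ : ℝ} (hκ : 0 < κ) :
    Integrable (fun x : ℝ => Real.exp (-(κ * |x|))) := by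
  rw [← integrableOn_univ, ← Set.Iic_union_Ioi (a := (0 : ℝ))]
  refine IntegrableOn.union ?_ ?_
  · refine (integrableOn_exp_mul_Iic hκ 0).congr_fun (fun x hx => ?_) measurableSet_Iic
    simp only [abs_of_nonpos (Set.mem_Iic.1 hx)]
    congr 1; ring
  · refine (exp_neg_integrableOn_Ioi 0 hκ).congr_fun (fun x hx => ?_) measurableSet_Ioi
    simp only [abs_of_pos (Set.mem_Ioi.1 hx)]
    congr 1; ring

/-- Measurable functions that decay exponentially. -/
def IsExpDecay (f : ℝ → ℂ) : Prop :=
  AEStronglyMeasurable f volume ∧ ∃ κ C : ℝ, 0 < κ ∧ ∀ x, ‖f x‖ ≤ C * Real.exp (-(κ * |x|))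

theorem IsExpDecay.integrable {f : ℝ → ℂ} (hf : IsExpDecay f) : Integrable f := by
  obtain ⟨h0, κ, C, hκ, h⟩ := hf
  exact ((integrable_exp_neg_mul_abs hκ).const_mul C).mono' h0 (Eventually.of_forall h)

theorem IsExpDecay.memLp {f : ℝ → ℂ} (hf : IsExpDecay f) : MemLp f 2 volume := by
  obtain ⟨h0, κ, C, hκ, h⟩ := hf
  rw [memLp_two_iff_integrable_sq_norm h0]
  refine ((integrable_exp_neg_mul_abs (show 0 < 2 * κ by positivity)).const_mul (C ^ 2)).mono'
    (h0.norm.pow 2) (Eventually.of_forall fun x => ?_)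
  rw [Real.norm_of_nonneg (by positivity)]
  calc ‖f x‖ ^ 2 ≤ (C * Real.exp (-(κ * |x|))) ^ 2 := pow_le_pow_left₀ (norm_nonneg _) (h x) 2
    _ = C ^ 2 * Real.exp (-(2 * κ * |x|)) := by
        rw [mul_pow, ← Real.exp_nat_mul]; congr 2; push_cast; ring

theorem IsExpDecay.add {f g : ℝ → ℂ} (hf : IsExpDecay f) (hg : IsExpDecay g) :
    IsExpDecay fun x => f x + g x := by
  obtain ⟨h0, κ, C, hκ, h⟩ := hf
  obtain ⟨h0', κ', C', hκ', h'⟩ := hg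
  refine ⟨h0.add h0', min κ κ', |C| + |C'|, lt_min hκ hκ', fun x => ?_⟩
  have e1 : Real.exp (-(κ * |x|)) ≤ Real.exp (-(min κ κ' * |x|)) := by
    gcongr; exact min_le_left _ _
  have e2 : Real.exp (-(κ' * |x|)) ≤ Real.exp (-(min κ κ' * |x|)) := by
    gcongr; exact min_le_right _ _
  calc ‖f x + g x‖ ≤ ‖f x‖ + ‖g x‖ := norm_add_le _ _
    _ ≤ |C| * Real.exp (-(κ * |x|)) + |C'| * Real.exp (-(κ' * |x|)) :=
        add_le_add ((h x).trans (mul_le_mul_of_nonneg_right (le_abs_self C) (Real.exp_nonneg _)))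
          ((h' x).trans (mul_le_mul_of_nonneg_right (le_abs_self C') (Real.exp_nonneg _)))
    _ ≤ _ := by
        rw [add_mul]
        exact add_le_add (mul_le_mul_of_nonneg_left e1 (abs_nonneg _))
          (mul_le_mul_of_nonneg_left e2 (abs_nonneg _))

theorem IsExpDecay.bdd_mul {m f : ℝ → ℂ} (hm : IsBddMul m) (hf : IsExpDecay f) :
    IsExpDecay fun x => m x * f x := by
  obtain ⟨h0, κ, C, hκ, h⟩ := hf
  obtain ⟨B, hB⟩ := hm.2
  refine ⟨hm.1.mul h0, κ, B * C, hκ, fun x => ?_⟩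
  rw [norm_mul, mul_assoc]
  exact mul_le_mul (hB x) (h x) (norm_nonneg _) ((norm_nonneg _).trans (hB x))

theorem isBddMul_const (c : ℂ) : IsBddMul fun _ => c :=
  IsBddMul.of_continuous continuous_const (fun _ => le_rfl)

theorem IsExpDecay.const_mul {f : ℝ → ℂ} (c : ℂ) (hf : IsExpDecay f) :
    IsExpDecay fun x => c * f x := hf.bdd_mul (isBddMul_const c)

theorem IsExpDecay.of_compactSupport {f : ℝ → ℂ} (hf : Continuous f) (hc : HasCompactSupport f) :
    IsExpDecay f := by
  obtain ⟨B, hB⟩ := hc.exists_bound_of_continuous hf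
  obtain ⟨R, hR⟩ := hc.isCompact.isBounded.subset_closedBall 0
  refine ⟨hf.aestronglyMeasurable, 1, B * Real.exp R, one_pos, fun x => ?_⟩
  by_cases hx : x ∈ tsupport f
  · have h1 : |x| ≤ R := by simpa using hR hx
    have hB0 : 0 ≤ B := (norm_nonneg _).trans (hB x)
    calc ‖f x‖ ≤ B * 1 := by simpa using hB x
      _ ≤ B * (Real.exp R * Real.exp (-(1 * |x|))) := by
          gcongr
          rw [← Real.exp_add]
          exact Real.one_le_exp (by linarith)
      _ = _ := by ring
  · have hB0 : 0 ≤ B := (norm_nonneg _).trans (hB x)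
    rw [image_eq_zero_of_notMem_tsupport hx, norm_zero]
    positivity

/-- The symbol of `(∂ₓ - c)⁻¹`. -/
def resSymbol (c ξ : ℝ) : ℂ := (2 * Real.pi * Complex.I * ξ - c)⁻¹

theorem abs_le_norm_symbol (c ξ : ℝ) : |c| ≤ ‖(2 * Real.pi * Complex.I * ξ - c : ℂ)‖ := by
  have := Complex.abs_re_le_norm (2 * Real.pi * Complex.I * ξ - c : ℂ)
  simpa using this

theorem symbol_ne_zero {c : ℝ} (hc : c ≠ 0) (ξ : ℝ) : (2 * Real.pi * Complex.I * ξ - c : ℂ) ≠ 0 :=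
  norm_pos_iff.1 ((abs_pos.2 hc).trans_le (abs_le_norm_symbol c ξ))

theorem norm_resSymbol_le {c : ℝ} (hc : c ≠ 0) (ξ : ℝ) : ‖resSymbol c ξ‖ ≤ |c|⁻¹ := by
  rw [resSymbol, norm_inv]
  exact inv_anti₀ (abs_pos.2 hc) (abs_le_norm_symbol c ξ)

theorem isBddMul_resSymbol {c : ℝ} (hc : c ≠ 0) : IsBddMul (resSymbol c) := by
  refine IsBddMul.of_continuous ?_ (norm_resSymbol_le hc)
  exact Continuous.inv₀ (by fun_prop) (symbol_ne_zero hc)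

/-- `(∂ₓ - c)⁻¹` on `L²(ℝ)`. -/
def resD (c : ℝ) : Ltwo →L[ℂ] Ltwo := fourierMul (resSymbol c)

theorem norm_resD_le {c : ℝ} (hc : c ≠ 0) : ‖resD c‖ ≤ |c|⁻¹ :=
  norm_fourierMul_le (isBddMul_resSymbol hc) (norm_resSymbol_le hc)

/-- The adjoint of ∂ₓ − c is −(∂ₓ + c). On the symbol side this is complex conjugation. -/
theorem inner_resD_left {c : ℝ} (hc : c ≠ 0) (f g : Ltwo) :
    inner ℂ (resD c f) g = - inner ℂ f (resD (-c) g) := by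
  rw [resD, inner_fourierMul_left (isBddMul_resSymbol hc), ← inner_neg_right]
  congr 1
  apply fourier_injective
  rw [fourier_fourierMul, resD]
  have : 𝓕 (-(fourierMul (resSymbol (-c)) g)) = - 𝓕 (fourierMul (resSymbol (-c)) g) :=
    map_neg (Lp.fourierTransformₗᵢ ℝ ℂ) _
  rw [this, fourier_fourierMul]
  have hm : IsBddMul fun x => (starRingEnd ℂ) (resSymbol c x) :=
    ⟨Complex.continuous_conj.comp_aestronglyMeasurable (isBddMul_resSymbol hc).1, |c|⁻¹, fun x => by
      simpa using norm_resSymbol_le hc x⟩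
  ext1
  filter_upwards [mulOp_coe hm (𝓕 g), mulOp_coe (isBddMul_resSymbol (neg_ne_zero.2 hc)) (𝓕 g),
    Lp.coeFn_neg (mulOp (resSymbol (-c)) (𝓕 g))] with x h1 h2 h3
  rw [h1, h3, Pi.neg_apply, h2, ← neg_mul, resSymbol, resSymbol, map_inv₀, ← inv_neg]
  congr 2
  simp [Complex.conj_ofReal, map_ofNat (starRingEnd ℂ) 2]
  ring

theorem resD_injective {c : ℝ} (hc : c ≠ 0) {f g : Ltwo} (h : resD c f = resD c g) : f = g := by
  apply fourier_injective
  have h1 := congrArg (fun F : Ltwo => 𝓕 F) h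
  simp only [resD, fourier_fourierMul] at h1
  ext1
  have h2 := mulOp_coe (isBddMul_resSymbol hc) (𝓕 f)
  rw [h1] at h2
  filter_upwards [h2, mulOp_coe (isBddMul_resSymbol hc) (𝓕 g)] with x h3 h4
  rw [h3] at h4
  exact mul_left_cancel₀ (inv_ne_zero (symbol_ne_zero hc x)) h4

/-- `(∂ₓ - c)⁻¹` is the inverse of the classical `∂ₓ - c`. -/
theorem resD_classical {c : ℝ} (hc : c ≠ 0) {f f' : ℝ → ℂ} (hd : ∀ x, HasDerivAt f (f' x) x)
    (hf : Integrable f) (hf' : Integrable f') (hf2 : MemLp f 2 volume) (hf2' : MemLp f' 2 volume)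
    {g : Ltwo} (hg : g =ᵐ[volume] fun x => f' x - c * f x) : resD c g = hf2.toLp f := by
  apply fourier_injective
  rw [resD, fourier_fourierMul]
  have hi : Integrable fun x => f' x - c * f x := hf'.sub (hf.const_mul _)
  have h2 : MemLp (fun x => f' x - c * f x) 2 volume := hf2'.sub (hf2.const_mul _)
  have hg' : g = h2.toLp _ := by
    ext1
    exact hg.trans h2.coeFn_toLp.symm
  have hder : deriv f = f' := funext fun x => (hd x).deriv
  have hF : ∀ ξ, 𝓕 (fun x => f' x - c * f x) ξ = (2 * Real.pi * Complex.I * ξ - c) * 𝓕 f ξ := by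
    intro ξ
    have e1 : 𝓕 f' ξ = (2 * Real.pi * Complex.I * ξ) * 𝓕 f ξ := by
      have := congrFun (Real.fourier_deriv hf (fun x => (hd x).differentiableAt)
        (by rw [hder]; exact hf')) ξ
      rw [hder] at this
      simpa using this
    rw [sub_mul, ← e1, Real.fourier_real_eq, Real.fourier_real_eq, Real.fourier_real_eq,
      ← integral_const_mul, ← integral_sub]
    · refine integral_congr_ae (Eventually.of_forall fun x => ?_)
      simp only [Circle.smul_def, smul_eq_mul]
      ring
    · exact (Real.fourierIntegral_convergent_iff (f := f') (μ := volume) ξ).2 hf' |>.congr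
        (Eventually.of_forall fun x => by simp [mul_comm])
    · exact (((Real.fourierIntegral_convergent_iff (f := f) (μ := volume) ξ).2 hf).const_mul
        (c : ℂ)).congr (Eventually.of_forall fun x => by simp [mul_comm])
  rw [hg']
  ext1
  filter_upwards [mulOp_coe (isBddMul_resSymbol hc) (𝓕 (h2.toLp _)), fourier_toLp_ae hi h2,
    fourier_toLp_ae hf hf2] with ξ h3 h4 h5
  rw [h3, h4, h5, hF, resSymbol, inv_mul_cancel_left₀ (symbol_ne_zero hc ξ)]

/-- Continuous functions of compact support are dense. -/
theorem dense_compactSupport : Dense {f : Ltwo | ∃ g : ℝ → ℂ, Continuous g ∧ HasCompactSupport g ∧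
    f =ᵐ[volume] g} := by
  intro f
  rw [Metric.mem_closure_iff]
  intro ε hε
  obtain ⟨g, hgc, hg, hgcont, hgm⟩ := (Lp.memLp f).exists_hasCompactSupport_eLpNorm_sub_le
    (by norm_num) (ε := ENNReal.ofReal (ε / 2)) (by simpa using hε)
  refine ⟨hgm.toLp g, ⟨g, hgcont, hgc, hgm.coeFn_toLp⟩, ?_⟩
  rw [Lp.dist_def]
  have : eLpNorm (⇑f - ⇑(hgm.toLp g)) 2 volume = eLpNorm (⇑f - g) 2 volume :=
    eLpNorm_congr_ae ((EventuallyEq.refl _ _).sub hgm.coeFn_toLp)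
  rw [this]
  calc _ ≤ (ENNReal.ofReal (ε / 2)).toReal := ENNReal.toReal_mono (by simp) hg
    _ = ε / 2 := ENNReal.toReal_ofReal (by positivity)
    _ < ε := by linarith

/-- The weighted primitive `-∫_x^∞ e^{a(x - s)} g(s) ds`. -/
def prim (a : ℝ) (g : ℝ → ℂ) (x : ℝ) : ℂ :=
  -∫ s in Set.Ioi x, (Real.exp (a * (x - s)) : ℂ) * g s

/-- The integrand vanishes beyond R, so the half-line integral becomes an integral with a fixed
endpoint, which can be differentiated in x. -/
theorem prim_eq {a R : ℝ} {g : ℝ → ℂ} (hg : Continuous g) (hR : ∀ s, R ≤ s → g s = 0) (x : ℝ) :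
    prim a g x = (Real.exp (a * x) : ℂ) * ∫ s in R..x, (Real.exp (-a * s) : ℂ) * g s := by
  have e : ∀ s, (Real.exp (a * (x - s)) : ℂ) * g s =
      (Real.exp (a * x) : ℂ) * ((Real.exp (-a * s) : ℂ) * g s) := fun s => by
    rw [← mul_assoc, ← Complex.ofReal_mul, ← Real.exp_add]; congr 3; ring
  have hcont : Continuous fun s => (Real.exp (-a * s) : ℂ) * g s := by fun_prop
  rw [prim]
  simp_rw [e]
  rw [integral_const_mul, ← mul_neg]
  congr 1
  rcases le_or_gt x R with hx | hx
  · rw [intervalIntegral.integral_of_ge hx, ← Set.Ioc_union_Ioi_eq_Ioi hx]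
    congr 1
    refine setIntegral_eq_of_subset_of_forall_sdiff_eq_zero
      (measurableSet_Ioc.union measurableSet_Ioi) Set.subset_union_left ?_
    rintro s ⟨hs, hs'⟩
    have : R < s := by
      rcases hs with hs | hs
      · exact absurd hs hs'
      · exact hs
    simp [hR s this.le]
  · have h1 : ∫ s in R..x, (Real.exp (-a * s) : ℂ) * g s = 0 := by
      rw [intervalIntegral.integral_of_le hx.le]
      refine (setIntegral_congr_fun measurableSet_Ioc (g := fun _ => (0 : ℂ)) fun s hs => ?_).trans
        (by simp)
      simp [hR s hs.1.le]
    rw [h1, neg_eq_zero]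
    refine (setIntegral_congr_fun measurableSet_Ioi (g := fun _ => (0 : ℂ)) fun s hs => ?_).trans
        (by simp)
    simp [hR s (hx.trans hs).le]

theorem hasDerivAt_prim {a : ℝ} {g : ℝ → ℂ} (hg : Continuous g) (hc : HasCompactSupport g)
    (x : ℝ) : HasDerivAt (prim a g) (a * prim a g x + g x) x := by
  obtain ⟨R, hR⟩ := hc.isCompact.isBounded.subset_closedBall 0
  have hR' : ∀ s, R + 1 ≤ s → g s = 0 := fun s hs => by
    by_contra h
    have := hR (subset_tsupport g h)
    simp only [Metric.mem_closedBall, dist_zero_right, Real.norm_eq_abs] at this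
    linarith [le_abs_self s]
  have e : prim a g = fun x => (Real.exp (a * x) : ℂ) *
      ∫ s in (R + 1)..x, (Real.exp (-a * s) : ℂ) * g s := funext fun x => prim_eq hg hR' x
  have hcont : Continuous fun s => (Real.exp (-a * s) : ℂ) * g s := by fun_prop
  rw [e]
  have h1 : HasDerivAt (fun x : ℝ => (Real.exp (a * x) : ℂ)) ((Real.exp (a * x) * a : ℝ) : ℂ) x := by
    have : HasDerivAt (fun x : ℝ => Real.exp (a * x)) (Real.exp (a * x) * a) x := by
      simpa using ((hasDerivAt_id x).const_mul a).exp
    exact this.ofReal_comp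
  refine (h1.mul (hcont.integral_hasStrictDerivAt (R + 1) x).hasDerivAt).congr_deriv ?_
  have : (Real.exp (a * x) : ℂ) * ((Real.exp (-a * x) : ℂ) * g x) = g x := by
    rw [← mul_assoc, ← Complex.ofReal_mul, ← Real.exp_add]; simp
  rw [this]
  push_cast
  ring

/-- To the right of the support of g the primitive vanishes, and to the left it is a constant
multiple of e^{ax}. With a > 0 this decays, so integrating from +∞ is the choice that inverts ∂ₓ − a
in L². -/
theorem isExpDecay_prim {a : ℝ} (ha : 0 < a) {g : ℝ → ℂ} (hg : Continuous g)
    (hc : HasCompactSupport g) : IsExpDecay (prim a g) := by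
  have hcont : Continuous (prim a g) :=
    continuous_iff_continuousAt.2 fun x => (hasDerivAt_prim hg hc x).continuousAt
  obtain ⟨R, hR⟩ := hc.isCompact.isBounded.subset_closedBall 0
  have hR' : ∀ s, |R| + 1 ≤ |s| → g s = 0 := fun s hs => by
    by_contra h
    have := hR (subset_tsupport g h)
    simp only [Metric.mem_closedBall, dist_zero_right, Real.norm_eq_abs] at this
    linarith [le_abs_self R]
  have hR1 : ∀ s, |R| + 1 ≤ s → g s = 0 := fun s hs => hR' s (hs.trans (le_abs_self s))
  set M : ℝ := ∫ s, ‖(Real.exp (-a * s) : ℂ) * g s‖ with hM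
  have hint : Integrable fun s => (Real.exp (-a * s) : ℂ) * g s :=
    Continuous.integrable_of_hasCompactSupport (by fun_prop) hc.mul_left
  refine ⟨hcont.aestronglyMeasurable, a, M * Real.exp (2 * a * (|R| + 1)), ha, fun x => ?_⟩
  have hM0 : 0 ≤ M := integral_nonneg fun _ => norm_nonneg _
  rw [prim_eq hg hR1]
  rcases le_or_gt (|R| + 1) x with hx | hx
  · have h1 : ∫ s in (|R| + 1)..x, (Real.exp (-a * s) : ℂ) * g s = 0 := by
      rw [intervalIntegral.integral_of_le hx]
      refine (setIntegral_congr_fun measurableSet_Ioc (g := fun _ => (0 : ℂ)) fun s hs => ?_).trans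
        (by simp)
      simp [hR1 s hs.1.le]
    rw [h1, mul_zero, norm_zero]
    positivity
  · rw [norm_mul, Complex.norm_real, Real.norm_of_nonneg (Real.exp_nonneg _)]
    have h2 : ‖∫ s in (|R| + 1)..x, (Real.exp (-a * s) : ℂ) * g s‖ ≤ M := by
      refine (intervalIntegral.norm_integral_le_integral_norm_uIoc).trans ?_
      exact setIntegral_le_integral hint.norm (Eventually.of_forall fun _ => norm_nonneg _)
    have h3 : Real.exp (a * x) ≤ Real.exp (2 * a * (|R| + 1)) * Real.exp (-(a * |x|)) := by
      rw [← Real.exp_add]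
      refine Real.exp_le_exp.2 ?_
      rcases abs_cases x with ⟨h, _⟩ | ⟨h, _⟩ <;> rw [h] <;> nlinarith [abs_nonneg R]
    calc _ ≤ (Real.exp (2 * a * (|R| + 1)) * Real.exp (-(a * |x|))) * M :=
          mul_le_mul h3 h2 (norm_nonneg _) (by positivity)
      _ = _ := by ring

theorem resD_coe_compactSupport {a : ℝ} (ha : 0 < a) {g : ℝ → ℂ} (hg : Continuous g)
    (hc : HasCompactSupport g) {G : Ltwo} (hG : G =ᵐ[volume] g) :
    resD a G = (isExpDecay_prim ha hg hc).memLp.toLp (prim a g) := by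
  have h1 := isExpDecay_prim ha hg hc
  have h2 : IsExpDecay fun x => a * prim a g x + g x :=
    (h1.const_mul a).add (IsExpDecay.of_compactSupport hg hc)
  refine resD_classical ha.ne' (hasDerivAt_prim hg hc) h1.integrable h2.integrable h1.memLp h2.memLp
    ?_
  filter_upwards [hG] with x hx
  rw [hx]; ring

/-- The product rule for `(∂ₓ - a)⁻¹`. -/
theorem resD_product {a : ℝ} (ha : 0 < a) {m m' : ℝ → ℂ} (hd : ∀ x, HasDerivAt m (m' x) x)
    (hm : IsBddMul m) (hm' : IsBddMul m') (G : Ltwo) :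
    resD a (mulOp m G + mulOp m' (resD a G)) = mulOp m (resD a G) := by
  have hcl : IsClosed {G : Ltwo | resD a (mulOp m G + mulOp m' (resD a G)) = mulOp m (resD a G)} :=
    isClosed_eq (by fun_prop) (by fun_prop)
  refine hcl.closure_subset_iff.2 ?_ (dense_compactSupport G)
  rintro G ⟨g, hg, hc, hG⟩
  simp only [Set.mem_ofPred_eq]
  have h1 := isExpDecay_prim ha hg hc
  have h2 := IsExpDecay.bdd_mul hm h1
  have h4 : IsExpDecay fun x => m' x * prim a g x + m x * (a * prim a g x + g x) :=
    (h1.bdd_mul hm').add (((h1.const_mul a).add (IsExpDecay.of_compactSupport hg hc)).bdd_mul hm)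
  rw [resD_classical (f := fun x => m x * prim a g x) ha.ne'
    (fun x => (hd x).mul (hasDerivAt_prim hg hc x)) h2.integrable h4.integrable h2.memLp h4.memLp]
  · ext1
    rw [resD_coe_compactSupport ha hg hc hG]
    filter_upwards [h2.memLp.coeFn_toLp, mulOp_coe hm (h1.memLp.toLp _), h1.memLp.coeFn_toLp]
      with x h5 h6 h7
    rw [h6, h7, h5]
  · rw [resD_coe_compactSupport ha hg hc hG]
    filter_upwards [Lp.coeFn_add (mulOp m G) (mulOp m' (h1.memLp.toLp _)), mulOp_coe hm G,
      mulOp_coe hm' (h1.memLp.toLp _), h1.memLp.coeFn_toLp, hG] with x h5 h6 h7 h8 h9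
    rw [h5, Pi.add_apply, h6, h7, h8, h9]
    ring

/-- The kernel of the weighted primitive. -/
def primKernel (a x s : ℝ) : ℂ := Set.indicator (Set.Ioi x) (fun s => (Real.exp (a * (x - s)) : ℂ)) s

theorem isExpDecay_primKernel {a : ℝ} (ha : 0 < a) (x : ℝ) : IsExpDecay (primKernel a x) := by
  refine ⟨?_, a, Real.exp (2 * a * |x|), ha, fun s => ?_⟩
  · exact (Continuous.aestronglyMeasurable (by fun_prop)).indicator measurableSet_Ioi
  · by_cases hs : s ∈ Set.Ioi x
    swap
    · rw [primKernel, Set.indicator_of_notMem hs, norm_zero]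
      positivity
    rw [primKernel, Set.indicator_of_mem hs, Complex.norm_real, Real.norm_of_nonneg (Real.exp_nonneg _), ← Real.exp_add]
    refine Real.exp_le_exp.2 ?_
    have hs' : x < s := hs
    rcases abs_cases x with ⟨h, _⟩ | ⟨h, _⟩ <;> rcases abs_cases s with ⟨h', _⟩ | ⟨h', _⟩ <;>
      rw [h, h'] <;> nlinarith

theorem prim_congr {a : ℝ} {g g' : ℝ → ℂ} (h : g =ᵐ[volume] g') (x : ℝ) :
    prim a g x = prim a g' x := by
  rw [prim, prim]
  congr 1
  refine integral_congr_ae ((ae_restrict_of_ae h).mono fun s hs => ?_)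
  simp only [hs]

/-- As a pairing with a square integrable kernel, the value of the primitive at a given point
depends continuously on G, so it passes to limits in L². -/
theorem prim_eq_inner {a : ℝ} (ha : 0 < a) (x : ℝ) (G : Ltwo) :
    prim a G x = - inner ℂ ((isExpDecay_primKernel ha x).memLp.toLp _) G := by
  rw [prim, L2.inner_def, ← integral_indicator measurableSet_Ioi]
  congr 1
  refine integral_congr_ae ?_
  filter_upwards [(isExpDecay_primKernel ha x).memLp.coeFn_toLp] with s hs
  rw [RCLike.inner_apply, hs, primKernel]
  by_cases h : s ∈ Set.Ioi x
  · simp only [Set.indicator_of_mem h, Complex.conj_ofReal]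
    ring
  · simp [Set.indicator_of_notMem h]

/-- `(∂ₓ - a)⁻¹` is given by the weighted primitive. -/
theorem resD_coe {a : ℝ} (ha : 0 < a) (G : Ltwo) : resD a G =ᵐ[volume] prim a G := by
  obtain ⟨u, hu, hlim⟩ := mem_closure_iff_seq_limit.1 (dense_compactSupport G)
  choose g hg hc hG using hu
  have h1 : Tendsto (fun n => resD a (u n)) atTop (𝓝 (resD a G)) :=
    ((resD a).continuous.tendsto G).comp hlim
  -- Convergence in L² gives almost everywhere convergence only along a subsequence; the primitives
  -- converge at every point, so this is enough.
  obtain ⟨ns, hmono, hns⟩ := (tendstoInMeasure_of_tendsto_Lp h1).exists_seq_tendsto_ae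
  have h3 : ∀ n, resD a (u n) =ᵐ[volume] prim a (u n) := fun n => by
    rw [resD_coe_compactSupport ha (hg n) (hc n) (hG n)]
    exact (isExpDecay_prim ha (hg n) (hc n)).memLp.coeFn_toLp.trans
      (Eventually.of_forall fun x => (prim_congr (hG n) x).symm)
  filter_upwards [hns, ae_all_iff.2 h3] with x hx hx'
  have h4 : Tendsto (fun n => prim a (u n) x) atTop (𝓝 (prim a G x)) := by
    simp_rw [prim_eq_inner ha]
    exact (Continuous.tendsto (by fun_prop) G).comp hlim |>.neg
  refine tendsto_nhds_unique hx ?_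
  simp_rw [hx']
  exact h4.comp hmono.tendsto_atTop

end KPII

namespace KPII

/-! ### The action of polynomials in `tanh` and the weighted derivative -/

/-- The hyperbolic tangent. -/
def th (x : ℝ) : ℝ := Real.sinh x / Real.cosh x

theorem hasDerivAt_th (x : ℝ) : HasDerivAt th (1 - th x ^ 2) x := by
  have h := (Real.hasDerivAt_sinh x).div (Real.hasDerivAt_cosh x) (Real.cosh_pos x).ne'
  refine h.congr_deriv ?_
  have := (Real.cosh_pos x).ne'
  rw [th]
  field_simp

theorem continuous_th : Continuous th :=
  continuous_iff_continuousAt.2 fun x => (hasDerivAt_th x).continuousAt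

theorem one_sub_th_sq (x : ℝ) : 1 - th x ^ 2 = (Real.cosh x ^ 2)⁻¹ := by
  have := (Real.cosh_pos x).ne'
  have h := Real.cosh_sq_sub_sinh_sq x
  rw [th, div_pow]
  field_simp
  linarith

theorem abs_th_le_one (x : ℝ) : |th x| ≤ 1 := by
  have h : 0 ≤ 1 - th x ^ 2 := by rw [one_sub_th_sq]; positivity
  rw [abs_le]
  constructor <;> nlinarith

/-- A polynomial in `tanh x`. -/
def polyFun (p : Polynomial ℂ) (x : ℝ) : ℂ := p.eval (th x : ℂ)

theorem continuous_polyFun (p : Polynomial ℂ) : Continuous (polyFun p) :=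
  p.continuous.comp (Complex.continuous_ofReal.comp continuous_th)

theorem isBddMul_polyFun (p : Polynomial ℂ) : IsBddMul (polyFun p) := by
  obtain ⟨C, hC⟩ := (isCompact_Icc (a := (-1 : ℝ)) (b := 1)).exists_bound_of_continuousOn
    (f := fun t : ℝ => p.eval (t : ℂ)) (by fun_prop)
  exact IsBddMul.of_continuous (continuous_polyFun p) (C := C) fun x =>
    hC _ (abs_le.1 (abs_th_le_one x))

theorem mulOp_add {m m' : ℝ → ℂ} (hm : IsBddMul m) (hm' : IsBddMul m') (f : Ltwo) :
    mulOp (fun x => m x + m' x) f = mulOp m f + mulOp m' f := by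
  have h : IsBddMul fun x => m x + m' x := by
    obtain ⟨C, hC⟩ := hm.2
    obtain ⟨C', hC'⟩ := hm'.2
    exact ⟨hm.1.add hm'.1, C + C', fun x => (norm_add_le _ _).trans (add_le_add (hC x) (hC' x))⟩
  ext1
  filter_upwards [mulOp_coe h f, mulOp_coe hm f, mulOp_coe hm' f,
    Lp.coeFn_add (mulOp m f) (mulOp m' f)] with x h1 h2 h3 h4
  rw [h1, h4, Pi.add_apply, h2, h3]; ring

theorem mulOp_const (c : ℂ) (f : Ltwo) : mulOp (fun _ => c) f = c • f := by
  ext1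
  filter_upwards [mulOp_coe (isBddMul_const c) f, Lp.coeFn_smul c f] with x h1 h2
  rw [h1, h2]; rfl

/-- A polynomial acts on `L²(ℝ)` as the multiplication by its value at `tanh`. -/
instance instModulePolynomial : Module (Polynomial ℂ) Ltwo :=
  { smul := fun p f => mulOp (polyFun p) f
    one_smul := fun f => by
      change mulOp (polyFun 1) f = f
      have : polyFun 1 = fun _ => 1 := by ext x; simp [polyFun]
      rw [this, mulOp_const, one_smul]
    mul_smul := fun p q f => by
      change mulOp (polyFun (p * q)) f = mulOp (polyFun p) (mulOp (polyFun q) f)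
      rw [mulOp_mulOp (isBddMul_polyFun p) (isBddMul_polyFun q)]
      congr 2; ext x; simp [polyFun]
    smul_zero := fun p => map_zero (mulOp (polyFun p))
    smul_add := fun p => map_add (mulOp (polyFun p))
    add_smul := fun p q f => by
      change mulOp (polyFun (p + q)) f = mulOp (polyFun p) f + mulOp (polyFun q) f
      rw [← mulOp_add (isBddMul_polyFun p) (isBddMul_polyFun q)]
      congr 2; ext x; simp [polyFun]
    zero_smul := fun f => by
      change mulOp (polyFun 0) f = 0
      have : polyFun 0 = fun _ => 0 := by ext x; simp [polyFun]
      rw [this, mulOp_const, zero_smul] }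

/-- The point of the module structure over ℂ[T] is that operator identities whose coefficients are
polynomials in tanh become commutative algebra, closed by `module` or `match_scalars`. -/
theorem psmul_def (p : Polynomial ℂ) (f : Ltwo) : p • f = mulOp (polyFun p) f := rfl

instance instIsScalarTowerPolynomial : IsScalarTower ℂ (Polynomial ℂ) Ltwo where
  smul_assoc c p f := by
    rw [psmul_def, psmul_def]
    have : polyFun (c • p) = fun x => (fun _ => c) x * polyFun p x := by
      ext x; simp [polyFun]
    rw [this, ← mulOp_mulOp (isBddMul_const c) (isBddMul_polyFun p), mulOp_const]

/-- The polynomial that acts as the multiplication by `tanh`. -/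
notation "𝐓" => (Polynomial.X : Polynomial ℂ)

/-- The derivation `∂ₓ` on polynomials in `tanh`. -/
def pder (p : Polynomial ℂ) : Polynomial ℂ := (1 - 𝐓 ^ 2) * Polynomial.derivative p

theorem hasDerivAt_polyFun (p : Polynomial ℂ) (x : ℝ) :
    HasDerivAt (polyFun p) (polyFun (pder p) x) x := by
  have h1 := (p.hasDerivAt (th x : ℂ)).comp x (hasDerivAt_th x).ofReal_comp
  refine h1.congr_deriv ?_
  simp [polyFun, pder]
  ring

/-- Partial fractions of the symbols, 1/(s − a) − 1/(s + a) = 2a/((s − a)(s + a)). This is the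
source of the term −2a⟨y, y'⟩ in the integration by parts for the weighted derivative. -/
theorem resD_sub_resD_neg {a : ℝ} (ha : a ≠ 0) (g : Ltwo) :
    resD a g - resD (-a) g = (2 * a : ℂ) • resD (-a) (resD a g) := by
  have hna := neg_ne_zero.2 ha
  have h1 : ∀ c : ℂ, c • resD (-a) (resD a g) =
      fourierMul (fun ξ => (fun _ => c) ξ * (resSymbol (-a) ξ * resSymbol a ξ)) g := fun c => by
    have e : c • resD (-a) (resD a g) = fourierMul (fun _ => c) (resD (-a) (resD a g)) := by
      apply fourier_injective
      rw [fourier_fourierMul, mulOp_const]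
      exact map_smul (Lp.fourierTransformₗᵢ ℝ ℂ) _ _
    rw [e, resD, resD, fourierMul_fourierMul (isBddMul_resSymbol hna) (isBddMul_resSymbol ha),
      fourierMul_fourierMul (isBddMul_const c)
        ((isBddMul_resSymbol hna).mul (isBddMul_resSymbol ha))]
  rw [h1, sub_eq_iff_eq_add]
  apply fourier_injective
  have h2 : 𝓕 (fourierMul (fun ξ => (fun _ => (2 * a : ℂ)) ξ * (resSymbol (-a) ξ * resSymbol a ξ)) g
      + resD (-a) g) = 𝓕 (fourierMul (fun ξ => (fun _ => (2 * a : ℂ)) ξ *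
        (resSymbol (-a) ξ * resSymbol a ξ)) g) + 𝓕 (resD (-a) g) :=
    map_add (Lp.fourierTransformₗᵢ ℝ ℂ) _ _
  rw [h2, resD, resD, fourier_fourierMul, fourier_fourierMul, fourier_fourierMul,
    ← mulOp_add ((isBddMul_const _).mul ((isBddMul_resSymbol hna).mul (isBddMul_resSymbol ha)))
      (isBddMul_resSymbol hna)]
  congr 2
  ext ξ
  have h3 := symbol_ne_zero ha ξ
  have h4 := symbol_ne_zero hna ξ
  simp only [resSymbol]
  push_cast at h4 ⊢
  field_simp
  ring

/-- `y` is in the domain of the weighted derivative `D = ∂ₓ - a`, and `D y = g`. -/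
def IsD (a : ℝ) (y g : Ltwo) : Prop := resD a g = y

namespace IsD
variable {a : ℝ} {y g y' g' : Ltwo}

theorem resD (a : ℝ) (g : Ltwo) : IsD a (KPII.resD a g) g := rfl

theorem add (h : IsD a y g) (h' : IsD a y' g') : IsD a (y + y') (g + g') := by
  rw [IsD, map_add, h, h']

theorem sub (h : IsD a y g) (h' : IsD a y' g') : IsD a (y - y') (g - g') := by
  rw [IsD, map_sub, h, h']

theorem neg (h : IsD a y g) : IsD a (-y) (-g) := by
  rw [IsD, map_neg, h]

theorem smul (c : ℂ) (h : IsD a y g) : IsD a (c • y) (c • g) := by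
  rw [IsD, map_smul, h]

theorem mul (ha : 0 < a) {m m' : ℝ → ℂ} (hd : ∀ x, HasDerivAt m (m' x) x)
    (hm : IsBddMul m) (hm' : IsBddMul m') (h : IsD a y g) :
    IsD a (mulOp m y) (mulOp m g + mulOp m' y) := by
  rw [IsD, ← h]
  exact resD_product ha hd hm hm' g

theorem psmul (ha : 0 < a) (p : Polynomial ℂ) (h : IsD a y g) :
    IsD a (p • y) (p • g + pder p • y) :=
  h.mul ha (hasDerivAt_polyFun p) (isBddMul_polyFun p) (isBddMul_polyFun _)

theorem unique (ha : a ≠ 0) (h : IsD a y g) (h' : IsD a y g') : g = g' :=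
  resD_injective ha (h.trans h'.symm)

/-- D has trivial kernel on L², so an identity between elements of its domain may be checked after
differentiation. The intertwining relation is verified in this way. -/
theorem eq_of_deriv (h : IsD a y g) (h' : IsD a y' g') (e : g = g') : y = y' := by
  rw [← h, ← h', e]

theorem congr (h : IsD a y g) (ey : y' = y) (eg : g' = g) : IsD a y' g' := by
  rw [ey, eg]; exact h

/-- Integration by parts. -/
theorem inner (ha : 0 < a) (h : IsD a y g) (h' : IsD a y' g') :
    Inner.inner ℂ y g' + Inner.inner ℂ g y' = -(2 * a : ℂ) * Inner.inner ℂ y y' := by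
  rw [← h, ← h', inner_resD_left ha.ne', inner_resD_left ha.ne']
  have := resD_sub_resD_neg ha.ne' g'
  rw [sub_eq_iff_eq_add'] at this
  rw [this, inner_add_right, inner_smul_right, ← this]
  ring

/-- D is the skew-adjoint ∂ₓ minus a. -/
theorem re_inner (ha : 0 < a) (h : IsD a y g) :
    (Inner.inner ℂ y g).re = -a * ‖y‖ ^ 2 := by
  have h1 := congrArg Complex.re (h.inner ha h)
  rw [Complex.add_re, ← inner_conj_symm g y, Complex.conj_re, inner_self_eq_norm_sq_to_K] at h1
  have h2 : (-(2 * a : ℂ) * ((‖y‖ : ℝ) : ℂ) ^ 2).re = -2 * a * ‖y‖ ^ 2 := by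
    rw [← Complex.ofReal_pow, show (-(2 * a : ℂ)) = ((-2 * a : ℝ) : ℂ) by push_cast; ring,
      ← Complex.ofReal_mul, Complex.ofReal_re]
  rw [show ((‖y‖ : ℝ) : ℂ) = (RCLike.ofReal ‖y‖ : ℂ) from rfl] at h2
  linarith

end IsD

theorem norm_resD_apply_le {a : ℝ} (ha : 0 < a) (g : Ltwo) : a * ‖resD a g‖ ≤ ‖g‖ := by
  have h := (resD a).le_of_opNorm_le (norm_resD_le ha.ne') g
  rw [abs_of_pos ha, inv_mul_eq_div, le_div_iff₀ ha] at h
  linarith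

theorem re_inner_mulOp_le {m : ℝ → ℂ} (hm : IsBddMul m) {m' : ℝ → ℂ} (hm' : IsBddMul m')
    (h : ∀ x, (m x).re ≤ (m' x).re) (u : Ltwo) :
    (inner ℂ u (mulOp m u)).re ≤ (inner ℂ u (mulOp m' u)).re := by
  rw [L2.inner_def, L2.inner_def]
  have e : ∀ f : ℝ → ℂ, Integrable f → (∫ x, f x).re = ∫ x, (f x).re := fun f hf =>
    (integral_re (𝕜 := ℂ) hf).symm
  rw [e _ (L2.integrable_inner _ _), e _ (L2.integrable_inner _ _)]
  have hre : ∀ f : ℝ → ℂ, Integrable f → Integrable fun x => (f x).re := fun f hf => hf.re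
  refine integral_mono_ae (hre _ (L2.integrable_inner _ _)) (hre _ (L2.integrable_inner _ _)) ?_
  filter_upwards [mulOp_coe hm u, mulOp_coe hm' u] with x h1 h2
  simp only [RCLike.inner_apply, h1, h2]
  have e2 : ∀ z : ℂ, (z * u x * (starRingEnd ℂ) (u x)).re = z.re * Complex.normSq (u x) := by
    intro z
    rw [mul_assoc, Complex.mul_conj, Complex.re_mul_ofReal]
  rw [e2, e2]
  exact mul_le_mul_of_nonneg_right (h x) (Complex.normSq_nonneg _)

theorem re_inner_smul_self (c : ℝ) (u : Ltwo) : (inner ℂ u ((c : ℂ) • u)).re = c * ‖u‖ ^ 2 := by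
  rw [inner_smul_right, inner_self_eq_norm_sq_to_K, Complex.re_ofReal_mul]
  congr 1
  change (((‖u‖ : ℝ) : ℂ) ^ 2).re = _
  rw [← Complex.ofReal_pow, Complex.ofReal_re]

theorem re_inner_psmul_le {p : Polynomial ℂ} {c : ℝ} (h : ∀ x, (polyFun p x).re ≤ c) (u : Ltwo) :
    (inner ℂ u (p • u)).re ≤ c * ‖u‖ ^ 2 := by
  rw [← re_inner_smul_self, ← mulOp_const]
  exact re_inner_mulOp_le (isBddMul_polyFun p) (isBddMul_const _) (by simpa using h) u

/-- Polynomials in `tanh` with real values. -/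
def IsRealPoly (p : Polynomial ℂ) : Prop := ∀ x, (starRingEnd ℂ) (polyFun p x) = polyFun p x

theorem IsRealPoly.inner {p : Polynomial ℂ} (hp : IsRealPoly p) (u v : Ltwo) :
    inner ℂ (p • u) v = inner ℂ u (p • v) := by
  rw [psmul_def, inner_mulOp_left (isBddMul_polyFun p), psmul_def]
  congr 3
  exact funext hp

/-- Differentiation of `tanh`-weighted quadratic forms. -/
theorem IsD.re_inner_psmul {a : ℝ} (ha : 0 < a) {y g : Ltwo} (h : IsD a y g) {p : Polynomial ℂ}
    (hp : IsRealPoly p) : 2 * (Inner.inner ℂ y (p • g)).re =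
      -(2 * a) * (Inner.inner ℂ y (p • y)).re - (Inner.inner ℂ y (pder p • y)).re := by
  have h1 := congrArg Complex.re (h.inner ha (h.psmul ha p))
  rw [inner_add_right, ← hp.inner g y, ← inner_conj_symm (p • g) y] at h1
  simp only [Complex.add_re, Complex.conj_re] at h1
  rw [show (-(2 * a : ℂ)) = ((-(2 * a) : ℝ) : ℂ) by push_cast; ring, Complex.re_ofReal_mul] at h1
  linarith

end KPII

namespace KPII

/-! ### The linearized operator at a fixed transverse frequency -/

/-- The potential `2 sech²`. -/
def pot : Polynomial ℂ := 2 * (1 - 𝐓 ^ 2)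

theorem pder_X : pder 𝐓 = 1 - 𝐓 ^ 2 := by simp [pder]

theorem pder_C (c : ℂ) : pder (Polynomial.C c) = 0 := by simp [pder]

theorem pder_one : pder 1 = 0 := by simp [pder]

theorem pder_ofNat (n : ℕ) [n.AtLeastTwo] : pder (ofNat(n)) = 0 := by simp [pder]

theorem pder_add (p q : Polynomial ℂ) : pder (p + q) = pder p + pder q := by
  simp [pder, mul_add]

theorem pder_sub (p q : Polynomial ℂ) : pder (p - q) = pder p - pder q := by
  simp [pder, mul_sub]

theorem pder_neg (p : Polynomial ℂ) : pder (-p) = -pder p := by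
  simp [pder]

theorem pder_mul (p q : Polynomial ℂ) : pder (p * q) = pder p * q + p * pder q := by
  simp [pder]; ring

theorem pder_pow (p : Polynomial ℂ) (n : ℕ) : pder (p ^ n) = n * p ^ (n - 1) * pder p := by
  simp [pder, Polynomial.derivative_pow]; ring

/-- The operator of multiplication by a polynomial in `tanh`. -/
def polyOp (p : Polynomial ℂ) : Ltwo →L[ℂ] Ltwo := mulOp (polyFun p)

theorem polyOp_apply (p : Polynomial ℂ) (f : Ltwo) : polyOp p f = p • f := rfl

/-- The constant polynomial `η`. -/
abbrev ceta (η : ℝ) : Polynomial ℂ := Polynomial.C (η : ℂ)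

/-- The operator `g ↦ 𝓛(η) J³ g`. -/
def genMap (a η : ℝ) : Ltwo →L[ℂ] Ltwo :=
  -1 + polyOp 4 * (resD a) ^ 2 + polyOp (3 * ceta η ^ 2) * (resD a) ^ 4
    - polyOp (6 * pder pot) * (resD a) ^ 3 - polyOp (6 * pot) * (resD a) ^ 2

theorem genMap_apply (a η : ℝ) (g : Ltwo) : genMap a η g =
    -g + (4 : Polynomial ℂ) • resD a (resD a g)
      + (3 * ceta η ^ 2) • resD a (resD a (resD a (resD a g)))
      - (6 * pder pot) • resD a (resD a (resD a g)) - (6 * pot) • resD a (resD a g) := rfl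

/-- The graph of the linearized operator at transverse frequency `η`, conjugated by `e^{ax}`. -/
def fibreGraph (a η : ℝ) : Submodule ℂ (Ltwo × Ltwo) :=
  LinearMap.range ((((resD a) ^ 3).prod (genMap a η)) : Ltwo →ₗ[ℂ] Ltwo × Ltwo)

theorem mem_fibreGraph {a η : ℝ} {u w : Ltwo} : (u, w) ∈ fibreGraph a η ↔
    ∃ g, resD a (resD a (resD a g)) = u ∧ genMap a η g = w := by
  simp only [fibreGraph, LinearMap.mem_range, ContinuousLinearMap.coe_coe,
    ContinuousLinearMap.prod_apply, Prod.mk.injEq]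
  rfl

/-- The operator `D² + 4 T D + 4 + η² J²` preceded and followed by a double primitive. -/
def miura (a η : ℝ) : Ltwo →L[ℂ] Ltwo :=
  1 + polyOp 4 * resD a * polyOp 𝐓 + polyOp 4 * (resD a) ^ 2 * polyOp (𝐓 ^ 2) +
    polyOp (ceta η ^ 2) * (resD a) ^ 4

/-- This is J²(D² + 4TD + 4 + η²J²) with TD rewritten as DT − (1 − T²): the constant terms cancel,
no derivative of u is left, and the operator is bounded on all of L². -/
theorem miura_apply (a η : ℝ) (u : Ltwo) : miura a η u =
    u + (4 : Polynomial ℂ) • resD a (𝐓 • u) + (4 : Polynomial ℂ) • resD a (resD a (𝐓 ^ 2 • u)) +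
      (ceta η ^ 2) • resD a (resD a (resD a (resD a u))) := rfl

section
variable {a η : ℝ} {g₀ g₁ g₂ g₃ g₄ g₅ : Ltwo}

/-- `g₅ = J⁵ g₀` through the successive primitives. -/
structure IsTower (a : ℝ) (g₀ g₁ g₂ g₃ g₄ g₅ : Ltwo) : Prop where
  d₁ : IsD a g₁ g₀
  d₂ : IsD a g₂ g₁
  d₃ : IsD a g₃ g₂
  d₄ : IsD a g₄ g₃
  d₅ : IsD a g₅ g₄

theorem isTower (a : ℝ) (g : Ltwo) : IsTower a g (resD a g) (resD a (resD a g))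
    (resD a (resD a (resD a g))) (resD a (resD a (resD a (resD a g))))
    (resD a (resD a (resD a (resD a (resD a g))))) := ⟨rfl, rfl, rfl, rfl, rfl⟩

namespace IsTower
variable (ha : 0 < a) (h : IsTower a g₀ g₁ g₂ g₃ g₄ g₅)
include h

theorem genMap_eq : genMap a η g₀ = -g₀ + (4 : Polynomial ℂ) • g₂ + (3 * ceta η ^ 2) • g₄
    + (24 * 𝐓 * (1 - 𝐓 ^ 2)) • g₃ - (12 * (1 - 𝐓 ^ 2)) • g₂ := by
  have h1 : resD a g₀ = g₁ := h.d₁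
  have h2 : resD a g₁ = g₂ := h.d₂
  have h3 : resD a g₂ = g₃ := h.d₃
  have h4 : resD a g₃ = g₄ := h.d₄
  rw [genMap_apply, h1, h2, h3, h4]
  simp only [pot, pder_X, pder_one, pder_ofNat, pder_sub, pder_mul, pder_pow]
  push_cast
  module

include ha

/-- 𝓛(η) is an exact derivative, D applied to −D² + 4 − 6φ + 3η²J², and 4 − 6φ = 12T² − 8. -/
theorem isD_genMap : IsD a (-g₁ + (12 * 𝐓 ^ 2 - 8) • g₃ + (3 * ceta η ^ 2) • g₅)
    (genMap a η g₀) := by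
  rw [h.genMap_eq]
  refine ((h.d₁.neg.add (h.d₃.psmul ha _)).add (h.d₅.psmul ha _)).congr rfl ?_
  simp only [pder_X, pder_ofNat, pder_sub, pder_mul, pder_pow, pder_C]
  push_cast
  module

/-- The second primitive of `𝓛 u`, `u = g₃`. -/
theorem isD_genMap₂ {v : Ltwo}
    (hv : v = g₁ + (4 * 𝐓) • g₂ + (4 : Polynomial ℂ) • g₃ + (ceta η ^ 2) • g₅) :
    IsD a (-(4 : Polynomial ℂ) • g₂ - (12 * 𝐓) • g₃ - (8 : Polynomial ℂ) • g₄ +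
      (3 : Polynomial ℂ) • resD a v) (resD a (genMap a η g₀)) := by
  -- The η² term of the first primitive is that of 3v. After 3v is subtracted, what remains is an
  -- explicit derivative, so a second primitive exists in closed form apart from 3Jv.
  rw [show resD a (genMap a η g₀) = _ from h.isD_genMap ha, hv]
  refine ((((h.d₂.psmul ha _).sub (h.d₃.psmul ha _)).sub
    (h.d₄.psmul ha _)).add ((IsD.resD a _).psmul ha _)).congr rfl ?_
  simp only [pder_X, pder_ofNat, pder_mul, pder_neg]
  module

theorem isD_miura₁ : IsD a (miura a η g₃) (g₂ + (4 * 𝐓) • g₃ +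
    (4 : Polynomial ℂ) • resD a (𝐓 ^ 2 • g₃) + (ceta η ^ 2) • resD a g₅) := by
  have h4 : resD a g₃ = g₄ := h.d₄
  have h5 : resD a g₄ = g₅ := h.d₅
  rw [miura_apply, h4, h5]
  refine (((h.d₃.add ((IsD.resD a (𝐓 • g₃)).psmul ha _)).add
    ((IsD.resD a (resD a (𝐓 ^ 2 • g₃))).psmul ha _)).add
    ((IsD.resD a (resD a g₅)).psmul ha _)).congr rfl ?_
  simp only [pder_ofNat, pder_pow, pder_C]
  module

theorem isD_miura₂ : IsD a
    (g₂ + (4 * 𝐓) • g₃ + (4 : Polynomial ℂ) • resD a (𝐓 ^ 2 • g₃) + (ceta η ^ 2) • resD a g₅)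
    (g₁ + (4 * 𝐓) • g₂ + (4 : Polynomial ℂ) • g₃ + (ceta η ^ 2) • g₅) := by
  refine (((h.d₂.add (h.d₃.psmul ha _)).add ((IsD.resD a _).psmul ha _)).add
    ((IsD.resD a g₅).psmul ha _)).congr rfl ?_
  simp only [pder_X, pder_ofNat, pder_mul, pder_pow, pder_C]
  module

/-- The intertwining relation `Γ 𝓛 = 𝓛₀ Γ`, where `Γ u = D⁻² v`. -/
theorem miura_genMap {v v₁ : Ltwo}
    (hv : v = g₁ + (4 * 𝐓) • g₂ + (4 : Polynomial ℂ) • g₃ + (ceta η ^ 2) • g₅)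
    (hv₁ : v₁ = g₀ + (4 * 𝐓) • g₁ + (8 - 4 * 𝐓 ^ 2) • g₂ + (ceta η ^ 2) • g₄) :
    IsD a v v₁ ∧ miura a η (genMap a η g₀) = -v₁ + (4 : Polynomial ℂ) • resD a v +
      (3 * ceta η ^ 2) • resD a (resD a (resD a v)) := by
  have e0 : IsD a v v₁ := by
    rw [hv, hv₁]
    refine (((h.d₁.add (h.d₂.psmul ha _)).add (h.d₃.psmul ha _)).add
      (h.d₅.psmul ha _)).congr rfl ?_
    simp only [pder_X, pder_ofNat, pder_mul, pder_pow, pder_C]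
    module
  refine ⟨e0, ?_⟩
  have hI : resD a (resD a (genMap a η g₀)) = _ := h.isD_genMap₂ ha hv
  have hw := h.genMap_eq (η := η)
  set w := genMap a η g₀
  set j := -(4 : Polynomial ℂ) • g₂ - (12 * 𝐓) • g₃ - (8 : Polynomial ℂ) • g₄ +
      (3 : Polynomial ℂ) • resD a v with hj
  rw [miura_apply, hI]
  -- Neither w nor v₁ need be differentiable, but their sum is: the top order terms −g₀ and g₀
  -- cancel.
  have hA : w + v₁ = (4 * 𝐓) • g₁ + (8 * 𝐓 ^ 2) • g₂ + (24 * 𝐓 * (1 - 𝐓 ^ 2)) • g₃ +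
      (4 * ceta η ^ 2) • g₄ := by
    rw [hw, hv₁]; module
  have hB : IsD a ((4 * 𝐓) • g₁ + (8 * 𝐓 ^ 2) • g₂ + (24 * 𝐓 * (1 - 𝐓 ^ 2)) • g₃ +
      (4 * ceta η ^ 2) • g₄) ((-4 * 𝐓) • w + ((4 + 4 * 𝐓 ^ 2) • g₁ +
        (8 * 𝐓 + 8 * 𝐓 ^ 3) • g₂ + (24 - 24 * 𝐓 ^ 4 + 4 * ceta η ^ 2) • g₃ + (12 * ceta η ^ 2 * 𝐓) • g₄)) := by
    refine ((((h.d₁.psmul ha _).add (h.d₂.psmul ha _)).add (h.d₃.psmul ha _)).add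
      (h.d₄.psmul ha _)).congr rfl ?_
    rw [hw]
    simp only [pder_X, pder_ofNat, pder_mul, pder_pow, pder_C, pder_sub, pder_one]
    push_cast
    module
  -- The identity is verified after two differentiations, each an application of `IsD.eq_of_deriv`;
  -- what remains is linear algebra over ℂ[T].
  have key : w + v₁ + (4 : Polynomial ℂ) • resD a (𝐓 • w) +
      (4 : Polynomial ℂ) • resD a (resD a (𝐓 ^ 2 • w)) + (ceta η ^ 2) • resD a (resD a j) =
      (4 : Polynomial ℂ) • resD a v + (3 * ceta η ^ 2) • resD a (resD a (resD a v)) := by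
    rw [hA]
    refine IsD.eq_of_deriv (((hB.add ((IsD.resD a (𝐓 • w)).psmul ha _)).add
      ((IsD.resD a _).psmul ha _)).add ((IsD.resD a _).psmul ha _))
      (((IsD.resD a v).psmul ha _).add ((IsD.resD a _).psmul ha _)) ?_
    simp only [pder_ofNat, pder_mul, pder_pow, pder_C]
    have hC := (((((h.d₁.psmul ha (4 + 4 * 𝐓 ^ 2)).add (h.d₂.psmul ha (8 * 𝐓 + 8 * 𝐓 ^ 3))).add
      (h.d₃.psmul ha (24 - 24 * 𝐓 ^ 4 + 4 * ceta η ^ 2))).add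
      (h.d₄.psmul ha (12 * ceta η ^ 2 * 𝐓))).add
      ((IsD.resD a (𝐓 ^ 2 • w)).psmul ha 4)).add ((IsD.resD a j).psmul ha (ceta η ^ 2))
    have hE := (e0.psmul ha 4).add ((IsD.resD a (resD a v)).psmul ha (3 * ceta η ^ 2))
    have := hC.eq_of_deriv hE (by
      rw [hw, hj, hv₁]
      simp only [pder_X, pder_ofNat, pder_mul, pder_pow, pder_C, pder_sub, pder_add]
      push_cast
      module)
    linear_combination (norm := module) this
  linear_combination (norm := module) key
end IsTower
end

end KPII

namespace KPII

/-! ### Energy identities -/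

section Energy
variable {a η : ℝ} {g₀ g₁ g₂ g₃ g₄ g₅ : Ltwo}

theorem IsD.norm_le {y g : Ltwo} (ha : 0 < a) (h : IsD a y g) : a * ‖y‖ ≤ ‖g‖ := by
  rw [← h]; exact norm_resD_apply_le ha g

namespace IsTower
variable (ha : 0 < a) (h : IsTower a g₀ g₁ g₂ g₃ g₄ g₅)
include h ha

/-- On the Fourier side, s = −a + iω has Re s³ = 3aω² − a³ = 3a|s|² − 4a³. Here it is obtained by
two integrations by parts. -/
theorem re_inner_three : (inner ℂ g₃ g₀).re = 3 * a * ‖g₂‖ ^ 2 - 4 * a ^ 3 * ‖g₃‖ ^ 2 := by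
  have e : ∀ z w : ℂ, z = -(2 * a : ℂ) * w → z.re = -(2 * a) * w.re := fun z w hz => by
    rw [hz, show (-(2 * a : ℂ)) = ((-(2 * a) : ℝ) : ℂ) by push_cast; ring, Complex.re_ofReal_mul]
  have h1 := e _ _ (h.d₃.inner ha h.d₁)
  have h2 := e _ _ (h.d₃.inner ha h.d₂)
  have h3 := h.d₂.re_inner ha
  have h4 := h.d₃.re_inner ha
  have h5 : (inner ℂ g₂ g₂).re = ‖g₂‖ ^ 2 := inner_self_eq_norm_sq (𝕜 := ℂ) g₂
  rw [Complex.add_re] at h1 h2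
  rw [h3] at h1
  rw [h5, h4] at h2
  linear_combination h1 - 2 * a * h2

theorem re_inner_cubic :
    (inner ℂ g₃ (-g₀ + (4 : Polynomial ℂ) • g₂ + (3 * ceta η ^ 2) • g₄)).re =
      -(3 * a * ‖g₂‖ ^ 2) + (4 * a ^ 3 - 4 * a) * ‖g₃‖ ^ 2 - 3 * η ^ 2 * a * ‖g₄‖ ^ 2 := by
  have e4 : (4 : Polynomial ℂ) • g₂ = ((4 : ℝ) : ℂ) • g₂ := by
    rw [psmul_def, ← mulOp_const]; congr 2; ext x; simp [polyFun]
  have e3 : (3 * ceta η ^ 2) • g₄ = ((3 * η ^ 2 : ℝ) : ℂ) • g₄ := by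
    rw [psmul_def, ← mulOp_const]; congr 2; ext x; simp [polyFun]
  have h4 := h.d₃.re_inner ha
  have h6 := h.d₄.re_inner ha
  rw [e4, e3, inner_add_right, inner_add_right, inner_neg_right, inner_smul_right,
    inner_smul_right]
  simp only [Complex.add_re, Complex.neg_re, Complex.re_ofReal_mul]
  rw [← inner_conj_symm g₃ g₄, Complex.conj_re, h6, h.re_inner_three ha, h4]
  ring

/-- The bound a‖u‖ ≤ ‖Du‖ turns −3a‖Du‖² + (4a³ − 4a)‖u‖² into −(4a − a³)‖u‖². The resulting rate is
positive precisely for 0 < a < 2. -/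
theorem re_inner_cubic_le :
    (inner ℂ g₃ (-g₀ + (4 : Polynomial ℂ) • g₂ + (3 * ceta η ^ 2) • g₄)).re ≤
      -(a * (4 - a ^ 2)) * ‖g₃‖ ^ 2 := by
  rw [h.re_inner_cubic ha]
  have h1 := h.d₃.norm_le ha
  have h2 : (a * ‖g₃‖) ^ 2 ≤ ‖g₂‖ ^ 2 := pow_le_pow_left₀ (by positivity) h1 2
  have h3 : 0 ≤ 3 * η ^ 2 * a * ‖g₄‖ ^ 2 := by positivity
  nlinarith

/-- Integration by parts gives ‖u‖² = −Re⟨Ju, Du⟩ + 2a²‖Ju‖², and a²‖Ju‖ ≤ ‖Du‖ absorbs the second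
term; hence the factor 1 + 2 = 3. -/
theorem norm_sq_le : ‖g₃‖ ^ 2 ≤ 3 * (‖g₄‖ * ‖g₂‖) := by
  have h1 := congrArg Complex.re (h.d₄.inner ha h.d₃)
  have h4 := h.d₄.re_inner ha
  have h5 : (inner ℂ g₃ g₃).re = ‖g₃‖ ^ 2 := inner_self_eq_norm_sq (𝕜 := ℂ) g₃
  rw [show (-(2 * a : ℂ)) = ((-(2 * a) : ℝ) : ℂ) by push_cast; ring, Complex.re_ofReal_mul,
    Complex.add_re, h4, h5] at h1
  have h6 : -(inner ℂ g₄ g₂).re ≤ ‖g₄‖ * ‖g₂‖ :=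
    (neg_le_abs _).trans ((Complex.abs_re_le_norm _).trans (norm_inner_le_norm _ _))
  have h7 := h.d₄.norm_le ha
  have h8 := h.d₃.norm_le ha
  have h9 : a * (a * ‖g₄‖) ≤ ‖g₂‖ := (mul_le_mul_of_nonneg_left h7 ha.le).trans h8
  have h10 := mul_le_mul_of_nonneg_left h9 (norm_nonneg g₄)
  nlinarith

end IsTower

/-- The potential in the energy identity. -/
def energyPot (a : ℝ) : Polynomial ℂ := Polynomial.C (6 * a : ℂ) * pot - 3 * pder pot

theorem polyFun_energyPot (a x : ℝ) : polyFun (energyPot a) x =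
    ((12 * a * (1 - th x ^ 2) + 12 * th x * (1 - th x ^ 2) : ℝ) : ℂ) := by
  simp [polyFun, energyPot, pot, pder]; ring

theorem isRealPoly_pot : IsRealPoly pot := fun x => by
  have : polyFun pot x = ((2 * (1 - th x ^ 2) : ℝ) : ℂ) := by simp [polyFun, pot]
  rw [this, Complex.conj_ofReal]

/-- The potential enters the energy through Re⟨u, −6D(φu)⟩ = ⟨(6aφ − 3φ')u, u⟩, again one
integration by parts; the rest is the free operator. -/
theorem IsTower.re_inner_genMap (ha : 0 < a) (h : IsTower a g₀ g₁ g₂ g₃ g₄ g₅) :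
    (inner ℂ g₃ (genMap a η g₀)).re = -(3 * a * ‖g₂‖ ^ 2) + (4 * a ^ 3 - 4 * a) * ‖g₃‖ ^ 2
      - 3 * η ^ 2 * a * ‖g₄‖ ^ 2 + (inner ℂ g₃ (energyPot a • g₃)).re := by
  have h1 : resD a g₀ = g₁ := h.d₁
  have h2 : resD a g₁ = g₂ := h.d₂
  have h3 : resD a g₂ = g₃ := h.d₃
  have h4 : resD a g₃ = g₄ := h.d₄
  have h5 := h.d₃.re_inner_psmul ha isRealPoly_pot
  have e6 : ∀ (p : Polynomial ℂ) (y : Ltwo) (n : ℕ), (n * p) • y = ((n : ℝ) : ℂ) • (p • y) := by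
    intro p y n
    rw [mul_smul, psmul_def, psmul_def, ← mulOp_const]; congr 2; ext x; simp [polyFun]
  have e7 : energyPot a • g₃ = ((6 * a : ℝ) : ℂ) • (pot • g₃) - ((3 : ℝ) : ℂ) • (pder pot • g₃) := by
    have := e6 (pder pot) g₃ 3
    push_cast at this
    rw [energyPot, sub_smul, this, mul_smul]
    congr 1
    rw [psmul_def, ← mulOp_const]; congr 2; ext x; simp [polyFun]
  have e8 : (6 * pder pot) • g₃ = ((6 : ℝ) : ℂ) • (pder pot • g₃) := by
    have := e6 (pder pot) g₃ 6
    push_cast at this ⊢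
    exact this
  have e9 : (6 * pot) • g₂ = ((6 : ℝ) : ℂ) • (pot • g₂) := by
    have := e6 pot g₂ 6
    push_cast at this ⊢
    exact this
  rw [genMap_apply, h1, h2, h3, h4, e8, e9, inner_sub_right, inner_sub_right, Complex.sub_re,
    Complex.sub_re, h.re_inner_cubic ha, e7, inner_sub_right, Complex.sub_re]
  simp only [inner_smul_right, Complex.re_ofReal_mul]
  linarith

theorem energyPot_le (ha : 0 < a) (x : ℝ) : (polyFun (energyPot a) x).re ≤ 12 * a + 12 := by
  rw [polyFun_energyPot, Complex.ofReal_re]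
  have := abs_le.1 (abs_th_le_one x)
  have h1 : 0 ≤ 1 - th x ^ 2 := by nlinarith
  have h2 := mul_nonneg (sub_nonneg.2 this.2) h1
  have h3 := mul_nonneg ha.le (sq_nonneg (th x))
  nlinarith [sq_nonneg (th x)]

theorem re_inner_fibreGraph_le (ha : 0 < a) (ha2 : a < 2) {u w : Ltwo}
    (h : (u, w) ∈ fibreGraph a η) : (inner ℂ u w).re ≤ (12 * a + 12) * ‖u‖ ^ 2 := by
  obtain ⟨g, rfl, rfl⟩ := mem_fibreGraph.1 h
  have ht := isTower a g
  rw [ht.re_inner_genMap ha, ← ht.re_inner_cubic ha]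
  have h1 := ht.re_inner_cubic_le ha (η := η)
  have h2 := re_inner_psmul_le (energyPot_le ha) (resD a (resD a (resD a g)))
  have h3 : 0 ≤ a * (4 - a ^ 2) * ‖resD a (resD a (resD a g))‖ ^ 2 := by
    have : 0 < 4 - a ^ 2 := by nlinarith
    positivity
  linarith

/-- At high transverse frequency the linearized operator is dissipative. -/
theorem re_inner_fibreGraph_le_of_large (ha : 0 < a) {b : ℝ}
    (hη : 4 * a ^ 3 + 8 * a + 12 + b ≤ 2 * a * |η|) {u w : Ltwo}
    (h : (u, w) ∈ fibreGraph a η) : (inner ℂ u w).re ≤ -b * ‖u‖ ^ 2 := by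
  obtain ⟨g, rfl, rfl⟩ := mem_fibreGraph.1 h
  have ht := isTower a g
  rw [ht.re_inner_genMap ha]
  have h1 := ht.norm_sq_le ha
  have h2 := re_inner_psmul_le (energyPot_le ha) (resD a (resD a (resD a g)))
  set x := ‖resD a (resD a g)‖
  set y := ‖resD a (resD a (resD a g))‖
  set z := ‖resD a (resD a (resD a (resD a g)))‖
  -- By the arithmetic-geometric mean inequality, −3a(‖Du‖² + η²‖Ju‖²) ≤ −6a|η|‖Ju‖‖Du‖ ≤
  -- −2a|η|‖u‖², and for large |η| this beats the cubic and potential terms.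
  have h3 : 2 * |η| * (z * x) ≤ x ^ 2 + η ^ 2 * z ^ 2 := by
    rw [← sq_abs η]; nlinarith [sq_nonneg (x - |η| * z)]
  have h4 : 2 * a * |η| * y ^ 2 ≤ 2 * a * |η| * (3 * (z * x)) := by gcongr
  have h5 := mul_le_mul_of_nonneg_right hη (sq_nonneg y)
  nlinarith

end Energy

/-! ### The resolvent of the linearized operator -/

section Resolvent
variable {a : ℝ}

/-- The symbol of the free operator. -/
def freeSymbol (a η ξ : ℝ) : ℂ :=
  -(2 * Real.pi * Complex.I * ξ - a) ^ 3 + 4 * (2 * Real.pi * Complex.I * ξ - a) +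
    3 * η ^ 2 * resSymbol a ξ

/-- Since Re s = −a < 0, the nonlocal term 3η²/s has nonpositive real part and can be dropped. This
is why the bound, and later the growth rate, do not depend on η. -/
theorem freeSymbol_re_le (ha : 0 < a) (η ξ : ℝ) : (freeSymbol a η ξ).re ≤
    4 * a ^ 3 - 3 * a * ‖(2 * Real.pi * Complex.I * ξ - a : ℂ)‖ ^ 2 := by
  set s : ℂ := 2 * Real.pi * Complex.I * ξ - a with hs
  have hre : s.re = -a := by simp [hs]
  have h1 : (resSymbol a ξ).re ≤ 0 := by
    rw [resSymbol, ← hs, Complex.inv_re, hre]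
    exact div_nonpos_of_nonpos_of_nonneg (by linarith) (Complex.normSq_nonneg _)
  have h2 : ‖s‖ ^ 2 = a ^ 2 + s.im ^ 2 := by
    rw [← Complex.normSq_eq_norm_sq, Complex.normSq_apply, hre]; ring
  have h3 : (s ^ 3).re = -a ^ 3 + 3 * a * s.im ^ 2 := by
    simp only [pow_succ, pow_zero, one_mul, Complex.mul_re, Complex.mul_im, hre]; ring
  have h4 : (freeSymbol a η ξ).re = -(s ^ 3).re + 4 * s.re + 3 * η ^ 2 * (resSymbol a ξ).re := by
    rw [freeSymbol, ← hs]
    rw [show (3 * (η : ℂ) ^ 2) = ((3 * η ^ 2 : ℝ) : ℂ) by push_cast; ring]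
    simp [-Complex.ofReal_mul]
  rw [h4, h3, hre, h2]
  have h5 : 3 * η ^ 2 * (resSymbol a ξ).re ≤ 0 :=
    mul_nonpos_of_nonneg_of_nonpos (by positivity) h1
  nlinarith [pow_pos ha 3]

/-- A uniform bound for the growth of the semigroups. -/
def growth (a : ℝ) : ℝ := 12 * a + 12 + 8 * a ^ 3 + 96 + 96 / a

variable {l : ℝ}

/-- The summand 8a³ of `growth` is spent here, to absorb 4a³ into l/2. The summands 96 and 96/a
serve the bounds 1/48 and 1/24 on the free resolvent and on its derivative, and 12a + 12 the
quasi-dissipativity. -/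
theorem le_norm_sub_freeSymbol (ha : 0 < a) (hl : growth a < l) (η ξ : ℝ) :
    l / 2 + 3 * a * ‖(2 * Real.pi * Complex.I * ξ - a : ℂ)‖ ^ 2 ≤ ‖(l : ℂ) - freeSymbol a η ξ‖ := by
  have h1 := freeSymbol_re_le ha η ξ
  have h2 := Complex.re_le_norm ((l : ℂ) - freeSymbol a η ξ)
  rw [Complex.sub_re, Complex.ofReal_re] at h2
  have h3 : 0 < 96 / a := by positivity
  rw [growth] at hl
  linarith

theorem growth_pos (ha : 0 < a) : 96 < growth a := by
  rw [growth]
  have h3 : 0 < 96 / a := by positivity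
  have := pow_pos ha 3
  linarith

theorem sub_freeSymbol_ne_zero (ha : 0 < a) (hl : growth a < l) (η ξ : ℝ) :
    (l : ℂ) - freeSymbol a η ξ ≠ 0 := by
  have h1 := le_norm_sub_freeSymbol ha hl η ξ
  have h2 := growth_pos ha
  refine norm_pos_iff.1 (lt_of_lt_of_le ?_ h1)
  have : 0 < l := by linarith
  positivity

/-- The symbol of the resolvent of the free operator. -/
def freeRes (a l η ξ : ℝ) : ℂ := ((l : ℂ) - freeSymbol a η ξ)⁻¹

theorem norm_freeRes_le (ha : 0 < a) (hl : growth a < l) (η ξ : ℝ) :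
    ‖freeRes a l η ξ‖ ≤ 2 / l := by
  have h1 := le_norm_sub_freeSymbol ha hl η ξ
  have h2 := growth_pos ha
  have : 0 < l := by linarith
  rw [freeRes, norm_inv, ← inv_div]
  refine inv_anti₀ (by positivity) (le_trans ?_ h1)
  have : 0 ≤ 3 * a * ‖(2 * Real.pi * Complex.I * ξ - a : ℂ)‖ ^ 2 := by positivity
  linarith

theorem continuous_freeRes (ha : 0 < a) (hl : growth a < l) (η : ℝ) :
    Continuous (freeRes a l η) := by
  refine Continuous.inv₀ ?_ (sub_freeSymbol_ne_zero ha hl η)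
  have : Continuous (resSymbol a) := Continuous.inv₀ (by fun_prop) (symbol_ne_zero ha.ne')
  unfold freeSymbol
  fun_prop

theorem isBddMul_freeRes (ha : 0 < a) (hl : growth a < l) (η : ℝ) :
    IsBddMul (freeRes a l η) :=
  .of_continuous (continuous_freeRes ha hl η) (norm_freeRes_le ha hl η)

/-- The symbol of the weighted derivative of the resolvent of the free operator. -/
def freeResD (a l η ξ : ℝ) : ℂ := (2 * Real.pi * Complex.I * ξ - a) * freeRes a l η ξ

/-- Arithmetic-geometric mean: (l/2 + 3a|s|²)² ≥ 6al|s|², and al > 96 makes this at least (24|s|)².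
-/
theorem norm_freeResD_le (ha : 0 < a) (hl : growth a < l) (η ξ : ℝ) :
    ‖freeResD a l η ξ‖ ≤ 1 / 24 := by
  have h1 := le_norm_sub_freeSymbol ha hl η ξ
  have h2 := growth_pos ha
  have hl0 : 0 < l := by linarith
  have hal : 96 < a * l := by
    have : 96 / a < l := by
      rw [growth] at hl
      have := pow_pos ha 3
      linarith
    rwa [div_lt_iff₀ ha, mul_comm] at this
  rw [freeResD, freeRes, norm_mul, norm_inv, ← div_eq_mul_inv]
  set s := ‖(2 * Real.pi * Complex.I * ξ - a : ℂ)‖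
  have hpos : 0 < l / 2 + 3 * a * s ^ 2 := by positivity
  rw [div_le_div_iff₀ (hpos.trans_le h1) (by norm_num)]
  have hs : 0 ≤ s := norm_nonneg _
  have h3 : (s * 24) ^ 2 ≤ (l / 2 + 3 * a * s ^ 2) ^ 2 := by
    have : 4 * (l / 2) * (3 * a * s ^ 2) ≤ (l / 2 + 3 * a * s ^ 2) ^ 2 := by
      nlinarith [sq_nonneg (l / 2 - 3 * a * s ^ 2)]
    nlinarith [sq_nonneg s]
  linarith [le_of_abs_le (abs_le_of_sq_le_sq h3 hpos.le)]

theorem isBddMul_freeResD (ha : 0 < a) (hl : growth a < l) (η : ℝ) :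
    IsBddMul (freeResD a l η) :=
  .of_continuous (Continuous.mul (by fun_prop) (continuous_freeRes ha hl η))
    (norm_freeResD_le ha hl η)

theorem fourierMul_add {m m' : ℝ → ℂ} (hm : IsBddMul m) (hm' : IsBddMul m') (f : Ltwo) :
    fourierMul (fun x => m x + m' x) f = fourierMul m f + fourierMul m' f := by
  apply fourier_injective
  have : 𝓕 (fourierMul m f + fourierMul m' f) = 𝓕 (fourierMul m f) + 𝓕 (fourierMul m' f) :=
    map_add (Lp.fourierTransformₗᵢ ℝ ℂ) _ _
  rw [this, fourier_fourierMul, fourier_fourierMul, fourier_fourierMul, mulOp_add hm hm']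

theorem fourierMul_const (c : ℂ) (f : Ltwo) : fourierMul (fun _ => c) f = c • f := by
  apply fourier_injective
  rw [fourier_fourierMul, mulOp_const]
  exact (map_smul (Lp.fourierTransformₗᵢ ℝ ℂ) _ _).symm

theorem IsBddMul.add {m m' : ℝ → ℂ} (hm : IsBddMul m) (hm' : IsBddMul m') :
    IsBddMul fun x => m x + m' x := by
  obtain ⟨C, hC⟩ := hm.2
  obtain ⟨C', hC'⟩ := hm'.2
  exact ⟨hm.1.add hm'.1, C + C', fun x => (norm_add_le _ _).trans (add_le_add (hC x) (hC' x))⟩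

/-- The third weighted derivative of the free resolvent. -/
def freeResDDD (a l η : ℝ) (h : Ltwo) : Ltwo :=
  h - (l : ℂ) • fourierMul (freeRes a l η) h + (4 : ℂ) • fourierMul (freeResD a l η) h +
    (3 * η ^ 2 : ℂ) • resD a (fourierMul (freeRes a l η) h)

theorem resD_freeResD (ha : 0 < a) (hl : growth a < l) (η : ℝ) (h : Ltwo) :
    resD a (fourierMul (freeResD a l η) h) = fourierMul (freeRes a l η) h := by
  rw [resD, fourierMul_fourierMul (isBddMul_resSymbol ha.ne') (isBddMul_freeResD ha hl η)]
  congr 2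
  ext ξ
  rw [freeResD, resSymbol, inv_mul_cancel_left₀ (symbol_ne_zero ha.ne' ξ)]

/-- The free resolvent equation, solved for its top order term, expresses D³R through bounded
multipliers. This places Rh in the range of J³, as the definition of the graph requires. -/
theorem resD_resD_freeResDDD (ha : 0 < a) (hl : growth a < l) (η : ℝ) (h : Ltwo) :
    resD a (resD a (freeResDDD a l η h)) = fourierMul (freeResD a l η) h := by
  have b1 := isBddMul_freeRes ha hl η
  have b2 := isBddMul_freeResD ha hl η
  have b3 := isBddMul_resSymbol ha.ne'
  have e : freeResDDD a l η h = fourierMul (fun ξ => ((fun _ => (1 : ℂ)) ξ +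
      (fun _ => (-l : ℂ)) ξ * freeRes a l η ξ) + ((fun _ => (4 : ℂ)) ξ * freeResD a l η ξ +
      (fun _ => (3 * η ^ 2 : ℂ)) ξ * (resSymbol a ξ * freeRes a l η ξ))) h := by
    rw [fourierMul_add ((isBddMul_const _).add ((isBddMul_const _).mul b1))
      (((isBddMul_const _).mul b2).add ((isBddMul_const _).mul (b3.mul b1))),
      fourierMul_add (isBddMul_const _) ((isBddMul_const _).mul b1),
      fourierMul_add ((isBddMul_const _).mul b2) ((isBddMul_const _).mul (b3.mul b1)),
      ← fourierMul_fourierMul (isBddMul_const _) b1, ← fourierMul_fourierMul (isBddMul_const _) b2,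
      ← fourierMul_fourierMul (isBddMul_const _) (b3.mul b1), ← fourierMul_fourierMul b3 b1]
    simp only [fourierMul_const]
    rw [freeResDDD, resD]
    module
  have b4 := ((isBddMul_const (1 : ℂ)).add ((isBddMul_const (-l : ℂ)).mul b1)).add
    (((isBddMul_const (4 : ℂ)).mul b2).add ((isBddMul_const (3 * η ^ 2 : ℂ)).mul (b3.mul b1)))
  rw [e, resD, fourierMul_fourierMul b3 b4, fourierMul_fourierMul b3 (b3.mul b4)]
  congr 2
  ext ξ
  have h1 := sub_freeSymbol_ne_zero ha hl η ξ
  have h2 := symbol_ne_zero ha.ne' ξ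
  have h3 : (l : ℂ) - freeSymbol a η ξ = l - (-(2 * Real.pi * Complex.I * ξ - a) ^ 3 +
    4 * (2 * Real.pi * Complex.I * ξ - a) + 3 * η ^ 2 * (2 * Real.pi * Complex.I * ξ - a)⁻¹) := rfl
  simp only [freeResD, freeRes, resSymbol]
  rw [h3] at h1 ⊢
  set s : ℂ := 2 * Real.pi * Complex.I * ξ - a
  have h4 := mul_inv_cancel₀ h1
  have h5 := mul_inv_cancel₀ h2
  generalize s⁻¹ = r at h4 h5 ⊢
  generalize ((l : ℂ) - (-s ^ 3 + 4 * s + 3 * η ^ 2 * r))⁻¹ = k at h4 ⊢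
  linear_combination (-r ^ 2) * h4 + s * k * (s * r + 1) * h5

/-- The perturbation in the resolvent equation. -/
def resPert (a l η : ℝ) : Ltwo →L[ℂ] Ltwo :=
  polyOp (6 * pder pot) * fourierMul (freeRes a l η) + polyOp (6 * pot) *
    fourierMul (freeResD a l η)

theorem norm_resPert_lt (ha : 0 < a) (hl : growth a < l) (η : ℝ) : ‖resPert a l η‖ < 1 := by
  have h1 : ‖fourierMul (freeRes a l η)‖ ≤ 1 / 48 := by
    refine (norm_fourierMul_le (isBddMul_freeRes ha hl η) (norm_freeRes_le ha hl η)).trans ?_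
    have := growth_pos ha
    rw [div_le_div_iff₀ (by linarith) (by norm_num)]
    linarith
  have h2 : ‖fourierMul (freeResD a l η)‖ ≤ 1 / 24 :=
    norm_fourierMul_le (isBddMul_freeResD ha hl η) (norm_freeResD_le ha hl η)
  have h3 : ‖polyOp (6 * pot)‖ ≤ 12 := by
    refine norm_mulOp_le (isBddMul_polyFun _) fun x => ?_
    have e : polyFun (6 * pot) x = ((12 * (1 - th x ^ 2) : ℝ) : ℂ) := by
      simp [polyFun, pot]; ring
    have := abs_le.1 (abs_th_le_one x)
    rw [e, Complex.norm_real, Real.norm_eq_abs, abs_le]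
    constructor <;> nlinarith
  -- The immediate bound 24 would make the final sum exactly 1; the estimate |t(1 − t²)| ≤ 23/24
  -- leaves a margin.
  have h4 : ‖polyOp (6 * pder pot)‖ ≤ 23 := by
    refine norm_mulOp_le (isBddMul_polyFun _) fun x => ?_
    have e : polyFun (6 * pder pot) x = ((-(24 * (th x * (1 - th x ^ 2))) : ℝ) : ℂ) := by
      simp [polyFun, pot, pder]; ring
    have := abs_le.1 (abs_th_le_one x)
    have h5 : |th x * (1 - th x ^ 2)| ≤ 23 / 24 := by
      rw [abs_le]
      constructor <;> nlinarith [sq_nonneg (th x - 1 / 2), sq_nonneg (th x + 1 / 2)]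
    rw [abs_le] at h5
    rw [e, Complex.norm_real, Real.norm_eq_abs, abs_le]
    constructor <;> nlinarith
  calc ‖resPert a l η‖ ≤ ‖polyOp (6 * pder pot)‖ * ‖fourierMul (freeRes a l η)‖ +
        ‖polyOp (6 * pot)‖ * ‖fourierMul (freeResD a l η)‖ :=
        (norm_add_le _ _).trans (add_le_add (norm_mul_le _ _) (norm_mul_le _ _))
    _ ≤ 23 * (1 / 48) + 12 * (1 / 24) := by gcongr
    _ < 1 := by norm_num

/-- The ansatz u = Rh with R the free resolvent turns the equation into (1 + resPert)h = f, which is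
solved by a Neumann series. -/
theorem fibreGraph_surj (ha : 0 < a) (hl : growth a < l) (η : ℝ) (f : Ltwo) :
    ∃ p ∈ fibreGraph a η, (l : ℂ) • p.1 - p.2 = f := by
  obtain ⟨U, hU⟩ := isUnit_one_sub_of_norm_lt_one (x := -resPert a l η)
    (by rw [norm_neg]; exact norm_resPert_lt ha hl η)
  set h : Ltwo := (↑U⁻¹ : Ltwo →L[ℂ] Ltwo) f with hh
  have hf : h + resPert a l η h = f := by
    have h1 : ((U : Ltwo →L[ℂ] Ltwo) * ↑U⁻¹) f = f := by rw [Units.mul_inv]; rfl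
    rw [hU] at h1
    simpa [sub_neg_eq_add] using! h1
  refine ⟨_, mem_fibreGraph.2 ⟨freeResDDD a l η h, rfl, rfl⟩, ?_⟩
  simp only [genMap_apply]
  rw [resD_resD_freeResDDD ha hl, resD_freeResD ha hl, ← hf]
  have e1 : resPert a l η h = (6 * pder pot) • fourierMul (freeRes a l η) h +
    (6 * pot) • fourierMul (freeResD a l η) h := rfl
  have e4 : ∀ y : Ltwo, (4 : Polynomial ℂ) • y = (4 : ℂ) • y := fun y => by
    rw [psmul_def, ← mulOp_const]; congr 2; ext x; simp [polyFun]
  have e3 : ∀ y : Ltwo, (3 * ceta η ^ 2) • y = (3 * η ^ 2 : ℂ) • y := fun y => by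
    rw [psmul_def, ← mulOp_const]; congr 2; ext x; simp [polyFun]
  rw [e1, e4, e3, freeResDDD]
  module

/-- A vector orthogonal to the range is annihilated by the adjoint, which up to sign is the
injective operator `resD (-a)`. -/
theorem denseRange_resD (ha : a ≠ 0) : DenseRange (resD a) := by
  have h : (LinearMap.range (resD a : Ltwo →ₗ[ℂ] Ltwo)).topologicalClosure = ⊤ := by
    rw [Submodule.topologicalClosure_eq_top_iff, Submodule.eq_bot_iff]
    intro x hx
    have h1 : resD (-a) x = 0 := by
      rw [← inner_self_eq_zero (𝕜 := ℂ)]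
      have := (Submodule.mem_orthogonal _ _).1 hx _ ⟨resD (-a) x, rfl⟩
      rw [ContinuousLinearMap.coe_coe, inner_resD_left ha, neg_eq_zero] at this
      exact this
    exact resD_injective (neg_ne_zero.2 ha) (by rw [h1, map_zero])
  rw [DenseRange, ← dense_closure]
  have h2 := congrArg (fun S : Submodule ℂ Ltwo => (S : Set Ltwo)) h
  simp only [Submodule.topologicalClosure_coe, Submodule.top_coe] at h2
  have h3 : closure (Set.range (resD a)) = Set.univ := h2
  rw [h3]
  exact dense_univ

theorem isQuasiDissipative_fibreGraph (ha : 0 < a) (ha2 : a < 2) (η : ℝ) :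
    IsQuasiDissipative (fibreGraph a η) (growth a) where
  bound p hp l hl := by
    have h1 := re_inner_fibreGraph_le ha ha2 (u := p.1) (w := p.2) hp
    have h2 : (inner ℂ p.1 ((l : ℂ) • p.1 - p.2)).re = l * ‖p.1‖ ^ 2 - (inner ℂ p.1 p.2).re := by
      rw [inner_sub_right, Complex.sub_re, re_inner_smul_self]
    have h3 : (inner ℂ p.1 ((l : ℂ) • p.1 - p.2)).re ≤ ‖p.1‖ * ‖(l : ℂ) • p.1 - p.2‖ :=
      (Complex.re_le_norm _).trans (norm_inner_le_norm _ _)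
    have h4 : 12 * a + 12 ≤ growth a := by
      rw [growth]
      have : 0 < 96 / a := by positivity
      have := pow_pos ha 3
      linarith
    rcases (norm_nonneg p.1).eq_or_lt with h0 | h0
    · rw [← h0, mul_zero]; exact norm_nonneg _
    · refine le_of_mul_le_mul_left (le_trans ?_ h3) h0
      rw [h2]
      nlinarith [sq_nonneg ‖p.1‖]
  surj l hl f := fibreGraph_surj ha hl η f
  dense := by
    have h1 : Prod.fst '' (fibreGraph a η : Set (Ltwo × Ltwo)) =
        Set.range (resD a ∘ resD a ∘ resD a) := by
      ext u
      constructor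
      · rintro ⟨⟨u, w⟩, h, rfl⟩
        obtain ⟨g, rfl, -⟩ := mem_fibreGraph.1 h
        exact ⟨g, rfl⟩
      · rintro ⟨g, rfl⟩
        exact ⟨_, mem_fibreGraph.2 ⟨g, rfl, rfl⟩, rfl⟩
    rw [h1]
    have h2 := denseRange_resD ha.ne'
    exact h2.comp (h2.comp h2 (resD a).continuous) (resD a).continuous

/-- A change of frequency is the bounded perturbation 3(η'² − η²)J on an unchanged domain. This
makes the resolvents norm continuous in η. -/
theorem fibreGraph_shift {η η' : ℝ} {u w : Ltwo} (h : (u, w) ∈ fibreGraph a η) :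
    (u, w + (3 * (η' ^ 2 - η ^ 2) : ℂ) • resD a u) ∈ fibreGraph a η' := by
  obtain ⟨g, rfl, rfl⟩ := mem_fibreGraph.1 h
  refine mem_fibreGraph.2 ⟨g, rfl, ?_⟩
  have e3 : ∀ (η : ℝ) (y : Ltwo), (3 * ceta η ^ 2) • y = (3 * η ^ 2 : ℂ) • y := fun η y => by
    rw [psmul_def, ← mulOp_const]; congr 2; ext x; simp [polyFun]
  rw [genMap_apply, genMap_apply, e3, e3]
  module

end Resolvent
end KPII

namespace KPII

/-! ### The square root `β` -/

theorem beta_sq (η : ℝ) : beta η ^ 2 = 1 + Complex.I * η := by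
  have := Complex.cpow_nat_inv_pow (1 + Complex.I * (η : ℂ)) (n := 2) two_ne_zero
  rw [beta, show (1 / 2 : ℂ) = ((2 : ℕ) : ℂ)⁻¹ by norm_num]
  exact this

theorem beta_re_pos (η : ℝ) : 0 < (beta η).re := by
  have h0 : (1 + Complex.I * (η : ℂ)) ≠ 0 := fun h => by
    have := congrArg Complex.re h
    simp at this
  have hre : (1 + Complex.I * (η : ℂ)).re = 1 := by simp
  have harg := Complex.abs_arg_lt_pi_div_two_iff.2 (Or.inl (by rw [hre]; norm_num :
    0 < (1 + Complex.I * (η : ℂ)).re))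
  rw [abs_lt] at harg
  rw [beta, Complex.cpow_def_of_ne_zero h0, Complex.exp_re]
  refine mul_pos (Real.exp_pos _) (Real.cos_pos_of_mem_Ioo ?_)
  have him : (Complex.log (1 + Complex.I * (η : ℂ)) * (1 / 2)).im =
      (1 + Complex.I * (η : ℂ)).arg / 2 := by
    rw [show (1 / 2 : ℂ) = ((1 / 2 : ℝ) : ℂ) by norm_num, Complex.im_mul_ofReal, Complex.log_im]
    ring
  rw [him]
  constructor <;> linarith [Real.pi_pos, harg.1, harg.2]

theorem eq_of_sq_eq_of_re_pos {z w : ℂ} (h : z ^ 2 = w ^ 2) (hz : 0 < z.re) (hw : 0 < w.re) :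
    z = w := by
  rcases sq_eq_sq_iff_eq_or_eq_neg.1 h with h | h
  · exact h
  · rw [h, Complex.neg_re] at hz
    linarith

theorem beta_neg (η : ℝ) : beta (-η) = (starRingEnd ℂ) (beta η) := by
  refine eq_of_sq_eq_of_re_pos ?_ (beta_re_pos _) (by rw [Complex.conj_re]; exact beta_re_pos η)
  rw [beta_sq, ← map_pow, beta_sq]
  simp

theorem beta_re_sq (η : ℝ) : (beta η).re ^ 2 = 1 + (beta η).im ^ 2 := by
  have := congrArg Complex.re (beta_sq η)
  rw [sq, Complex.mul_re] at this
  simp at this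
  linarith

theorem beta_re_mul_im (η : ℝ) : 2 * (beta η).re * (beta η).im = η := by
  have := congrArg Complex.im (beta_sq η)
  rw [sq, Complex.mul_im] at this
  simp at this
  linarith

theorem one_le_beta_re (η : ℝ) : 1 ≤ (beta η).re := by
  nlinarith [beta_re_sq η, beta_re_pos η, sq_nonneg (beta η).im]

theorem two_abs_beta_im_le (η : ℝ) : 2 * |(beta η).im| ≤ |η| := by
  have h := congrArg abs (beta_re_mul_im η)
  rw [abs_mul, abs_mul, abs_of_pos (beta_re_pos η), abs_two] at h
  nlinarith [one_le_beta_re η, abs_nonneg (beta η).im]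

theorem abs_eta_eq (η : ℝ) : |η| = 2 * (beta η).re * |(beta η).im| := by
  have h := congrArg abs (beta_re_mul_im η)
  rw [abs_mul, abs_mul, abs_of_pos (beta_re_pos η), abs_two] at h
  exact h.symm

/-- By |η| = 2 Re β |Im β| and (Re β)² = 1 + (Im β)², |η| is a strictly increasing function of |Im
β|. -/
theorem abs_beta_im_mono {η η' : ℝ} (h : |η| ≤ |η'|) : |(beta η).im| ≤ |(beta η').im| := by
  by_contra hc
  push Not at hc
  have h0 := abs_nonneg (beta η').im
  have h1 : (beta η').re ≤ (beta η).re := by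
    have h2 : (beta η').re ^ 2 ≤ (beta η).re ^ 2 := by
      rw [beta_re_sq, beta_re_sq, ← sq_abs, ← sq_abs (beta η).im]
      nlinarith
    exact le_of_sq_le_sq h2 (beta_re_pos η).le
  have h3 := beta_re_pos η'
  rw [abs_eta_eq, abs_eta_eq η'] at h
  nlinarith

theorem beta_re_mono {η η' : ℝ} (h : |η| ≤ |η'|) : (beta η).re ≤ (beta η').re := by
  refine le_of_sq_le_sq ?_ (beta_re_pos η').le
  rw [beta_re_sq, beta_re_sq, ← sq_abs, ← sq_abs (beta η').im]
  nlinarith [abs_beta_im_mono h, abs_nonneg (beta η).im]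

/-- Re λ = −4η Im β, and η and Im β have the same sign because 2 Re β Im β = η. -/
theorem lam_re (η : ℝ) : (lam η).re = -4 * (|η| * |(beta η).im|) := by
  have h : (lam η).re = -4 * (η * (beta η).im) := by
    rw [lam]; simp; ring
  rw [h, ← abs_mul, abs_of_nonneg]
  have := beta_re_mul_im η
  have h2 := beta_re_pos η
  calc (0 : ℝ) ≤ 2 * (beta η).re * (beta η).im ^ 2 := by positivity
    _ = _ := by rw [sq, ← mul_assoc, this]

/-- Among the resonant modes at frequencies above η₀ the slowest decay is thus the one at η₀; this
produces the exponent in the final estimate. -/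
theorem lam_re_anti {η η' : ℝ} (h : |η| ≤ |η'|) : (lam η').re ≤ (lam η).re := by
  rw [lam_re, lam_re]
  have := mul_le_mul h (abs_beta_im_mono h) (abs_nonneg _) (abs_nonneg _)
  linarith

theorem beta_im_ne_zero {η : ℝ} (h : η ≠ 0) : (beta η).im ≠ 0 := fun h0 => by
  have := beta_re_mul_im η
  rw [h0, mul_zero] at this
  exact h this.symm

theorem lam_re_neg {η : ℝ} (h : η ≠ 0) : (lam η).re < 0 := by
  rw [lam_re]
  have h1 := abs_pos.2 h
  have h2 := abs_pos.2 (beta_im_ne_zero h)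
  have := mul_pos h1 h2
  linarith

theorem norm_beta_le (η : ℝ) : ‖beta η‖ ≤ 1 + |η| := by
  have h1 : ‖beta η‖ ^ 2 ≤ (1 + |η|) ^ 2 := by
    rw [← norm_pow, beta_sq]
    calc _ ≤ ‖(1 : ℂ)‖ + ‖Complex.I * (η : ℂ)‖ := norm_add_le _ _
      _ = 1 + |η| := by simp
      _ ≤ _ := by nlinarith [abs_nonneg η]
  exact le_of_sq_le_sq h1 (by positivity)

theorem lam_eq (η : ℝ) : lam η = 4 * (beta η ^ 3 - beta η) := by
  rw [lam, show beta η ^ 3 = beta η ^ 2 * beta η by ring, beta_sq]; ring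

/-! ### Exponentials divided by `cosh` -/

/-- `e^{cx} sech x`. -/
def sechExp (c : ℂ) (x : ℝ) : ℂ := Complex.exp (c * x) / (Real.cosh x : ℂ)

theorem cosh_ne_zero' (x : ℝ) : (Real.cosh x : ℂ) ≠ 0 :=
  Complex.ofReal_ne_zero.2 (Real.cosh_pos x).ne'

theorem hasDerivAt_sechExp (c : ℂ) (x : ℝ) :
    HasDerivAt (sechExp c) ((c - th x) * sechExp c x) x := by
  have h1 : HasDerivAt (fun x : ℝ => Complex.exp (c * x)) (Complex.exp (c * x) * c) x := by
    have : HasDerivAt (fun x : ℝ => c * (x : ℂ)) (c * 1) x :=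
      ((hasDerivAt_id x).ofReal_comp).const_mul c
    simpa using this.cexp
  have h2 := (Real.hasDerivAt_cosh x).ofReal_comp
  refine (h1.div h2 (cosh_ne_zero' x)).congr_deriv ?_
  have := cosh_ne_zero' x
  rw [sechExp, th]
  push_cast at this ⊢
  field_simp

theorem continuous_sechExp (c : ℂ) : Continuous (sechExp c) :=
  continuous_iff_continuousAt.2 fun x => (hasDerivAt_sechExp c x).continuousAt

theorem norm_sechExp (c : ℂ) (x : ℝ) : ‖sechExp c x‖ = Real.exp (c.re * x) / Real.cosh x := by
  rw [sechExp, norm_div, Complex.norm_exp, Complex.norm_real,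
    Real.norm_of_nonneg (Real.cosh_pos x).le, Complex.re_mul_ofReal]

theorem exp_abs_le_two_cosh (x : ℝ) : Real.exp |x| ≤ 2 * Real.cosh x := by
  rw [← Real.cosh_abs, Real.cosh_eq]
  have := Real.exp_pos (-|x|)
  linarith

theorem cosh_le_exp_abs (x : ℝ) : Real.cosh x ≤ Real.exp |x| := by
  rw [← Real.cosh_abs, Real.cosh_eq]
  have : Real.exp (-|x|) ≤ Real.exp |x| := Real.exp_le_exp.2 (by linarith [abs_nonneg x])
  linarith

theorem norm_sechExp_le (c : ℂ) (x : ℝ) :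
    ‖sechExp c x‖ ≤ 2 * Real.exp (-((1 - |c.re|) * |x|)) := by
  rw [norm_sechExp, div_le_iff₀ (Real.cosh_pos x)]
  have h1 : Real.exp (c.re * x) ≤ Real.exp (|c.re| * |x|) :=
    Real.exp_le_exp.2 ((le_abs_self _).trans (abs_mul _ _).le)
  have h2 : Real.exp (|c.re| * |x|) = Real.exp (-((1 - |c.re|) * |x|)) * Real.exp |x| := by
    rw [← Real.exp_add]; congr 1; ring
  rw [h2] at h1
  have h3 := mul_le_mul_of_nonneg_left (exp_abs_le_two_cosh x)
    (Real.exp_nonneg (-((1 - |c.re|) * |x|)))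
  linarith

theorem isExpDecay_sechExp {c : ℂ} (hc : |c.re| < 1) : IsExpDecay (sechExp c) :=
  ⟨(continuous_sechExp c).aestronglyMeasurable, 1 - |c.re|, 2, by linarith, norm_sechExp_le c⟩

/-- The element `e^{cx} sech x` of `L²(ℝ)`. -/
def sechVec {c : ℂ} (hc : |c.re| < 1) : Ltwo := (isExpDecay_sechExp hc).memLp.toLp _

theorem sechVec_coe {c : ℂ} (hc : |c.re| < 1) : sechVec hc =ᵐ[volume] sechExp c :=
  (isExpDecay_sechExp hc).memLp.coeFn_toLp

theorem psmul_coe (p : Polynomial ℂ) (f : Ltwo) : (p • f : Ltwo) =ᵐ[volume] fun x => polyFun p x * f x :=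
  mulOp_coe (isBddMul_polyFun p) f

/-- Since (e^{cx} sech x)' = (c − T)e^{cx} sech x, the functions p(T)e^{cx} sech x are stable under
∂ₓ − r. Every computation with modes and adjoint modes becomes one with polynomials. -/
theorem resD_sechVec {r : ℝ} (hr : r ≠ 0) {c : ℂ} (hc : |c.re| < 1) (p : Polynomial ℂ) :
    resD r ((pder p + (Polynomial.C (c - r) - 𝐓) * p) • sechVec hc) = p • sechVec hc := by
  have h0 := isExpDecay_sechExp hc
  have h1 := h0.bdd_mul (isBddMul_polyFun p)
  have h2 := h0.bdd_mul (isBddMul_polyFun (pder p + (Polynomial.C c - 𝐓) * p))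
  have hd : ∀ x, HasDerivAt (fun x => polyFun p x * sechExp c x)
      (polyFun (pder p + (Polynomial.C c - 𝐓) * p) x * sechExp c x) x := fun x => by
    refine ((hasDerivAt_polyFun p x).mul (hasDerivAt_sechExp c x)).congr_deriv ?_
    simp [polyFun]; ring
  rw [resD_classical hr hd h1.integrable h2.integrable h1.memLp h2.memLp]
  · ext1
    filter_upwards [h1.memLp.coeFn_toLp, psmul_coe p (sechVec hc), sechVec_coe hc] with x e1 e2 e3
    rw [e1, e2, e3]
  · filter_upwards [psmul_coe (pder p + (Polynomial.C (c - r) - 𝐓) * p) (sechVec hc),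
      sechVec_coe hc] with x e2 e3
    rw [e2, e3]
    simp [polyFun]; ring

/-! ### Local control by the first order operator -/

/-- `e^{-cx} cosh x`. -/
def coshExp (c : ℂ) (x : ℝ) : ℂ := Complex.exp (-c * x) * (Real.cosh x : ℂ)

theorem sechExp_mul_coshExp (c : ℂ) (x : ℝ) : sechExp c x * coshExp c x = 1 := by
  have := cosh_ne_zero' x
  have h : Complex.exp (c * x) * Complex.exp (-c * x) = 1 := by rw [← Complex.exp_add]; simp
  rw [sechExp, coshExp, div_mul_eq_mul_div, div_eq_one_iff_eq this, ← mul_assoc, h, one_mul]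

theorem hasDerivAt_coshExp (c : ℂ) (x : ℝ) :
    HasDerivAt (coshExp c) ((th x - c) * coshExp c x) x := by
  have h1 : HasDerivAt (fun x : ℝ => Complex.exp (-c * x)) (Complex.exp (-c * x) * (-c)) x := by
    have : HasDerivAt (fun x : ℝ => -c * (x : ℂ)) (-c * 1) x :=
      ((hasDerivAt_id x).ofReal_comp).const_mul (-c)
    simpa using this.cexp
  have h2 := (Real.hasDerivAt_cosh x).ofReal_comp
  refine (h1.mul h2).congr_deriv ?_
  have := cosh_ne_zero' x
  rw [coshExp, th]
  push_cast at this ⊢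
  field_simp
  ring

theorem norm_coshExp_le (c : ℂ) (x : ℝ) : ‖coshExp c x‖ ≤ Real.exp ((|c.re| + 1) * |x|) := by
  rw [coshExp, norm_mul, Complex.norm_exp, Complex.norm_real,
    Real.norm_of_nonneg (Real.cosh_pos x).le, Complex.re_mul_ofReal, add_mul, Real.exp_add, one_mul]
  refine mul_le_mul (Real.exp_le_exp.2 ?_) (cosh_le_exp_abs x) (Real.cosh_pos x).le (by positivity)
  rw [Complex.neg_re, neg_mul, ← abs_mul]
  exact neg_le_abs _

theorem norm_sechExp_le' (c : ℂ) (x : ℝ) : ‖sechExp c x‖ ≤ Real.exp (|c.re| * |x|) := by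
  rw [norm_sechExp]
  refine (div_le_self (Real.exp_nonneg _) (Real.one_le_cosh x)).trans (Real.exp_le_exp.2 ?_)
  exact (le_abs_self _).trans (abs_mul _ _).le

/-- A smooth function supported in `[-1, 1]`. -/
structure IsBump (ϱ : ℝ → ℝ) : Prop where
  smooth : ContDiff ℝ ((⊤ : ℕ∞) : WithTop ℕ∞) ϱ
  supp : ∀ x, 1 < |x| → ϱ x = 0

theorem IsBump.deriv {ϱ : ℝ → ℝ} (h : IsBump ϱ) : IsBump (deriv ϱ) where
  smooth := (contDiff_infty_iff_deriv.1 h.smooth).2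
  supp x hx := by
    have : ϱ =ᶠ[𝓝 x] fun _ => 0 := by
      filter_upwards [(isOpen_lt continuous_const continuous_abs).mem_nhds hx] with y hy
      exact h.supp y hy
    rw [this.deriv_eq, deriv_const]

/-- A mollifier: smooth, nonnegative, supported in `[-1, 1]`, with integral one. -/
structure IsMollifier (ϱ : ℝ → ℝ) : Prop extends IsBump ϱ where
  nonneg : ∀ x, 0 ≤ ϱ x
  integral : ∫ x, ϱ x = 1

theorem exists_isMollifier : ∃ ϱ, IsMollifier ϱ := by
  let f : ContDiffBump (0 : ℝ) := ⟨1 / 2, 1, by norm_num, by norm_num⟩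
  refine ⟨f.normed volume, ⟨f.contDiff_normed, fun x hx => ?_⟩, f.nonneg_normed, f.integral_normed⟩
  have : x ∉ Function.support (f.normed volume) := by
    rw [f.support_normed_eq]
    simpa using hx.le
  exact Function.notMem_support.1 this

theorem hasCompactSupport_of_abs {f : ℝ → ℂ} (h : ∀ x, 1 < |x| → f x = 0) : HasCompactSupport f := by
  refine HasCompactSupport.intro (isCompact_Icc (a := (-1 : ℝ)) (b := 1)) fun x hx => h x ?_
  by_contra hc
  push Not at hc
  exact hx (abs_le.1 hc)

theorem IsMollifier.integrable {ϱ : ℝ → ℝ} (h : IsMollifier ϱ) : Integrable ϱ := by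
  by_contra hc
  have := h.integral
  rw [integral_undef hc] at this
  exact zero_ne_one this

/-- Cauchy–Schwarz on [−R, R], with √(2R) replaced by the cruder 1 + 2R. -/
theorem setIntegral_norm_le (F : Ltwo) {R : ℝ} (hR : 0 ≤ R) :
    ∫ x in Set.Icc (-R) R, ‖F x‖ ≤ (1 + 2 * R) * ‖F‖ := by
  have hm : MemLp (fun x => ‖F x‖) 2 volume := (Lp.memLp F).norm
  have h1 := L2.inner_indicatorConstLp_one (𝕜 := ℝ) (measurableSet_Icc (a := -R) (b := R))
    (by simp : volume (Set.Icc (-R) R) ≠ ∞) (hm.toLp _)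
  have h2 : ∫ x in Set.Icc (-R) R, (hm.toLp (fun x => ‖F x‖)) x = ∫ x in Set.Icc (-R) R, ‖F x‖ :=
    integral_congr_ae (ae_restrict_of_ae hm.coeFn_toLp)
  rw [← h2, ← h1]
  refine (real_inner_le_norm _ _).trans ?_
  have h3 : ‖hm.toLp (fun x => ‖F x‖)‖ = ‖F‖ := by
    rw [Lp.norm_toLp, Lp.norm_def, eLpNorm_norm]
  rw [h3, norm_indicatorConstLp (by norm_num) (by norm_num)]
  refine mul_le_mul_of_nonneg_right ?_ (norm_nonneg _)
  simp only [norm_one, one_mul, ENNReal.toReal_ofNat, Measure.real, Real.volume_Icc]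
  rw [ENNReal.toReal_ofReal (by linarith), ← Real.sqrt_eq_rpow]
  refine Real.sqrt_le_iff.2 ⟨by linarith, by nlinarith⟩

/-- `sech^n`. -/
def sechPow (n : ℕ) (x : ℝ) : ℂ := (((Real.cosh x)⁻¹ ^ n : ℝ) : ℂ)

theorem norm_sechPow_le (n : ℕ) (x : ℝ) : ‖sechPow n x‖ ≤ 2 ^ n * Real.exp (-(n * |x|)) := by
  have h1 : (Real.cosh x)⁻¹ ≤ 2 * Real.exp (-|x|) := by
    rw [inv_le_iff_one_le_mul₀ (Real.cosh_pos x), Real.exp_neg]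
    have := exp_abs_le_two_cosh x
    have h := Real.exp_pos |x|
    field_simp
    linarith
  have h0 := inv_nonneg.2 (Real.cosh_pos x).le
  rw [sechPow, Complex.norm_real, Real.norm_of_nonneg (pow_nonneg h0 n)]
  refine (pow_le_pow_left₀ h0 h1 n).trans (le_of_eq ?_)
  rw [mul_pow, ← Real.exp_nat_mul]
  congr 2; ring

theorem isBddMul_sechPow (n : ℕ) : IsBddMul (sechPow n) := by
  refine IsBddMul.of_continuous (C := 2 ^ n) ?_ fun x => (norm_sechPow_le n x).trans ?_
  · unfold sechPow
    have : ∀ x, Real.cosh x ≠ 0 := fun x => (Real.cosh_pos x).ne'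
    fun_prop (disch := assumption)
  · refine mul_le_of_le_one_right (by positivity) ?_
    rw [Real.exp_le_one_iff]
    have := abs_nonneg x
    have : (0 : ℝ) ≤ n := Nat.cast_nonneg n
    nlinarith

end KPII

/-! ### Local functionals, and local control of y by (D + T + β)y. -/

namespace KPII

/-- The weight defining the local functional `y ↦ ∫ ϱ y e^{-cx} cosh x`. -/
def probeFun (ϱ : ℝ → ℝ) (c : ℂ) (x : ℝ) : ℂ := ϱ x * coshExp c x

theorem continuous_coshExp (c : ℂ) : Continuous (coshExp c) :=
  continuous_iff_continuousAt.2 fun x => (hasDerivAt_coshExp c x).continuousAt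

theorem IsBump.isExpDecay_probe {ϱ : ℝ → ℝ} (hϱ : IsBump ϱ) (c : ℂ) : IsExpDecay (probeFun ϱ c) := by
  refine IsExpDecay.of_compactSupport ?_ (hasCompactSupport_of_abs fun x hx => ?_)
  · have := hϱ.smooth.continuous
    have h2 := continuous_coshExp c
    unfold probeFun
    fun_prop
  · simp [probeFun, hϱ.supp x hx]

/-- The local functional as an element of `L²(ℝ)`. -/
def IsBump.probe {ϱ : ℝ → ℝ} (hϱ : IsBump ϱ) (c : ℂ) : Ltwo :=
  (hϱ.isExpDecay_probe ((starRingEnd ℂ) c)).memLp.toLp _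

theorem IsBump.probe_coe {ϱ : ℝ → ℝ} (hϱ : IsBump ϱ) (c : ℂ) :
    hϱ.probe c =ᵐ[volume] probeFun ϱ ((starRingEnd ℂ) c) :=
  (hϱ.isExpDecay_probe ((starRingEnd ℂ) c)).memLp.coeFn_toLp

theorem conj_coshExp (c : ℂ) (x : ℝ) :
    (starRingEnd ℂ) (coshExp ((starRingEnd ℂ) c) x) = coshExp c x := by
  rw [coshExp, coshExp, map_mul, Complex.conj_ofReal, ← Complex.exp_conj, map_mul,
    Complex.conj_ofReal, map_neg, Complex.conj_conj]

theorem IsBump.inner_probe {ϱ : ℝ → ℝ} (hϱ : IsBump ϱ) (c : ℂ) (y : Ltwo) :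
    inner ℂ (hϱ.probe c) y = ∫ t, probeFun ϱ c t * y t := by
  rw [L2.inner_def]
  refine integral_congr_ae ?_
  filter_upwards [(hϱ.isExpDecay_probe ((starRingEnd ℂ) c)).memLp.coeFn_toLp] with t ht
  rw [RCLike.inner_apply, IsBump.probe, ht, probeFun, map_mul, conj_coshExp, Complex.conj_ofReal,
    probeFun, mul_comm]

theorem IsBump.exists_norm_probe_le {ϱ : ℝ → ℝ} (hϱ : IsBump ϱ) (k : ℝ) :
    ∃ C, 0 ≤ C ∧ ∀ c : ℂ, |c.re| + 1 ≤ k → ‖hϱ.probe c‖ ≤ C := by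
  have h0 : IsExpDecay fun x => (ϱ x : ℂ) :=
    IsExpDecay.of_compactSupport (Complex.continuous_ofReal.comp hϱ.smooth.continuous)
      (hasCompactSupport_of_abs fun x hx => by simp [hϱ.supp x hx])
  refine ⟨Real.exp k * ‖h0.memLp.toLp _‖, by positivity, fun c hc => ?_⟩
  refine Lp.norm_le_mul_norm_of_ae_le_mul ?_
  filter_upwards [(hϱ.isExpDecay_probe ((starRingEnd ℂ) c)).memLp.coeFn_toLp, h0.memLp.coeFn_toLp]
    with x e1 e2
  rw [IsBump.probe, e1, e2, probeFun, norm_mul, mul_comm]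
  by_cases hx : |x| ≤ 1
  · refine mul_le_mul_of_nonneg_right ((norm_coshExp_le _ x).trans (Real.exp_le_exp.2 ?_))
      (norm_nonneg _)
    rw [Complex.conj_re]
    have := abs_nonneg c.re
    calc _ ≤ k * 1 := mul_le_mul hc hx (abs_nonneg _) (by linarith)
      _ = k := mul_one k
  · simp [hϱ.supp x (not_le.1 hx)]

/-- Integration by parts in the local functional. -/
theorem IsBump.inner_probe_deriv {ϱ : ℝ → ℝ} (hϱ : IsBump ϱ) {a : ℝ} (ha : 0 < a) (β : ℂ)
    {y g : Ltwo} (hy : IsD a y g) : inner ℂ (hϱ.probe (a - β)) (g + (𝐓 + Polynomial.C β) • y) =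
      -inner ℂ (hϱ.deriv.probe (a - β)) y := by
  set c : ℂ := (starRingEnd ℂ) (a - β) with hc
  have hcc := continuous_coshExp c
  have h1 := hϱ.isExpDecay_probe c
  have h2 := hϱ.deriv.isExpDecay_probe c
  have hm : IsBddMul fun x => polyFun (𝐓 - Polynomial.C c) x := isBddMul_polyFun _
  have h3 := h2.add (h1.bdd_mul hm)
  have hd : ∀ x, HasDerivAt (probeFun ϱ c)
      (probeFun (_root_.deriv ϱ) c x + polyFun (𝐓 - Polynomial.C c) x * probeFun ϱ c x) x := by
    intro x
    have h4 := ((hϱ.smooth.differentiable (by simp)).differentiableAt (x := x)).hasDerivAt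
    refine (h4.ofReal_comp.mul (hasDerivAt_coshExp c x)).congr_deriv ?_
    simp [probeFun, polyFun]; ring
  -- The probe p satisfies (∂ₓ + a)p = (T + β̄)p + p₁, where p₁ is the probe built from ϱ'. Up to
  -- this term it lies in the kernel of the adjoint of D + T + β.
  have e1 : resD (-a) (hϱ.deriv.probe (a - β) + (𝐓 + Polynomial.C ((starRingEnd ℂ) β)) •
      hϱ.probe (a - β)) = hϱ.probe (a - β) := by
    refine resD_classical (neg_ne_zero.2 ha.ne') hd h1.integrable h3.integrable h1.memLp h3.memLp ?_
    filter_upwards [Lp.coeFn_add (hϱ.deriv.probe (a - β)) ((𝐓 + Polynomial.C ((starRingEnd ℂ) β)) •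
      hϱ.probe (a - β)), psmul_coe (𝐓 + Polynomial.C ((starRingEnd ℂ) β)) (hϱ.probe (a - β)),
      hϱ.probe_coe (a - β), hϱ.deriv.probe_coe (a - β)] with x e1 e2 e3 e4
    rw [e1, Pi.add_apply, e2, e3, e4, ← hc]
    simp [polyFun, hc]; ring
  have e2 := inner_resD_left (neg_ne_zero.2 ha.ne') (hϱ.deriv.probe (a - β) +
    (𝐓 + Polynomial.C ((starRingEnd ℂ) β)) • hϱ.probe (a - β)) g
  rw [e1, neg_neg, show resD a g = y from hy, inner_add_left] at e2
  have e3 : inner ℂ ((𝐓 + Polynomial.C ((starRingEnd ℂ) β)) • hϱ.probe (a - β)) y =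
      inner ℂ (hϱ.probe (a - β)) ((𝐓 + Polynomial.C β) • y) := by
    rw [psmul_def, inner_mulOp_left (isBddMul_polyFun _), psmul_def]
    congr 3
    ext x
    simp [polyFun, Complex.conj_ofReal]
  rw [inner_add_right, e2, e3]
  ring

section Local
variable {ϱ : ℝ → ℝ} (hϱ : IsMollifier ϱ)
include hϱ

/-- The pointwise bound of a function through its local average and the first order operator. -/
theorem IsMollifier.pointwise {c : ℂ} {k : ℝ} (hk : |c.re| + 1 ≤ k) {y f : ℝ → ℂ}
    (hy : ∀ x, HasDerivAt y ((c - th x) * y x + f x) x) (hf : Continuous f) {B : ℝ}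
    (hB : ∀ R, 0 ≤ R → ∫ x in Set.Icc (-R) R, ‖f x‖ ≤ (1 + 2 * R) * B) (x : ℝ) :
    ‖y x‖ ≤ Real.exp (k * |x|) * (‖∫ t, probeFun ϱ c t * y t‖ +
      Real.exp (k * (|x| + 1)) * ((1 + 2 * (|x| + 1)) * B)) := by
  have hk0 : 0 ≤ k := by linarith [abs_nonneg c.re]
  -- Integrating factor: z' = e^{−cx} cosh x · f. Hence z(x) differs from z(t), |t| ≤ 1, by at most
  -- M, and the average of z against the mollifier plays the role of an initial value.
  set z : ℝ → ℂ := fun x => coshExp c x * y x with hz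
  have hzd : ∀ x, HasDerivAt z (coshExp c x * f x) x := fun x => by
    refine ((hasDerivAt_coshExp c x).mul (hy x)).congr_deriv ?_
    ring
  have hcc := continuous_coshExp c
  have hzc : Continuous z := continuous_iff_continuousAt.2 fun x => (hzd x).continuousAt
  have hcf : Continuous fun x => coshExp c x * f x := hcc.mul hf
  have hyz : y x = sechExp c x * z x := by
    rw [hz]; simp only; rw [← mul_assoc, sechExp_mul_coshExp, one_mul]
  set R : ℝ := |x| + 1 with hR
  set M : ℝ := Real.exp (k * R) * ((1 + 2 * R) * B) with hM
  have hdiff : ∀ t, |t| ≤ 1 → ‖z x - z t‖ ≤ M := by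
    intro t ht
    have hxI : x ∈ Set.Icc (-R) R := abs_le.1 (by rw [hR]; linarith)
    have htI : t ∈ Set.Icc (-R) R := abs_le.1 (by rw [hR]; linarith [abs_nonneg x])
    have hint : IntegrableOn (fun s => ‖f s‖) (Set.Icc (-R) R) := hf.norm.integrableOn_Icc
    rw [← intervalIntegral.integral_eq_sub_of_hasDerivAt (fun s _ => hzd s)
      (hcf.intervalIntegrable t x)]
    refine intervalIntegral.norm_integral_le_integral_norm_uIoc.trans ?_
    have hsub : Set.uIoc t x ⊆ Set.Icc (-R) R :=
      Set.uIoc_subset_uIcc.trans (Set.uIcc_subset_Icc htI hxI)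
    calc ∫ s in Set.uIoc t x, ‖coshExp c s * f s‖
        ≤ ∫ s in Set.Icc (-R) R, ‖coshExp c s * f s‖ := by
          refine setIntegral_mono_set hcf.norm.integrableOn_Icc
            (Eventually.of_forall fun _ => norm_nonneg _) hsub.eventuallyLE
      _ ≤ ∫ s in Set.Icc (-R) R, Real.exp (k * R) * ‖f s‖ := by
          refine setIntegral_mono_on hcf.norm.integrableOn_Icc (hint.const_mul _) measurableSet_Icc
            fun s hs => ?_
          rw [norm_mul]
          refine mul_le_mul_of_nonneg_right ((norm_coshExp_le c s).trans
            (Real.exp_le_exp.2 ?_)) (norm_nonneg _)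
          have := abs_le.2 hs
          exact mul_le_mul hk this (abs_nonneg _) hk0
      _ ≤ M := by
          rw [integral_const_mul, hM]
          refine mul_le_mul_of_nonneg_left (hB R ?_) (Real.exp_nonneg _)
          rw [hR]; positivity
  have hM0 : 0 ≤ M := (norm_nonneg _).trans (hdiff 0 (by simp))
  have hiϱ := hϱ.integrable
  have hcs : HasCompactSupport fun t => (ϱ t : ℂ) * z t :=
    hasCompactSupport_of_abs fun t ht => by simp [hϱ.supp t ht]
  have hi1 : Integrable fun t => (ϱ t : ℂ) * z t := by
    refine Continuous.integrable_of_hasCompactSupport ?_ hcs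
    have := hϱ.smooth.continuous
    fun_prop
  have e1 : ∫ t, probeFun ϱ c t * y t = ∫ t, (ϱ t : ℂ) * z t := by
    refine integral_congr_ae (Eventually.of_forall fun t => ?_)
    simp only [probeFun, hz]; ring
  have hi2 : Integrable fun t => (ϱ t : ℂ) * z x := (hiϱ.ofReal (𝕜 := ℂ)).mul_const _
  have e2 : ∫ t, (ϱ t : ℂ) * z x = z x := by
    rw [integral_mul_const]
    have : ∫ t, (ϱ t : ℂ) = ((∫ t, ϱ t : ℝ) : ℂ) := integral_ofReal (𝕜 := ℂ)
    rw [this, hϱ.integral]; simp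
  have h3 : ‖z x - ∫ t, (ϱ t : ℂ) * z t‖ ≤ M := by
    nth_rewrite 1 [← e2]
    rw [← integral_sub hi2 hi1]
    calc _ ≤ ∫ t, ϱ t * M := by
          refine norm_integral_le_of_norm_le (hiϱ.mul_const M) (Eventually.of_forall fun t => ?_)
          rw [← mul_sub, norm_mul, Complex.norm_real, Real.norm_of_nonneg (hϱ.nonneg t)]
          by_cases ht : |t| ≤ 1
          · exact mul_le_mul_of_nonneg_left (hdiff t ht) (hϱ.nonneg t)
          · simp [hϱ.supp t (not_le.1 ht)]
      _ = M := by rw [integral_mul_const, hϱ.integral, one_mul]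
  rw [e1, hyz, norm_mul]
  refine mul_le_mul ((norm_sechExp_le' c x).trans (Real.exp_le_exp.2 ?_)) ?_ (norm_nonneg _)
    (Real.exp_nonneg _)
  · exact mul_le_mul_of_nonneg_right (by linarith) (abs_nonneg x)
  · calc ‖z x‖ = ‖(∫ t, (ϱ t : ℂ) * z t) + (z x - ∫ t, (ϱ t : ℂ) * z t)‖ := by congr 1; ring
      _ ≤ _ := (norm_add_le _ _).trans (add_le_add_right h3 _)

/-- The first order operator controls the function locally, up to one functional. -/
theorem IsMollifier.local_bound {a : ℝ} (ha : 0 < a) {k : ℝ} {n : ℕ} (hn : 2 * k + 2 ≤ n) :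
    ∃ C, 0 ≤ C ∧ ∀ (β : ℂ) (_ : |((a : ℂ) - β).re| + 1 ≤ k) (y g : Ltwo), IsD a y g →
      ‖mulOp (sechPow n) y‖ ≤
        C * (‖g + (𝐓 + Polynomial.C β) • y‖ + ‖inner ℂ (hϱ.probe (a - β)) y‖) := by
  have hed : IsExpDecay fun x => (Real.exp (-(1 * |x|)) : ℂ) := by
    refine ⟨Continuous.aestronglyMeasurable (by fun_prop), 1, 1, one_pos, fun x => ?_⟩
    rw [Complex.norm_real, Real.norm_of_nonneg (Real.exp_nonneg _)]
    simp
  set D : ℝ := 2 ^ n * (Real.exp k * 4) with hD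
  refine ⟨D * ‖hed.memLp.toLp _‖, by positivity, fun β hβ y g hy => ?_⟩
  have hk0 : 0 ≤ k := by linarith [abs_nonneg ((a : ℂ) - β).re]
  have hcl : IsClosed {g : Ltwo | ‖mulOp (sechPow n) (resD a g)‖ ≤ D * ‖hed.memLp.toLp _‖ *
      (‖g + (𝐓 + Polynomial.C β) • resD a g‖ + ‖inner ℂ (hϱ.probe (a - β)) (resD a g)‖)} := by
    simp only [psmul_def]
    exact isClosed_le (by fun_prop) (by fun_prop)
  rw [← show resD a g = y from hy]
  refine hcl.closure_subset_iff.2 ?_ (dense_compactSupport g)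
  rintro G ⟨g, hg, hc, hG⟩
  simp only [Set.mem_ofPred_eq]
  have h1 := isExpDecay_prim ha hg hc
  have hy : resD a G =ᵐ[volume] prim a g := by
    rw [resD_coe_compactSupport ha hg hc hG]; exact h1.memLp.coeFn_toLp
  set F := G + (𝐓 + Polynomial.C β) • resD a G with hF
  set f : ℝ → ℂ := fun x => g x + (th x + β) * prim a g x with hf
  have hFf : F =ᵐ[volume] f := by
    filter_upwards [Lp.coeFn_add G ((𝐓 + Polynomial.C β) • resD a G), hG, hy,
      psmul_coe (𝐓 + Polynomial.C β) (resD a G)] with x e1 e2 e3 e4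
    rw [hF, e1, Pi.add_apply, e2, e4, e3]
    simp [polyFun, hf]
  have hcont : Continuous (prim a g) :=
    continuous_iff_continuousAt.2 fun x => (hasDerivAt_prim hg hc x).continuousAt
  have hth := continuous_th
  set N := ‖inner ℂ (hϱ.probe (a - β)) (resD a G)‖ with hN
  have hNe : ‖∫ t, probeFun ϱ (a - β) t * prim a g t‖ = N := by
    rw [hN, hϱ.inner_probe]
    congr 1
    refine integral_congr_ae ?_
    filter_upwards [hy] with t ht
    rw [ht]
  have hpt := hϱ.pointwise hβ (y := prim a g) (f := f) (B := ‖F‖) (fun x => by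
    refine (hasDerivAt_prim hg hc x).congr_deriv ?_
    simp only [hf]; ring) (by rw [hf]; fun_prop) (fun R hR => by
      rw [← setIntegral_congr_ae (f := fun x => ‖F x‖) measurableSet_Icc
        (hFf.mono fun x hx _ => by rw [hx])]
      exact setIntegral_norm_le F hR)
  rw [hNe] at hpt
  have hfin : ‖mulOp (sechPow n) (resD a G)‖ ≤ D * (‖F‖ + N) * ‖hed.memLp.toLp _‖ := by
    refine Lp.norm_le_mul_norm_of_ae_le_mul ?_
    filter_upwards [mulOp_coe (isBddMul_sechPow n) (resD a G), hy, hed.memLp.coeFn_toLp]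
      with x e1 e2 e3
    rw [e1, e2, e3, norm_mul, Complex.norm_real, Real.norm_of_nonneg (Real.exp_nonneg _)]
    have hx0 := abs_nonneg x
    have hN0 : 0 ≤ N := norm_nonneg _
    have hF0 : 0 ≤ ‖F‖ := norm_nonneg _
    have b1 : 1 + 2 * (|x| + 1) ≤ 4 * Real.exp |x| := by
      have := Real.add_one_le_exp |x|
      linarith
    have b2 : (1 : ℝ) ≤ Real.exp (k * (|x| + 1)) := Real.one_le_exp (by positivity)
    have b3 : N + Real.exp (k * (|x| + 1)) * ((1 + 2 * (|x| + 1)) * ‖F‖) ≤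
        Real.exp (k * (|x| + 1)) * (4 * Real.exp |x|) * (‖F‖ + N) := by
      have b4 : 1 ≤ 4 * Real.exp |x| := by linarith
      have b5 : N ≤ Real.exp (k * (|x| + 1)) * (4 * Real.exp |x|) * N :=
        le_mul_of_one_le_left hN0 (one_le_mul_of_one_le_of_one_le b2 b4)
      have b6 : (1 + 2 * (|x| + 1)) * ‖F‖ ≤ 4 * Real.exp |x| * ‖F‖ :=
        mul_le_mul_of_nonneg_right b1 hF0
      have b7 := mul_le_mul_of_nonneg_left b6 (Real.exp_nonneg (k * (|x| + 1)))
      linarith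
    calc ‖sechPow n x‖ * ‖prim a g x‖ ≤ (2 ^ n * Real.exp (-(n * |x|))) * (Real.exp (k * |x|) *
          (Real.exp (k * (|x| + 1)) * (4 * Real.exp |x|) * (‖F‖ + N))) :=
          mul_le_mul (norm_sechPow_le n x) ((hpt x).trans
            (mul_le_mul_of_nonneg_left b3 (Real.exp_nonneg _))) (norm_nonneg _) (by positivity)
      _ = D * (‖F‖ + N) * (Real.exp (-(n * |x|)) * Real.exp (k * |x|) * Real.exp (k * |x|) *
          Real.exp |x|) := by
          rw [mul_add k, Real.exp_add, mul_one, hD]; ring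
      _ ≤ D * (‖F‖ + N) * Real.exp (-(1 * |x|)) := by
          refine mul_le_mul_of_nonneg_left ?_ (by positivity)
          rw [← Real.exp_add, ← Real.exp_add, ← Real.exp_add]
          -- Here 2k + 2 ≤ n is spent: sech^n must beat two factors e^{k|x|} and one factor e^{|x|}
          -- from the pointwise bound and still leave the square integrable e^{−|x|}.
          refine Real.exp_le_exp.2 ?_
          nlinarith
  linarith

end Local

end KPII

namespace KPII

/-! ### Factorization of the Miura operator -/

/-- Compactness: tanh x, β and γ range over bounded sets and f is continuous. This is what makes
constants uniform in the frequency. -/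
theorem exists_psmul_bound (f : ℂ → ℂ → ℂ → ℂ)
    (hf : Continuous fun z : ℂ × ℂ × ℂ => f z.1 z.2.1 z.2.2) (B : ℝ) :
    ∃ C, 0 ≤ C ∧ ∀ (p : Polynomial ℂ) (β γ : ℂ), ‖β‖ ≤ B → ‖γ‖ ≤ B →
      (∀ x, polyFun p x = f (th x) β γ) → ∀ y : Ltwo, ‖p • y‖ ≤ C * ‖y‖ := by
  obtain ⟨C, hC⟩ := (isCompact_closedBall (0 : ℂ × ℂ × ℂ) (max 1 B)).exists_bound_of_continuousOn
    hf.continuousOn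
  refine ⟨max C 0, le_max_right _ _, fun p β γ hβ hγ hp y => ?_⟩
  refine norm_mulOp_apply_le (isBddMul_polyFun p) (fun x => ?_) y
  rw [hp x]
  refine (hC (th x, β, γ) ?_).trans (le_max_left _ _)
  rw [mem_closedBall_zero_iff, Prod.norm_def, Prod.norm_def]
  refine max_le ?_ (max_le (hβ.trans (le_max_right _ _)) (hγ.trans (le_max_right _ _)))
  rw [Complex.norm_real, Real.norm_eq_abs]
  exact (abs_th_le_one x).trans (le_max_left _ _)

/-- The function `(D + T + β)(D + T + γ) J² u`. -/
def facOf (a : ℝ) (β γ : ℂ) (u : Ltwo) : Ltwo :=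
  u + (2 * 𝐓 + Polynomial.C β + Polynomial.C γ) • resD a u +
    (1 + (Polynomial.C β + Polynomial.C γ) * 𝐓 + Polynomial.C β * Polynomial.C γ) •
      resD a (resD a u)

/-- The function `(D + T + γ) J² u`. -/
def yOf (a : ℝ) (γ : ℂ) (u : Ltwo) : Ltwo :=
  resD a u + (𝐓 + Polynomial.C γ) • resD a (resD a u)

theorem facOf_comm (a : ℝ) (β γ : ℂ) (u : Ltwo) : facOf a β γ u = facOf a γ β u := by
  rw [facOf, facOf]; module

variable {a : ℝ}

/-- Peels one factor off: with y = (D + T + γ)J²u, the remaining relation is (D + T + β)y = F. -/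
theorem isD_yOf (ha : 0 < a) (β γ : ℂ) (u : Ltwo) :
    IsD a (yOf a γ u) (facOf a β γ u - (𝐓 + Polynomial.C β) • yOf a γ u) := by
  refine ((IsD.resD a u).add ((IsD.resD a (resD a u)).psmul ha (𝐓 + Polynomial.C γ))).congr rfl ?_
  rw [facOf, yOf, pder_add, pder_X, pder_C]
  module

/-- The operator `D + T - β` is bounded below. -/
theorem IsD.norm_le_sub (ha : 0 < a) {β : ℂ} (hβ : 1 ≤ β.re) {y g : Ltwo} (h : IsD a y g) :
    a * ‖y‖ ≤ ‖g + (𝐓 - Polynomial.C β) • y‖ := by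
  have h1 := h.re_inner ha
  have h2 := re_inner_psmul_le (p := 𝐓 - Polynomial.C β) (c := 0) (fun x => by
    have := (abs_le.1 (abs_th_le_one x)).2
    simp [polyFun]; linarith) y
  have h3 : (Inner.inner ℂ y (g + (𝐓 - Polynomial.C β) • y)).re ≤ -a * ‖y‖ ^ 2 := by
    rw [inner_add_right, Complex.add_re]; linarith
  have h4 : -(Inner.inner ℂ y (g + (𝐓 - Polynomial.C β) • y)).re ≤
      ‖y‖ * ‖g + (𝐓 - Polynomial.C β) • y‖ :=
    (neg_le_abs _).trans ((Complex.abs_re_le_norm _).trans (norm_inner_le_norm _ _))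
  rcases (norm_nonneg y).eq_or_lt with h0 | h0
  · rw [← h0, mul_zero]; exact norm_nonneg _
  · exact le_of_mul_le_mul_left (by nlinarith) h0

theorem denseRange_resD₃ (ha : a ≠ 0) : DenseRange fun g => resD a (resD a (resD a g)) := by
  have h2 := denseRange_resD ha
  exact h2.comp (h2.comp h2 (resD a).continuous) (resD a).continuous

theorem continuous_facOf (β γ : ℂ) : Continuous (facOf a β γ) := by
  unfold facOf
  simp only [psmul_def]
  fun_prop

theorem C_sq_of {β : ℂ} {η : ℝ} (hβ : β ^ 2 = 1 + Complex.I * η) :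
    Polynomial.C β ^ 2 = 1 + Polynomial.C Complex.I * ceta η := by
  rw [← map_pow, hβ]; simp

/-- The relations for β² and γ² give (D + T − β)(D + T − γ)F = D²Γu. Since T ≤ 1 ≤ Re β, Re γ, each
of these factors is bounded below by a, so both can be undone with a constant that does not depend
on the frequency as long as β and γ stay bounded. -/
theorem exists_norm_facOf_le (ha : 0 < a) (B : ℝ) : ∃ C, 0 ≤ C ∧ ∀ (η : ℝ) (β γ : ℂ),
    β ^ 2 = 1 + Complex.I * η → γ ^ 2 = 1 + Complex.I * ((-η : ℝ) : ℂ) → 1 ≤ β.re → 1 ≤ γ.re →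
      ‖β‖ ≤ B → ‖γ‖ ≤ B → ∀ u, ‖facOf a β γ u‖ ≤ C * ‖miura a η u‖ := by
  obtain ⟨C₁, hC₁, h₁⟩ := exists_psmul_bound (fun t b c => 1 - (b + c) * t + b * c -
    2 * (1 - t ^ 2) - (t - b) * (2 * t - b - c)) (by fun_prop) B
  obtain ⟨C₂, hC₂, h₂⟩ := exists_psmul_bound (fun t b c => 2 * t - b - c) (by fun_prop) B
  refine ⟨(C₁ / a + C₂) / a + 1, by positivity, fun η β γ hβ hγ hβ1 hγ1 hβB hγB u => ?_⟩
  have hcl : IsClosed {u : Ltwo | ‖facOf a β γ u‖ ≤ ((C₁ / a + C₂) / a + 1) * ‖miura a η u‖} :=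
    isClosed_le (continuous_facOf β γ).norm (by fun_prop)
  refine hcl.closure_subset_iff.2 ?_ (denseRange_resD₃ ha.ne' u)
  rintro _ ⟨g₀, rfl⟩
  simp only [Set.mem_ofPred_eq]
  have h := isTower a g₀
  rw [facOf]
  set g₁ := resD a g₀
  set g₂ := resD a g₁
  set g₃ := resD a g₂
  set g₄ := resD a g₃
  set g₅ := resD a g₄
  have hβ' := C_sq_of hβ
  have hγ' := C_sq_of hγ
  have hI : Polynomial.C Complex.I ^ 2 = (-1 : Polynomial ℂ) := by
    rw [← map_pow, Complex.I_sq]; simp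
  have hη' : ceta (-η) = - ceta η := by rw [ceta, Complex.ofReal_neg, map_neg]
  rw [hη'] at hγ'
  set V := miura a η g₃
  set b := Polynomial.C β with hb
  set c := Polynomial.C γ with hc
  obtain ⟨v, hv⟩ : ∃ v, v = g₁ + (4 * 𝐓) • g₂ + (4 : Polynomial ℂ) • g₃ + (ceta η ^ 2) • g₅ :=
    ⟨_, rfl⟩
  obtain ⟨V₁, hV, hV₁⟩ : ∃ V₁, IsD a V V₁ ∧ IsD a V₁ v :=
    ⟨_, h.isD_miura₁ ha, hv ▸ h.isD_miura₂ ha⟩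
  set F := g₃ + (2 * 𝐓 + b + c) • g₄ + (1 + (b + c) * 𝐓 + b * c) • g₅ with hF
  obtain ⟨F₁, hF₁⟩ : ∃ F₁, F₁ = g₂ + (2 * 𝐓 + b + c) • g₃ + (2 * (1 - 𝐓 ^ 2)) • g₄ +
    (1 + (b + c) * 𝐓 + b * c) • g₄ + ((b + c) * (1 - 𝐓 ^ 2)) • g₅ := ⟨_, rfl⟩
  have dF : IsD a F F₁ := by
    refine ((h.d₃.add (h.d₄.psmul ha _)).add (h.d₅.psmul ha _)).congr rfl ?_
    simp only [hF₁, hb, hc, pder_add, pder_X, pder_C, pder_mul, pder_ofNat, pder_one]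
    module
  obtain ⟨F₂, dF₁⟩ : ∃ F₂, IsD a F₁ F₂ ∧
      F₂ + (2 * 𝐓 - b - c) • F₁ + (1 - (b + c) * 𝐓 + b * c) • F = v := by
    rw [hF₁]
    refine ⟨_, ((((h.d₂.add (h.d₃.psmul ha _)).add (h.d₄.psmul ha _)).add
      (h.d₄.psmul ha _)).add (h.d₅.psmul ha _)), ?_⟩
    simp only [hF, hv, hb, hc, pder_add, pder_X, pder_C, pder_mul, pder_ofNat, pder_one, pder_sub,
      pder_pow]
    rw [← hb, ← hc]
    push_cast
    -- The coefficients of g₃ and g₄ use β² + γ² = 2, and the coefficient of g₅ uses (β² − 1)(γ² −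
    -- 1) = η².
    match_scalars
    · ring
    · ring
    · linear_combination (-1 : Polynomial ℂ) * hβ' - hγ'
    · linear_combination (-2 * 𝐓 : Polynomial ℂ) * hβ' - 2 * 𝐓 * hγ'
    · linear_combination (c ^ 2 - 1) * hβ' + Polynomial.C Complex.I * ceta η * hγ' -
        ceta η ^ 2 * hI
  have dG := dF.sub hV
  have dG₁ := dF₁.1.sub hV₁
  set G := F - V with hG
  set G₁ := F₁ - V₁ with hG₁
  -- (D + T − β)(D + T − γ) applied to G = F − V is a first order expression in V. Adding (2T − β −
  -- γ)V before applying the outer factor removes DV, so that only ‖V‖ enters.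
  set k := (G₁ + (𝐓 - c) • G) + (2 * 𝐓 - b - c) • V with hk
  have dk : IsD a k ((F₂ - v + ((𝐓 - c) • G₁ + (1 - 𝐓 ^ 2) • G)) + ((2 * 𝐓 - b - c) • V₁ +
      (2 * (1 - 𝐓 ^ 2)) • V)) := by
    refine ((dG₁.add (dG.psmul ha _)).add (hV.psmul ha _)).congr rfl ?_
    simp only [hb, hc, pder_X, pder_C, pder_mul, pder_ofNat, pder_sub]
    module
  have e1 : ((F₂ - v + ((𝐓 - c) • G₁ + (1 - 𝐓 ^ 2) • G)) + ((2 * 𝐓 - b - c) • V₁ +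
      (2 * (1 - 𝐓 ^ 2)) • V)) + (𝐓 - b) • k = -((1 - (b + c) * 𝐓 + b * c -
    2 * (1 - 𝐓 ^ 2) - (𝐓 - b) * (2 * 𝐓 - b - c)) • V) := by
    rw [hk, hG₁, hG, ← dF₁.2]
    module
  have n1 := dk.norm_le_sub ha hβ1
  rw [← hb, e1, norm_neg] at n1
  have n2 := h₁ (1 - (b + c) * 𝐓 + b * c - 2 * (1 - 𝐓 ^ 2) - (𝐓 - b) * (2 * 𝐓 - b - c)) β γ hβB hγB
    (fun x => by simp [polyFun, hb, hc]) V
  have n3 := h₂ (2 * 𝐓 - b - c) β γ hβB hγB (fun x => by simp [polyFun, hb, hc]) V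
  have n4 := dG.norm_le_sub ha hγ1
  rw [← hc, show G₁ + (𝐓 - c) • G = k - (2 * 𝐓 - b - c) • V by rw [hk]; module] at n4
  have n5 := norm_sub_le k ((2 * 𝐓 - b - c) • V)
  have n6 : ‖k‖ ≤ C₁ / a * ‖V‖ := by
    rw [div_mul_eq_mul_div, le_div_iff₀ ha]; linarith
  have n7 : ‖G‖ ≤ (C₁ / a + C₂) / a * ‖V‖ := by
    rw [div_mul_eq_mul_div, le_div_iff₀ ha]; linarith
  calc ‖F‖ = ‖G + V‖ := by rw [hG, sub_add_cancel]
    _ ≤ ‖G‖ + ‖V‖ := norm_add_le _ _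
    _ ≤ _ := by linarith

/-! ### Control of functions by the Miura transform -/

/-- For s ≤ ε/(K + 1) the left side is below ε, and above that level s^n is bounded from below. With
s = sech² x it trades a localized potential for a small constant plus an arbitrarily strongly
localized weight. -/
theorem exists_pow_bound {ε K : ℝ} (hε : 0 < ε) (hK : 0 ≤ K) (n : ℕ) :
    ∃ C, 0 ≤ C ∧ ∀ s, 0 ≤ s → s ≤ 1 → K * s ≤ ε + C * s ^ n := by
  refine ⟨K / (ε / (K + 1)) ^ n, by positivity, fun s h0 h1 => ?_⟩
  rcases le_or_gt s (ε / (K + 1)) with h | h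
  · have h2 : K * s ≤ K * (ε / (K + 1)) := by gcongr
    have h3 : K * (ε / (K + 1)) ≤ ε := by
      rw [mul_div_assoc', div_le_iff₀ (by positivity)]
      nlinarith
    have h4 : 0 ≤ K / (ε / (K + 1)) ^ n * s ^ n := by positivity
    linarith
  · have hd : 0 < ε / (K + 1) := by positivity
    have h2 : (ε / (K + 1)) ^ n ≤ s ^ n := pow_le_pow_left₀ hd.le h.le n
    have h3 : K ≤ K / (ε / (K + 1)) ^ n * s ^ n := by
      rw [div_mul_eq_mul_div, le_div_iff₀ (by positivity)]
      gcongr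
    nlinarith

theorem sechPow_sq (n : ℕ) (x : ℝ) : ‖sechPow n x‖ ^ 2 = (1 - th x ^ 2) ^ n := by
  rw [one_sub_th_sq, sechPow, Complex.norm_real, Real.norm_of_nonneg
    (pow_nonneg (inv_nonneg.2 (Real.cosh_pos x).le) n), ← pow_mul, mul_comm, pow_mul, inv_pow]

theorem norm_mulOp_sechPow_sq (n : ℕ) (y : Ltwo) :
    ‖mulOp (sechPow n) y‖ ^ 2 = (inner ℂ y ((1 - 𝐓 ^ 2) ^ n • y)).re := by
  have h : inner ℂ (mulOp (sechPow n) y) (mulOp (sechPow n) y) =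
      inner ℂ y ((1 - 𝐓 ^ 2) ^ n • y) := by
    rw [inner_mulOp_left (isBddMul_sechPow n), mulOp_mulOp _ (isBddMul_sechPow n), psmul_def]
    · congr 3
      ext x
      rw [mul_comm, Complex.mul_conj, Complex.normSq_eq_norm_sq, sechPow_sq]
      simp [polyFun]
    · simp only [sechPow, Complex.conj_ofReal]
      exact isBddMul_sechPow n
  rw [← h]
  exact (inner_self_eq_norm_sq (𝕜 := ℂ) _).symm

/-- The potential is controlled by a small multiple of the mass and a localized mass. -/
theorem re_inner_psmul_le_sechPow {p : Polynomial ℂ} {ε C : ℝ} {n : ℕ}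
    (h : ∀ x, (polyFun p x).re ≤ ε + C * (1 - th x ^ 2) ^ n) (y : Ltwo) :
    (inner ℂ y (p • y)).re ≤ ε * ‖y‖ ^ 2 + C * ‖mulOp (sechPow n) y‖ ^ 2 := by
  rw [norm_mulOp_sechPow_sq, ← re_inner_smul_self, ← Complex.re_ofReal_mul, ← Complex.add_re,
    ← inner_smul_right, ← inner_add_right]
  have e : (ε : ℂ) • y + (C : ℂ) • ((1 - 𝐓 ^ 2) ^ n • y) =
      (Polynomial.C (ε : ℂ) + Polynomial.C (C : ℂ) * (1 - 𝐓 ^ 2) ^ n) • y := by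
    have e1 : ∀ (r : ℂ) (z : Ltwo), r • z = Polynomial.C r • z := fun r z => by
      rw [psmul_def, ← mulOp_const]; congr 2; ext x; simp [polyFun]
    rw [e1, e1]; module
  rw [e]
  refine re_inner_mulOp_le (isBddMul_polyFun _) (isBddMul_polyFun _) (fun x => ?_) y
  refine (h x).trans (le_of_eq ?_)
  have : polyFun (Polynomial.C (ε : ℂ) + Polynomial.C (C : ℂ) * (1 - 𝐓 ^ 2) ^ n) x =
      ((ε + C * (1 - th x ^ 2) ^ n : ℝ) : ℂ) := by simp [polyFun]
  rw [this, Complex.ofReal_re]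

/-- Below the threshold `Re β - 1 < a`, the first order operator controls the functions that are
annihilated by the local functional. -/
theorem exists_norm_le_of_probe_eq_zero {ϱ : ℝ → ℝ} (hϱ : IsMollifier ϱ) (ha : 0 < a) {δ k : ℝ}
    (hδ : 0 < δ) : ∃ C, 0 ≤ C ∧ ∀ β : ℂ, |β.re - a| ≤ 1 - δ → |((a : ℂ) - β).re| + 1 ≤ k →
      ∀ y g : Ltwo, IsD a y g → inner ℂ (hϱ.probe (a - β)) y = 0 →
        ‖y‖ ≤ C * ‖g + (𝐓 + Polynomial.C β) • y‖ := by
  obtain ⟨n, hn⟩ := exists_nat_ge (2 * k + 2)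
  obtain ⟨C₁, hC₁, h₁⟩ := hϱ.local_bound ha hn
  obtain ⟨C₂, hC₂, h₂⟩ := exists_pow_bound (half_pos hδ) (by norm_num : (0 : ℝ) ≤ 3 / 2) n
  refine ⟨(1 + C₂ * C₁ ^ 2) / (δ / 2) + 1, by positivity, fun β hβ hk y g hy h0 => ?_⟩
  have h3 := h₁ β hk y g hy
  rw [h0, norm_zero, add_zero] at h3
  set F := g + (𝐓 + Polynomial.C β) • y with hF
  -- Multiplier T: Re⟨y, TF⟩ is the real part of the form of T² + (β − a)T − ½ sech², which at both
  -- ends of the line is at least 1 − |Re β − a| ≥ δ. The deficit is localized near the origin,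
  -- where the vanishing functional lets F control y.
  have h4 := hy.re_inner_psmul ha (p := 𝐓) (fun x => by simp [polyFun, Complex.conj_ofReal])
  rw [pder_X] at h4
  have e1 : ∀ (r : ℝ) (z : Ltwo), (r : ℂ) • z = Polynomial.C (r : ℂ) • z := fun r z => by
    rw [psmul_def, ← mulOp_const]; congr 2; ext x; simp [polyFun]
  have h5 : (inner ℂ y (𝐓 • F)).re = (inner ℂ y ((𝐓 ^ 2 + (Polynomial.C β - Polynomial.C (a : ℂ)) *
      𝐓 - Polynomial.C ((1 / 2 : ℝ) : ℂ) * (1 - 𝐓 ^ 2)) • y)).re := by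
    have e2 : (𝐓 ^ 2 + (Polynomial.C β - Polynomial.C (a : ℂ)) *
        𝐓 - Polynomial.C ((1 / 2 : ℝ) : ℂ) * (1 - 𝐓 ^ 2)) • y =
        (𝐓 • F - 𝐓 • g) - (a : ℂ) • (𝐓 • y) - ((1 / 2 : ℝ) : ℂ) • ((1 - 𝐓 ^ 2) • y) := by
      rw [e1, e1, hF]; module
    rw [e2]
    simp only [inner_sub_right, inner_smul_right, Complex.sub_re, Complex.re_ofReal_mul]
    linarith
  have h6 := re_inner_psmul_le_sechPow (p := -(𝐓 ^ 2 + (Polynomial.C β - Polynomial.C (a : ℂ)) *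
      𝐓 - Polynomial.C ((1 / 2 : ℝ) : ℂ) * (1 - 𝐓 ^ 2))) (ε := -(δ / 2)) (C := C₂) (n := n)
      (fun x => by
        have h7 := h₂ (1 - th x ^ 2) (by rw [one_sub_th_sq]; positivity)
          (by linarith [sq_nonneg (th x)])
        have h8 : (β.re - a) * th x ≥ -(1 - δ) := by
          have h9 : |(β.re - a) * th x| ≤ (1 - δ) * 1 := by
            rw [abs_mul]
            exact mul_le_mul hβ (abs_th_le_one x) (abs_nonneg _) ((abs_nonneg _).trans hβ)
          linarith [(abs_le.1 h9).1]
        have e3 : (polyFun (-(𝐓 ^ 2 + (Polynomial.C β - Polynomial.C (a : ℂ)) *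
            𝐓 - Polynomial.C ((1 / 2 : ℝ) : ℂ) * (1 - 𝐓 ^ 2))) x).re =
            -(th x ^ 2 + (β.re - a) * th x - 1 / 2 * (1 - th x ^ 2)) := by
          have : polyFun (-(𝐓 ^ 2 + (Polynomial.C β - Polynomial.C (a : ℂ)) *
            𝐓 - Polynomial.C ((1 / 2 : ℝ) : ℂ) * (1 - 𝐓 ^ 2))) x =
            ((-(th x ^ 2 - a * th x - 1 / 2 * (1 - th x ^ 2)) : ℝ) : ℂ) - β * (th x : ℝ) := by
            simp [polyFun]; ring
          rw [this, Complex.sub_re, Complex.ofReal_re, Complex.re_mul_ofReal]; ring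
        rw [e3]
        linarith) y
  rw [neg_smul, inner_neg_right, Complex.neg_re, ← h5] at h6
  have h7 : (inner ℂ y (𝐓 • F)).re ≤ ‖y‖ * ‖F‖ := by
    refine (Complex.re_le_norm _).trans ((norm_inner_le_norm _ _).trans ?_)
    refine mul_le_mul_of_nonneg_left ?_ (norm_nonneg _)
    have := norm_mulOp_apply_le (isBddMul_polyFun 𝐓) (C := 1) (fun x => by
      simp only [polyFun, Polynomial.eval_X, Complex.norm_real, Real.norm_eq_abs]
      exact abs_th_le_one x) F
    rwa [one_mul] at this
  have h8 : ‖mulOp (sechPow n) y‖ ^ 2 ≤ C₁ ^ 2 * ‖F‖ ^ 2 := by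
    rw [← mul_pow]; exact pow_le_pow_left₀ (norm_nonneg _) h3 2
  by_contra hc
  push Not at hc
  have hF0 := norm_nonneg F
  have h9 : ‖F‖ ≤ ‖y‖ := by
    refine le_trans ?_ hc.le
    have : 0 ≤ (1 + C₂ * C₁ ^ 2) / (δ / 2) * ‖F‖ := by positivity
    linarith
  have hy0 : 0 < ‖y‖ := lt_of_le_of_lt (by positivity) hc
  have h10 : C₂ * ‖mulOp (sechPow n) y‖ ^ 2 ≤ C₂ * C₁ ^ 2 * (‖F‖ * ‖y‖) := by
    calc _ ≤ C₂ * (C₁ ^ 2 * ‖F‖ ^ 2) := by gcongr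
      _ = C₂ * C₁ ^ 2 * (‖F‖ * ‖F‖) := by ring
      _ ≤ _ := by gcongr
  have h11 : δ / 2 * ‖y‖ * ‖y‖ ≤ (1 + C₂ * C₁ ^ 2) * ‖F‖ * ‖y‖ := by nlinarith
  have h12 := le_of_mul_le_mul_right h11 hy0
  have h13 : ‖y‖ ≤ (1 + C₂ * C₁ ^ 2) / (δ / 2) * ‖F‖ := by
    rw [div_mul_eq_mul_div, le_div_iff₀ (by positivity)]; linarith
  linarith

end KPII

/-! ### Recovering u from F = (D + T + β)(D + T + γ)J²u, modulo the modes or the local functionals.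
-/

namespace KPII

variable {a : ℝ}

theorem csmul_eq (r : ℂ) (z : Ltwo) : r • z = Polynomial.C r • z := by
  rw [psmul_def, ← mulOp_const]; congr 2; ext x; simp [polyFun]

/-- The weighted derivative of polynomials in `tanh` times `e^{(a - β)x} sech x`. -/
theorem isD_sechVec (ha : 0 < a) {β : ℂ} (hβ : |((a : ℂ) - β).re| < 1) (p : Polynomial ℂ) :
    IsD a (p • sechVec hβ) ((pder p - (𝐓 + Polynomial.C β) * p) • sechVec hβ) := by
  have h := resD_sechVec ha.ne' hβ p
  rw [IsD, ← h]
  congr 2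
  rw [show (a : ℂ) - β - (a : ℝ) = -β by ring, map_neg]
  ring

/-- The element `D² (e^{(a - β)x} sech x)` of `L²(ℝ)`. -/
def modeVec {β : ℂ} (hβ : |((a : ℂ) - β).re| < 1) : Ltwo :=
  (2 * 𝐓 ^ 2 + 2 * Polynomial.C β * 𝐓 + Polynomial.C β ^ 2 - 1) • sechVec hβ

theorem isD_sechVec₁ (ha : 0 < a) {β : ℂ} (hβ : |((a : ℂ) - β).re| < 1) :
    IsD a (sechVec hβ) (-(𝐓 + Polynomial.C β) • sechVec hβ) := by
  refine (isD_sechVec ha hβ 1).congr (one_smul _ _).symm ?_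
  rw [pder_one]; module

theorem isD_sechVec₂ (ha : 0 < a) {β : ℂ} (hβ : |((a : ℂ) - β).re| < 1) :
    IsD a (-(𝐓 + Polynomial.C β) • sechVec hβ) (modeVec hβ) := by
  refine (isD_sechVec ha hβ (-(𝐓 + Polynomial.C β))).congr rfl ?_
  rw [modeVec, pder_neg, pder_add, pder_X, pder_C]; module

/-- The factor e^{−cx} cosh x in the probe is the reciprocal of e^{cx} sech x, so the pairing is ∫ϱ.
A multiple of the kernel element can therefore be subtracted to make the functional vanish. -/
theorem IsMollifier.inner_probe_sechVec {ϱ : ℝ → ℝ} (hϱ : IsMollifier ϱ) {β : ℂ}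
    (hβ : |((a : ℂ) - β).re| < 1) : inner ℂ (hϱ.probe (a - β)) (sechVec hβ) = 1 := by
  rw [hϱ.inner_probe]
  have : ∫ t, (ϱ t : ℂ) = ((∫ t, ϱ t : ℝ) : ℂ) := integral_ofReal (𝕜 := ℂ)
  rw [hϱ.integral, Complex.ofReal_one] at this
  rw [← this]
  refine integral_congr_ae ?_
  filter_upwards [sechVec_coe hβ] with t ht
  rw [ht, probeFun, mul_assoc, mul_comm (coshExp _ t), sechExp_mul_coshExp, mul_one]

/-- Below the threshold, the factorized operator controls the function up to the two modes. -/
theorem exists_sub_modes_le (ha : 0 < a) {δ : ℝ} (hδ : 0 < δ) (B : ℝ) : ∃ C, 0 ≤ C ∧ ∀ (β γ : ℂ)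
    (hβ : |((a : ℂ) - β).re| < 1) (hγ : |((a : ℂ) - γ).re| < 1), β ≠ γ → |β.re - a| ≤ 1 - δ →
      |γ.re - a| ≤ 1 - δ → ‖β‖ ≤ B → ‖γ‖ ≤ B → ∀ u, ∃ c₁ c₂ : ℂ,
        ‖u - (c₁ • modeVec hβ + c₂ • modeVec hγ)‖ ≤ C * ‖facOf a β γ u‖ := by
  obtain ⟨ϱ, hϱ⟩ := exists_isMollifier
  obtain ⟨C₁, hC₁, h₁⟩ := exists_norm_le_of_probe_eq_zero hϱ ha (k := 2) hδ
  obtain ⟨C₂, hC₂, h₂⟩ := exists_psmul_bound (fun t b c => t + c) (by fun_prop) B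
  obtain ⟨C₃, hC₃, h₃⟩ := exists_psmul_bound (fun t b c => 2 * t + b + c) (by fun_prop) B
  obtain ⟨C₄, hC₄, h₄⟩ := exists_psmul_bound (fun t b c => 1 + (b + c) * t + b * c) (by fun_prop) B
  refine ⟨1 + C₃ * (C₁ + C₂ * (C₁ * C₁)) + C₄ * (C₁ * C₁), by positivity,
    fun β γ hβ hγ hne hβδ hγδ hβB hγB u => ?_⟩
  set F := facOf a β γ u with hF
  set b := Polynomial.C β with hb
  set c := Polynomial.C γ with hc
  set y := yOf a γ u with hy
  have dy : IsD a y (F - (𝐓 + b) • y) := isD_yOf ha β γ u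
  set N : ℂ := inner ℂ (hϱ.probe (a - β)) y with hN
  set Eβ := sechVec hβ
  set Eγ := sechVec hγ
  have dβ : IsD a Eβ _ := isD_sechVec₁ ha hβ
  have dγ : IsD a Eγ _ := isD_sechVec₁ ha hγ
  -- Eβ spans the kernel of D + T + β: the equation keeps its right side F, and the functional is
  -- now zero.
  set y₁ := y - N • Eβ with hy₁
  have dy₁ : IsD a y₁ (F - (𝐓 + b) • y₁) := by
    refine (dy.sub (dβ.smul N)).congr rfl ?_
    rw [hy₁, csmul_eq, csmul_eq]; module
  have n1 : ‖y₁‖ ≤ C₁ * ‖F‖ := by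
    have := h₁ β hβδ (by linarith) y₁ _ dy₁ (by
      rw [hy₁, inner_sub_right, inner_smul_right, hϱ.inner_probe_sechVec, mul_one, hN, sub_self])
    rwa [← hb, sub_add_cancel] at this
  -- Since (D + T + γ)(Eβ − Eγ) = (γ − β)Eβ, the element s(Eβ − Eγ) lifts the correction N Eβ from y
  -- to q. The size of s never enters the bound, so the constant survives the collision β → γ.
  set s : ℂ := N / (γ - β) with hs
  have hsN : s * (γ - β) = N := div_mul_cancel₀ _ (sub_ne_zero.2 hne.symm)
  set q := resD a (resD a u) with hq
  have dq : IsD a q (y - (𝐓 + c) • q) := by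
    refine (IsD.resD a (resD a u)).congr rfl ?_
    rw [hy, yOf]; module
  set q₀ := q - s • (Eβ - Eγ) with hq₀
  set N' : ℂ := inner ℂ (hϱ.probe (a - γ)) q₀ with hN'
  set q₁ := q₀ - N' • Eγ with hq₁
  have dq₀ : IsD a q₀ (y₁ - (𝐓 + c) • q₀) := by
    refine (dq.sub ((dβ.sub dγ).smul s)).congr rfl ?_
    rw [hq₀, hy₁, ← hsN]
    simp only [csmul_eq, map_mul, map_sub]
    module
  have dq₁ : IsD a q₁ (y₁ - (𝐓 + c) • q₁) := by
    refine (dq₀.sub (dγ.smul N')).congr rfl ?_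
    rw [hq₁, csmul_eq, csmul_eq]; module
  have n2 : ‖q₁‖ ≤ C₁ * ‖y₁‖ := by
    have := h₁ γ hγδ (by linarith) q₁ _ dq₁ (by
      rw [hq₁, inner_sub_right, inner_smul_right, hϱ.inner_probe_sechVec, mul_one, hN', sub_self])
    rwa [← hc, sub_add_cancel] at this
  set q₂ := y₁ - (𝐓 + c) • q₁ with hq₂
  have dq₂ : IsD a q₂ (F - (2 * 𝐓 + b + c) • q₂ - (1 + (b + c) * 𝐓 + b * c) • q₁) := by
    refine (dy₁.sub (dq₁.psmul ha _)).congr rfl ?_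
    have : y₁ = q₂ + (𝐓 + c) • q₁ := by rw [hq₂]; module
    rw [hc, pder_add, pder_X, pder_C, ← hc, this]
    module
  -- The second derivative of q₁ = q − sEβ − (N' − s)Eγ is u minus the modes, while q₁ and q₂ are
  -- already bounded by F.
  have hmodes : IsD a q₂ (u - (s • modeVec hβ + (N' - s) • modeVec hγ)) := by
    have e1 : q₁ = q - (s • Eβ + (N' - s) • Eγ) := by
      rw [hq₁, hq₀]; module
    have e2 : IsD a q₁ (resD a u - (s • (-(𝐓 + b) • Eβ) + (N' - s) • (-(𝐓 + c) • Eγ))) := by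
      rw [e1]
      exact (IsD.resD a (resD a u)).sub ((dβ.smul s).add (dγ.smul (N' - s)))
    rw [dq₁.unique ha.ne' e2]
    exact (IsD.resD a u).sub (((isD_sechVec₂ ha hβ).smul s).add ((isD_sechVec₂ ha hγ).smul _))
  refine ⟨s, N' - s, ?_⟩
  rw [hmodes.unique ha.ne' dq₂]
  have m1 := h₃ (2 * 𝐓 + b + c) β γ hβB hγB (fun x => by simp [polyFun, hb, hc]) q₂
  have m2 := h₄ (1 + (b + c) * 𝐓 + b * c) β γ hβB hγB (fun x => by simp [polyFun, hb, hc]) q₁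
  have m3 := h₂ (𝐓 + c) β γ hβB hγB (fun x => by simp [polyFun, hc]) q₁
  have m4 : ‖q₂‖ ≤ ‖y₁‖ + ‖(𝐓 + c) • q₁‖ := norm_sub_le _ _
  have m5 := norm_sub_le (F - (2 * 𝐓 + b + c) • q₂) ((1 + (b + c) * 𝐓 + b * c) • q₁)
  have m6 := norm_sub_le F ((2 * 𝐓 + b + c) • q₂)
  have n3 : ‖q₁‖ ≤ C₁ * C₁ * ‖F‖ := by
    rw [mul_assoc]; exact n2.trans (mul_le_mul_of_nonneg_left n1 hC₁)
  have n4 : ‖q₂‖ ≤ (C₁ + C₂ * (C₁ * C₁)) * ‖F‖ := by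
    have := mul_le_mul_of_nonneg_left n3 hC₂
    linarith
  have n5 := mul_le_mul_of_nonneg_left n3 hC₄
  have n6 := mul_le_mul_of_nonneg_left n4 hC₃
  linarith

theorem mulOp_sechPow_psmul (n : ℕ) (p : Polynomial ℂ) (y : Ltwo) :
    mulOp (sechPow n) (p • y) = p • mulOp (sechPow n) y := by
  rw [psmul_def, psmul_def, mulOp_mulOp (isBddMul_sechPow n) (isBddMul_polyFun p),
    mulOp_mulOp (isBddMul_polyFun p) (isBddMul_sechPow n)]
  congr 2
  ext x
  ring

/-- Away from the double root, the function is locally controlled by the factorized operator and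
two functionals. -/
theorem exists_sechPow_le {ϱ : ℝ → ℝ} (hϱ : IsMollifier ϱ) (ha : 0 < a) {δ k : ℝ} (hδ : 0 < δ)
    (B : ℝ) {n : ℕ} (hn : 2 * k + 2 ≤ n) : ∃ C, 0 ≤ C ∧ ∀ β γ : ℂ, |((a : ℂ) - β).re| + 1 ≤ k →
      |((a : ℂ) - γ).re| + 1 ≤ k → δ ≤ ‖γ - β‖ → ‖β‖ ≤ B → ‖γ‖ ≤ B → ∀ u,
        ‖mulOp (sechPow n) u‖ ≤ C * (‖facOf a β γ u‖ +
          (‖inner ℂ (hϱ.probe (a - β)) (yOf a γ u)‖ + ‖inner ℂ (hϱ.probe (a - γ)) (yOf a β u)‖)) := by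
  obtain ⟨C₁, hC₁, h₁⟩ := hϱ.local_bound ha hn
  obtain ⟨C₂, hC₂, h₂⟩ := exists_psmul_bound (fun t b c => t + c) (by fun_prop) B
  obtain ⟨C₃, hC₃, h₃⟩ := exists_psmul_bound (fun t b c => 2 * t + b + c) (by fun_prop) B
  obtain ⟨C₄, hC₄, h₄⟩ := exists_psmul_bound (fun t b c => 1 + (b + c) * t + b * c) (by fun_prop) B
  obtain ⟨C₀, hC₀⟩ := (isBddMul_sechPow n).2
  have hC₀' : 0 ≤ C₀ := (norm_nonneg _).trans (hC₀ 0)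
  refine ⟨C₀ + C₃ * (C₁ + C₂ * (2 * C₁ / δ)) + C₄ * (2 * C₁ / δ), by positivity,
    fun β γ hβ hγ hne hβB hγB u => ?_⟩
  set F := facOf a β γ u with hF
  set b := Polynomial.C β with hb
  set c := Polynomial.C γ with hc
  set N := ‖inner ℂ (hϱ.probe (a - β)) (yOf a γ u)‖
  set N' := ‖inner ℂ (hϱ.probe (a - γ)) (yOf a β u)‖
  have n1 := h₁ β hβ _ _ (isD_yOf ha β γ u)
  rw [sub_add_cancel, ← hF] at n1
  have n2 := h₁ γ hγ _ _ (isD_yOf ha γ β u)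
  rw [sub_add_cancel, ← facOf_comm, ← hF] at n2
  set W := mulOp (sechPow n) with hW
  set q := resD a (resD a u) with hq
  set y := yOf a γ u with hy
  set y' := yOf a β u with hy'
  -- Eliminating between (D + T + γ)q and (D + T + β)q recovers q without derivatives; here the
  -- separation of β and γ is needed.
  have e1 : (γ - β) • W q = W y - W y' := by
    rw [← map_sub, ← map_smul]
    congr 1
    rw [hy, hy', yOf, yOf, csmul_eq, map_sub]; module
  have hN0 : 0 ≤ N := norm_nonneg _
  have hN0' : 0 ≤ N' := norm_nonneg _
  have hF0 : 0 ≤ ‖F‖ := norm_nonneg _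
  set S := ‖F‖ + (N + N') with hS
  have n3 : ‖W q‖ ≤ 2 * C₁ / δ * S := by
    have e2 := congrArg norm e1
    rw [norm_smul] at e2
    have e3 := norm_sub_le (W y) (W y')
    rw [div_mul_eq_mul_div, le_div_iff₀ hδ]
    have e4 : ‖W q‖ * δ ≤ ‖W q‖ * ‖γ - β‖ := by gcongr
    have e5 : C₁ * (‖F‖ + N) ≤ C₁ * S := by gcongr; linarith
    have e6 : C₁ * (‖F‖ + N') ≤ C₁ * S := by gcongr; linarith
    linarith
  have n4 : ‖W y‖ ≤ C₁ * S := n1.trans (by gcongr; linarith)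
  have e7 : W (resD a u) = W y - (𝐓 + c) • W q := by
    rw [hW, ← mulOp_sechPow_psmul, ← map_sub]
    congr 1
    rw [hy, yOf]; module
  have m3 := h₂ (𝐓 + c) β γ hβB hγB (fun x => by simp [polyFun, hc]) (W q)
  have n5 : ‖W (resD a u)‖ ≤ (C₁ + C₂ * (2 * C₁ / δ)) * S := by
    rw [e7]
    have := norm_sub_le (W y) ((𝐓 + c) • W q)
    have := mul_le_mul_of_nonneg_left n3 hC₂
    linarith
  have e8 : W u = W F - (2 * 𝐓 + b + c) • W (resD a u) - (1 + (b + c) * 𝐓 + b * c) • W q := by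
    rw [hW, ← mulOp_sechPow_psmul, ← mulOp_sechPow_psmul, ← map_sub, ← map_sub]
    congr 1
    rw [hF, facOf]; module
  have m1 := h₃ (2 * 𝐓 + b + c) β γ hβB hγB (fun x => by simp [polyFun, hb, hc]) (W (resD a u))
  have m2 := h₄ (1 + (b + c) * 𝐓 + b * c) β γ hβB hγB (fun x => by simp [polyFun, hb, hc]) (W q)
  have m5 := norm_sub_le (W F - (2 * 𝐓 + b + c) • W (resD a u)) ((1 + (b + c) * 𝐓 + b * c) • W q)
  have m6 := norm_sub_le (W F) ((2 * 𝐓 + b + c) • W (resD a u))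
  have m7 : ‖W F‖ ≤ C₀ * S := by
    refine (norm_mulOp_apply_le (isBddMul_sechPow n) hC₀ F).trans ?_
    gcongr; linarith
  rw [← e8] at m5
  have n6 := mul_le_mul_of_nonneg_left n3 hC₄
  have n7 := mul_le_mul_of_nonneg_left n5 hC₃
  linarith

/-- The local functionals are approximate eigenfunctionals of the linearized operator. -/
theorem exists_probe_genMap_le {ϱ : ℝ → ℝ} (hϱ : IsMollifier ϱ) (ha : 0 < a) (k B : ℝ) :
    ∃ C, 0 ≤ C ∧ ∀ (η : ℝ) (β γ l : ℂ), l = 4 * (β ^ 3 - β) →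
      |((a : ℂ) - β).re| + 1 ≤ k → ‖β‖ ≤ B → ‖γ‖ ≤ B → ∀ u w, (u, w) ∈ fibreGraph a η →
        ‖inner ℂ (hϱ.probe (a - β)) (yOf a γ w) - l * inner ℂ (hϱ.probe (a - β)) (yOf a γ u)‖ ≤
          C * (‖facOf a β γ u‖ + ‖miura a η u‖) := by
  obtain ⟨P₀, hP₀, p₀⟩ := hϱ.exists_norm_probe_le k
  obtain ⟨P₁, hP₁, p₁⟩ := hϱ.deriv.exists_norm_probe_le k
  obtain ⟨P₂, hP₂, p₂⟩ := hϱ.deriv.deriv.exists_norm_probe_le k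
  obtain ⟨C₂, hC₂, h₂⟩ := exists_psmul_bound (fun t b c => t + b) (by fun_prop) B
  refine ⟨4 * (P₂ + 3 * |B| * P₁ + (3 * |B| ^ 2 + 1) * P₀) +
    3 * (P₂ + P₁ * C₂ + 2 * |B| * (P₁ + P₀ * C₂)), by positivity,
    fun η β γ l hl hk hβB hγB u w huw => ?_⟩
  obtain ⟨g₀, rfl, rfl⟩ := mem_fibreGraph.1 huw
  have h := isTower a g₀
  set g₁ := resD a g₀
  set g₂ := resD a g₁
  set g₃ := resD a g₂
  set g₄ := resD a g₃ with hg₄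
  set g₅ := resD a g₄ with hg₅
  set V := miura a η g₃
  set w := genMap a η g₀
  have hl' : Polynomial.C l = 4 * (Polynomial.C β ^ 3 - Polynomial.C β) := by
    rw [hl, map_mul, map_sub, map_pow, map_ofNat]
  obtain ⟨v, hv⟩ : ∃ v, v = g₁ + (4 * 𝐓) • g₂ + (4 : Polynomial ℂ) • g₃ + (ceta η ^ 2) • g₅ :=
    ⟨_, rfl⟩
  obtain ⟨V₁, hV, hV₁⟩ : ∃ V₁, IsD a V V₁ ∧ IsD a V₁ v :=
    ⟨_, h.isD_miura₁ ha, hv ▸ h.isD_miura₂ ha⟩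
  have hw₁ : resD a w = _ := h.isD_genMap ha
  have hw₂ : resD a (resD a w) = _ := h.isD_genMap₂ ha hv
  rw [show resD a v = V₁ from hV₁] at hw₂
  set F := facOf a β γ g₃ with hF
  rw [facOf, ← hg₄, ← hg₅] at hF
  set y := yOf a γ g₃ with hy
  rw [yOf, ← hg₄, ← hg₅] at hy
  have hyw : yOf a γ w = resD a w + (𝐓 + Polynomial.C γ) • resD a (resD a w) := rfl
  rw [hw₂, hw₁] at hyw
  set b := Polynomial.C β with hb
  set c := Polynomial.C γ with hc
  obtain ⟨F₁, hF₁⟩ : ∃ F₁, F₁ = g₂ + (2 * 𝐓 + b + c) • g₃ + (2 * (1 - 𝐓 ^ 2)) • g₄ +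
    (1 + (b + c) * 𝐓 + b * c) • g₄ + ((b + c) * (1 - 𝐓 ^ 2)) • g₅ := ⟨_, rfl⟩
  have dF : IsD a F F₁ := by
    rw [hF]
    refine ((h.d₃.add (h.d₄.psmul ha _)).add (h.d₅.psmul ha _)).congr rfl ?_
    simp only [hF₁, hb, hc, pder_add, pder_X, pder_C, pder_mul, pder_ofNat, pder_one]
    module
  obtain ⟨F₂, hF₂⟩ : ∃ F₂, F₂ = g₁ + (2 * 𝐓 + b + c) • g₂ + (2 * (1 - 𝐓 ^ 2)) • g₃ +
    (2 * (1 - 𝐓 ^ 2)) • g₃ - (4 * 𝐓 * (1 - 𝐓 ^ 2)) • g₄ + (1 + (b + c) * 𝐓 + b * c) • g₃ +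
    (2 * (b + c) * (1 - 𝐓 ^ 2)) • g₄ - (2 * 𝐓 * (b + c) * (1 - 𝐓 ^ 2)) • g₅ := ⟨_, rfl⟩
  have dF₁ : IsD a F₁ F₂ := by
    rw [hF₁, hF₂]
    refine ((((h.d₂.add (h.d₃.psmul ha _)).add (h.d₄.psmul ha _)).add
      (h.d₄.psmul ha _)).add (h.d₅.psmul ha _)).congr rfl ?_
    simp only [hb, hc, pder_add, pder_X, pder_C, pder_mul, pder_ofNat, pder_one, pder_sub, pder_pow]
    push_cast
    module
  set A := F₁ + (𝐓 + b) • F with hA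
  obtain ⟨A', hA', dA⟩ : ∃ A', A' = F₂ + ((𝐓 + b) • F₁ + (1 - 𝐓 ^ 2) • F) ∧ IsD a A A' := by
    refine ⟨_, rfl, (dF₁.add (dF.psmul ha (𝐓 + b))).congr rfl ?_⟩
    rw [hb, pder_add, pder_X, pder_C]; module
  -- Modulo powers of D + T + β applied to F and terms in V, the operator acts on y as the scalar λ
  -- = 4(β³ − β). The integrations by parts below move each factor D + T + β onto the bump, so that
  -- no derivative of F or V is left.
  have key : yOf a γ w = Polynomial.C l • y - (4 : Polynomial ℂ) • ((A' + (𝐓 + b) • A)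
      - (3 * b) • A + (3 * b ^ 2 - 1) • F) + (3 : Polynomial ℂ) • ((v + (𝐓 + b) • V₁) +
        (c - b) • V₁) := by
    rw [hyw, hA', hA, hF₂, hF₁, hF, hy, hv, hl']
    match_scalars
    · ring
    · ring
    · ring
    · ring
    · ring
    · ring
  have i0 := hϱ.inner_probe_deriv ha β dF
  have i1 := hϱ.inner_probe_deriv ha β dA
  have i2 := hϱ.deriv.inner_probe_deriv ha β dF
  have i3 := hϱ.inner_probe_deriv ha β hV₁
  have i4 := hϱ.deriv.inner_probe_deriv ha β hV
  have i5 := hϱ.inner_probe_deriv ha β hV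
  rw [← hb] at i0 i1 i2 i3 i4 i5
  rw [← hA] at i0 i2
  rw [inner_add_right] at i4 i5
  set ℓ₀ := hϱ.probe (a - β)
  set ℓ₁ := hϱ.deriv.probe (a - β)
  set ℓ₂ := hϱ.deriv.deriv.probe (a - β)
  set X := (𝐓 + b) • V with hX
  have e1 : inner ℂ ℓ₀ (yOf a γ w) - l * inner ℂ ℓ₀ y =
      -4 * (inner ℂ ℓ₂ F + 3 * β * inner ℂ ℓ₁ F + (3 * β ^ 2 - 1) * inner ℂ ℓ₀ F) +
      3 * (inner ℂ ℓ₂ V + inner ℂ ℓ₁ X - (γ - β) * (inner ℂ ℓ₁ V + inner ℂ ℓ₀ X)) := by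
    have e2 : yOf a γ w = l • y - (4 : ℂ) • ((A' + (𝐓 + b) • A)
      - (3 * β) • A + (3 * β ^ 2 - 1) • F) + (3 : ℂ) • ((v + (𝐓 + b) • V₁) + (γ - β) • V₁) := by
      rw [key]
      simp only [csmul_eq, map_mul, map_sub, map_pow, map_one, map_ofNat]
      rfl
    rw [e2]
    simp only [inner_add_right, inner_sub_right, inner_smul_right]
    rw [inner_add_right] at i1 i3
    linear_combination (-4) * i1 + 12 * β * i0 + 4 * i2 + 3 * i3 - 3 * i4 + 3 * (γ - β) * i5
  rw [e1]
  have bnd : ∀ {P : ℝ} {ℓ : Ltwo} (_ : ‖ℓ‖ ≤ P) (z : Ltwo), ‖(inner ℂ ℓ z : ℂ)‖ ≤ P * ‖z‖ :=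
    fun hP z => (norm_inner_le_norm _ _).trans (mul_le_mul_of_nonneg_right hP (norm_nonneg _))
  have q₀ := p₀ _ hk
  have q₁ := p₁ _ hk
  have q₂ := p₂ _ hk
  have hXV : ‖X‖ ≤ C₂ * ‖V‖ := h₂ (𝐓 + b) β γ hβB hγB (fun x => by simp [polyFun, hb]) V
  have hBa : B ≤ |B| := le_abs_self B
  have r1 : ‖3 * β‖ ≤ 3 * |B| := by rw [norm_mul, Complex.norm_ofNat]; linarith
  have r2 : ‖3 * β ^ 2 - 1‖ ≤ 3 * |B| ^ 2 + 1 := by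
    refine (norm_sub_le _ _).trans ?_
    rw [norm_mul, Complex.norm_ofNat, norm_pow, norm_one]
    have := pow_le_pow_left₀ (norm_nonneg β) (hβB.trans hBa) 2
    linarith
  have r3 : ‖γ - β‖ ≤ 2 * |B| := (norm_sub_le _ _).trans (by linarith)
  have t1 : ‖-4 * (inner ℂ ℓ₂ F + 3 * β * inner ℂ ℓ₁ F + (3 * β ^ 2 - 1) * inner ℂ ℓ₀ F)‖ ≤
      4 * (P₂ * ‖F‖ + 3 * |B| * (P₁ * ‖F‖) + (3 * |B| ^ 2 + 1) * (P₀ * ‖F‖)) := by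
    rw [norm_mul, norm_neg, Complex.norm_ofNat]
    gcongr
    refine (norm_add_le _ _).trans (add_le_add ((norm_add_le _ _).trans (add_le_add
      (bnd q₂ F) ?_)) ?_)
    · rw [norm_mul]; exact mul_le_mul r1 (bnd q₁ F) (norm_nonneg _) (by positivity)
    · rw [norm_mul]; exact mul_le_mul r2 (bnd q₀ F) (norm_nonneg _) (by positivity)
  have t2 : ‖3 * (inner ℂ ℓ₂ V + inner ℂ ℓ₁ X - (γ - β) * (inner ℂ ℓ₁ V + inner ℂ ℓ₀ X))‖ ≤
      3 * (P₂ * ‖V‖ + P₁ * (C₂ * ‖V‖) + 2 * |B| * (P₁ * ‖V‖ + P₀ * (C₂ * ‖V‖))) := by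
    have s1 : ‖(inner ℂ ℓ₁ X : ℂ)‖ ≤ P₁ * (C₂ * ‖V‖) :=
      (bnd q₁ X).trans (mul_le_mul_of_nonneg_left hXV hP₁)
    have s0 : ‖(inner ℂ ℓ₀ X : ℂ)‖ ≤ P₀ * (C₂ * ‖V‖) :=
      (bnd q₀ X).trans (mul_le_mul_of_nonneg_left hXV hP₀)
    rw [norm_mul, Complex.norm_ofNat]
    gcongr
    refine (norm_sub_le _ _).trans (add_le_add ((norm_add_le _ _).trans
      (add_le_add (bnd q₂ V) s1)) ?_)
    rw [norm_mul]
    exact mul_le_mul r3 ((norm_add_le _ _).trans (add_le_add (bnd q₁ V) s0)) (norm_nonneg _)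
      (by positivity)
  refine (norm_add_le _ _).trans ((add_le_add t1 t2).trans ?_)
  have hF0 := norm_nonneg F
  have hV0 := norm_nonneg V
  have u1 : 0 ≤ 4 * (P₂ + 3 * |B| * P₁ + (3 * |B| ^ 2 + 1) * P₀) * ‖V‖ := by positivity
  have u2 : 0 ≤ 3 * (P₂ + P₁ * C₂ + 2 * |B| * (P₁ + P₀ * C₂)) * ‖F‖ := by positivity
  linarith

end KPII

namespace KPII

/-! ### Decay of the semigroups at fixed transverse frequency -/

section Lyapunov
variable {E : Type*} [NormedAddCommGroup E] [InnerProductSpace ℂ E] [CompleteSpace E]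

/-- Decay of an operator along the semigroup. -/
theorem IsSemigroupOf.norm_map_le {G : Submodule ℂ (E × E)} {ω : ℝ} {S : ℝ → E →L[ℂ] E}
    (hS : IsSemigroupOf G ω S) (hD : Dense (Prod.fst '' (G : Set (E × E)))) (Γ : E →L[ℂ] E) {b : ℝ}
    (h : ∀ u w, (u, w) ∈ G → (inner ℂ (Γ u) (Γ w)).re ≤ -b * ‖Γ u‖ ^ 2) {t : ℝ} (ht : 0 ≤ t)
    (x : E) : ‖Γ (S t x)‖ ≤ Real.exp (-b * t) * ‖Γ x‖ := by
  have hP : IsSelfAdjoint (Γ.adjoint ∘L Γ) :=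
    (ContinuousLinearMap.isPositive_adjoint_comp_self Γ).isSelfAdjoint
  have e : ∀ y z, inner ℂ ((Γ.adjoint ∘L Γ) y) z = inner ℂ (Γ y) (Γ z) := fun y z =>
    ContinuousLinearMap.adjoint_inner_left Γ z (Γ y)
  have e2 : ∀ y, (inner ℂ (Γ y) (Γ y)).re = ‖Γ y‖ ^ 2 := fun y => inner_self_eq_norm_sq (𝕜 := ℂ) _
  have h1 := hS.quadratic_decay hP (b := b) (fun u w huw => by
    rw [e, e, e2]; exact h u w huw) hD ht x
  rw [e, e, e2, e2] at h1
  have h2 : ‖Γ (S t x)‖ ^ 2 ≤ (Real.exp (-b * t) * ‖Γ x‖) ^ 2 := by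
    refine h1.trans (le_of_eq ?_)
    rw [mul_pow, ← Real.exp_nat_mul]
    congr 2; push_cast; ring
  exact le_of_sq_le_sq h2 (by positivity)

/-- The weighted energy built from three operators. -/
def energyOp (K₁ K₂ : ℝ) (N₁ N₂ : E →L[ℂ] ℂ) (Γ : E →L[ℂ] E) : E →L[ℂ] E :=
  1 + (K₁ : ℂ) • (N₁.adjoint ∘L N₁) + (K₁ : ℂ) • (N₂.adjoint ∘L N₂) + (K₂ : ℂ) • (Γ.adjoint ∘L Γ)

theorem isSelfAdjoint_smul_adjoint_comp {F : Type*} [NormedAddCommGroup F] [InnerProductSpace ℂ F]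
    [CompleteSpace F] (r : ℝ) (A : E →L[ℂ] F) : IsSelfAdjoint ((r : ℂ) • (A.adjoint ∘L A)) :=
  IsSelfAdjoint.smul (by rw [isSelfAdjoint_iff]; exact Complex.conj_ofReal r)
    (ContinuousLinearMap.isPositive_adjoint_comp_self A).isSelfAdjoint

theorem isSelfAdjoint_energyOp (K₁ K₂ : ℝ) (N₁ N₂ : E →L[ℂ] ℂ) (Γ : E →L[ℂ] E) :
    IsSelfAdjoint (energyOp K₁ K₂ N₁ N₂ Γ) :=
  (((IsSelfAdjoint.one _).add (isSelfAdjoint_smul_adjoint_comp K₁ N₁)).add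
    (isSelfAdjoint_smul_adjoint_comp K₁ N₂)).add (isSelfAdjoint_smul_adjoint_comp K₂ Γ)

theorem re_inner_energyOp (K₁ K₂ : ℝ) (N₁ N₂ : E →L[ℂ] ℂ) (Γ : E →L[ℂ] E) (u w : E) :
    (inner ℂ (energyOp K₁ K₂ N₁ N₂ Γ u) w).re = (inner ℂ u w).re +
      K₁ * (inner ℂ (N₁ u) (N₁ w)).re + K₁ * (inner ℂ (N₂ u) (N₂ w)).re +
      K₂ * (inner ℂ (Γ u) (Γ w)).re := by
  have e : energyOp K₁ K₂ N₁ N₂ Γ u = u + (K₁ : ℂ) • N₁.adjoint (N₁ u) +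
      (K₁ : ℂ) • N₂.adjoint (N₂ u) + (K₂ : ℂ) • Γ.adjoint (Γ u) := rfl
  rw [e]
  simp only [inner_add_left, inner_smul_left, Complex.conj_ofReal, Complex.add_re,
    Complex.re_ofReal_mul, ContinuousLinearMap.adjoint_inner_left]

theorem re_inner_energyOp_self (K₁ K₂ : ℝ) (N₁ N₂ : E →L[ℂ] ℂ) (Γ : E →L[ℂ] E) (u : E) :
    (inner ℂ (energyOp K₁ K₂ N₁ N₂ Γ u) u).re = ‖u‖ ^ 2 + K₁ * ‖N₁ u‖ ^ 2 + K₁ * ‖N₂ u‖ ^ 2 +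
      K₂ * ‖Γ u‖ ^ 2 := by
  have n1 : ∀ y : E, (inner ℂ y y : ℂ).re = ‖y‖ ^ 2 := fun y => inner_self_eq_norm_sq (𝕜 := ℂ) y
  have n2 : ∀ y : ℂ, (inner ℂ y y : ℂ).re = ‖y‖ ^ 2 := fun y => inner_self_eq_norm_sq (𝕜 := ℂ) y
  rw [re_inner_energyOp, n1, n1, n2, n2]

omit [CompleteSpace E] in
-- Young's inequality: half of the decay rate δ pays for the error in the eigenvalue equation.
theorem re_inner_le_of_approx_eigen {δ C v : ℝ} (hδ : 0 < δ) {l N M : ℂ} (hl : l.re ≤ -δ)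
    (h : ‖M - l * N‖ ≤ C * v) :
    (inner ℂ N M).re ≤ -(δ / 2) * ‖N‖ ^ 2 + C ^ 2 / (2 * δ) * v ^ 2 := by
  have e1 : (inner ℂ N M : ℂ) = l * inner ℂ N N + inner ℂ N (M - l * N) := by
    rw [inner_sub_right, ← smul_eq_mul l N, inner_smul_right]; ring
  have e2 : (inner ℂ N N : ℂ) = ((‖N‖ ^ 2 : ℝ) : ℂ) := by
    rw [inner_self_eq_norm_sq_to_K]; push_cast; rfl
  have e3 : (inner ℂ N (M - l * N) : ℂ).re ≤ ‖N‖ * (C * v) :=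
    (Complex.re_le_norm _).trans ((norm_inner_le_norm _ _).trans
      (mul_le_mul_of_nonneg_left h (norm_nonneg _)))
  rw [e1, e2, Complex.add_re, Complex.re_mul_ofReal]
  have e4 : l.re * ‖N‖ ^ 2 ≤ -δ * ‖N‖ ^ 2 := by gcongr
  have e5 : ‖N‖ * (C * v) ≤ δ / 2 * ‖N‖ ^ 2 + C ^ 2 / (2 * δ) * v ^ 2 := by
    have : 0 ≤ (δ * ‖N‖ - C * v) ^ 2 / (2 * δ) := by positivity
    have e6 : (δ * ‖N‖ - C * v) ^ 2 / (2 * δ) = δ / 2 * ‖N‖ ^ 2 +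
      C ^ 2 / (2 * δ) * v ^ 2 - ‖N‖ * (C * v) := by field_simp; ring
    linarith
  linarith

/-- A Lyapunov function built from two approximate eigenfunctionals and an intertwining operator. -/
theorem exists_lyapunov_decay {c D δ C B : ℝ} (hc : 0 < c) (hD : 0 ≤ D) (hδ : 0 < δ) :
    ∃ K b : ℝ, 0 < K ∧ 0 < b ∧ ∀ (G : Submodule ℂ (E × E)) (ω : ℝ)
      (S : ℝ → E →L[ℂ] E) (N₁ N₂ : E →L[ℂ] ℂ) (Γ : E →L[ℂ] E) (l₁ l₂ : ℂ), IsSemigroupOf G ω S →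
      Dense (Prod.fst '' (G : Set (E × E))) → l₁.re ≤ -δ → l₂.re ≤ -δ →
      (∀ u, ‖N₁ u‖ ≤ B * ‖u‖) → (∀ u, ‖N₂ u‖ ≤ B * ‖u‖) → (∀ u, ‖Γ u‖ ≤ B * ‖u‖) →
      (∀ u w, (u, w) ∈ G → (inner ℂ u w).re ≤
        -c * ‖u‖ ^ 2 + D * (‖Γ u‖ ^ 2 + ‖N₁ u‖ ^ 2 + ‖N₂ u‖ ^ 2)) →
      (∀ u w, (u, w) ∈ G → ‖N₁ w - l₁ * N₁ u‖ ≤ C * ‖Γ u‖) →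
      (∀ u w, (u, w) ∈ G → ‖N₂ w - l₂ * N₂ u‖ ≤ C * ‖Γ u‖) →
      (∀ u w, (u, w) ∈ G → (inner ℂ (Γ u) (Γ w)).re ≤ -c * ‖Γ u‖ ^ 2) →
      ∀ t : ℝ, 0 ≤ t → ∀ x, ‖S t x‖ ≤ K * Real.exp (-b * t) * ‖x‖ := by
  -- K₁ is taken so large that the decay of the functionals beats the D|Nᵢu|² of the energy
  -- inequality with one to spare; K₂ below does the same for Γ, including the errors K₁m fed back
  -- by the functionals.
  obtain ⟨K₁, g1⟩ : ∃ K₁ : ℝ, K₁ = 2 / δ * (D + 1) := ⟨_, rfl⟩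
  have hK₁0 : 0 < K₁ := by rw [g1]; positivity
  replace g1 : K₁ * (δ / 2) = D + 1 := by rw [g1]; field_simp
  obtain ⟨m, hm⟩ : ∃ m : ℝ, m = C ^ 2 / (2 * δ) := ⟨_, rfl⟩
  have hm0 : 0 ≤ m := by rw [hm]; positivity
  obtain ⟨K₂, g2⟩ : ∃ K₂ : ℝ, K₂ = (D + 2 * (K₁ * m) + 1) / c := ⟨_, rfl⟩
  have hK₂0 : 0 < K₂ := by rw [g2]; positivity
  replace g2 : K₂ * c = D + 2 * (K₁ * m) + 1 := by rw [g2]; field_simp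
  -- The rate uses up at most the spare unit in each term: bK₁ ≤ 1 and bK₂ ≤ 1.
  obtain ⟨b, hb⟩ : ∃ b : ℝ, b = min c (min (1 / K₁) (1 / K₂)) := ⟨_, rfl⟩
  have hb0 : 0 < b := by rw [hb]; positivity
  have hbc : b ≤ c := by rw [hb]; exact min_le_left _ _
  have b2 : b * K₁ ≤ 1 := by
    rw [← le_div_iff₀ hK₁0, hb]; exact (min_le_right _ _).trans (min_le_left _ _)
  have b3 : b * K₂ ≤ 1 := by
    rw [← le_div_iff₀ hK₂0, hb]; exact (min_le_right _ _).trans (min_le_right _ _)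
  clear hb
  refine ⟨1 + 2 * K₁ * B ^ 2 + K₂ * B ^ 2, b, by positivity, hb0, ?_⟩
  intro G ω S N₁ N₂ Γ l₁ l₂ hS hdense hl₁ hl₂ hB₁ hB₂ hBΓ h0 hN₁ hN₂ hΓ t ht x
  have hdec := hS.quadratic_decay (isSelfAdjoint_energyOp K₁ K₂ N₁ N₂ Γ) (b := b)
    (fun u w huw => by
    rw [re_inner_energyOp, re_inner_energyOp_self]
    have f1 := h0 u w huw
    have f2 := mul_le_mul_of_nonneg_left
      (re_inner_le_of_approx_eigen hδ hl₁ (hN₁ u w huw)) hK₁0.le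
    have f3 := mul_le_mul_of_nonneg_left
      (re_inner_le_of_approx_eigen hδ hl₂ (hN₂ u w huw)) hK₁0.le
    have f4 := mul_le_mul_of_nonneg_left (hΓ u w huw) hK₂0.le
    rw [← hm] at f2 f3
    have b1 : b * ‖u‖ ^ 2 ≤ c * ‖u‖ ^ 2 := by gcongr
    have b4 := mul_le_mul_of_nonneg_right b2 (sq_nonneg ‖N₁ u‖)
    have b5 := mul_le_mul_of_nonneg_right b2 (sq_nonneg ‖N₂ u‖)
    have b6 := mul_le_mul_of_nonneg_right b3 (sq_nonneg ‖Γ u‖)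
    have f2' : K₁ * (inner ℂ (N₁ u) (N₁ w)).re ≤ -(D + 1) * ‖N₁ u‖ ^ 2 +
        K₁ * m * ‖Γ u‖ ^ 2 := by rw [← g1]; linarith
    have f3' : K₁ * (inner ℂ (N₂ u) (N₂ w)).re ≤ -(D + 1) * ‖N₂ u‖ ^ 2 +
        K₁ * m * ‖Γ u‖ ^ 2 := by rw [← g1]; linarith
    have f4' : K₂ * (inner ℂ (Γ u) (Γ w)).re ≤ -(D + 2 * (K₁ * m) + 1) * ‖Γ u‖ ^ 2 := by
      rw [← g2]; linarith
    linarith) hdense ht x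
  rw [re_inner_energyOp_self, re_inner_energyOp_self] at hdec
  have k1 : ‖S t x‖ ^ 2 ≤ Real.exp (-(2 * b) * t) * (‖x‖ ^ 2 + K₁ * ‖N₁ x‖ ^ 2 + K₁ * ‖N₂ x‖ ^ 2 +
      K₂ * ‖Γ x‖ ^ 2) := by
    refine le_trans ?_ hdec
    have : 0 ≤ K₁ * ‖N₁ (S t x)‖ ^ 2 + K₁ * ‖N₂ (S t x)‖ ^ 2 + K₂ * ‖Γ (S t x)‖ ^ 2 := by positivity
    linarith
  have s1 := pow_le_pow_left₀ (norm_nonneg _) (hB₁ x) 2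
  have s2 := pow_le_pow_left₀ (norm_nonneg _) (hB₂ x) 2
  have s3 := pow_le_pow_left₀ (norm_nonneg _) (hBΓ x) 2
  obtain ⟨K, hK⟩ : ∃ K : ℝ, K = 1 + 2 * K₁ * B ^ 2 + K₂ * B ^ 2 := ⟨_, rfl⟩
  rw [← hK]
  have hK1 : 1 ≤ K := by
    have : 0 ≤ 2 * K₁ * B ^ 2 + K₂ * B ^ 2 := by positivity
    linarith
  have k2 : ‖x‖ ^ 2 + K₁ * ‖N₁ x‖ ^ 2 + K₁ * ‖N₂ x‖ ^ 2 + K₂ * ‖Γ x‖ ^ 2 ≤ K ^ 2 * ‖x‖ ^ 2 := by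
    have : K * ‖x‖ ^ 2 ≤ K ^ 2 * ‖x‖ ^ 2 := by
      refine mul_le_mul_of_nonneg_right ?_ (sq_nonneg _)
      nlinarith
    refine le_trans ?_ this
    rw [mul_pow] at s1 s2 s3
    have t1 := mul_le_mul_of_nonneg_left s1 hK₁0.le
    have t2 := mul_le_mul_of_nonneg_left s2 hK₁0.le
    have t3 := mul_le_mul_of_nonneg_left s3 hK₂0.le
    rw [hK]
    linarith
  have k3 : ‖S t x‖ ^ 2 ≤ (K * Real.exp (-b * t) * ‖x‖) ^ 2 := by
    refine (k1.trans (mul_le_mul_of_nonneg_left k2 (Real.exp_nonneg _))).trans (le_of_eq ?_)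
    rw [mul_pow, mul_pow, ← Real.exp_nat_mul]
    rw [show ((2 : ℕ) : ℝ) * (-b * t) = -(2 * b) * t by push_cast; ring]
    ring
  exact le_of_sq_le_sq k3 (by positivity)

end Lyapunov

variable {a : ℝ}

/-- By the intertwining relation this is the energy inequality of the free operator at V = Γu. -/
theorem re_inner_miura_le (ha : 0 < a) {η : ℝ} {u w : Ltwo} (h : (u, w) ∈ fibreGraph a η) :
    (inner ℂ (miura a η u) (miura a η w)).re ≤ -(a * (4 - a ^ 2)) * ‖miura a η u‖ ^ 2 := by
  obtain ⟨g₀, rfl, rfl⟩ := mem_fibreGraph.1 h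
  have h := isTower a g₀
  obtain ⟨d0, e⟩ := h.miura_genMap ha (η := η) rfl rfl
  have key : ∀ v₁ v V₁ V : Ltwo, IsD a v v₁ → IsD a V₁ v → IsD a V V₁ →
      (inner ℂ V (-v₁ + (4 : Polynomial ℂ) • resD a v +
        (3 * ceta η ^ 2) • resD a (resD a (resD a v)))).re ≤ -(a * (4 - a ^ 2)) * ‖V‖ ^ 2 := by
    intro v₁ v V₁ V h1 h2 h3
    rw [show resD a v = V₁ from h2, show resD a V₁ = V from h3]
    exact IsTower.re_inner_cubic_le ha ⟨h1, h2, h3, IsD.resD a V, rfl⟩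
  rw [e]
  exact key _ _ _ _ d0 (h.isD_miura₂ ha) (h.isD_miura₁ ha)

/-- The growth of the Miura transform is bounded. -/
theorem norm_miura_le (ha : 0 < a) (η : ℝ) (u : Ltwo) :
    ‖miura a η u‖ ≤ (1 + 4 / a + 4 / a ^ 2 + η ^ 2 / a ^ 4) * ‖u‖ := by
  have J : ∀ z, ‖resD a z‖ ≤ 1 / a * ‖z‖ := fun z => by
    rw [div_mul_eq_mul_div, one_mul, le_div_iff₀ ha, mul_comm]; exact norm_resD_apply_le ha z
  have hT : ∀ (n : ℕ) (z : Ltwo), ‖(𝐓 ^ n) • z‖ ≤ ‖z‖ := fun n z => by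
    have := norm_mulOp_apply_le (isBddMul_polyFun (𝐓 ^ n)) (C := 1) (fun x => by
      simp only [polyFun, Polynomial.eval_pow, Polynomial.eval_X, norm_pow, Complex.norm_real,
        Real.norm_eq_abs]
      exact pow_le_one₀ (abs_nonneg _) (abs_th_le_one x)) z
    rwa [one_mul] at this
  have e4 : ∀ z : Ltwo, (4 : Polynomial ℂ) • z = ((4 : ℝ) : ℂ) • z := fun z => by
    rw [csmul_eq, show ((4 : ℝ) : ℂ) = 4 by norm_num, map_ofNat]
  have eη : ∀ z : Ltwo, (ceta η ^ 2) • z = ((η ^ 2 : ℝ) : ℂ) • z := fun z => by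
    rw [csmul_eq, Complex.ofReal_pow, map_pow]
  have hpos : 0 ≤ 1 / a := by positivity
  have J2 : ∀ z, ‖resD a (resD a z)‖ ≤ 1 / a * (1 / a * ‖z‖) := fun z =>
    (J _).trans (mul_le_mul_of_nonneg_left (J z) hpos)
  rw [miura_apply, e4, e4, eη]
  have n1 : ‖((4 : ℝ) : ℂ) • resD a (𝐓 • u)‖ ≤ 4 / a * ‖u‖ := by
    rw [norm_smul, Complex.norm_real, Real.norm_of_nonneg (by norm_num)]
    have h1 := hT 1 u
    rw [pow_one] at h1
    calc _ ≤ 4 * (1 / a * ‖u‖) := mul_le_mul_of_nonneg_left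
          ((J _).trans (mul_le_mul_of_nonneg_left h1 hpos)) (by norm_num)
      _ = _ := by ring
  have n2 : ‖((4 : ℝ) : ℂ) • resD a (resD a (𝐓 ^ 2 • u))‖ ≤ 4 / a ^ 2 * ‖u‖ := by
    rw [norm_smul, Complex.norm_real, Real.norm_of_nonneg (by norm_num)]
    calc _ ≤ 4 * (1 / a * (1 / a * ‖u‖)) := mul_le_mul_of_nonneg_left ((J2 _).trans
          (mul_le_mul_of_nonneg_left (mul_le_mul_of_nonneg_left (hT 2 u) hpos) hpos)) (by norm_num)
      _ = _ := by field_simp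
  have n3 : ‖((η ^ 2 : ℝ) : ℂ) • resD a (resD a (resD a (resD a u)))‖ ≤ η ^ 2 / a ^ 4 * ‖u‖ := by
    rw [norm_smul, Complex.norm_real, Real.norm_of_nonneg (by positivity)]
    calc _ ≤ η ^ 2 * (1 / a * (1 / a * (1 / a * (1 / a * ‖u‖)))) :=
          mul_le_mul_of_nonneg_left ((J2 _).trans (mul_le_mul_of_nonneg_left
            (mul_le_mul_of_nonneg_left (J2 u) hpos) hpos)) (by positivity)
      _ = _ := by field_simp
  refine (norm_add_le _ _).trans ?_
  have m1 := norm_add_le (u + ((4 : ℝ) : ℂ) • resD a (𝐓 • u))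
    (((4 : ℝ) : ℂ) • resD a (resD a (𝐓 ^ 2 • u)))
  have m2 := norm_add_le u (((4 : ℝ) : ℂ) • resD a (𝐓 • u))
  linarith

end KPII

namespace KPII

/-! ### Uniform decay away from the zero transverse frequency -/

variable {a : ℝ}

/-- The semigroup generated by the linearized operator at transverse frequency `η`. -/
def fibreSemigroup (ha : 0 < a) (ha2 : a < 2) (η t : ℝ) : Ltwo →L[ℂ] Ltwo :=
  (isQuasiDissipative_fibreGraph ha ha2 η).semigroup t

theorem isSemigroupOf_fibre (ha : 0 < a) (ha2 : a < 2) (η : ℝ) :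
    IsSemigroupOf (fibreGraph a η) (growth a) (fibreSemigroup ha ha2 η) :=
  (isQuasiDissipative_fibreGraph ha ha2 η).isSemigroupOf

theorem dense_fibreGraph (ha : 0 < a) (ha2 : a < 2) (η : ℝ) :
    Dense (Prod.fst '' (fibreGraph a η : Set (Ltwo × Ltwo))) :=
  (isQuasiDissipative_fibreGraph ha ha2 η).dense

theorem exists_decay_of_large (ha : 0 < a) (ha2 : a < 2) : ∃ M : ℝ, 0 < M ∧ ∀ η : ℝ, M ≤ |η| →
    ∀ t : ℝ, 0 ≤ t → ∀ x, ‖fibreSemigroup ha ha2 η t x‖ ≤ Real.exp (-1 * t) * ‖x‖ := by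
  refine ⟨(4 * a ^ 3 + 8 * a + 12 + 1) / (2 * a), by positivity, fun η hη t ht x => ?_⟩
  rw [div_le_iff₀ (by positivity)] at hη
  exact (isSemigroupOf_fibre ha ha2 η).norm_map_le (dense_fibreGraph ha ha2 η) 1 (b := 1)
    (fun u w h => re_inner_fibreGraph_le_of_large ha (by linarith) h) ht x

/-- `yOf` as a bounded operator. -/
def yOp (a : ℝ) (γ : ℂ) : Ltwo →L[ℂ] Ltwo :=
  resD a + polyOp (𝐓 + Polynomial.C γ) * (resD a) ^ 2

theorem exists_norm_yOf_le (ha : 0 < a) (B : ℝ) : ∃ C, 0 ≤ C ∧ ∀ γ : ℂ, ‖γ‖ ≤ B → ∀ u,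
    ‖yOf a γ u‖ ≤ C * ‖u‖ := by
  obtain ⟨C, hC, h⟩ := exists_psmul_bound (fun t b c => t + b) (by fun_prop) B
  refine ⟨1 / a + C * (1 / a * (1 / a)), by positivity, fun γ hγ u => ?_⟩
  have J : ∀ z, ‖resD a z‖ ≤ 1 / a * ‖z‖ := fun z => by
    rw [div_mul_eq_mul_div, one_mul, le_div_iff₀ ha, mul_comm]; exact norm_resD_apply_le ha z
  have h1 := h (𝐓 + Polynomial.C γ) γ γ hγ hγ (fun x => by simp [polyFun]) (resD a (resD a u))
  have h2 : ‖resD a (resD a u)‖ ≤ 1 / a * (1 / a * ‖u‖) :=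
    (J _).trans (mul_le_mul_of_nonneg_left (J u) (by positivity))
  have h3 := mul_le_mul_of_nonneg_left h2 hC
  refine (norm_add_le _ _).trans ?_
  have := J u
  linarith

/-- Half of the free dissipation a(4 − a²) absorbs the tails of the potential; what remains of the
potential is as localized as desired. -/
theorem exists_re_inner_fibreGraph_le (ha : 0 < a) (ha2 : a < 2) (n : ℕ) : ∃ C, 0 ≤ C ∧
    ∀ (η : ℝ) (u w : Ltwo), (u, w) ∈ fibreGraph a η → (inner ℂ u w).re ≤
      -(a * (4 - a ^ 2) / 2) * ‖u‖ ^ 2 + C * ‖mulOp (sechPow n) u‖ ^ 2 := by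
  have hpos : 0 < a * (4 - a ^ 2) := mul_pos ha (by nlinarith)
  obtain ⟨C, hC, h⟩ := exists_pow_bound (ε := a * (4 - a ^ 2) / 2) (K := 12 * a + 12)
    (by positivity) (by positivity) n
  refine ⟨C, hC, fun η u w huw => ?_⟩
  obtain ⟨g₀, rfl, rfl⟩ := mem_fibreGraph.1 huw
  have ht := isTower a g₀
  have e1 := ht.re_inner_genMap (η := η) ha
  have e2 := ht.re_inner_cubic_le (η := η) ha
  rw [ht.re_inner_cubic ha] at e2
  have e3 := re_inner_psmul_le_sechPow (p := energyPot a) (ε := a * (4 - a ^ 2) / 2) (C := C)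
    (n := n) (fun x => by
      rw [polyFun_energyPot, Complex.ofReal_re]
      have hs0 : 0 ≤ 1 - th x ^ 2 := by
        have := abs_th_le_one x
        rw [← sq_abs]; nlinarith [abs_nonneg (th x)]
      have h1 := h (1 - th x ^ 2) hs0 (by linarith [sq_nonneg (th x)])
      have h2 := mul_le_mul_of_nonneg_right (abs_le.1 (abs_th_le_one x)).2 hs0
      nlinarith) (resD a (resD a (resD a g₀)))
  linarith

theorem sq_add_three_le (x y z : ℝ) : (x + (y + z)) ^ 2 ≤ 3 * (x ^ 2 + y ^ 2 + z ^ 2) := by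
  nlinarith [sq_nonneg (x - y), sq_nonneg (y - z), sq_nonneg (x - z)]

/-- On this range β(η) and β(−η) stay at distance at least 2|Im β(η₁)|, and Re λ(η) ≤ Re λ(η₁) < 0.
The functionals are local, so nothing changes where ν(η) = a and the modes leave the space. -/
theorem exists_decay_of_middle (ha : 0 < a) (ha2 : a < 2) {η₁ : ℝ} (hη₁ : 0 < η₁) (M : ℝ) :
    ∃ K b : ℝ, 0 < K ∧ 0 < b ∧ ∀ η : ℝ, η₁ ≤ |η| → |η| ≤ M → ∀ t : ℝ, 0 ≤ t → ∀ x,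
      ‖fibreSemigroup ha ha2 η t x‖ ≤ K * Real.exp (-b * t) * ‖x‖ := by
  obtain ⟨ϱ, hϱ⟩ := exists_isMollifier
  obtain ⟨k, hk⟩ : ∃ k : ℝ, k = a + (1 + |M|) + 1 := ⟨_, rfl⟩
  obtain ⟨n, hn⟩ := exists_nat_ge (2 * k + 2)
  have him : 0 < |(beta η₁).im| := abs_pos.2 (beta_im_ne_zero hη₁.ne')
  obtain ⟨C₁, hC₁, h₁⟩ := exists_sechPow_le hϱ ha (δ := 2 * |(beta η₁).im|) (k := k)
    (by positivity) (1 + |M|) hn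
  obtain ⟨C₂, hC₂, h₂⟩ := exists_norm_facOf_le ha (1 + |M|)
  obtain ⟨C₃, hC₃, h₃⟩ := exists_probe_genMap_le hϱ ha k (1 + |M|)
  obtain ⟨C₄, hC₄, h₄⟩ := exists_re_inner_fibreGraph_le ha ha2 n
  obtain ⟨C₅, hC₅, h₅⟩ := exists_norm_yOf_le ha (1 + |M|)
  obtain ⟨C₆, hC₆, h₆⟩ := hϱ.exists_norm_probe_le k
  have hpos : 0 < a * (4 - a ^ 2) / 2 := half_pos (mul_pos ha (by nlinarith))
  obtain ⟨K, b, hK, hb, main⟩ := exists_lyapunov_decay (E := Ltwo)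
    (c := a * (4 - a ^ 2) / 2) (D := C₄ * (C₁ ^ 2 * (3 * (C₂ ^ 2 + 1)))) (δ := -(lam η₁).re)
    (C := C₃ * (C₂ + 1)) (B := C₆ * C₅ + (1 + 4 / a + 4 / a ^ 2 + M ^ 2 / a ^ 4)) hpos
    (by positivity) (neg_pos.2 (lam_re_neg hη₁.ne'))
  refine ⟨K, b, hK, hb, fun η hη hηM t ht x => ?_⟩
  have hMM : |η| ≤ |M| := hηM.trans (le_abs_self M)
  have bb : ∀ s : ℝ, |s| = |η| → ‖beta s‖ ≤ 1 + |M| := fun s hs =>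
    (norm_beta_le s).trans (by rw [hs]; linarith)
  have bk : ∀ s : ℝ, |s| = |η| → |((a : ℂ) - beta s).re| + 1 ≤ k := fun s hs => by
    rw [Complex.sub_re, Complex.ofReal_re, hk]
    have h1 := (Complex.abs_re_le_norm _).trans (bb s hs)
    have h2 := abs_sub a (beta s).re
    rw [abs_of_pos ha] at h2
    linarith
  have hgap : ∀ s : ℝ, |s| = |η| → 2 * |(beta η₁).im| ≤ ‖beta (-s) - beta s‖ := fun s hs => by
    have h1 : |(beta η₁).im| ≤ |(beta s).im| :=
      abs_beta_im_mono (by rw [hs, abs_of_pos hη₁]; exact hη)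
    have h2 := Complex.abs_im_le_norm (beta (-s) - beta s)
    rw [Complex.sub_im, beta_neg, Complex.conj_im,
      show -(beta s).im - (beta s).im = -(2 * (beta s).im) by ring, abs_neg, abs_mul, abs_two] at h2
    rw [beta_neg]
    linarith
  have hlr : ∀ s : ℝ, |s| = |η| → (lam s).re ≤ -(-(lam η₁).re) := fun s hs => by
    rw [neg_neg]; exact lam_re_anti (by rw [hs, abs_of_pos hη₁]; exact hη)
  have hne : |(-η)| = |η| := abs_neg η
  -- The two functionals are s = η and s = −η: exchanging the sign of the frequency exchanges β and
  -- γ, while the fibre depends only on η².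
  set N : ℝ → Ltwo →L[ℂ] ℂ := fun s => (innerSL ℂ (hϱ.probe (a - beta s))) ∘L yOp a (beta (-s))
    with hN
  have Nap : ∀ s u, N s u = inner ℂ (hϱ.probe (a - beta s)) (yOf a (beta (-s)) u) :=
    fun s u => rfl
  have hΓ0 : 0 ≤ 1 + 4 / a + 4 / a ^ 2 + M ^ 2 / a ^ 4 := by positivity
  have Nb : ∀ s : ℝ, |s| = |η| → ∀ u, ‖N s u‖ ≤
      (C₆ * C₅ + (1 + 4 / a + 4 / a ^ 2 + M ^ 2 / a ^ 4)) * ‖u‖ := fun s hs u => by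
    rw [Nap]
    refine (norm_inner_le_norm _ _).trans ?_
    have h1 := h₆ _ (bk s hs)
    have h2 := h₅ _ (bb (-s) (by rw [abs_neg, hs])) u
    calc _ ≤ C₆ * (C₅ * ‖u‖) := mul_le_mul h1 h2 (norm_nonneg _) hC₆
      _ ≤ _ := by
        have := mul_nonneg hΓ0 (norm_nonneg u)
        linarith
  have Fb : ∀ s : ℝ, |s| = |η| → ∀ u, ‖facOf a (beta s) (beta (-s)) u‖ ≤ C₂ * ‖miura a η u‖ :=
    fun s hs u => by
      have hm : miura a s = miura a η := by
        rcases abs_eq_abs.1 hs with rfl | rfl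
        · rfl
        · ext1 z; rw [miura_apply, miura_apply, ceta, ceta]; simp
      rw [← hm]
      exact h₂ s _ _ (beta_sq s) (beta_sq (-s)) (one_le_beta_re _) (one_le_beta_re _) (bb s hs)
        (bb (-s) (by rw [abs_neg, hs])) u
  have Gs : ∀ s : ℝ, |s| = |η| → fibreGraph a s = fibreGraph a η := fun s hs => by
    rcases abs_eq_abs.1 hs with rfl | rfl
    · rfl
    · have : genMap a (-η) = genMap a η := by
        ext1 z; rw [genMap_apply, genMap_apply, ceta, ceta]; simp
      rw [fibreGraph, this, fibreGraph]
  have Ne : ∀ s : ℝ, |s| = |η| → ∀ u w, (u, w) ∈ fibreGraph a η →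
      ‖N s w - lam s * N s u‖ ≤ C₃ * (C₂ + 1) * ‖miura a η u‖ := fun s hs u w huw => by
    have hm : miura a s = miura a η := by
      rcases abs_eq_abs.1 hs with rfl | rfl
      · rfl
      · ext1 z; rw [miura_apply, miura_apply, ceta, ceta]; simp
    rw [Nap, Nap]
    refine (h₃ s (beta s) (beta (-s)) (lam s) (lam_eq s) (bk s hs) (bb s hs)
      (bb (-s) (by rw [abs_neg, hs])) u w (by rw [Gs s hs]; exact huw)).trans ?_
    rw [mul_assoc, hm]
    refine mul_le_mul_of_nonneg_left ?_ hC₃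
    have := Fb s hs u
    linarith
  refine main (fibreGraph a η) _ (fibreSemigroup ha ha2 η) (N η) (N (-η)) (miura a η) (lam η)
    (lam (-η)) (isSemigroupOf_fibre ha ha2 η) (dense_fibreGraph ha ha2 η) (hlr η rfl)
    (hlr (-η) hne) (Nb η rfl) (Nb (-η) hne) (fun u => ?_) (fun u w huw => ?_) (Ne η rfl)
    (Ne (-η) hne) (fun u w huw => ?_) t ht x
  · refine (norm_miura_le ha η u).trans (mul_le_mul_of_nonneg_right ?_ (norm_nonneg u))
    have h1 : η ^ 2 ≤ M ^ 2 := sq_le_sq.2 hMM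
    have h2 : η ^ 2 / a ^ 4 ≤ M ^ 2 / a ^ 4 := by gcongr
    have := mul_nonneg hC₆ hC₅
    linarith
  · refine (h₄ η u w huw).trans ?_
    have h1 := h₁ (beta η) (beta (-η)) (bk η rfl) (bk (-η) hne) (hgap η rfl) (bb η rfl)
      (bb (-η) hne) u
    have e2 : inner ℂ (hϱ.probe (a - beta (-η))) (yOf a (beta η) u) = N (-η) u := by
      rw [Nap, neg_neg]
    rw [← Nap, e2] at h1
    have h2 : ‖mulOp (sechPow n) u‖ ^ 2 ≤ C₁ ^ 2 * (3 * (C₂ ^ 2 + 1)) *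
        (‖miura a η u‖ ^ 2 + ‖N η u‖ ^ 2 + ‖N (-η) u‖ ^ 2) := by
      have h3 := pow_le_pow_left₀ (norm_nonneg _) h1 2
      have h4 := sq_add_three_le ‖facOf a (beta η) (beta (-η)) u‖ ‖N η u‖ ‖N (-η) u‖
      have h5 := pow_le_pow_left₀ (norm_nonneg _) (Fb η rfl u) 2
      rw [mul_pow] at h3 h5
      refine h3.trans ?_
      rw [mul_assoc]
      refine mul_le_mul_of_nonneg_left (h4.trans ?_) (sq_nonneg _)
      have k1 : 0 ≤ C₂ ^ 2 * (‖N η u‖ ^ 2 + ‖N (-η) u‖ ^ 2) + ‖miura a η u‖ ^ 2 := by positivity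
      linarith
    have h6 := mul_le_mul_of_nonneg_left h2 hC₄
    linarith
  · refine (re_inner_miura_le ha huw).trans ?_
    have : 0 ≤ a * (4 - a ^ 2) / 2 * ‖miura a η u‖ ^ 2 := by positivity
    linarith

end KPII

namespace KPII

/-! ### The resonant modes -/

variable {a : ℝ}

theorem pder_zero : pder 0 = 0 := by simp [pder]

theorem pder_natCast (n : ℕ) : pder (n : Polynomial ℂ) = 0 := by simp [pder]

theorem ceta_sq_of {β : ℂ} {η : ℝ} (hβ : β ^ 2 = 1 + Complex.I * η) :
    ceta η ^ 2 = -(Polynomial.C β ^ 2 - 1) ^ 2 := by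
  have h1 : (η : ℂ) ^ 2 = -(β ^ 2 - 1) ^ 2 := by
    rw [hβ]; ring_nf; rw [Complex.I_sq]; ring
  have h2 := congrArg Polynomial.C h1
  simpa using h2

/-- The modes are eigenvectors of the linearized operator. -/
theorem modeVec_mem (ha : 0 < a) {β : ℂ} {η : ℝ} (hη : β ^ 2 = 1 + Complex.I * η)
    (hβ : |((a : ℂ) - β).re| < 1) :
    (modeVec hβ, (4 * (β ^ 3 - β)) • modeVec hβ) ∈ fibreGraph a η := by
  -- q p is the coefficient of D(p(T)e^{(a−β)x} sech x). All derivatives up to D⁵ of the kernel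
  -- element are thus explicit, and the eigenvalue equation is a polynomial identity.
  set q : Polynomial ℂ → Polynomial ℂ := fun p => pder p - (𝐓 + Polynomial.C β) * p with hq
  set p₂ : Polynomial ℂ := 2 * 𝐓 ^ 2 + 2 * Polynomial.C β * 𝐓 + Polynomial.C β ^ 2 - 1 with hp₂
  have ht : IsTower a (q (q (q p₂)) • sechVec hβ) (q (q p₂) • sechVec hβ) (q p₂ • sechVec hβ)
    (modeVec hβ) (-(𝐓 + Polynomial.C β) • sechVec hβ) (sechVec hβ) :=
    ⟨isD_sechVec ha hβ _, isD_sechVec ha hβ _, isD_sechVec ha hβ _, isD_sechVec₂ ha hβ,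
      isD_sechVec₁ ha hβ⟩
  refine mem_fibreGraph.2 ⟨_, ?_, ht.genMap_eq.trans ?_⟩
  · rw [show resD a _ = _ from ht.d₁, show resD a _ = _ from ht.d₂]
    exact ht.d₃
  · rw [csmul_eq, modeVec, ← hp₂]
    simp only [smul_smul, ← neg_smul, ← add_smul, ← sub_smul]
    congr 1
    have hC : Polynomial.C (4 * (β ^ 3 - β)) = 4 * (Polynomial.C β ^ 3 - Polynomial.C β) := by
      simp only [map_mul, map_sub, map_pow, map_ofNat]
    rw [hC]
    simp only [hq, hp₂, pder_X, pder_C, pder_one, pder_zero, pder_ofNat, pder_natCast, pder_sub,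
      pder_add, pder_mul, pder_pow]
    push_cast
    linear_combination (-3 * (𝐓 + Polynomial.C β)) * ceta_sq_of hη

/-- The adjoint mode `D` applied to `e^{(γ - a)x} sech x`. -/
def adjVec {γ : ℂ} (hγ : |(γ - (a : ℂ)).re| < 1) : Ltwo := (Polynomial.C γ - 𝐓) • sechVec hγ

theorem isRealPoly_of {p : Polynomial ℂ} {f : ℝ → ℝ} (h : ∀ x, polyFun p x = f (th x)) :
    IsRealPoly p := fun x => by rw [h]; exact Complex.conj_ofReal _

theorem inner_sechVec (ha : 0 < a) {γ : ℂ} (hγ : |(γ - (a : ℂ)).re| < 1) (p : Polynomial ℂ)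
    (z : Ltwo) : inner ℂ (p • sechVec hγ) z =
      -inner ℂ ((pder p + (Polynomial.C γ - 𝐓) * p) • sechVec hγ) (resD a z) := by
  have h := resD_sechVec (r := -a) (neg_ne_zero.2 ha.ne') hγ p
  have e : γ - (a : ℂ) - ((-a : ℝ) : ℂ) = γ := by push_cast; ring
  rw [e] at h
  conv_lhs => rw [← h, inner_resD_left (neg_ne_zero.2 ha.ne'), neg_neg]

/-- The adjoint modes are eigenfunctionals of the linearized operator. -/
theorem inner_adjVec (ha : 0 < a) {γ : ℂ} {η : ℝ} (hη : γ ^ 2 = 1 - Complex.I * η)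
    (hγ : |(γ - (a : ℂ)).re| < 1) {u w : Ltwo} (h : (u, w) ∈ fibreGraph a η) :
    inner ℂ (adjVec hγ) w = (starRingEnd ℂ) (4 * (γ ^ 3 - γ)) * inner ℂ (adjVec hγ) u := by
  obtain ⟨g₀, rfl, rfl⟩ := mem_fibreGraph.1 h
  set q : Polynomial ℂ → Polynomial ℂ := fun p => pder p + (Polynomial.C γ - 𝐓) * p with hq
  have hi : ∀ p z, inner ℂ (p • sechVec hγ) z = -inner ℂ (q p • sechVec hγ) (resD a z) :=
    fun p z => inner_sechVec ha hγ p z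
  set p₁ : Polynomial ℂ := Polynomial.C γ - 𝐓 with hp₁
  have hq1 : q 1 = p₁ := by simp only [hq, hp₁, pder_one]; ring
  rw [← inner_smul_left, adjVec, ← hp₁, genMap_apply]
  have r1 : IsRealPoly 4 := isRealPoly_of (f := fun _ => 4) fun x => by simp [polyFun]
  have r2 : IsRealPoly (3 * ceta η ^ 2) := isRealPoly_of (f := fun _ => 3 * η ^ 2) fun x => by
    simp [polyFun]
  have r3 : IsRealPoly (6 * pder pot) := isRealPoly_of (f := fun t => 6 * (2 * ((1 - t ^ 2) *
      -(2 * t)))) fun x => by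
    simp only [pot, pder_X, pder_one, pder_ofNat, pder_sub, pder_mul, pder_pow]
    simp [polyFun]; ring
  have r4 : IsRealPoly (6 * pot) := isRealPoly_of (f := fun t => 6 * (2 * (1 - t ^ 2))) fun x => by
    simp [polyFun, pot]
  have e1 : inner ℂ (p₁ • sechVec hγ) g₀ =
      -inner ℂ (q (q (q p₁)) • sechVec hγ) (resD a (resD a (resD a g₀))) := by
    rw [hi, hi, hi, neg_neg]
  have e2 : inner ℂ (p₁ • sechVec hγ) ((4 : Polynomial ℂ) • resD a (resD a g₀)) =
      -inner ℂ (q (4 * p₁) • sechVec hγ) (resD a (resD a (resD a g₀))) := by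
    rw [← r1.inner, smul_smul, hi]
  -- The adjoint mode is itself a derivative, p₁ = q 1. Integration by parts read backwards removes
  -- one of the four primitives in the nonlocal term.
  have e3 : inner ℂ (p₁ • sechVec hγ)
      ((3 * ceta η ^ 2) • resD a (resD a (resD a (resD a g₀)))) =
      -inner ℂ ((3 * ceta η ^ 2) • sechVec hγ) (resD a (resD a (resD a g₀))) := by
    rw [hi (3 * ceta η ^ 2), neg_neg, ← r2.inner, smul_smul]
    congr 2
    simp only [hq, hp₁, pder_C, pder_ofNat, pder_mul, pder_pow]; ring
  have e4 : inner ℂ (p₁ • sechVec hγ) ((6 * pder pot) • resD a (resD a (resD a g₀))) =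
      inner ℂ ((6 * pder pot * p₁) • sechVec hγ) (resD a (resD a (resD a g₀))) := by
    rw [← r3.inner, smul_smul]
  have e5 : inner ℂ (p₁ • sechVec hγ) ((6 * pot) • resD a (resD a g₀)) =
      -inner ℂ (q (6 * pot * p₁) • sechVec hγ) (resD a (resD a (resD a g₀))) := by
    rw [← r4.inner, smul_smul, hi]
  rw [inner_sub_right, inner_sub_right, inner_add_right, inner_add_right, inner_neg_right, e1, e2,
    e3, e4, e5]
  have hC : Polynomial.C (4 * (γ ^ 3 - γ)) = 4 * (Polynomial.C γ ^ 3 - Polynomial.C γ) := by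
    simp only [map_mul, map_sub, map_pow, map_ofNat]
  have key : (4 * (γ ^ 3 - γ)) • p₁ • sechVec hγ = q (q (q p₁)) • sechVec hγ -
      q (4 * p₁) • sechVec hγ - (3 * ceta η ^ 2) • sechVec hγ - (6 * pder pot * p₁) • sechVec hγ +
      q (6 * pot * p₁) • sechVec hγ := by
    rw [csmul_eq, hC]
    simp only [smul_smul, ← add_smul, ← sub_smul]
    congr 1
    have hη' := ceta_sq_of (β := γ) (η := -η) (by rw [hη]; push_cast; ring)
    simp only [ceta, Complex.ofReal_neg, map_neg, neg_sq] at hη'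
    simp only [hq, hp₁, pot, pder_X, pder_C, pder_one, pder_zero, pder_ofNat, pder_natCast,
      pder_sub, pder_add, pder_mul, pder_pow]
    push_cast
    linear_combination 3 * hη'
  rw [key, inner_add_left, inner_sub_left, inner_sub_left, inner_sub_left]
  ring

theorem tendsto_th_atTop : Tendsto th atTop (𝓝 1) := by
  have h : ∀ x, th x = 1 - 2 * (Real.exp (-(2 * x)) / (1 + Real.exp (-(2 * x)))) := fun x => by
    have h0 : Real.exp (-(2 * x)) = Real.exp (-x) * Real.exp (-x) := by rw [← Real.exp_add]; ring_nf
    have h1 : Real.exp x * Real.exp (-x) = 1 := by rw [← Real.exp_add]; simp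
    have := Real.exp_pos x
    have := Real.exp_pos (-x)
    rw [th, Real.sinh_eq, Real.cosh_eq, h0]
    field_simp
    linear_combination (2 * Real.exp (-x)) * h1
  simp_rw [funext h]
  have h2 : Tendsto (fun x : ℝ => Real.exp (-(2 * x))) atTop (𝓝 0) :=
    Real.tendsto_exp_neg_atTop_nhds_zero.comp (tendsto_id.const_mul_atTop two_pos)
  have := (h2.div (h2.const_add 1) (by norm_num)).const_mul 2 |>.const_sub 1
  simpa using this

theorem th_neg (x : ℝ) : th (-x) = -th x := by
  rw [th, th, Real.sinh_neg, Real.cosh_neg, neg_div]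

theorem tendsto_th_atBot : Tendsto th atBot (𝓝 (-1)) := by
  have := (tendsto_th_atTop.comp tendsto_neg_atBot_atTop).neg
  refine this.congr fun x => ?_
  simp [th_neg]

theorem isExpDecay_sech_sq : IsExpDecay fun x => polyFun (1 - 𝐓 ^ 2) x := by
  have h := (isExpDecay_sechExp (c := 0) (by simp)).bdd_mul
    (IsBddMul.of_continuous (continuous_sechExp 0) (C := 2) fun x => (norm_sechExp_le 0 x).trans (by
      have : Real.exp (-((1 - |(0 : ℂ).re|) * |x|)) ≤ 1 := Real.exp_le_one_iff.2 (by simp)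
      linarith))
  suffices e : (fun x => polyFun (1 - 𝐓 ^ 2) x) = fun x => sechExp 0 x * sechExp 0 x by rwa [e]
  funext x
  have h1 := one_sub_th_sq x
  simp only [sechExp, polyFun, zero_mul, Complex.exp_zero, Polynomial.eval_sub,
    Polynomial.eval_one, Polynomial.eval_pow, Polynomial.eval_X]
  have h2 : (1 : ℂ) - (th x : ℂ) ^ 2 = ((1 - th x ^ 2 : ℝ) : ℂ) := by push_cast; ring
  rw [h2, h1]
  push_cast
  field_simp

/-- p ↦ (1 − T²)p' is d/dx on functions of tanh, and tanh tends to ±1 at ±∞. -/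
theorem integral_pder (q : Polynomial ℂ) :
    ∫ x, polyFun (pder q) x = q.eval 1 - q.eval (-1) := by
  have hI : Integrable (polyFun (pder q)) := by
    have := (isExpDecay_sech_sq.bdd_mul (isBddMul_polyFun (Polynomial.derivative q))).integrable
    refine this.congr (Eventually.of_forall fun x => ?_)
    simp only [pder, polyFun, Polynomial.eval_mul]; ring
  refine integral_of_hasDerivAt_of_tendsto (f := polyFun q) (fun x => hasDerivAt_polyFun q x) hI
    ?_ ?_
  · change Tendsto (fun x => q.eval (th x : ℂ)) _ _
    have := (q.continuous.tendsto ((-1 : ℝ) : ℂ)).comp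
      ((Complex.continuous_ofReal.tendsto _).comp tendsto_th_atBot)
    simpa [Function.comp_def] using this
  · change Tendsto (fun x => q.eval (th x : ℂ)) _ _
    have := (q.continuous.tendsto ((1 : ℝ) : ℂ)).comp
      ((Complex.continuous_ofReal.tendsto _).comp tendsto_th_atTop)
    simpa [Function.comp_def] using this

theorem conj_sechExp (c : ℂ) (x : ℝ) :
    (starRingEnd ℂ) (sechExp c x) = sechExp ((starRingEnd ℂ) c) x := by
  rw [sechExp, sechExp, map_div₀, ← Complex.exp_conj, map_mul, Complex.conj_ofReal,
    Complex.conj_ofReal]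

theorem sechExp_mul_sechExp_neg (c : ℂ) (x : ℝ) :
    sechExp (-c) x * sechExp c x = 1 - (th x : ℂ) ^ 2 := by
  have h2 : (1 : ℂ) - (th x : ℂ) ^ 2 = ((1 - th x ^ 2 : ℝ) : ℂ) := by push_cast; ring
  rw [h2, one_sub_th_sq, sechExp, sechExp, div_mul_div_comm, ← Complex.exp_add]
  simp only [neg_mul, neg_add_cancel, Complex.exp_zero]
  push_cast
  field_simp

/-- The normalization of the modes. -/
theorem inner_adjVec_modeVec {β γ : ℂ} (hβγ : (starRingEnd ℂ) γ = β)
    (hγ : |(γ - (a : ℂ)).re| < 1) (hβ : |((a : ℂ) - β).re| < 1) :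
    inner ℂ (adjVec hγ) (modeVec hβ) = 2 * β * (β ^ 2 - 1) := by
  -- q is an antiderivative of (β − t)(2t² + 2βt + β² − 1), the product of the two polynomial
  -- coefficients; the exponentials cancel, leaving the factor sech² = 1 − T².
  set q : Polynomial ℂ := Polynomial.C (β * (β ^ 2 - 1)) * 𝐓 + Polynomial.C ((1 + β ^ 2) / 2) * 𝐓 ^ 2
    - Polynomial.C (1 / 2) * 𝐓 ^ 4 with hq
  have hI : inner ℂ (adjVec hγ) (modeVec hβ) = ∫ x, polyFun (pder q) x := by
    rw [L2.inner_def]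
    refine integral_congr_ae ?_
    filter_upwards [psmul_coe (Polynomial.C γ - 𝐓) (sechVec hγ), sechVec_coe hγ, sechVec_coe hβ,
      psmul_coe (2 * 𝐓 ^ 2 + 2 * Polynomial.C β * 𝐓 + Polynomial.C β ^ 2 - 1) (sechVec hβ)]
      with x h1 h2 h3 h4
    rw [adjVec, modeVec, h1, h2, h4, h3, RCLike.inner_apply, map_mul, conj_sechExp]
    have e1 : (starRingEnd ℂ) (γ - a) = -((a : ℂ) - β) := by
      rw [map_sub, hβγ, Complex.conj_ofReal]; ring
    have e2 := sechExp_mul_sechExp_neg ((a : ℂ) - β) x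
    rw [e1]
    simp only [polyFun, pder, hq, Polynomial.eval_sub, Polynomial.eval_add, Polynomial.eval_mul,
      Polynomial.eval_pow, Polynomial.eval_X, Polynomial.eval_C, Polynomial.eval_one,
      Polynomial.eval_ofNat, map_sub, hβγ, Complex.conj_ofReal,
      Polynomial.derivative_add, Polynomial.derivative_mul, Polynomial.derivative_C,
      Polynomial.derivative_X, Polynomial.derivative_X_pow, Polynomial.eval_zero]
    push_cast
    linear_combination ((2 * (th x : ℂ) ^ 2 + 2 * β * th x + β ^ 2 - 1) * (β - th x)) * e2
  rw [hI, integral_pder]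
  simp [hq]
  ring

end KPII

namespace KPII

/-! ### The resonant projection at fixed transverse frequency -/

/-- The element `e^{cx} sech x` of `L²(ℝ)`, and zero when the function is not there. -/
def sechTot (c : ℂ) : Ltwo := if h : |c.re| < 1 then sechVec h else 0

theorem sechTot_eq {c : ℂ} (h : |c.re| < 1) : sechTot c = sechVec h := dif_pos h

theorem sechTot_coe {c : ℂ} (h : |c.re| < 1) : sechTot c =ᵐ[volume] sechExp c := by
  rw [sechTot_eq h]; exact sechVec_coe h

/-- The function `e^{-κ|x|}` in `L²`. -/
def expVec {κ : ℝ} (hκ : 0 < κ) : Ltwo :=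
  (show IsExpDecay fun x => (Real.exp (-(κ * |x|)) : ℂ) from
    ⟨by fun_prop, κ, 1, hκ, fun x => by
      rw [Complex.norm_real, Real.norm_of_nonneg (Real.exp_nonneg _), one_mul]⟩).memLp.toLp _

theorem norm_expVec_coe {κ : ℝ} (hκ : 0 < κ) :
    ∀ᵐ x, ‖expVec hκ x‖ = Real.exp (-(κ * |x|)) := by
  filter_upwards [MemLp.coeFn_toLp (show IsExpDecay fun x => (Real.exp (-(κ * |x|)) : ℂ) from
    ⟨by fun_prop, κ, 1, hκ, fun x => by
      rw [Complex.norm_real, Real.norm_of_nonneg (Real.exp_nonneg _), one_mul]⟩).memLp] with x hx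
  rw [expVec, hx, Complex.norm_real, Real.norm_of_nonneg (Real.exp_nonneg _)]

theorem norm_sechExp_le_of {δ : ℝ} {c : ℂ} (hc : |c.re| ≤ 1 - δ) (x : ℝ) :
    ‖sechExp c x‖ ≤ 2 * Real.exp (-(δ * |x|)) := by
  refine (norm_sechExp_le c x).trans ?_
  gcongr
  linarith

/-- The two exponentials differ by the phase 2x Im c, so the difference is at most |2 Im c||x| times
one of them; half of the exponential decay pays for the factor |x|. -/
theorem norm_sechExp_sub_le {δ : ℝ} (hδ : 0 < δ) {c : ℂ} (hc : |c.re| ≤ 1 - δ) (x : ℝ) :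
    ‖sechExp c x - sechExp ((starRingEnd ℂ) c) x‖ ≤
      ‖c - (starRingEnd ℂ) c‖ * (4 / δ * Real.exp (-(δ / 2 * |x|))) := by
  set d := (starRingEnd ℂ) c with hd
  have e1 : c = d + Complex.I * ((2 * c.im : ℝ) : ℂ) := by
    apply Complex.ext <;> simp [hd]; ring
  have e2 : sechExp c x - sechExp d x =
      sechExp d x * (Complex.exp (Complex.I * ((2 * c.im * x : ℝ) : ℂ)) - 1) := by
    have : Complex.exp (c * x) =
        Complex.exp (d * x) * Complex.exp (Complex.I * ((2 * c.im * x : ℝ) : ℂ)) := by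
      rw [← Complex.exp_add]; congr 1
      conv_lhs => rw [e1]
      push_cast; ring
    rw [sechExp, this, sechExp]; ring
  have e3 : ‖c - d‖ = |2 * c.im| := by
    have : c - d = Complex.I * ((2 * c.im : ℝ) : ℂ) := by linear_combination e1
    rw [this, norm_mul, Complex.norm_I, one_mul, Complex.norm_real, Real.norm_eq_abs]
  rw [e2, norm_mul, e3]
  have h1 := norm_sechExp_le_of (δ := δ) (c := d) (by rw [hd, Complex.conj_re]; exact hc) x
  have h2 : ‖Complex.exp (Complex.I * ((2 * c.im * x : ℝ) : ℂ)) - 1‖ ≤ |2 * c.im| * |x| := by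
    have := Real.norm_exp_I_mul_ofReal_sub_one_le (x := 2 * c.im * x)
    rwa [Real.norm_eq_abs, abs_mul] at this
  have h3 : |x| * Real.exp (-(δ * |x|)) ≤ 2 / δ * Real.exp (-(δ / 2 * |x|)) := by
    have h4 : δ / 2 * |x| ≤ Real.exp (δ / 2 * |x|) := by
      have := Real.add_one_le_exp (δ / 2 * |x|); linarith
    have h5 : Real.exp (-(δ * |x|)) = Real.exp (-(δ / 2 * |x|)) * Real.exp (-(δ / 2 * |x|)) := by
      rw [← Real.exp_add]; congr 1; ring
    have h6 : Real.exp (δ / 2 * |x|) * Real.exp (-(δ / 2 * |x|)) = 1 := by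
      rw [← Real.exp_add, add_neg_cancel, Real.exp_zero]
    have h7 := Real.exp_pos (-(δ / 2 * |x|))
    have h8 : δ / 2 * |x| * Real.exp (-(δ / 2 * |x|)) ≤ 1 := by
      rw [← h6]; exact mul_le_mul_of_nonneg_right h4 h7.le
    rw [h5]
    calc _ = 2 / δ * Real.exp (-(δ / 2 * |x|)) * (δ / 2 * |x| * Real.exp (-(δ / 2 * |x|))) := by
          field_simp
      _ ≤ 2 / δ * Real.exp (-(δ / 2 * |x|)) * 1 := by gcongr
      _ = _ := mul_one _
  calc _ ≤ (2 * Real.exp (-(δ * |x|))) * (|2 * c.im| * |x|) := by gcongr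
    _ = |2 * c.im| * (2 * (|x| * Real.exp (-(δ * |x|)))) := by ring
    _ ≤ |2 * c.im| * (2 * (2 / δ * Real.exp (-(δ / 2 * |x|)))) := by gcongr
    _ = _ := by ring

theorem exists_norm_sechTot_le {δ : ℝ} (hδ : 0 < δ) : ∃ C, 0 ≤ C ∧ ∀ c : ℂ, |c.re| ≤ 1 - δ →
    ‖sechTot c‖ ≤ C ∧
      ‖sechTot c - sechTot ((starRingEnd ℂ) c)‖ ≤ C * ‖c - (starRingEnd ℂ) c‖ := by
  have hδ2 : 0 < δ / 2 := by positivity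
  refine ⟨max (2 * ‖expVec hδ‖) (4 / δ * ‖expVec hδ2‖), by positivity, fun c hc => ⟨?_, ?_⟩⟩
  · refine le_trans ?_ (le_max_left _ _)
    refine Lp.norm_le_mul_norm_of_ae_le_mul ?_
    filter_upwards [sechTot_coe (c := c) (by linarith), norm_expVec_coe hδ] with x h1 h2
    rw [h1, h2]
    exact norm_sechExp_le_of hc x
  · refine le_trans ?_ (mul_le_mul_of_nonneg_right (le_max_right _ _) (norm_nonneg _))
    rw [mul_comm, ← mul_assoc]
    refine Lp.norm_le_mul_norm_of_ae_le_mul ?_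
    filter_upwards [sechTot_coe (c := c) (by linarith), norm_expVec_coe hδ2,
      sechTot_coe (c := (starRingEnd ℂ) c) (by rw [Complex.conj_re]; linarith),
      Lp.coeFn_sub (sechTot c) (sechTot ((starRingEnd ℂ) c))] with x h1 h2 h3 h4
    rw [h4, Pi.sub_apply, h1, h2, h3, mul_assoc]
    exact norm_sechExp_sub_le hδ hc x

/-- The element `β⁻¹ D² (e^{(a - β)x} sech x)` of `L²(ℝ)`. -/
def normMode (a : ℝ) (β : ℂ) : Ltwo :=
  (Polynomial.C β⁻¹ * (2 * 𝐓 ^ 2 - 1) + 2 * 𝐓 + Polynomial.C β) • sechTot (a - β)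

/-- The weighted resonant mode `e^{ax} g(x, η)`. -/
def resMode (a η : ℝ) : Ltwo := (-Complex.I / (2 * η)) • normMode a (beta η)

/-- The weighted adjoint resonant mode `e^{-ax} g*(x, η)`. -/
def adjRes (a η : ℝ) : Ltwo := (Polynomial.C (beta (-η)) - 𝐓) • sechTot (beta (-η) - a)

theorem normMode_eq {a : ℝ} {β : ℂ} (hβ0 : β ≠ 0) (hβ : |((a : ℂ) - β).re| < 1) :
    normMode a β = β⁻¹ • modeVec hβ := by
  rw [normMode, sechTot_eq hβ, modeVec, csmul_eq, smul_smul]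
  congr 1
  have : Polynomial.C β⁻¹ * Polynomial.C β = 1 := by
    rw [← map_mul, inv_mul_cancel₀ hβ0, map_one]
  linear_combination (-2 * 𝐓 - Polynomial.C β) * this

theorem norm_beta_sub_le (η : ℝ) : ‖beta η - beta (-η)‖ ≤ |η| := by
  have e : beta η - (starRingEnd ℂ) (beta η) = ((2 * (beta η).im : ℝ) : ℂ) * Complex.I := by
    rw [Complex.sub_conj]
  rw [beta_neg, e, norm_mul, Complex.norm_I, mul_one, Complex.norm_real, Real.norm_eq_abs, abs_mul,
    abs_two]
  exact two_abs_beta_im_le η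

/-- The frequencies at which the modes belong to the weighted space. -/
theorem exists_gap {a η₁ : ℝ} (ha2 : a < 2) (hν : nu η₁ < a) : ∃ δ, 0 < δ ∧ ∀ η : ℝ,
    |η| ≤ |η₁| → |(beta η).re - a| ≤ 1 - δ := by
  -- The two entries are the two sides of the absolute value: a − Re β ≤ 1 − (2 − a) because Re β ≥
  -- 1, and Re β − a ≤ 1 − (a − ν(η₁)) because Re β increases with |η|.
  refine ⟨min (2 - a) (a - nu η₁), lt_min (by linarith) (by linarith), fun η h => ?_⟩
  have h1 := one_le_beta_re η
  have h2 := beta_re_mono h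
  have h3 := min_le_left (2 - a) (a - nu η₁)
  have h4 := min_le_right (2 - a) (a - nu η₁)
  rw [nu] at h3 h4 ⊢
  rw [abs_le]
  constructor <;> linarith

/-- The modes have a simple pole at η = 0. Since β(η) − β(−η) = O(η), the odd part of the adjoint
modes vanishes there and the pole is cancelled in the even part of the modes. These cancellations
keep the projections bounded at small frequencies. -/
theorem exists_res_bounds {a η₁ : ℝ} (ha2 : a < 2) (hν : nu η₁ < a) :
    ∃ C, 0 ≤ C ∧ ∀ η : ℝ, η ≠ 0 → |η| ≤ |η₁| → |η| * ‖resMode a η‖ ≤ C ∧ ‖adjRes a η‖ ≤ C ∧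
      ‖resMode a η + resMode a (-η)‖ ≤ C ∧ ‖adjRes a η - adjRes a (-η)‖ ≤ C * |η| := by
  obtain ⟨δ, hδ, hgap⟩ := exists_gap ha2 hν
  obtain ⟨C₀, hC₀, h₀⟩ := exists_norm_sechTot_le hδ
  have hB : 1 ≤ 1 + |η₁| := by linarith [abs_nonneg η₁]
  obtain ⟨C₁, hC₁, h₁⟩ := exists_psmul_bound (fun t b c => c * (2 * t ^ 2 - 1) + 2 * t + b)
    (by fun_prop) (1 + |η₁|)
  obtain ⟨C₂, hC₂, h₂⟩ := exists_psmul_bound (fun t b c => 1 - (2 * t ^ 2 - 1) * b)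
    (by fun_prop) (1 + |η₁|)
  obtain ⟨C₃, hC₃, h₃⟩ := exists_psmul_bound (fun t b c => b - t) (by fun_prop) (1 + |η₁|)
  obtain ⟨C, hC⟩ : ∃ C, C = C₁ * C₀ + C₃ * C₀ + C₂ * C₀ + C₀ := ⟨_, rfl⟩
  have k1 : 0 ≤ C₁ * C₀ := by positivity
  have k2 : 0 ≤ C₂ * C₀ := by positivity
  have k3 : 0 ≤ C₃ * C₀ := by positivity
  refine ⟨C, by linarith, fun η hη0 hη => ?_⟩
  have hbn : ∀ s : ℝ, |s| ≤ |η₁| → ‖beta s‖ ≤ 1 + |η₁| := fun s hs =>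
    (norm_beta_le s).trans (by linarith)
  have hb1 : ∀ s : ℝ, 1 ≤ ‖beta s‖ := fun s =>
    ((one_le_beta_re s).trans (le_abs_self _)).trans (Complex.abs_re_le_norm _)
  have hb0 : ∀ s : ℝ, beta s ≠ 0 := fun s h => by
    have := hb1 s; rw [h, norm_zero] at this; linarith
  have hbi : ∀ s : ℝ, ‖(beta s)⁻¹‖ ≤ 1 := fun s => by
    rw [norm_inv]; exact inv_le_one_of_one_le₀ (hb1 s)
  have hη' : |(-η)| ≤ |η₁| := by rwa [abs_neg]
  have gm : ∀ s : ℝ, |s| ≤ |η₁| → |((a : ℂ) - beta s).re| ≤ 1 - δ := fun s hs => by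
    rw [Complex.sub_re, Complex.ofReal_re, abs_sub_comm]; exact hgap s hs
  have ga : ∀ s : ℝ, |s| ≤ |η₁| → |(beta s - (a : ℂ)).re| ≤ 1 - δ := fun s hs => by
    rw [Complex.sub_re, Complex.ofReal_re]; exact hgap s hs
  have hconj : ∀ s : ℝ, (starRingEnd ℂ) (beta s) = beta (-s) := fun s => (beta_neg s).symm
  have hηp : 0 < |η| := abs_pos.2 hη0
  have ncoef : ‖-Complex.I / (2 * (η : ℂ))‖ = 1 / (2 * |η|) := by
    rw [norm_div, norm_neg, Complex.norm_I, norm_mul, Complex.norm_real, Real.norm_eq_abs]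
    norm_num
  refine ⟨?_, ?_, ?_, ?_⟩
  · rw [resMode, norm_smul, ncoef]
    have h1 := h₁ (Polynomial.C (beta η)⁻¹ * (2 * 𝐓 ^ 2 - 1) + 2 * 𝐓 + Polynomial.C (beta η))
      (beta η) (beta η)⁻¹ (hbn η hη) ((hbi η).trans hB) (fun x => by simp [polyFun])
      (sechTot (a - beta η))
    have h2 := mul_le_mul_of_nonneg_left (h₀ _ (gm η hη)).1 hC₁
    calc _ = 1 / 2 * ‖normMode a (beta η)‖ := by field_simp
      _ ≤ 1 / 2 * (C₁ * C₀) := by gcongr; exact h1.trans h2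
      _ ≤ C := by linarith
  · have h1 := h₃ (Polynomial.C (beta (-η)) - 𝐓) (beta (-η)) 0 (hbn _ hη')
      (by rw [norm_zero]; linarith) (fun x => by simp [polyFun]) (sechTot (beta (-η) - a))
    have h2 := mul_le_mul_of_nonneg_left (h₀ _ (ga (-η) hη')).1 hC₃
    rw [adjRes]
    linarith
  · have e : resMode a η + resMode a (-η) = (-Complex.I / (2 * (η : ℂ))) •
        ((beta η - beta (-η)) • ((1 - (2 * 𝐓 ^ 2 - 1) *
          Polynomial.C ((beta η)⁻¹ * (beta (-η))⁻¹)) • sechTot (a - beta η)) +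
        (Polynomial.C (beta (-η))⁻¹ * (2 * 𝐓 ^ 2 - 1) + 2 * 𝐓 + Polynomial.C (beta (-η))) •
          (sechTot (a - beta η) - sechTot (a - beta (-η)))) := by
      have e1 : (-Complex.I / (2 * ((-η : ℝ) : ℂ))) = -(-Complex.I / (2 * (η : ℂ))) := by
        push_cast; rw [mul_neg, div_neg]
      rw [resMode, resMode, e1, neg_smul, ← sub_eq_add_neg, ← smul_sub]
      congr 1
      rw [normMode, normMode, csmul_eq]
      have h1 : Polynomial.C (beta η) * Polynomial.C ((beta η)⁻¹ * (beta (-η))⁻¹) =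
          Polynomial.C (beta (-η))⁻¹ := by
        rw [← map_mul, ← mul_assoc, mul_inv_cancel₀ (hb0 η), one_mul]
      have h2 : Polynomial.C (beta (-η)) * Polynomial.C ((beta η)⁻¹ * (beta (-η))⁻¹) =
          Polynomial.C (beta η)⁻¹ := by
        rw [← map_mul, mul_comm (beta η)⁻¹, ← mul_assoc, mul_inv_cancel₀ (hb0 _), one_mul]
      rw [map_sub, ← h1, ← h2]
      module
    have h1 := h₁ (Polynomial.C (beta (-η))⁻¹ * (2 * 𝐓 ^ 2 - 1) + 2 * 𝐓 + Polynomial.C (beta (-η)))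
      (beta (-η)) (beta (-η))⁻¹ (hbn _ hη') ((hbi _).trans hB) (fun x => by simp [polyFun])
      (sechTot (a - beta η) - sechTot (a - beta (-η)))
    have h2 := h₂ (1 - (2 * 𝐓 ^ 2 - 1) * Polynomial.C ((beta η)⁻¹ * (beta (-η))⁻¹))
      ((beta η)⁻¹ * (beta (-η))⁻¹) 0 (by
        rw [norm_mul]
        exact (mul_le_one₀ (hbi _) (norm_nonneg _) (hbi _)).trans hB)
      (by rw [norm_zero]; linarith) (fun x => by simp [polyFun]) (sechTot (a - beta η))
    have h3 := (h₀ _ (gm η hη)).1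
    have h4 := (h₀ _ (gm η hη)).2
    rw [map_sub, Complex.conj_ofReal, hconj, sub_sub_sub_cancel_left, norm_sub_rev (beta (-η))] at h4
    have h5 := norm_beta_sub_le η
    have h4' := h4.trans (mul_le_mul_of_nonneg_left h5 hC₀)
    rw [e, norm_smul, ncoef]
    have h6 : ‖(beta η - beta (-η)) • ((1 - (2 * 𝐓 ^ 2 - 1) *
          Polynomial.C ((beta η)⁻¹ * (beta (-η))⁻¹)) • sechTot (a - beta η)) +
        (Polynomial.C (beta (-η))⁻¹ * (2 * 𝐓 ^ 2 - 1) + 2 * 𝐓 + Polynomial.C (beta (-η))) •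
          (sechTot (a - beta η) - sechTot (a - beta (-η)))‖ ≤ |η| * (C₂ * C₀) +
          C₁ * (C₀ * |η|) := by
      refine (norm_add_le _ _).trans (add_le_add ?_ ?_)
      · rw [norm_smul]
        exact mul_le_mul h5 (h2.trans (mul_le_mul_of_nonneg_left h3 hC₂)) (norm_nonneg _)
          (abs_nonneg _)
      · exact h1.trans (mul_le_mul_of_nonneg_left h4' hC₁)
    calc _ ≤ 1 / (2 * |η|) * (|η| * (C₂ * C₀) + C₁ * (C₀ * |η|)) := by gcongr
      _ = 1 / 2 * (C₂ * C₀ + C₁ * C₀) := by field_simp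
      _ ≤ C := by linarith
  · have e : adjRes a η - adjRes a (-η) = (beta (-η) - beta η) • sechTot (beta (-η) - a) +
        (Polynomial.C (beta η) - 𝐓) • (sechTot (beta (-η) - a) - sechTot (beta η - a)) := by
      rw [adjRes, adjRes, neg_neg, csmul_eq, map_sub]; module
    have h1 := h₃ (Polynomial.C (beta η) - 𝐓) (beta η) 0 (hbn _ hη)
      (by rw [norm_zero]; linarith) (fun x => by simp [polyFun])
      (sechTot (beta (-η) - a) - sechTot (beta η - a))
    have h3 := (h₀ _ (ga (-η) hη')).1
    have h4 := (h₀ _ (ga (-η) hη')).2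
    rw [map_sub, Complex.conj_ofReal, hconj, neg_neg, sub_sub_sub_cancel_right,
      norm_sub_rev (beta (-η))] at h4
    have h5 := norm_beta_sub_le η
    have h4' := h4.trans (mul_le_mul_of_nonneg_left h5 hC₀)
    rw [e]
    refine (norm_add_le _ _).trans ?_
    rw [norm_smul, norm_sub_rev (beta (-η))]
    have h6 := mul_le_mul h5 h3 (norm_nonneg _) (abs_nonneg _)
    have h7 := h1.trans (mul_le_mul_of_nonneg_left h4' hC₃)
    rw [hC]
    have := mul_nonneg (add_nonneg k1 k2) hηp.le
    linarith

end KPII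

namespace KPII

/-! ### Decay of the semigroups at fixed transverse frequency off the resonant modes -/

theorem eq_exp_smul_of_deriv {F : Type*} [NormedAddCommGroup F] [NormedSpace ℂ F] {f : ℝ → F}
    {l : ℂ} (hc : ContinuousOn f (Set.Ici 0))
    (hd : ∀ t, 0 ≤ t → HasDerivWithinAt f (l • f t) (Set.Ici t) t) {t : ℝ} (ht : 0 ≤ t) :
    f t = Complex.exp (l * t) • f 0 := by
  have he : ∀ s : ℝ, HasDerivAt (fun s : ℝ => Complex.exp (-l * s))
      (Complex.exp (-l * s) * (-l)) s := fun s => by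
    have h1 : HasDerivAt (fun s : ℝ => -l * (s : ℂ)) (-l) s := by
      simpa using (Complex.ofRealCLM.hasDerivAt (x := s)).const_mul (-l)
    exact h1.cexp
  have h0 := constant_of_has_deriv_right_zero (f := fun s : ℝ => Complex.exp (-l * s) • f s)
    (a := 0) (b := t)
    (ContinuousOn.smul (Continuous.continuousOn (by fun_prop)) (hc.mono Set.Icc_subset_Ici_self))
    (fun s hs => by
      have h := (he s).hasDerivWithinAt.smul (hd s hs.1) (s := Set.Ici s)
      refine h.congr_deriv ?_
      rw [smul_smul, ← add_smul]
      have : Complex.exp (-l * s) * l + Complex.exp (-l * s) * -l = 0 := by ring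
      rw [this, zero_smul]) t ⟨ht, le_rfl⟩
  simp only [Complex.ofReal_zero, mul_zero, Complex.exp_zero, one_smul] at h0
  rw [← h0, smul_smul, ← Complex.exp_add]
  simp

section
variable {E : Type*} [NormedAddCommGroup E] [NormedSpace ℂ E] [CompleteSpace E]
  {G : Submodule ℂ (E × E)} {ω : ℝ} {S : ℝ → E →L[ℂ] E}

theorem IsSemigroupOf.apply_eigenvector (hS : IsSemigroupOf G ω S) {u : E} {l : ℂ}
    (h : (u, l • u) ∈ G) {t : ℝ} (ht : 0 ≤ t) : S t u = Complex.exp (l * t) • u := by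
  have := eq_exp_smul_of_deriv (f := fun t => S t u) (l := l) (hS.cont u) (fun s hs => by
    have := hS.hasDerivWithinAt h hs
    rwa [map_smul] at this) ht
  rwa [hS.zero] at this

theorem IsSemigroupOf.eigenfunctional_apply (hS : IsSemigroupOf G ω S)
    (hD : Dense (Prod.fst '' (G : Set (E × E)))) {N : E →L[ℂ] ℂ} {l : ℂ}
    (h : ∀ u w, (u, w) ∈ G → N w = l * N u) {t : ℝ} (ht : 0 ≤ t) (x : E) :
    N (S t x) = Complex.exp (l * t) * N x := by
  have hcl : IsClosed {x : E | N (S t x) = Complex.exp (l * t) * N x} :=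
    isClosed_eq (by fun_prop) (by fun_prop)
  refine hcl.closure_subset_iff.2 ?_ (hD x)
  rintro _ ⟨⟨u, w⟩, huw, rfl⟩
  have := eq_exp_smul_of_deriv (f := fun t => N (S t u)) (l := l)
    (N.continuous.comp_continuousOn (hS.cont u)) (fun s hs => by
      have h1 := hS.hasDerivWithinAt huw hs
      have h2 := (N.restrictScalars ℝ).hasFDerivAt.comp_hasDerivWithinAt s h1
      refine h2.congr_deriv ?_
      exact h _ _ (hS.mem u w huw s hs)) ht
  simpa [hS.zero] using this
end

theorem genMap_neg (a η : ℝ) : genMap a (-η) = genMap a η := by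
  ext1 z; rw [genMap_apply, genMap_apply, ceta, ceta]; simp

theorem fibreGraph_neg (a η : ℝ) : fibreGraph a (-η) = fibreGraph a η := by
  rw [fibreGraph, genMap_neg, fibreGraph]

theorem lam_neg (η : ℝ) : lam (-η) = (starRingEnd ℂ) (lam η) := by
  rw [lam_eq, lam_eq, beta_neg, map_mul, map_sub, map_pow, Complex.conj_ofNat]

/-- The two eigenvalues are complex conjugate, and Im λ(η) = 4η Re β(η) does not vanish. -/
theorem lam_ne_lam_neg {η : ℝ} (hη : η ≠ 0) : lam η ≠ lam (-η) := fun h => by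
  rw [lam_neg] at h
  have h1 := Complex.conj_eq_iff_im.1 h.symm
  rw [lam] at h1
  simp only [Complex.mul_im, Complex.mul_re, Complex.I_re, Complex.I_im, Complex.ofReal_re,
    Complex.ofReal_im] at h1
  have h2 := beta_re_pos η
  norm_num at h1
  rcases h1 with h1 | h1
  · exact hη h1
  · linarith

variable {a η₁ η : ℝ}

section
variable (ha : 0 < a) (ha2 : a < 2) (hν : nu η₁ < a) (hη : |η| ≤ |η₁|)
include ha2 hν hη

theorem abs_re_sub_beta_lt : |((a : ℂ) - beta η).re| < 1 := by
  obtain ⟨δ, hδ, h⟩ := exists_gap ha2 hν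
  have := h η hη
  rw [Complex.sub_re, Complex.ofReal_re, abs_sub_comm]
  linarith

theorem abs_re_beta_neg_sub_lt : |(beta (-η) - (a : ℂ)).re| < 1 := by
  obtain ⟨δ, hδ, h⟩ := exists_gap ha2 hν
  have := h (-η) (by rwa [abs_neg])
  rw [Complex.sub_re, Complex.ofReal_re]
  linarith

theorem resMode_eq : resMode a η = (-Complex.I / (2 * η * beta η)) •
    modeVec (abs_re_sub_beta_lt ha2 hν hη) := by
  have hb0 : beta η ≠ 0 := fun h => by
    have := beta_re_pos η; rw [h] at this; simp at this
  rw [resMode, normMode_eq hb0 (abs_re_sub_beta_lt ha2 hν hη), smul_smul]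
  congr 1
  field_simp

theorem adjRes_eq : adjRes a η = adjVec (abs_re_beta_neg_sub_lt ha2 hν hη) := by
  rw [adjRes, adjVec, sechTot_eq]

include ha

theorem resMode_mem : (resMode a η, lam η • resMode a η) ∈ fibreGraph a η := by
  have h := (fibreGraph a η).smul_mem (-Complex.I / (2 * η * beta η))
    (modeVec_mem ha (beta_sq η) (abs_re_sub_beta_lt ha2 hν hη))
  rw [resMode_eq ha2 hν hη, smul_comm, lam_eq]
  exact h

theorem inner_adjRes {u w : Ltwo} (h : (u, w) ∈ fibreGraph a η) :
    inner ℂ (adjRes a η) w = lam η * inner ℂ (adjRes a η) u := by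
  rw [adjRes_eq ha2 hν hη, inner_adjVec ha (η := η) (by rw [beta_sq]; push_cast; ring) _ h,
    ← lam_eq, lam_neg, Complex.conj_conj]

omit ha in
-- The integral 2β(β² − 1) = 2iηβ is cancelled by the prefactor −i/(2ηβ) of the mode.
theorem inner_adjRes_resMode (hη0 : η ≠ 0) : inner ℂ (adjRes a η) (resMode a η) = 1 := by
  have hb0 : beta η ≠ 0 := fun h => by
    have := beta_re_pos η; rw [h] at this; simp at this
  rw [adjRes_eq ha2 hν hη, resMode_eq ha2 hν hη, inner_smul_right,
    inner_adjVec_modeVec (by rw [beta_neg, Complex.conj_conj]), beta_sq]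
  have hc : (η : ℂ) ≠ 0 := by exact_mod_cast hη0
  field_simp
  ring_nf
  rw [Complex.I_sq]; ring

/-- The fibres at η and −η are the same operator, and an eigenfunctional annihilates the
eigenvectors of a different eigenvalue. -/
theorem inner_adjRes_neg_resMode (hη0 : η ≠ 0) :
    inner ℂ (adjRes a (-η)) (resMode a η) = 0 := by
  have h1 := resMode_mem ha ha2 hν hη
  rw [← fibreGraph_neg] at h1
  have h2 := inner_adjRes ha ha2 hν (by rwa [abs_neg]) h1
  rw [inner_smul_right] at h2
  by_contra h
  exact lam_ne_lam_neg hη0 (mul_right_cancel₀ h h2)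
end

/-- The spectral projection onto the two resonant modes at the frequencies `±η`. -/
def resProj (a η : ℝ) : Ltwo →L[ℂ] Ltwo :=
  (innerSL ℂ (adjRes a η)).smulRight (resMode a η) +
    (innerSL ℂ (adjRes a (-η))).smulRight (resMode a (-η))

theorem resProj_apply (a η : ℝ) (x : Ltwo) : resProj a η x =
    (inner ℂ (adjRes a η) x : ℂ) • resMode a η +
      (inner ℂ (adjRes a (-η)) x : ℂ) • resMode a (-η) := rfl

theorem exists_norm_resProj_le (ha2 : a < 2) (hν : nu η₁ < a) : ∃ C, 0 ≤ C ∧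
    ∀ η : ℝ, η ≠ 0 → |η| ≤ |η₁| → ∀ x, ‖resProj a η x‖ ≤ C * ‖x‖ := by
  obtain ⟨C, hC, h⟩ := exists_res_bounds ha2 hν
  refine ⟨C * C + C * C, by positivity, fun η hη0 hη x => ?_⟩
  obtain ⟨h1, h2, h3, h4⟩ := h η hη0 hη
  obtain ⟨-, h2', -, -⟩ := h (-η) (neg_ne_zero.2 hη0) (by rwa [abs_neg])
  -- Regrouping h⊗g + h'⊗g' as (h − h')⊗g + h'⊗(g + g'): the pole of g meets the zero of h − h', and
  -- g + g' has no pole.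
  have e : resProj a η x = (inner ℂ (adjRes a η - adjRes a (-η)) x : ℂ) • resMode a η +
      (inner ℂ (adjRes a (-η)) x : ℂ) • (resMode a η + resMode a (-η)) := by
    rw [resProj_apply, inner_sub_left]; module
  rw [e]
  refine (norm_add_le _ _).trans ?_
  rw [norm_smul, norm_smul]
  have i1 := (norm_inner_le_norm (𝕜 := ℂ) (adjRes a η - adjRes a (-η)) x).trans
    (mul_le_mul_of_nonneg_right h4 (norm_nonneg x))
  have i2 := (norm_inner_le_norm (𝕜 := ℂ) (adjRes a (-η)) x).trans
    (mul_le_mul_of_nonneg_right h2' (norm_nonneg x))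
  have i3 := mul_le_mul_of_nonneg_right i1 (norm_nonneg (resMode a η))
  have i4 := mul_le_mul i2 h3 (norm_nonneg _) (by positivity)
  have i5 := mul_le_mul_of_nonneg_left h1 (mul_nonneg hC (norm_nonneg x))
  linarith

section
variable (ha : 0 < a) (ha2 : a < 2) (hν : nu η₁ < a) (hη : |η| ≤ |η₁|) (hη0 : η ≠ 0)
include ha ha2 hν hη hη0

theorem resProj_resMode : resProj a η (resMode a η) = resMode a η := by
  rw [resProj_apply, inner_adjRes_resMode ha2 hν hη hη0,
    inner_adjRes_neg_resMode ha ha2 hν hη hη0, one_smul, zero_smul, add_zero]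

theorem resProj_resMode_neg : resProj a η (resMode a (-η)) = resMode a (-η) := by
  have h := inner_adjRes_neg_resMode ha ha2 hν (by rwa [abs_neg]) (neg_ne_zero.2 hη0)
  rw [neg_neg] at h
  rw [resProj_apply, inner_adjRes_resMode ha2 hν (by rwa [abs_neg]) (neg_ne_zero.2 hη0),
    h, one_smul, zero_smul, zero_add]

theorem resProj_resProj (x : Ltwo) : resProj a η (resProj a η x) = resProj a η x := by
  conv_lhs => rw [resProj_apply a η x, map_add, map_smul, map_smul,
    resProj_resMode ha ha2 hν hη hη0, resProj_resMode_neg ha ha2 hν hη hη0]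
  rw [resProj_apply]

omit hη0 in
theorem fibreSemigroup_resProj {t : ℝ} (ht : 0 ≤ t) (x : Ltwo) :
    fibreSemigroup ha ha2 η t (resProj a η x) =
      (Complex.exp (lam η * t) * inner ℂ (adjRes a η) x) • resMode a η +
        (Complex.exp (lam (-η) * t) * inner ℂ (adjRes a (-η)) x) • resMode a (-η) := by
  have hS := isSemigroupOf_fibre ha ha2 η
  have h2 := resMode_mem ha ha2 hν (η := -η) (by rwa [abs_neg])
  rw [fibreGraph_neg] at h2
  rw [resProj_apply, map_add, map_smul, map_smul,
    hS.apply_eigenvector (resMode_mem ha ha2 hν hη) ht, hS.apply_eigenvector h2 ht, smul_smul,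
    smul_smul, mul_comm, mul_comm (inner ℂ (adjRes a (-η)) x)]

omit hη0 in
theorem resProj_fibreSemigroup {t : ℝ} (ht : 0 ≤ t) (x : Ltwo) :
    resProj a η (fibreSemigroup ha ha2 η t x) = fibreSemigroup ha ha2 η t (resProj a η x) := by
  have hS := isSemigroupOf_fibre ha ha2 η
  have hD := dense_fibreGraph ha ha2 η
  have h1 := hS.eigenfunctional_apply hD (N := innerSL ℂ (adjRes a η)) (l := lam η)
    (fun u w h => inner_adjRes ha ha2 hν hη h) ht x
  have h2 := hS.eigenfunctional_apply hD (N := innerSL ℂ (adjRes a (-η))) (l := lam (-η))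
    (fun u w h => inner_adjRes ha ha2 hν (by rwa [abs_neg]) (by rwa [fibreGraph_neg])) ht x
  simp only [innerSL_apply_apply] at h1 h2
  rw [fibreSemigroup_resProj ha ha2 hν hη ht, resProj_apply, h1, h2]

end

/-- The two modes evolve with different factors e^{λ(±η)t}, so they are estimated separately and the
pole costs |η|⁻¹. This is the origin of the factor η₀⁻¹ in the final estimate. -/
theorem exists_norm_fibreSemigroup_resProj_le (ha : 0 < a) (ha2 : a < 2) (hν : nu η₁ < a) :
    ∃ C, 0 ≤ C ∧ ∀ η : ℝ, η ≠ 0 → |η| ≤ |η₁| → ∀ t : ℝ, 0 ≤ t → ∀ x,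
      ‖fibreSemigroup ha ha2 η t (resProj a η x)‖ ≤
        C * (|η|⁻¹ * Real.exp ((lam η).re * t)) * ‖x‖ := by
  obtain ⟨C, hC, h⟩ := exists_res_bounds ha2 hν
  refine ⟨C * C + C * C, by positivity, fun η hη0 hη t ht x => ?_⟩
  have hp : 0 < |η| := abs_pos.2 hη0
  have key : ∀ s : ℝ, |s| = |η| → ‖(Complex.exp (lam s * t) * inner ℂ (adjRes a s) x) •
      resMode a s‖ ≤ C * C * (|η|⁻¹ * Real.exp ((lam η).re * t)) * ‖x‖ := fun s hs => by
    have hs0 : s ≠ 0 := fun h0 => by rw [h0, abs_zero] at hs; linarith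
    obtain ⟨h1, h2, -, -⟩ := h s hs0 (by rwa [hs])
    have e : (lam s).re = (lam η).re := le_antisymm (lam_re_anti hs.ge) (lam_re_anti hs.le)
    rw [norm_smul, norm_mul, Complex.norm_exp, Complex.re_mul_ofReal, e]
    have i1 := (norm_inner_le_norm (𝕜 := ℂ) (adjRes a s) x).trans
      (mul_le_mul_of_nonneg_right h2 (norm_nonneg x))
    have i2 : ‖resMode a s‖ ≤ C * |η|⁻¹ := by
      rw [hs] at h1
      rw [← div_eq_mul_inv, le_div_iff₀ hp]; linarith
    calc _ ≤ Real.exp ((lam η).re * t) * (C * ‖x‖) * (C * |η|⁻¹) := by gcongr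
      _ = _ := by ring
  rw [fibreSemigroup_resProj ha ha2 hν hη ht]
  refine (norm_add_le _ _).trans ?_
  have k1 := key η rfl
  have k2 := key (-η) (abs_neg η)
  linarith

/-- Q = 1 − resProj commutes with the semigroup and annihilates both modes. So u = S(t)Qx equals Q(u
− modes) for any combination of modes, and ‖u − modes‖ is bounded through F by ‖Γu‖, which decays.
-/
theorem exists_decay_of_small (ha : 0 < a) (ha2 : a < 2) (hν : nu η₁ < a) : ∃ C, 0 ≤ C ∧
    ∀ η : ℝ, η ≠ 0 → |η| ≤ |η₁| → ∀ t : ℝ, 0 ≤ t → ∀ x,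
      ‖fibreSemigroup ha ha2 η t (x - resProj a η x)‖ ≤
        C * Real.exp (-(a * (4 - a ^ 2)) * t) * ‖x‖ := by
  obtain ⟨δ, hδ, hgap⟩ := exists_gap ha2 hν
  obtain ⟨C₁, hC₁, h₁⟩ := exists_sub_modes_le ha hδ (1 + |η₁|)
  obtain ⟨C₂, hC₂, h₂⟩ := exists_norm_facOf_le ha (1 + |η₁|)
  obtain ⟨C₃, hC₃, h₃⟩ := exists_norm_resProj_le ha2 hν
  obtain ⟨C₄, hC₄⟩ : ∃ C₄, C₄ = 1 + 4 / a + 4 / a ^ 2 + η₁ ^ 2 / a ^ 4 := ⟨_, rfl⟩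
  have hC₄0 : 0 ≤ C₄ := by rw [hC₄]; positivity
  refine ⟨(1 + C₃) * (C₁ * (C₂ * (C₄ * (1 + C₃)))), by positivity, fun η hη0 hη t ht x => ?_⟩
  set Q : Ltwo →L[ℂ] Ltwo := 1 - resProj a η with hQ
  have Qa : ∀ z, Q z = z - resProj a η z := fun z => rfl
  have Qb : ∀ z, ‖Q z‖ ≤ (1 + C₃) * ‖z‖ := fun z => by
    rw [Qa]
    refine (norm_sub_le _ _).trans ?_
    have := h₃ η hη0 hη z
    linarith
  have hηn : |(-η)| ≤ |η₁| := by rwa [abs_neg]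
  have hbn : ∀ s : ℝ, |s| ≤ |η₁| → ‖beta s‖ ≤ 1 + |η₁| := fun s hs =>
    (norm_beta_le s).trans (by linarith)
  have Qm : ∀ s : ℝ, ∀ hs : |s| ≤ |η₁|, (s = η ∨ s = -η) →
      Q (modeVec (abs_re_sub_beta_lt ha2 hν hs)) = 0 := fun s hs hsη => by
    have hs0 : s ≠ 0 := by rcases hsη with rfl | rfl; exacts [hη0, neg_ne_zero.2 hη0]
    have hb0 : beta s ≠ 0 := fun h => by
      have := beta_re_pos s; rw [h] at this; simp at this
    have hcoef : (-Complex.I / (2 * s * beta s)) ≠ 0 := by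
      refine div_ne_zero (neg_ne_zero.2 Complex.I_ne_zero) (mul_ne_zero (mul_ne_zero two_ne_zero
        (by exact_mod_cast hs0)) hb0)
    have e1 : Q (resMode a s) = 0 := by
      rw [Qa, sub_eq_zero]
      rcases hsη with rfl | rfl
      · exact (resProj_resMode ha ha2 hν hη hη0).symm
      · exact (resProj_resMode_neg ha ha2 hν hη hη0).symm
    rw [resMode_eq ha2 hν hs, map_smul] at e1
    exact (smul_eq_zero.1 e1).resolve_left hcoef
  set y := Q x with hy
  have hSQ : fibreSemigroup ha ha2 η t y = Q (fibreSemigroup ha ha2 η t y) := by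
    rw [Qa, resProj_fibreSemigroup ha ha2 hν hη ht, ← map_sub, hy, Qa, map_sub (resProj a η),
      resProj_resProj ha ha2 hν hη hη0, sub_self, sub_zero]
  have hne : beta η ≠ beta (-η) := fun h => by
    have h1 := congrArg Complex.im h
    rw [beta_neg, Complex.conj_im] at h1
    exact beta_im_ne_zero hη0 (by linarith)
  obtain ⟨c₁, c₂, hc⟩ := h₁ (beta η) (beta (-η)) (abs_re_sub_beta_lt ha2 hν hη)
    (abs_re_sub_beta_lt ha2 hν hηn) hne (hgap η hη) (hgap (-η) hηn) (hbn η hη) (hbn _ hηn)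
    (fibreSemigroup ha ha2 η t y)
  have hF := h₂ η (beta η) (beta (-η)) (beta_sq η) (beta_sq (-η)) (one_le_beta_re _)
    (one_le_beta_re _) (hbn η hη) (hbn _ hηn) (fibreSemigroup ha ha2 η t y)
  have hdec := (isSemigroupOf_fibre ha ha2 η).norm_map_le (dense_fibreGraph ha ha2 η) (miura a η)
    (b := a * (4 - a ^ 2)) (fun u w h => re_inner_miura_le ha h) ht y
  have hG : ‖miura a η y‖ ≤ C₄ * ‖y‖ := by
    refine (norm_miura_le ha η y).trans (mul_le_mul_of_nonneg_right ?_ (norm_nonneg y))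
    have h1 : η ^ 2 ≤ η₁ ^ 2 := sq_le_sq.2 hη
    have h2 : η ^ 2 / a ^ 4 ≤ η₁ ^ 2 / a ^ 4 := by gcongr
    linarith
  -- The coefficients c₁ and c₂ are not controlled; it only matters that Q annihilates the modes.
  have hQ2 : Q (fibreSemigroup ha ha2 η t y) = Q (fibreSemigroup ha ha2 η t y -
      (c₁ • modeVec (abs_re_sub_beta_lt ha2 hν hη) +
        c₂ • modeVec (abs_re_sub_beta_lt ha2 hν hηn))) := by
    rw [map_sub, map_add, map_smul, map_smul, Qm η hη (Or.inl rfl), Qm (-η) hηn (Or.inr rfl),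
      smul_zero, smul_zero, add_zero, sub_zero]
  set ex := Real.exp (-(a * (4 - a ^ 2)) * t) with hex
  have hex0 : 0 ≤ ex := Real.exp_nonneg _
  rw [← Qa, ← hy, hSQ, hQ2]
  calc _ ≤ (1 + C₃) * (C₁ * (C₂ * (ex * (C₄ * ((1 + C₃) * ‖x‖))))) := by
        refine (Qb _).trans (mul_le_mul_of_nonneg_left (hc.trans (mul_le_mul_of_nonneg_left
          (hF.trans (mul_le_mul_of_nonneg_left (hdec.trans (mul_le_mul_of_nonneg_left
            (hG.trans (mul_le_mul_of_nonneg_left (Qb x) hC₄0)) hex0)) hC₂)) hC₁)) (by positivity))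
    _ = _ := by ring

/-- The part of the identity that is left at frequency `η` when the resonant modes up to the
frequency `η₀` are removed. -/
def nonresFibre (a η₀ η : ℝ) : Ltwo →L[ℂ] Ltwo :=
  if |η| ≤ η₀ then 1 - resProj a η else 1

/-- For |η| ≤ η₀ the modes are removed; for η₀ < |η| ≤ η₁ they are present and bounded by their
value at η₀; beyond η₁ the whole fibre decays exponentially. The constants depend on η₁ but not on
η₀. -/
theorem exists_fibre_decay (ha : 0 < a) (ha2 : a < 2) (hη₁ : 0 < η₁) (hν : nu η₁ < a) :
    ∃ K b : ℝ, 0 < K ∧ 0 < b ∧ ∀ η₀ : ℝ, 0 < η₀ → η₀ ≤ η₁ → ∀ η : ℝ, η ≠ 0 → ∀ t : ℝ, 0 ≤ t →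
      ∀ x, ‖fibreSemigroup ha ha2 η t (nonresFibre a η₀ η x)‖ ≤
        K * (η₀⁻¹ * Real.exp ((lam η₀).re * t) + Real.exp (-b * t)) * ‖x‖ := by
  obtain ⟨M, hM, hlarge⟩ := exists_decay_of_large ha ha2
  obtain ⟨K₂, b₂, hK₂, hb₂, hmid⟩ := exists_decay_of_middle ha ha2 hη₁ M
  obtain ⟨C₃, hC₃, hsmall⟩ := exists_decay_of_small ha ha2 hν
  obtain ⟨C₄, hC₄, hres⟩ := exists_norm_fibreSemigroup_resProj_le ha ha2 hν
  have hc : 0 < a * (4 - a ^ 2) := mul_pos ha (by nlinarith)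
  obtain ⟨b, hb⟩ : ∃ b, b = min (a * (4 - a ^ 2)) (min b₂ 1) := ⟨_, rfl⟩
  obtain ⟨K, hK⟩ : ∃ K, K = C₃ + C₄ + K₂ + 1 := ⟨_, rfl⟩
  have hb0 : 0 < b := by rw [hb]; positivity
  have l1 : b ≤ a * (4 - a ^ 2) := by rw [hb]; exact min_le_left _ _
  have l2 : b ≤ b₂ := by rw [hb]; exact (min_le_right _ _).trans (min_le_left _ _)
  have l3 : b ≤ 1 := by rw [hb]; exact (min_le_right _ _).trans (min_le_right _ _)
  have hexp : ∀ c t : ℝ, b ≤ c → 0 ≤ t → Real.exp (-c * t) ≤ Real.exp (-b * t) := fun c t hc ht =>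
    Real.exp_le_exp.2 (by nlinarith)
  refine ⟨K, b, by rw [hK]; positivity, hb0, fun η₀ hη₀ hle η hη t ht x => ?_⟩
  have hf : 0 ≤ η₀⁻¹ * Real.exp ((lam η₀).re * t) := by positivity
  have hg : 0 ≤ Real.exp (-b * t) := Real.exp_nonneg _
  have fin : ∀ c, c ≤ K → c * Real.exp (-b * t) * ‖x‖ ≤
      K * (η₀⁻¹ * Real.exp ((lam η₀).re * t) + Real.exp (-b * t)) * ‖x‖ := fun c hc => by
    refine mul_le_mul_of_nonneg_right ?_ (norm_nonneg x)
    have h1 := mul_le_mul_of_nonneg_right hc hg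
    have h2 : 0 ≤ K * (η₀⁻¹ * Real.exp ((lam η₀).re * t)) :=
      mul_nonneg (by rw [hK]; positivity) hf
    linarith
  have hηa : |η₁| = η₁ := abs_of_pos hη₁
  rw [nonresFibre]
  split_ifs with h0
  · refine (hsmall η hη (by rw [hηa]; exact h0.trans hle) t ht x).trans (le_trans ?_ (fin C₃ ?_))
    · have := hexp _ t l1 ht
      gcongr
    · rw [hK]; linarith
  push Not at h0
  rw [one_apply_eq_self]
  rcases le_or_gt |η| η₁ with h1 | h1
  · have e : fibreSemigroup ha ha2 η t x = fibreSemigroup ha ha2 η t (x - resProj a η x) +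
        fibreSemigroup ha ha2 η t (resProj a η x) := by rw [← map_add, sub_add_cancel]
    rw [e]
    refine (norm_add_le _ _).trans ?_
    have i1 := hsmall η hη (by rwa [hηa]) t ht x
    have i2 := hres η hη (by rwa [hηa]) t ht x
    have i3 := hexp _ t l1 ht
    have i4 : |η|⁻¹ * Real.exp ((lam η).re * t) ≤ η₀⁻¹ * Real.exp ((lam η₀).re * t) := by
      have : (lam η).re ≤ (lam η₀).re := lam_re_anti (by rw [abs_of_pos hη₀]; exact h0.le)
      gcongr
    have i5 := mul_le_mul_of_nonneg_left i3 hC₃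
    have i6 := mul_le_mul_of_nonneg_left i4 hC₄
    have i7 : C₃ * Real.exp (-(a * (4 - a ^ 2)) * t) +
        C₄ * (|η|⁻¹ * Real.exp ((lam η).re * t)) ≤
        K * (η₀⁻¹ * Real.exp ((lam η₀).re * t) + Real.exp (-b * t)) := by
      rw [hK]
      have j1 : 0 ≤ (C₃ + K₂ + 1) * (η₀⁻¹ * Real.exp ((lam η₀).re * t)) := by positivity
      have j2 : 0 ≤ (C₄ + K₂ + 1) * Real.exp (-b * t) := by positivity
      linarith
    have i8 := mul_le_mul_of_nonneg_right i7 (norm_nonneg x)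
    linarith
  rcases le_or_gt |η| M with h2 | h2
  · refine (hmid η h1.le h2 t ht x).trans (le_trans ?_ (fin K₂ ?_))
    · have := hexp _ t l2 ht
      gcongr
    · rw [hK]; linarith
  · refine (hlarge η h2.le t ht x).trans (le_trans ?_ (fin 1 ?_))
    · have := hexp _ t l3 ht
      rw [one_mul]
      gcongr
    · rw [hK]; linarith

end KPII

namespace KPII

/-! ### Square integrable functions of two variables as vector valued functions -/

/-- The space `L²(ℝ²)`. -/
abbrev LtwoPlane : Type := Lp ℂ 2 (volume : Measure (ℝ × ℝ))

/-- The space `L²(ℝ; L²(ℝ))`. -/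
abbrev LtwoLtwo : Type := Lp Ltwo 2 (volume : Measure ℝ)

/-- In a second countable space every open set is a countable union of balls, and preimages of balls
are described by distances to their centres. -/
theorem measurable_of_measurable_edist {α E : Type*} [MeasurableSpace α] [PseudoEMetricSpace E]
    [SecondCountableTopology E] [MeasurableSpace E] [BorelSpace E] {f : α → E}
    (h : ∀ g, Measurable fun x => edist (f x) g) : Measurable f := by
  refine measurable_of_isOpen fun U hU => ?_
  choose! r hr hrU using fun u (hu : u ∈ U) => EMetric.isOpen_iff.1 hU u hu
  obtain ⟨T, hT, hTU⟩ := TopologicalSpace.isOpen_iUnion_countable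
    (fun u : U => Metric.eball (u : E) (r u)) fun u => Metric.isOpen_eball
  have e : U = ⋃ u ∈ T, Metric.eball (u : E) (r u) := by
    rw [hTU]
    refine Set.Subset.antisymm (fun u hu => Set.mem_iUnion.2 ⟨⟨u, hu⟩,
      Metric.mem_eball_self (hr u hu)⟩) (Set.iUnion_subset fun u => hrU u u.2)
  rw [e, Set.preimage_iUnion₂]
  refine MeasurableSet.biUnion hT fun u _ => ?_
  exact measurableSet_lt (h u) measurable_const

/-- The section `f(x, ·)` as an element of `L²(ℝ)`, zero if it is not square integrable. -/
def secLp (f : ℝ × ℝ → ℂ) (x : ℝ) : Ltwo :=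
  open Classical in if h : MemLp (fun y => f (x, y)) 2 volume then h.toLp _ else 0

theorem secLp_coe {f : ℝ × ℝ → ℂ} {x : ℝ} (h : MemLp (fun y => f (x, y)) 2 volume) :
    secLp f x =ᵐ[volume] fun y => f (x, y) := by
  rw [secLp, dif_pos h]; exact h.coeFn_toLp

theorem eLpNorm_two_eq {α E : Type*} [MeasurableSpace α] [NormedAddCommGroup E] (f : α → E)
    (μ : Measure α) : eLpNorm f 2 μ = (∫⁻ x, ‖f x‖ₑ ^ (2 : ℝ) ∂μ) ^ (1 / 2 : ℝ) := by
  rw [eLpNorm_eq_lintegral_rpow_enorm_toReal two_ne_zero ENNReal.ofNat_ne_top, ENNReal.toReal_ofNat]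

/-- The distance from a section to a fixed g is the root of an integral depending measurably on the
parameter by Tonelli; measurable distances suffice for measurability. -/
theorem stronglyMeasurable_secLp {f : ℝ × ℝ → ℂ} (hf : StronglyMeasurable f) :
    StronglyMeasurable (secLp f) := by
  let _ : MeasurableSpace Ltwo := borel Ltwo
  have : BorelSpace Ltwo := ⟨rfl⟩
  have hsec : ∀ x, StronglyMeasurable fun y => f (x, y) := fun x =>
    hf.comp_measurable measurable_prodMk_left
  have hm : ∀ g : ℝ → ℂ, StronglyMeasurable g →
      Measurable fun x => eLpNorm (fun y => f (x, y) - g y) 2 volume := fun g hg => by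
    simp only [eLpNorm_two_eq]
    refine Measurable.pow_const (Measurable.lintegral_prod_right' (f := fun z : ℝ × ℝ =>
      ‖f z - g z.2‖ₑ ^ (2 : ℝ)) ?_) _
    exact ((hf.sub (hg.comp_measurable measurable_snd)).enorm).pow_const _
  have hset : MeasurableSet {x | MemLp (fun y => f (x, y)) 2 volume} := by
    have := hm 0 stronglyMeasurable_zero
    have h2 := measurableSet_lt this (measurable_const (a := (∞ : ℝ≥0∞)))
    convert h2 using 1
    ext x
    simp only [Set.mem_ofPred_eq, Pi.zero_apply, sub_zero]
    exact ⟨fun h => h.2, fun h => ⟨(hsec x).aestronglyMeasurable, h⟩⟩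
  refine (measurable_of_measurable_edist fun g => ?_).stronglyMeasurable
  have e : (fun x => edist (secLp f x) g) = fun x => open Classical in
      if MemLp (fun y => f (x, y)) 2 volume then
        eLpNorm (fun y => f (x, y) - (Lp.aestronglyMeasurable g).mk g y) 2 volume
      else edist 0 g := by
    funext x
    rw [secLp]
    split_ifs with h
    · rw [Lp.edist_def]
      refine eLpNorm_congr_ae ?_
      filter_upwards [h.coeFn_toLp, (Lp.aestronglyMeasurable g).ae_eq_mk] with y h1 h2
      rw [Pi.sub_apply, h1, h2]
    · rfl
  rw [e]
  exact Measurable.ite hset (hm _ (Lp.aestronglyMeasurable g).stronglyMeasurable_mk)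
    measurable_const

/-- Null sections give a null set only for measurable sets, whence the passage to measurable
representatives. -/
theorem ae_eq_of_ae_ae_eq {f g : ℝ × ℝ → ℂ} (hf : AEStronglyMeasurable f volume)
    (hg : AEStronglyMeasurable g volume) (h : ∀ᵐ x, ∀ᵐ y, f (x, y) = g (x, y)) :
    f =ᵐ[volume] g := by
  have h1 := Measure.ae_ae_of_ae_prod hf.ae_eq_mk
  have h2 := Measure.ae_ae_of_ae_prod hg.ae_eq_mk
  have hm : MeasurableSet {z | hf.mk f z = hg.mk g z} :=
    hf.stronglyMeasurable_mk.measurableSet_eq_fun hg.stronglyMeasurable_mk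
  have h3 : ∀ᵐ z : ℝ × ℝ, hf.mk f z = hg.mk g z := by
    refine (Measure.ae_prod_iff_ae_ae hm).2 ?_
    filter_upwards [h, h1, h2] with x a1 a2 a3
    filter_upwards [a1, a2, a3] with y b1 b2 b3
    rw [← b2, ← b3, b1]
  filter_upwards [h3, hf.ae_eq_mk, hg.ae_eq_mk] with z a1 a2 a3
  rw [a2, a3, a1]

theorem lintegral_enorm_sec {f : ℝ × ℝ → ℂ} (hf : AEStronglyMeasurable f volume) :
    ∫⁻ z, ‖f z‖ₑ ^ (2 : ℝ) = ∫⁻ x, ∫⁻ y, ‖f (x, y)‖ₑ ^ (2 : ℝ) :=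
  lintegral_prod _ (hf.enorm.pow_const _)

theorem ae_memLp_sec {f : ℝ × ℝ → ℂ} (hf : MemLp f 2 volume) :
    ∀ᵐ x, MemLp (fun y => f (x, y)) 2 volume := by
  have h1 : ∫⁻ x, ∫⁻ y, ‖f (x, y)‖ₑ ^ (2 : ℝ) < ∞ := by
    rw [← lintegral_enorm_sec hf.1]
    exact (eLpNorm_lt_top_iff_lintegral_rpow_enorm_lt_top two_ne_zero ENNReal.ofNat_ne_top).1 hf.2
  have h2 := ae_lt_top' (AEMeasurable.lintegral_prod_right' (hf.1.enorm.pow_const _)) h1.ne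
  filter_upwards [h2, hf.1.prodMk_left] with x h3 h4
  exact ⟨h4, (eLpNorm_lt_top_iff_lintegral_rpow_enorm_lt_top two_ne_zero
    ENNReal.ofNat_ne_top).2 (by simpa using h3)⟩

theorem eLpNorm_secLp {f : ℝ × ℝ → ℂ} (hf : MemLp f 2 volume) :
    eLpNorm (secLp f) 2 volume = eLpNorm f 2 volume := by
  rw [eLpNorm_two_eq, eLpNorm_two_eq, lintegral_enorm_sec hf.1]
  congr 1
  refine lintegral_congr_ae ?_
  filter_upwards [ae_memLp_sec hf] with x hx
  rw [secLp, dif_pos hx, Lp.enorm_toLp, eLpNorm_two_eq, ← ENNReal.rpow_mul]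
  norm_num

theorem secLp_congr {f g : ℝ × ℝ → ℂ} (h : f =ᵐ[volume] g) : secLp f =ᵐ[volume] secLp g := by
  filter_upwards [Measure.ae_ae_of_ae_prod h] with x hx
  by_cases h1 : MemLp (fun y => f (x, y)) 2 volume
  · have h2 := (memLp_congr_ae hx).1 h1
    rw [secLp, dif_pos h1, secLp, dif_pos h2]
    exact MemLp.toLp_congr h1 h2 hx
  · have h2 := fun h => h1 ((memLp_congr_ae hx).2 h)
    rw [secLp, dif_neg h1, secLp, dif_neg h2]

theorem memLp_secLp {f : ℝ × ℝ → ℂ} (hf : MemLp f 2 volume) : MemLp (secLp f) 2 volume :=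
  ⟨(stronglyMeasurable_secLp hf.1.stronglyMeasurable_mk).aestronglyMeasurable.congr
    (secLp_congr hf.1.ae_eq_mk.symm), by rw [eLpNorm_secLp hf]; exact hf.2⟩

/-- Currying, as an isometry. -/
def curryLI : LtwoPlane →ₗᵢ[ℂ] LtwoLtwo where
  toFun f := (memLp_secLp (Lp.memLp f)).toLp _
  map_add' f g := by
    ext1
    filter_upwards [(memLp_secLp (Lp.memLp (f + g))).coeFn_toLp,
      (memLp_secLp (Lp.memLp f)).coeFn_toLp, (memLp_secLp (Lp.memLp g)).coeFn_toLp,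
      Lp.coeFn_add ((memLp_secLp (Lp.memLp f)).toLp _) ((memLp_secLp (Lp.memLp g)).toLp _),
      ae_memLp_sec (Lp.memLp f), ae_memLp_sec (Lp.memLp g), ae_memLp_sec (Lp.memLp (f + g)),
      Measure.ae_ae_of_ae_prod (Lp.coeFn_add f g)] with x h1 h2 h3 h4 h5 h6 h7 h8
    rw [h1, h4, Pi.add_apply, h2, h3]
    ext1
    filter_upwards [secLp_coe h5, secLp_coe h6, secLp_coe h7, h8,
      Lp.coeFn_add (secLp f x) (secLp g x)] with y k1 k2 k3 k4 k5
    rw [k3, k5, k4, Pi.add_apply, Pi.add_apply, k1, k2]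
  map_smul' c f := by
    ext1
    filter_upwards [(memLp_secLp (Lp.memLp (c • f))).coeFn_toLp,
      (memLp_secLp (Lp.memLp f)).coeFn_toLp,
      Lp.coeFn_smul c ((memLp_secLp (Lp.memLp f)).toLp _),
      ae_memLp_sec (Lp.memLp f), ae_memLp_sec (Lp.memLp (c • f)),
      Measure.ae_ae_of_ae_prod (Lp.coeFn_smul c f)] with x h1 h2 h4 h5 h7 h8
    rw [RingHom.id_apply, h1, h4, Pi.smul_apply, h2]
    ext1
    filter_upwards [secLp_coe h5, secLp_coe h7, h8,
      Lp.coeFn_smul c (secLp f x)] with y k1 k3 k4 k5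
    rw [k3, k5, k4, Pi.smul_apply, Pi.smul_apply, k1]
  norm_map' f := by
    change ‖(memLp_secLp (Lp.memLp f)).toLp _‖ = _
    rw [Lp.norm_toLp, eLpNorm_secLp (Lp.memLp f), Lp.norm_def]

theorem curryLI_coe (f : LtwoPlane) : ∀ᵐ x, curryLI f x =ᵐ[volume] fun y => f (x, y) := by
  filter_upwards [(memLp_secLp (Lp.memLp f)).coeFn_toLp, ae_memLp_sec (Lp.memLp f)] with x h1 h2
  change ((memLp_secLp (Lp.memLp f)).toLp _ : LtwoLtwo) x =ᵐ[volume] _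
  rw [h1]
  exact secLp_coe h2

/-- The function `g(x) h(y)`. -/
theorem memLp_tensor (g h : Ltwo) : MemLp (fun z : ℝ × ℝ => g z.1 * h z.2) 2 volume := by
  have hm : AEStronglyMeasurable (fun z : ℝ × ℝ => g z.1 * h z.2) volume :=
    ((Lp.aestronglyMeasurable g).comp_quasiMeasurePreserving Measure.quasiMeasurePreserving_fst).mul
      ((Lp.aestronglyMeasurable h).comp_quasiMeasurePreserving Measure.quasiMeasurePreserving_snd)
  refine ⟨hm, (eLpNorm_lt_top_iff_lintegral_rpow_enorm_lt_top two_ne_zero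
    ENNReal.ofNat_ne_top).2 ?_⟩
  have e : ∀ g : Ltwo, ∫⁻ x, ‖g x‖ₑ ^ (2 : ℝ) < ∞ := fun g => by
    have := (eLpNorm_lt_top_iff_lintegral_rpow_enorm_lt_top two_ne_zero
      ENNReal.ofNat_ne_top).1 (Lp.memLp g).2
    simpa using this
  have h1 := lintegral_prod_mul ((Lp.aestronglyMeasurable g).enorm.pow_const (2 : ℝ))
    ((Lp.aestronglyMeasurable h).enorm.pow_const (2 : ℝ))
  simp only [enorm_mul, ENNReal.toReal_ofNat]
  simp only [ENNReal.mul_rpow_of_nonneg _ _ (zero_le_two : (0 : ℝ) ≤ 2)]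
  exact h1.trans_lt (ENNReal.mul_lt_top (e g) (e h))

/-- The function `g(x) h(y)` in `L²(ℝ²)`. -/
def tensor (g h : Ltwo) : LtwoPlane := (memLp_tensor g h).toLp _

theorem tensor_coe (g h : Ltwo) : tensor g h =ᵐ[volume] fun z => g z.1 * h z.2 :=
  (memLp_tensor g h).coeFn_toLp

theorem curryLI_tensor (g h : Ltwo) : ∀ᵐ x, curryLI (tensor g h) x = g x • h := by
  filter_upwards [curryLI_coe (tensor g h), Measure.ae_ae_of_ae_prod (tensor_coe g h)] with x h1 h2
  ext1
  filter_upwards [h1, h2, Lp.coeFn_smul (g x) h] with y k1 k2 k3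
  rw [k1, k2, k3, Pi.smul_apply, smul_eq_mul]

theorem curryLI_tensor_indicator {A : Set ℝ} (hA : MeasurableSet A) (hμ : volume A ≠ ∞) (h : Ltwo) :
    curryLI (tensor (indicatorConstLp 2 hA hμ 1) h) = indicatorConstLp 2 hA hμ h := by
  ext1
  filter_upwards [curryLI_tensor (indicatorConstLp 2 hA hμ 1) h,
    indicatorConstLp_coeFn (p := 2) (hs := hA) (hμs := hμ) (c := (1 : ℂ)),
    indicatorConstLp_coeFn (p := 2) (hs := hA) (hμs := hμ) (c := h)] with x h1 h2 h3
  rw [h1, h2, h3]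
  by_cases hx : x ∈ A <;> simp [hx]

/-- The vector valued simple functions 1_A h are curried tensors, so tensors generate L²(ℝ; L²(ℝ)).
-/
theorem LtwoLtwo_induction {P : LtwoLtwo → Prop} (hcl : IsClosed {F | P F})
    (hadd : ∀ F G, P F → P G → P (F + G))
    (ht : ∀ g h, P (curryLI (tensor g h))) (F : LtwoLtwo) : P F := by
  refine Lp.induction ENNReal.ofNat_ne_top P ?_ ?_ hcl F
  · intro c s hs hμ
    have := ht (indicatorConstLp 2 hs hμ.ne 1) c
    rwa [curryLI_tensor_indicator] at this
  · intro f g hf hg _ h1 h2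
    exact hadd _ _ h1 h2

theorem curryLI_surjective : Function.Surjective curryLI := fun F => by
  refine LtwoLtwo_induction (P := fun F => ∃ f, curryLI f = F) ?_ ?_ (fun g h => ⟨_, rfl⟩) F
  · exact curryLI.isometry.isClosedEmbedding.isClosed_range
  · rintro _ _ ⟨f, rfl⟩ ⟨g, rfl⟩
    exact ⟨f + g, map_add _ _ _⟩

/-- Currying, as a unitary operator `L²(ℝ²) → L²(ℝ; L²(ℝ))`. -/
def curryL : LtwoPlane ≃ₗᵢ[ℂ] LtwoLtwo := LinearIsometryEquiv.ofSurjective curryLI curryLI_surjective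

theorem curryL_coe (f : LtwoPlane) : ∀ᵐ x, curryL f x =ᵐ[volume] fun y => f (x, y) := curryLI_coe f

theorem LtwoPlane_induction {P : LtwoPlane → Prop} (hcl : IsClosed {F | P F})
    (hadd : ∀ F G, P F → P G → P (F + G)) (ht : ∀ g h, P (tensor g h)) (F : LtwoPlane) : P F := by
  have := LtwoLtwo_induction (P := fun F => P (curryL.symm F))
    (hcl.preimage curryL.symm.continuous) (fun F G h1 h2 => by
      rw [map_add]; exact hadd _ _ h1 h2) (fun g h => by
      rw [show curryLI (tensor g h) = curryL (tensor g h) from rfl,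
        LinearIsometryEquiv.symm_apply_apply]; exact ht g h) (curryL F)
  rwa [LinearIsometryEquiv.symm_apply_apply] at this

/-- The exchange of the two variables. -/
def swapL : LtwoPlane →ₗᵢ[ℂ] LtwoPlane :=
  Lp.compMeasurePreservingₗᵢ ℂ Prod.swap (Measure.measurePreserving_swap)

theorem swapL_coe (f : LtwoPlane) : swapL f =ᵐ[volume] fun z => f z.swap :=
  Lp.coeFn_compMeasurePreserving f Measure.measurePreserving_swap

theorem swapL_swapL (f : LtwoPlane) : swapL (swapL f) = f := by
  ext1
  have h : ∀ᵐ z : ℝ × ℝ, swapL f z.swap = f z.swap.swap :=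
    (Measure.measurePreserving_swap (μ := (volume : Measure ℝ))
      (ν := (volume : Measure ℝ))).quasiMeasurePreserving.ae (swapL_coe f)
  filter_upwards [swapL_coe (swapL f), h] with z h1 h2
  rw [h1, h2, Prod.swap_swap]

theorem swapL_tensor (g h : Ltwo) : swapL (tensor g h) = tensor h g := by
  ext1
  have e : ∀ᵐ z : ℝ × ℝ, tensor g h z.swap = g z.swap.1 * h z.swap.2 :=
    (Measure.measurePreserving_swap (μ := (volume : Measure ℝ))
      (ν := (volume : Measure ℝ))).quasiMeasurePreserving.ae (tensor_coe g h)
  filter_upwards [swapL_coe (tensor g h), e, tensor_coe h g] with z h1 h2 h3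
  rw [h1, h2, h3, Prod.fst_swap, Prod.snd_swap, mul_comm]

/-- The action of an operator in the second variable. -/
def actSnd (A : Ltwo →L[ℂ] Ltwo) (f : LtwoPlane) : LtwoPlane :=
  curryL.symm (A.compLpL 2 volume (curryL f))

/-- The action of an operator in the first variable. -/
def actFst (A : Ltwo →L[ℂ] Ltwo) (f : LtwoPlane) : LtwoPlane := swapL (actSnd A (swapL f))

theorem curryL_actSnd (A : Ltwo →L[ℂ] Ltwo) (f : LtwoPlane) :
    ∀ᵐ x, curryL (actSnd A f) x = A (curryL f x) := by
  rw [actSnd, LinearIsometryEquiv.apply_symm_apply]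
  exact ContinuousLinearMap.coeFn_compLpL A _

theorem actSnd_tensor (A : Ltwo →L[ℂ] Ltwo) (g h : Ltwo) :
    actSnd A (tensor g h) = tensor g (A h) := by
  apply curryL.injective
  ext1
  filter_upwards [curryL_actSnd A (tensor g h), curryLI_tensor g h, curryLI_tensor g (A h)]
    with x h1 h2 h3
  rw [h1]
  refine (congrArg A h2).trans ?_
  rw [map_smul]
  exact h3.symm

theorem actSnd_add (A : Ltwo →L[ℂ] Ltwo) (f g : LtwoPlane) :
    actSnd A (f + g) = actSnd A f + actSnd A g := by
  simp only [actSnd, map_add]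

theorem actFst_add (A : Ltwo →L[ℂ] Ltwo) (f g : LtwoPlane) :
    actFst A (f + g) = actFst A f + actFst A g := by
  simp only [actFst, actSnd_add, map_add]

theorem continuous_actSnd (A : Ltwo →L[ℂ] Ltwo) : Continuous (actSnd A) :=
  curryL.symm.continuous.comp ((ContinuousLinearMap.continuous _).comp curryL.continuous)

theorem continuous_actFst (A : Ltwo →L[ℂ] Ltwo) : Continuous (actFst A) :=
  swapL.continuous.comp ((continuous_actSnd A).comp swapL.continuous)

theorem actFst_actSnd (A B : Ltwo →L[ℂ] Ltwo) (f : LtwoPlane) :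
    actFst A (actSnd B f) = actSnd B (actFst A f) := by
  refine LtwoPlane_induction (P := fun f => actFst A (actSnd B f) = actSnd B (actFst A f))
    (isClosed_eq ((continuous_actFst A).comp (continuous_actSnd B))
      ((continuous_actSnd B).comp (continuous_actFst A))) ?_ ?_ f
  · intro F G h1 h2
    rw [actSnd_add, actFst_add, actFst_add, actSnd_add, h1, h2]
  · intro g h
    simp only [actFst, actSnd_tensor, swapL_tensor]

theorem actSnd_actSnd {A B : Ltwo →L[ℂ] Ltwo} (h : ∀ u, A (B u) = u) (f : LtwoPlane) :
    actSnd A (actSnd B f) = f := by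
  apply curryL.injective
  ext1
  filter_upwards [curryL_actSnd A (actSnd B f), curryL_actSnd B f] with x h1 h2
  rw [h1, h2, h]

end KPII

namespace KPII

/-! ### The transverse Fourier decomposition of the weighted space -/

/-- The factor `e^{ax}`. -/
def wt (a : ℝ) (z : ℝ × ℝ) : ℂ := (Real.exp (a * z.1) : ℂ)

theorem continuous_wt (a : ℝ) : Continuous (wt a) :=
  Complex.continuous_ofReal.comp (Real.continuous_exp.comp (continuous_fst.const_mul a))

theorem wt_neg_mul (a : ℝ) (z : ℝ × ℝ) : wt (-a) z * wt a z = 1 := by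
  rw [wt, wt, ← Complex.ofReal_mul, ← Real.exp_add]; simp

theorem weight_ac (a : ℝ) : weight a ≪ volume := withDensity_absolutelyContinuous _ _

theorem ac_weight (a : ℝ) : (volume : Measure (ℝ × ℝ)) ≪ weight a :=
  withDensity_absolutelyContinuous' (by fun_prop) (Eventually.of_forall fun z =>
    (ENNReal.ofReal_pos.2 (Real.exp_pos _)).ne')

theorem ae_weight_iff {a : ℝ} {p : ℝ × ℝ → Prop} : (∀ᵐ z ∂(weight a), p z) ↔ ∀ᵐ z, p z :=
  ⟨fun h => (ac_weight a).ae_le h, fun h => (weight_ac a).ae_le h⟩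

theorem eLpNorm_wt (a : ℝ) (f : ℝ × ℝ → ℂ) :
    eLpNorm (fun z => wt a z * f z) 2 volume = eLpNorm f 2 (weight a) := by
  rw [eLpNorm_two_eq, eLpNorm_two_eq, weight,
    lintegral_withDensity_eq_lintegral_mul_non_measurable _ (by fun_prop)
      (Eventually.of_forall fun z => ENNReal.ofReal_lt_top)]
  congr 1
  refine lintegral_congr fun z => ?_
  rw [Pi.mul_apply, enorm_mul, ENNReal.mul_rpow_of_nonneg _ _ zero_le_two, wt,
    ← ofReal_norm, Complex.norm_real, Real.norm_of_nonneg (Real.exp_nonneg _),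
    ENNReal.ofReal_rpow_of_pos (Real.exp_pos _), ← Real.exp_mul]
  congr 3
  ring

theorem memLp_wt {a : ℝ} {f : ℝ × ℝ → ℂ} (hf : MemLp f 2 (weight a)) :
    MemLp (fun z => wt a z * f z) 2 volume :=
  ⟨(continuous_wt a).aestronglyMeasurable.mul (hf.1.mono_ac (ac_weight a)), by
    rw [eLpNorm_wt]; exact hf.2⟩

theorem memLp_wt_neg {a : ℝ} {f : ℝ × ℝ → ℂ} (hf : MemLp f 2 volume) :
    MemLp (fun z => wt (-a) z * f z) 2 (weight a) :=
  ⟨(continuous_wt (-a)).aestronglyMeasurable.mul (hf.1.mono_ac (weight_ac a)), by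
    rw [← eLpNorm_wt]
    refine lt_of_eq_of_lt (congrArg (fun g => eLpNorm g 2 volume) (funext fun z => ?_)) hf.2
    rw [← mul_assoc, mul_comm (wt a z), wt_neg_mul, one_mul]⟩

/-- Multiplication by `e^{ax}`, as an isometry. -/
def wtLI (a : ℝ) : X a →ₗᵢ[ℂ] LtwoPlane where
  toFun f := (memLp_wt (Lp.memLp f)).toLp _
  map_add' f g := by
    ext1
    filter_upwards [(memLp_wt (Lp.memLp (f + g))).coeFn_toLp, (memLp_wt (Lp.memLp f)).coeFn_toLp,
      (memLp_wt (Lp.memLp g)).coeFn_toLp, ae_weight_iff.1 (Lp.coeFn_add f g),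
      Lp.coeFn_add ((memLp_wt (Lp.memLp f)).toLp _) ((memLp_wt (Lp.memLp g)).toLp _)]
      with z h1 h2 h3 h4 h5
    rw [h1, h5, Pi.add_apply, h2, h3, h4, Pi.add_apply, mul_add]
  map_smul' c f := by
    ext1
    filter_upwards [(memLp_wt (Lp.memLp (c • f))).coeFn_toLp, (memLp_wt (Lp.memLp f)).coeFn_toLp,
      ae_weight_iff.1 (Lp.coeFn_smul c f), Lp.coeFn_smul c ((memLp_wt (Lp.memLp f)).toLp _)]
      with z h1 h2 h4 h5
    rw [RingHom.id_apply, h1, h5, Pi.smul_apply, h2, h4, Pi.smul_apply, smul_eq_mul, smul_eq_mul]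
    ring
  norm_map' f := by
    change ‖(memLp_wt (Lp.memLp f)).toLp _‖ = _
    rw [Lp.norm_toLp, eLpNorm_wt, Lp.norm_def]

theorem wtLI_coe {a : ℝ} (f : X a) : wtLI a f =ᵐ[volume] fun z => wt a z * f z :=
  (memLp_wt (Lp.memLp f)).coeFn_toLp

theorem wtLI_surjective (a : ℝ) : Function.Surjective (wtLI a) := fun F => by
  refine ⟨(memLp_wt_neg (a := a) (Lp.memLp F)).toLp _, ?_⟩
  ext1
  filter_upwards [wtLI_coe ((memLp_wt_neg (a := a) (Lp.memLp F)).toLp _),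
    ae_weight_iff.1 (memLp_wt_neg (a := a) (Lp.memLp F)).coeFn_toLp] with z h1 h2
  rw [h1, h2, ← mul_assoc, mul_comm (wt a z), wt_neg_mul, one_mul]

/-- The Fourier transform on `L²(ℝ)`. -/
def fourierL : Ltwo →L[ℂ] Ltwo :=
  (Lp.fourierTransformₗᵢ ℝ ℂ).toContinuousLinearEquiv.toContinuousLinearMap

theorem fourierL_apply (f : Ltwo) : fourierL f = 𝓕 f := rfl

/-- The inverse Fourier transform on `L²(ℝ)`. -/
def fourierInvL : Ltwo →L[ℂ] Ltwo :=
  (Lp.fourierTransformₗᵢ ℝ ℂ).symm.toContinuousLinearEquiv.toContinuousLinearMap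

theorem fourierL_fourierInvL (f : Ltwo) : fourierL (fourierInvL f) = f :=
  (Lp.fourierTransformₗᵢ ℝ ℂ).apply_symm_apply f

theorem norm_actSnd_fourierL (f : LtwoPlane) : ‖actSnd fourierL f‖ = ‖f‖ := by
  rw [actSnd, LinearIsometryEquiv.norm_map, ← curryL.norm_map f, Lp.norm_def, Lp.norm_def]
  congr 1
  refine eLpNorm_congr_norm_ae ?_
  filter_upwards [ContinuousLinearMap.coeFn_compLpL fourierL (curryL f)] with x hx
  rw [hx]
  exact (Lp.fourierTransformₗᵢ ℝ ℂ).norm_map _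

/-- The decomposition of the weighted space into transverse frequencies. -/
def freqLI (a : ℝ) : X a →ₗᵢ[ℂ] LtwoLtwo where
  toFun f := curryL (swapL (actSnd fourierL (wtLI a f)))
  map_add' f g := by rw [map_add, actSnd_add, map_add, map_add]
  map_smul' c f := by simp only [actSnd, map_smul, RingHom.id_apply]
  norm_map' f := by
    change ‖curryL (swapL (actSnd fourierL (wtLI a f)))‖ = _
    rw [LinearIsometryEquiv.norm_map, LinearIsometry.norm_map, norm_actSnd_fourierL,
      LinearIsometry.norm_map]

theorem freqLI_surjective (a : ℝ) : Function.Surjective (freqLI a) := fun F => by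
  obtain ⟨f, hf⟩ := wtLI_surjective a (actSnd fourierInvL (swapL (curryL.symm F)))
  refine ⟨f, ?_⟩
  change curryL (swapL (actSnd fourierL (wtLI a f))) = F
  rw [hf, actSnd_actSnd fourierL_fourierInvL, swapL_swapL, LinearIsometryEquiv.apply_symm_apply]

/-- The decomposition of the weighted space into transverse frequencies, as a unitary operator. -/
def freqL (a : ℝ) : X a ≃ₗᵢ[ℂ] LtwoLtwo :=
  LinearIsometryEquiv.ofSurjective (freqLI a) (freqLI_surjective a)

theorem freqL_apply {a : ℝ} (f : X a) :
    freqL a f = curryL (swapL (actSnd fourierL (wtLI a f))) := rfl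

/-- The sections of the frequency decomposition. -/
theorem freqL_coe {a : ℝ} (f : X a) :
    ∀ᵐ ξ, freqL a f ξ =ᵐ[volume] fun x => actSnd fourierL (wtLI a f) (x, ξ) := by
  filter_upwards [curryL_coe (swapL (actSnd fourierL (wtLI a f))),
    Measure.ae_ae_of_ae_prod (swapL_coe (actSnd fourierL (wtLI a f)))] with ξ h1 h2
  rw [freqL_apply]
  filter_upwards [h1, h2] with x k1 k2
  rw [k1, k2, Prod.swap_prod_mk]

/-- Operators in the first variable act fibrewise. -/
theorem curryL_swapL_actFst (A : Ltwo →L[ℂ] Ltwo) (f : LtwoPlane) :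
    ∀ᵐ ξ, curryL (swapL (actSnd fourierL (actFst A f))) ξ =
      A (curryL (swapL (actSnd fourierL f)) ξ) := by
  rw [← actFst_actSnd, actFst, swapL_swapL]
  exact curryL_actSnd A _

/-! ### Decomposable operators -/

/-- Carathéodory: (x, ξ) ↦ T ξ x is continuous in x and measurable in ξ, hence jointly measurable,
and can be composed with a measurable F. -/
theorem stronglyMeasurable_apply {T : ℝ → Ltwo →L[ℂ] Ltwo} (hT : ∀ x, StronglyMeasurable fun ξ => T ξ x)
    {F : ℝ → Ltwo} (hF : AEStronglyMeasurable F volume) :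
    AEStronglyMeasurable (fun ξ => T ξ (F ξ)) volume := by
  let _ : MeasurableSpace Ltwo := borel Ltwo
  have : BorelSpace Ltwo := ⟨rfl⟩
  have h1 : StronglyMeasurable (Function.uncurry fun (x : Ltwo) ξ => T ξ x) :=
    stronglyMeasurable_uncurry_of_continuous_of_stronglyMeasurable
      (fun ξ => (T ξ).continuous) hT
  obtain ⟨G, hG, hFG⟩ := hF
  refine ⟨fun ξ => T ξ (G ξ), h1.comp_measurable (hG.measurable.prodMk measurable_id), ?_⟩
  filter_upwards [hFG] with ξ h
  rw [h]

theorem memLp_decomp {T : ℝ → Ltwo →L[ℂ] Ltwo} (hT : ∀ x, StronglyMeasurable fun ξ => T ξ x) {C : ℝ}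
    (hC : ∀ᵐ ξ, ∀ x, ‖T ξ x‖ ≤ C * ‖x‖) (F : LtwoLtwo) :
    MemLp (fun ξ => T ξ (F ξ)) 2 volume :=
  (Lp.memLp F).of_le_mul (stronglyMeasurable_apply hT (Lp.aestronglyMeasurable F)) (by
    filter_upwards [hC] with ξ h
    exact h _)

/-- A bounded measurable family of operators. -/
structure IsBddFamily (T : ℝ → Ltwo →L[ℂ] Ltwo) (C : ℝ) : Prop where
  meas : ∀ x, StronglyMeasurable fun ξ => T ξ x
  bound : ∀ᵐ ξ, ∀ x, ‖T ξ x‖ ≤ C * ‖x‖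

/-- The decomposable operator given by a bounded measurable family. -/
def decomp {T : ℝ → Ltwo →L[ℂ] Ltwo} {C : ℝ} (hT : IsBddFamily T C) : LtwoLtwo →L[ℂ] LtwoLtwo :=
  LinearMap.mkContinuous
    { toFun := fun F => (memLp_decomp hT.meas hT.bound F).toLp _
      map_add' := fun F G => by
        ext1
        filter_upwards [(memLp_decomp hT.meas hT.bound (F + G)).coeFn_toLp,
          (memLp_decomp hT.meas hT.bound F).coeFn_toLp,
          (memLp_decomp hT.meas hT.bound G).coeFn_toLp, Lp.coeFn_add F G,
          Lp.coeFn_add ((memLp_decomp hT.meas hT.bound F).toLp _)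
            ((memLp_decomp hT.meas hT.bound G).toLp _)] with ξ h1 h2 h3 h4 h5
        rw [h1, h5, Pi.add_apply, h2, h3, h4, Pi.add_apply, map_add]
      map_smul' := fun c F => by
        ext1
        filter_upwards [(memLp_decomp hT.meas hT.bound (c • F)).coeFn_toLp,
          (memLp_decomp hT.meas hT.bound F).coeFn_toLp, Lp.coeFn_smul c F,
          Lp.coeFn_smul c ((memLp_decomp hT.meas hT.bound F).toLp _)] with ξ h1 h2 h4 h5
        rw [RingHom.id_apply, h1, h5, Pi.smul_apply, h2, h4, Pi.smul_apply, map_smul] }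
    C fun F => by
      refine Lp.norm_le_mul_norm_of_ae_le_mul ?_
      filter_upwards [(memLp_decomp hT.meas hT.bound F).coeFn_toLp, hT.bound] with ξ h1 h2
      exact (congrArg norm h1).trans_le (h2 _)

theorem decomp_coe {T : ℝ → Ltwo →L[ℂ] Ltwo} {C : ℝ} (hT : IsBddFamily T C) (F : LtwoLtwo) :
    ∀ᵐ ξ, decomp hT F ξ = T ξ (F ξ) := (memLp_decomp hT.meas hT.bound F).coeFn_toLp

/-- Dominated convergence in `L²`. -/
theorem tendsto_Lp_of_dominated {ι : Type*} {l : Filter ι} [l.IsCountablyGenerated]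
    {f : ι → LtwoLtwo} {F : ι → ℝ → Ltwo} {g h : LtwoLtwo} {C : ℝ} (hF : ∀ i, f i =ᵐ[volume] F i)
    (hb : ∀ᶠ i in l, ∀ᵐ ξ, ‖F i ξ - g ξ‖ ≤ C * ‖h ξ‖)
    (ht : ∀ᵐ ξ, Tendsto (fun i => F i ξ) l (𝓝 (g ξ))) : Tendsto f l (𝓝 g) := by
  rw [tendsto_iff_edist_tendsto_0]
  have e : ∀ i, edist (f i) g = (∫⁻ ξ, ‖F i ξ - g ξ‖ₑ ^ (2 : ℝ)) ^ (1 / 2 : ℝ) := fun i => by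
    rw [Lp.edist_def, eLpNorm_two_eq]
    congr 1
    refine lintegral_congr_ae ?_
    filter_upwards [hF i] with ξ hξ
    rw [Pi.sub_apply, hξ]
  simp only [e]
  have h0 : (0 : ℝ≥0∞) = (∫⁻ _ : ℝ, (0 : ℝ≥0∞)) ^ (1 / 2 : ℝ) := by simp
  rw [h0]
  refine (ENNReal.continuous_rpow_const.tendsto _).comp ?_
  have hmem : MemLp (fun ξ => C * ‖h ξ‖) 2 volume := (Lp.memLp h).norm.const_mul C
  refine tendsto_lintegral_filter_of_dominated_convergence'
    (fun ξ => ‖C * ‖h ξ‖‖ₑ ^ (2 : ℝ)) (Eventually.of_forall fun i => ?_) ?_ ?_ ?_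
  · exact ((((Lp.aestronglyMeasurable (f i)).congr (hF i)).sub
      (Lp.aestronglyMeasurable g)).enorm).pow_const _
  · filter_upwards [hb] with i hi
    filter_upwards [hi] with ξ hξ
    gcongr
    rw [← ofReal_norm, ← ofReal_norm]
    exact ENNReal.ofReal_le_ofReal (hξ.trans (le_abs_self _))
  · have := (eLpNorm_lt_top_iff_lintegral_rpow_enorm_lt_top two_ne_zero
      ENNReal.ofNat_ne_top).1 hmem.2
    exact (by simpa using this : _ < ∞).ne
  · filter_upwards [ht] with ξ hξ
    have h1 := (tendsto_iff_edist_tendsto_0.1 hξ)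
    have h2 := (ENNReal.continuous_rpow_const (y := (2 : ℝ)).tendsto _).comp h1
    rw [ENNReal.zero_rpow_of_pos two_pos] at h2
    refine h2.congr fun i => ?_
    rw [Function.comp_apply, edist_eq_enorm_sub]

end KPII

namespace KPII

/-! ### The semigroup on the direct integral -/

variable {a : ℝ}

/-- The second resolvent identity for the bounded perturbation 3(η'² − η²)J. All its factors are
bounded uniformly in the frequencies, which yields continuity in norm. -/
theorem fibre_resolvent_sub (ha : 0 < a) (ha2 : a < 2) {l : ℝ} (hl : growth a < l) (η η' : ℝ)
    (f : Ltwo) : (isQuasiDissipative_fibreGraph ha ha2 η).resolvent hl f -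
      (isQuasiDissipative_fibreGraph ha ha2 η').resolvent hl f =
      -((3 * (η' ^ 2 - η ^ 2) : ℂ) • (isQuasiDissipative_fibreGraph ha ha2 η').resolvent hl
        (resD a ((isQuasiDissipative_fibreGraph ha ha2 η).resolvent hl f))) := by
  set u := (isQuasiDissipative_fibreGraph ha ha2 η).resolvent hl f with hu
  have h1 := fibreGraph_shift (η' := η') ((isQuasiDissipative_fibreGraph ha ha2 η).resolvent_mem hl f)
  rw [← hu] at h1
  have h2 := (isQuasiDissipative_fibreGraph ha ha2 η').resolvent_apply hl h1
  have e : (l : ℂ) • u - ((l : ℂ) • u - f + (3 * (η' ^ 2 - η ^ 2) : ℂ) • resD a u) =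
      f - (3 * (η' ^ 2 - η ^ 2) : ℂ) • resD a u := by abel
  rw [e, map_sub, map_smul] at h2
  nth_rewrite 1 [← h2]
  abel

theorem continuous_fibre_resolvent (ha : 0 < a) (ha2 : a < 2) {l : ℝ} (hl : growth a < l) :
    Continuous fun η => (isQuasiDissipative_fibreGraph ha ha2 η).resolvent hl := by
  refine continuous_iff_continuousAt.2 fun η₀ => ?_
  refine tendsto_iff_norm_sub_tendsto_zero.2 ?_
  show Tendsto (fun η => ‖(isQuasiDissipative_fibreGraph ha ha2 η).resolvent hl -
    (isQuasiDissipative_fibreGraph ha ha2 η₀).resolvent hl‖) (𝓝 η₀) (𝓝 0)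
  have hpos : 0 ≤ 1 / (l - growth a) := by have := sub_pos.2 hl; positivity
  refine squeeze_zero (g := fun η : ℝ => ‖(3 * (η₀ ^ 2 - η ^ 2) : ℂ)‖ *
    (1 / (l - growth a) * (1 / a * (1 / (l - growth a))))) (fun η : ℝ => norm_nonneg ((isQuasiDissipative_fibreGraph ha ha2 η).resolvent hl -
      (isQuasiDissipative_fibreGraph ha ha2 η₀).resolvent hl)) (fun η => ?_) ?_
  · refine ContinuousLinearMap.opNorm_le_bound _ (by positivity) fun f => ?_
    rw [sub_apply, fibre_resolvent_sub ha ha2 hl η η₀, norm_neg, norm_smul, mul_assoc]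
    refine mul_le_mul_of_nonneg_left ?_ (norm_nonneg _)
    have R : ∀ η z, ‖(isQuasiDissipative_fibreGraph ha ha2 η).resolvent hl z‖ ≤
        1 / (l - growth a) * ‖z‖ := fun η z => (ContinuousLinearMap.le_opNorm _ _).trans
      (mul_le_mul_of_nonneg_right ((isQuasiDissipative_fibreGraph ha ha2 η).norm_resolvent_le hl)
        (norm_nonneg z))
    have J : ∀ z, ‖resD a z‖ ≤ 1 / a * ‖z‖ := fun z => by
      rw [div_mul_eq_mul_div, one_mul, le_div_iff₀ ha, mul_comm]; exact norm_resD_apply_le ha z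
    rw [mul_assoc, mul_assoc]
    exact (R _ _).trans (mul_le_mul_of_nonneg_left ((J _).trans
      (mul_le_mul_of_nonneg_left (R _ _) (by positivity))) hpos)
  · have : Continuous fun η : ℝ => ‖(3 * (η₀ ^ 2 - η ^ 2) : ℂ)‖ *
      (1 / (l - growth a) * (1 / a * (1 / (l - growth a)))) := by fun_prop
    have h := this.tendsto η₀
    rwa [sub_self, mul_zero, norm_zero, zero_mul] at h

/-- The semigroup is a pointwise limit of exponentials of Yosida approximations, each continuous in
the frequency. The factor 2π converts the Fourier variable ξ of Mathlib into η. -/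
theorem stronglyMeasurable_fibreSemigroup (ha : 0 < a) (ha2 : a < 2) {t : ℝ} (ht : 0 ≤ t)
    (x : Ltwo) : StronglyMeasurable fun ξ : ℝ => fibreSemigroup ha ha2 (2 * Real.pi * ξ) t x := by
  refine stronglyMeasurable_of_tendsto atTop (fun n => ?_) (tendsto_pi_nhds.2 fun ξ =>
    (isQuasiDissipative_fibreGraph ha ha2 (2 * Real.pi * ξ)).tendsto_semigroup ht x)
  refine Continuous.stronglyMeasurable ?_
  let _ : NormedAlgebra ℚ (Ltwo →L[ℂ] Ltwo) := NormedAlgebra.restrictScalars ℚ ℂ _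
  have h1 : Continuous fun ξ : ℝ =>
      (isQuasiDissipative_fibreGraph ha ha2 (2 * Real.pi * ξ)).approx n := by
    simp only [IsQuasiDissipative.approx, yosida]
    exact (((continuous_fibre_resolvent ha ha2 (IsQuasiDissipative.lt_shift (growth a) n)).comp
      (continuous_const.mul continuous_id)).const_smul (_ : ℂ)).sub continuous_const
  have h2 : Continuous fun ξ : ℝ => NormedSpace.exp ((t : ℂ) •
      (isQuasiDissipative_fibreGraph ha ha2 (2 * Real.pi * ξ)).approx n) :=
    NormedSpace.exp_continuous.comp (h1.const_smul (t : ℂ))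
  exact (h2.clm_apply continuous_const).const_smul (_ : ℂ)

theorem isBddFamily_fibreSemigroup (ha : 0 < a) (ha2 : a < 2) {t : ℝ} (ht : 0 ≤ t) :
    IsBddFamily (fun ξ => fibreSemigroup ha ha2 (2 * Real.pi * ξ) t) (Real.exp (growth a * t)) where
  meas := stronglyMeasurable_fibreSemigroup ha ha2 ht
  bound := Eventually.of_forall fun _ x => (ContinuousLinearMap.le_opNorm _ _).trans
    (mul_le_mul_of_nonneg_right ((isSemigroupOf_fibre ha ha2 _).norm_le t ht) (norm_nonneg x))

theorem isBddFamily_resolvent (ha : 0 < a) (ha2 : a < 2) {l : ℝ} (hl : growth a < l) :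
    IsBddFamily (fun ξ => (isQuasiDissipative_fibreGraph ha ha2 (2 * Real.pi * ξ)).resolvent hl)
      (1 / (l - growth a)) where
  meas _ := (((continuous_fibre_resolvent ha ha2 hl).comp
      (continuous_const.mul continuous_id)).clm_apply continuous_const).stronglyMeasurable
  bound := Eventually.of_forall fun _ x => (ContinuousLinearMap.le_opNorm _ _).trans
    (mul_le_mul_of_nonneg_right (IsQuasiDissipative.norm_resolvent_le _ hl) (norm_nonneg x))

/-- The semigroup of the linearized equation on the direct integral. -/
def freqSemigroup (ha : 0 < a) (ha2 : a < 2) (t : ℝ≥0) : LtwoLtwo →L[ℂ] LtwoLtwo :=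
  decomp (isBddFamily_fibreSemigroup ha ha2 t.coe_nonneg)

variable (ha : 0 < a) (ha2 : a < 2)

theorem freqSemigroup_coe (t : ℝ≥0) (F : LtwoLtwo) :
    ∀ᵐ ξ, freqSemigroup ha ha2 t F ξ = fibreSemigroup ha ha2 (2 * Real.pi * ξ) t (F ξ) :=
  decomp_coe _ F

theorem freqSemigroup_zero : freqSemigroup ha ha2 0 = ContinuousLinearMap.id ℂ _ := by
  ext1 F
  ext1
  filter_upwards [freqSemigroup_coe ha ha2 0 F] with ξ h
  rw [h, NNReal.coe_zero, (isSemigroupOf_fibre ha ha2 _).zero]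
  rfl

theorem freqSemigroup_add (s t : ℝ≥0) : freqSemigroup ha ha2 (s + t) =
    (freqSemigroup ha ha2 s).comp (freqSemigroup ha ha2 t) := by
  ext1 F
  ext1
  filter_upwards [freqSemigroup_coe ha ha2 (s + t) F, freqSemigroup_coe ha ha2 t F,
    freqSemigroup_coe ha ha2 s (freqSemigroup ha ha2 t F)] with ξ h1 h2 h3
  rw [h1, ContinuousLinearMap.comp_apply, h3, h2, NNReal.coe_add]
  exact DFunLike.congr_fun ((isSemigroupOf_fibre ha ha2 (2 * Real.pi * ξ)).add s t s.2 t.coe_nonneg) (F ξ)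

theorem norm_fibreSemigroup_le (η : ℝ) {s t : ℝ} (hs : 0 ≤ s) (hst : s ≤ t) (x : Ltwo) :
    ‖fibreSemigroup ha ha2 η s x‖ ≤ Real.exp (growth a * t) * ‖x‖ := by
  refine (ContinuousLinearMap.le_opNorm _ _).trans (mul_le_mul_of_nonneg_right
    (((isSemigroupOf_fibre ha ha2 η).norm_le s hs).trans ?_) (norm_nonneg x))
  have := growth_pos ha
  exact Real.exp_le_exp.2 (mul_le_mul_of_nonneg_left hst (by linarith))

theorem continuous_freqSemigroup (F : LtwoLtwo) :
    Continuous fun t : ℝ≥0 => freqSemigroup ha ha2 t F := by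
  refine continuous_iff_continuousAt.2 fun t₀ => ?_
  refine tendsto_Lp_of_dominated (h := F) (C := 2 * Real.exp (growth a * (t₀ + 1)))
    (F := fun (t : ℝ≥0) ξ => fibreSemigroup ha ha2 (2 * Real.pi * ξ) t (F ξ))
    (fun t => freqSemigroup_coe ha ha2 t F) ?_ ?_
  · have : ∀ᶠ t : ℝ≥0 in 𝓝 t₀, t < t₀ + 1 := Iio_mem_nhds (by simp)
    filter_upwards [this] with t ht
    filter_upwards [freqSemigroup_coe ha ha2 t₀ F] with ξ hξ
    rw [hξ]
    refine (norm_sub_le _ _).trans ?_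
    have h1 := norm_fibreSemigroup_le ha ha2 (2 * Real.pi * ξ) t.coe_nonneg
      (show (t : ℝ) ≤ t₀ + 1 by exact_mod_cast ht.le) (F ξ)
    have h2 := norm_fibreSemigroup_le ha ha2 (2 * Real.pi * ξ) t₀.coe_nonneg
      (show (t₀ : ℝ) ≤ t₀ + 1 by linarith) (F ξ)
    exact (add_le_add h1 h2).trans_eq (by ring)
  · filter_upwards [freqSemigroup_coe ha ha2 t₀ F] with ξ hξ
    rw [hξ]
    have h1 := (isSemigroupOf_fibre ha ha2 (2 * Real.pi * ξ)).cont (F ξ)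
    exact ((h1.comp_continuous NNReal.continuous_coe fun t : ℝ≥0 => t.coe_nonneg).tendsto t₀)

/-- Fibrewise the difference quotient is the mean of S(s)w(ξ) over [0, t], which converges to w(ξ)
and for t < 1 is dominated by a multiple of ‖w(ξ)‖. -/
theorem tendsto_of_mem_fibreGraph {u w : LtwoLtwo}
    (h : ∀ᵐ ξ, (u ξ, w ξ) ∈ fibreGraph a (2 * Real.pi * ξ)) :
    Tendsto (fun t : ℝ≥0 => ((t : ℝ) : ℂ)⁻¹ • (freqSemigroup ha ha2 t u - u)) (𝓝[>] 0) (𝓝 w) := by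
  refine tendsto_Lp_of_dominated (l := 𝓝[>] 0) (h := w) (C := Real.exp (growth a * 1) + 1)
    (F := fun (t : ℝ≥0) ξ => ((t : ℝ) : ℂ)⁻¹ • (fibreSemigroup ha ha2 (2 * Real.pi * ξ) t (u ξ) - u ξ))
    (fun t => ?_) ?_ ?_
  · filter_upwards [freqSemigroup_coe ha ha2 t u, Lp.coeFn_sub (freqSemigroup ha ha2 t u) u,
      Lp.coeFn_smul ((t : ℝ) : ℂ)⁻¹ (freqSemigroup ha ha2 t u - u)] with ξ h1 h2 h3
    rw [h3, Pi.smul_apply, h2, Pi.sub_apply, h1]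
  · have h1 : ∀ᶠ t : ℝ≥0 in 𝓝[>] 0, t < 1 := nhdsWithin_le_nhds (Iio_mem_nhds one_pos)
    filter_upwards [h1, self_mem_nhdsWithin] with t ht ht0
    have ht0' : 0 < (t : ℝ) := by exact_mod_cast ht0
    filter_upwards [h] with ξ hξ
    rw [(isSemigroupOf_fibre ha ha2 (2 * Real.pi * ξ)).integral _ _ hξ t t.coe_nonneg]
    refine (norm_sub_le _ _).trans ?_
    rw [add_mul, one_mul]
    refine add_le_add_left ?_ _
    have h2 := intervalIntegral.norm_integral_le_of_norm_le_const (a := 0) (b := (t : ℝ))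
      (f := fun s => fibreSemigroup ha ha2 (2 * Real.pi * ξ) s (w ξ))
      (C := Real.exp (growth a * 1) * ‖w ξ‖) (fun s hs => by
        rw [Set.uIoc_of_le t.coe_nonneg] at hs
        exact norm_fibreSemigroup_le ha ha2 _ hs.1.le (hs.2.trans (by exact_mod_cast ht.le)) _)
    rw [sub_zero, abs_of_pos ht0'] at h2
    rw [norm_smul, norm_inv, Complex.norm_real, Real.norm_of_nonneg t.coe_nonneg, inv_mul_le_iff₀ ht0',
      mul_comm (t : ℝ)]
    exact h2
  · filter_upwards [h] with ξ hξ
    have hS := isSemigroupOf_fibre ha ha2 (2 * Real.pi * ξ)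
    have h1 := hS.hasDerivWithinAt hξ le_rfl
    rw [hS.zero] at h1
    replace h1 := hasDerivWithinAt_iff_tendsto_slope.1 h1
    have h2 : Tendsto (fun t : ℝ≥0 => (t : ℝ)) (𝓝[>] 0) (𝓝[Set.Ici 0 \ {0}] (0 : ℝ)) := by
      refine tendsto_nhdsWithin_iff.2 ⟨?_, ?_⟩
      · exact (NNReal.continuous_coe.tendsto 0).mono_left nhdsWithin_le_nhds
      · filter_upwards [self_mem_nhdsWithin] with t ht
        exact ⟨t.coe_nonneg, fun h0 => (ne_of_gt ht) (by exact_mod_cast h0)⟩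
    refine (h1.comp h2).congr fun t => ?_
    simp only [Function.comp_apply, slope, vsub_eq_sub, sub_zero, hS.zero, one_apply_eq_self]
    rw [← Complex.ofReal_inv]
    exact (Complex.coe_smul _ _).symm

/-- The decomposed resolvent R commutes with the semigroup and maps into the domain. The difference
quotients of Ru then converge both to Rw and to lRu − u, and this equality is the fibrewise
description of the graph. -/
theorem mem_fibreGraph_of_tendsto {u w : LtwoLtwo}
    (h : Tendsto (fun t : ℝ≥0 => ((t : ℝ) : ℂ)⁻¹ • (freqSemigroup ha ha2 t u - u)) (𝓝[>] 0) (𝓝 w)) :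
    ∀ᵐ ξ, (u ξ, w ξ) ∈ fibreGraph a (2 * Real.pi * ξ) := by
  have hl : growth a < growth a + 1 := by linarith
  set R := decomp (isBddFamily_resolvent ha ha2 hl) with hR
  have R_coe : ∀ F : LtwoLtwo, ∀ᵐ ξ, R F ξ =
      (isQuasiDissipative_fibreGraph ha ha2 (2 * Real.pi * ξ)).resolvent hl (F ξ) :=
    fun F => decomp_coe _ F
  set l : ℂ := ((growth a + 1 : ℝ) : ℂ) with hldef
  have h1 : Tendsto (fun t : ℝ≥0 => ((t : ℝ) : ℂ)⁻¹ • (freqSemigroup ha ha2 t (R u) - R u))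
      (𝓝[>] 0) (𝓝 (l • R u - u)) := by
    refine tendsto_of_mem_fibreGraph ha ha2 ?_
    filter_upwards [R_coe u, Lp.coeFn_sub (l • R u) u, Lp.coeFn_smul l (R u)] with ξ k1 k2 k3
    rw [k2, Pi.sub_apply, k3, Pi.smul_apply, k1]
    exact IsQuasiDissipative.resolvent_mem _ hl _
  have h2 : Tendsto (fun t : ℝ≥0 => ((t : ℝ) : ℂ)⁻¹ • (freqSemigroup ha ha2 t (R u) - R u))
      (𝓝[>] 0) (𝓝 (R w)) := by
    refine ((R.continuous.tendsto w).comp h).congr fun t => ?_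
    rw [Function.comp_apply, map_smul, map_sub]
    congr 2
    ext1
    filter_upwards [R_coe u, R_coe (freqSemigroup ha ha2 t u), freqSemigroup_coe ha ha2 t u,
      freqSemigroup_coe ha ha2 t (R u)] with ξ k1 k2 k3 k4
    rw [k2, k3, k4, k1]
    exact (IsQuasiDissipative.semigroup_commute_resolvent _ hl t.coe_nonneg _).symm
  have h3 : R w = l • R u - u := tendsto_nhds_unique h2 h1
  filter_upwards [R_coe u, R_coe w, Lp.coeFn_sub (l • R u) u, Lp.coeFn_smul l (R u)]
    with ξ k1 k2 k3 k4
  refine IsQuasiDissipative.mem_of_resolvent (isQuasiDissipative_fibreGraph ha ha2 _) hl ?_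
  rw [map_sub, map_smul, ← k1, ← k2, h3, k3, Pi.sub_apply, k4, Pi.smul_apply, sub_sub_cancel]

/-- The semigroup of the linearized equation on the weighted space. -/
def kpSemigroup (t : ℝ≥0) : X a →L[ℂ] X a :=
  (freqL a).symm.toContinuousLinearEquiv.toContinuousLinearMap ∘L freqSemigroup ha ha2 t ∘L
    (freqL a).toContinuousLinearEquiv.toContinuousLinearMap

theorem kpSemigroup_apply (t : ℝ≥0) (f : X a) :
    kpSemigroup ha ha2 t f = (freqL a).symm (freqSemigroup ha ha2 t (freqL a f)) := rfl

theorem freqL_kpSemigroup (t : ℝ≥0) (f : X a) :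
    freqL a (kpSemigroup ha ha2 t f) = freqSemigroup ha ha2 t (freqL a f) :=
  (freqL a).apply_symm_apply _

theorem isLinearizedKPSemigroup_of (hgen : ∀ u w : X a, IsLinearizedKP u w ↔
    ∀ᵐ ξ, (freqL a u ξ, freqL a w ξ) ∈ fibreGraph a (2 * Real.pi * ξ)) :
    IsLinearizedKPSemigroup a (kpSemigroup ha ha2) where
  map_zero := by
    ext1 f
    rw [kpSemigroup_apply, freqSemigroup_zero]
    exact (freqL a).symm_apply_apply f
  map_add s t := by
    ext1 f
    rw [ContinuousLinearMap.comp_apply, kpSemigroup_apply, kpSemigroup_apply, freqL_kpSemigroup,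
      freqSemigroup_add]
    rfl
  continuous f := (freqL a).symm.continuous.comp (continuous_freqSemigroup ha ha2 (freqL a f))
  generator u w := by
    have e : ∀ t : ℝ≥0, freqL a ((t : ℝ)⁻¹ • (kpSemigroup ha ha2 t u - u)) =
        ((t : ℝ) : ℂ)⁻¹ • (freqSemigroup ha ha2 t (freqL a u) - freqL a u) := fun t => by
      rw [← freqL_kpSemigroup, ← map_sub, ← map_smul, ← Complex.ofReal_inv]
      exact congrArg _ (Complex.coe_smul _ _).symm
    rw [hgen]
    constructor
    · intro h
      have h1 := ((freqL a).symm.continuous.tendsto _).comp (tendsto_of_mem_fibreGraph ha ha2 h)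
      rw [LinearIsometryEquiv.symm_apply_apply] at h1
      refine h1.congr fun t => ?_
      rw [Function.comp_apply, ← e, LinearIsometryEquiv.symm_apply_apply]
    · intro h
      refine mem_fibreGraph_of_tendsto ha ha2 ?_
      exact (((freqL a).continuous.tendsto _).comp h).congr e

end KPII

namespace KPII

/-! ### Test functions on the line -/

/-- Smooth compactly supported functions on the line. -/
structure IsTest (θ : ℝ → ℂ) : Prop where
  smooth : ContDiff ℝ ((⊤ : ℕ∞) : WithTop ℕ∞) θ
  supp : HasCompactSupport θ

namespace IsTest
variable {θ θ' : ℝ → ℂ}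

theorem memLp (h : IsTest θ) (p : ℝ≥0∞) : MemLp θ p volume :=
  (h.supp.toSchwartzMap h.smooth).memLp p volume

theorem integrable (h : IsTest θ) : Integrable θ := memLp_one_iff_integrable.1 (h.memLp 1)

theorem fourier_memLp (h : IsTest θ) (p : ℝ≥0∞) : MemLp (𝓕 θ) p volume :=
  (𝓕 (h.supp.toSchwartzMap h.smooth)).memLp p volume

theorem deriv (h : IsTest θ) : IsTest (deriv θ) where
  smooth := (contDiff_infty_iff_deriv.1 h.smooth).2
  supp := h.supp.deriv

theorem differentiable (h : IsTest θ) : Differentiable ℝ θ := (contDiff_infty_iff_deriv.1 h.smooth).1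

theorem hasDerivAt (h : IsTest θ) (x : ℝ) : HasDerivAt θ (_root_.deriv θ x) x :=
  (h.differentiable x).hasDerivAt

theorem fourier_deriv (h : IsTest θ) (ξ : ℝ) :
    𝓕 (_root_.deriv θ) ξ = 2 * Real.pi * Complex.I * ξ * 𝓕 θ ξ := by
  exact congrFun (Real.fourier_deriv h.integrable h.differentiable h.deriv.integrable) ξ

theorem translate (h : IsTest θ) (s : ℝ) : IsTest fun x => θ (x + s) where
  smooth := h.smooth.comp (contDiff_id.add contDiff_const)
  supp := h.supp.comp_homeomorph (Homeomorph.addRight s)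

theorem add (h : IsTest θ) (h' : IsTest θ') : IsTest fun x => θ x + θ' x where
  smooth := h.smooth.add h'.smooth
  supp := h.supp.add h'.supp

theorem mul_left (h : IsTest θ) {m : ℝ → ℂ} (hm : ContDiff ℝ ((⊤ : ℕ∞) : WithTop ℕ∞) m) :
    IsTest fun x => m x * θ x where
  smooth := hm.mul h.smooth
  supp := h.supp.mul_left

end IsTest

theorem fourier_eq_integral (f : ℝ → ℂ) (ξ : ℝ) :
    𝓕 f ξ = ∫ x : ℝ, Complex.exp (-(2 * Real.pi * x * ξ) * Complex.I) * f x := by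
  rw [Real.fourier_eq']
  congr 1
  funext x
  rw [smul_eq_mul]
  congr 2
  simp
  ring

theorem fourier_translate (f : ℝ → ℂ) (s ξ : ℝ) : 𝓕 (fun x => f (x + s)) ξ =
    Complex.exp (2 * Real.pi * s * ξ * Complex.I) * 𝓕 f ξ := by
  rw [fourier_eq_integral, fourier_eq_integral, ← integral_const_mul,
    ← integral_add_right_eq_self (fun x : ℝ => Complex.exp (2 * Real.pi * s * ξ * Complex.I) *
      (Complex.exp (-(2 * Real.pi * x * ξ) * Complex.I) * f x)) s]
  refine integral_congr_ae (Eventually.of_forall fun x => ?_)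
  simp only
  rw [← mul_assoc, ← Complex.exp_add]
  congr 2
  push_cast
  ring

theorem ae_eq_zero_of_fourier {G : ℝ → ℂ} (h1 : Integrable G) (h2 : MemLp G 2 volume)
    (h : ∀ s, 𝓕 G s = 0) : ∀ᵐ ξ, G ξ = 0 := by
  have e : h2.toLp G = 0 := by
    apply fourier_injective
    rw [show 𝓕 (0 : Ltwo) = 0 from map_zero (Lp.fourierTransformₗᵢ ℝ ℂ)]
    ext1
    filter_upwards [fourier_toLp_ae h1 h2, Lp.coeFn_zero ℂ 2 (volume : Measure ℝ)] with x k1 k2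
    rw [k1, k2, h, Pi.zero_apply]
  filter_upwards [h2.coeFn_toLp, Lp.coeFn_zero ℂ 2 (volume : Measure ℝ)] with x k1 k2
  rw [← k1, e, k2, Pi.zero_apply]

/-- Test functions approximating the Dirac mass. -/
def diracBump (n : ℕ) : ContDiffBump (0 : ℝ) where
  rIn := 1 / (n + 2)
  rOut := 1 / (n + 1)
  rIn_pos := by positivity
  rIn_lt_rOut := by gcongr; norm_num

theorem isTest_diracBump (n : ℕ) : IsTest fun x => ((diracBump n).normed volume x : ℂ) where
  smooth := Complex.ofRealCLM.contDiff.comp (diracBump n).contDiff_normed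
  supp := (diracBump n).hasCompactSupport_normed.comp_left Complex.ofReal_zero

theorem tendsto_fourier_diracBump (ξ : ℝ) :
    Tendsto (fun n => 𝓕 (fun x => ((diracBump n).normed volume x : ℂ)) ξ) atTop (𝓝 1) := by
  have h := ContDiffBump.convolution_tendsto_right_of_continuous (φ := diracBump) (l := atTop)
    (μ := (volume : Measure ℝ)) (g := fun t : ℝ => Complex.exp (2 * Real.pi * t * ξ * Complex.I))
    (tendsto_one_div_add_atTop_nhds_zero_nat) (by fun_prop) 0
  simp only [Complex.ofReal_zero, mul_zero, zero_mul, Complex.exp_zero] at h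
  refine h.congr fun n => ?_
  rw [convolution_def, fourier_eq_integral]
  congr 1
  funext t
  rw [ContinuousLinearMap.lsmul_apply, Complex.real_smul, mul_comm]
  congr 2
  push_cast
  ring

/-- A function on the frequency side is determined by its pairings with test functions. -/
theorem ae_eq_zero_of_forall_test {b : ℝ → ℂ}
    (hb : ∀ θ, IsTest θ → Integrable fun ξ => (starRingEnd ℂ) (𝓕 θ ξ) * b ξ)
    (hb2 : ∀ θ, IsTest θ → MemLp (fun ξ => (starRingEnd ℂ) (𝓕 θ ξ) * b ξ) 2 volume)
    (h : ∀ θ, IsTest θ → ∫ ξ, (starRingEnd ℂ) (𝓕 θ ξ) * b ξ = 0) : ∀ᵐ ξ, b ξ = 0 := by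
  have h1 : ∀ n, ∀ᵐ ξ, (starRingEnd ℂ) (𝓕 (fun x => ((diracBump n).normed volume x : ℂ)) ξ) * b ξ = 0 :=
    fun n => by
    have hn := isTest_diracBump n
    -- Translating the test function multiplies its transform by a character, so the vanishing
    -- pairings say that the Fourier transform of the product is zero.
    refine ae_eq_zero_of_fourier (hb _ hn) (hb2 _ hn) fun s => ?_
    rw [← h _ (hn.translate s), fourier_eq_integral]
    congr 1
    funext ξ
    rw [fourier_translate (fun x => ((diracBump n).normed volume x : ℂ)), map_mul, ← Complex.exp_conj, ← mul_assoc]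
    congr 3
    simp only [map_mul, Complex.conj_I, Complex.conj_ofReal, map_ofNat]
    ring
  filter_upwards [ae_all_iff.2 h1] with ξ hξ
  -- If b(ξ) ≠ 0, all transforms of the bumps would vanish at ξ, but they tend to 1.
  by_contra hne
  have h2 : ∀ n, 𝓕 (fun x => ((diracBump n).normed volume x : ℂ)) ξ = 0 := fun n => by
    simpa [hne] using hξ n
  have h3 := tendsto_fourier_diracBump ξ
  simp only [h2] at h3
  exact zero_ne_one (tendsto_nhds_unique tendsto_const_nhds h3)

theorem inner_eq_fourier_integral {p : ℝ → ℂ} (hp : IsTest p) (B : Ltwo) :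
    inner ℂ ((hp.memLp 2).toLp p) B = ∫ ξ, (starRingEnd ℂ) (𝓕 p ξ) * (𝓕 B : Ltwo) ξ := by
  rw [← Lp.inner_fourier_eq, L2.inner_def]
  refine integral_congr_ae ?_
  filter_upwards [fourier_toLp_ae hp.integrable (hp.memLp 2)] with ξ h
  rw [RCLike.inner_apply, h, mul_comm]

theorem integrable_conj_mul {f g : ℝ → ℂ} (hf : MemLp f 2 volume) (hg : MemLp g 2 volume) :
    Integrable fun ξ => (starRingEnd ℂ) (f ξ) * g ξ :=
  MemLp.integrable_mul hf.star hg

theorem memLp_conj_mul {f g : ℝ → ℂ} (hf : MemLp f ∞ volume) (hg : MemLp g 2 volume) :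
    MemLp (fun ξ => (starRingEnd ℂ) (f ξ) * g ξ) 2 volume :=
  hg.mul hf.star

/-- `(∂ₓ + a) θ`. -/
def wder (a : ℝ) (θ : ℝ → ℂ) (x : ℝ) : ℂ := deriv θ x + a * θ x

theorem IsTest.wder {θ : ℝ → ℂ} (h : IsTest θ) (a : ℝ) : IsTest (wder a θ) :=
  h.deriv.add (h.mul_left contDiff_const)

theorem IsTest.fourier_wder {θ : ℝ → ℂ} (h : IsTest θ) (a ξ : ℝ) :
    𝓕 (KPII.wder a θ) ξ = (2 * Real.pi * Complex.I * ξ + a) * 𝓕 θ ξ := by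
  rw [add_mul, ← h.fourier_deriv]
  have e : ∀ x : ℝ, ‖Complex.exp (-(2 * Real.pi * x * ξ) * Complex.I)‖ ≤ 1 := fun x => by
    rw [show (-(2 * Real.pi * x * ξ) * Complex.I : ℂ) = ((-(2 * Real.pi * x * ξ) : ℝ) : ℂ) * Complex.I
      by push_cast; ring, Complex.norm_exp_ofReal_mul_I]
  have hi : ∀ {f : ℝ → ℂ}, Integrable f →
      Integrable fun x : ℝ => Complex.exp (-(2 * Real.pi * x * ξ) * Complex.I) * f x := fun hf =>
    hf.bdd_mul (c := 1) (Continuous.aestronglyMeasurable (by fun_prop)) (Eventually.of_forall e)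
  rw [fourier_eq_integral, fourier_eq_integral, fourier_eq_integral, ← integral_const_mul,
    ← integral_add (hi h.deriv.integrable) ((hi h.integrable).const_mul _)]
  congr 1
  funext x
  rw [KPII.wder]
  ring

/-- The functions `(∂ₓ + a)³ θ` with `θ` a test function are total in `L²`. -/
theorem eq_zero_of_inner_wder {a : ℝ} (ha : a ≠ 0) {B : Ltwo}
    (h : ∀ θ (hθ : IsTest θ), inner ℂ (((((hθ.wder a).wder a).wder a).memLp 2).toLp _) B = 0) :
    B = 0 := by
  have e : ∀ θ (hθ : IsTest θ) ξ, (starRingEnd ℂ) (𝓕 θ ξ) *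
      ((starRingEnd ℂ) ((2 * Real.pi * Complex.I * ξ + a) ^ 3) * (𝓕 B : Ltwo) ξ) =
      (starRingEnd ℂ) (𝓕 (wder a (wder a (wder a θ))) ξ) * (𝓕 B : Ltwo) ξ := fun θ hθ ξ => by
    rw [((hθ.wder a).wder a).fourier_wder, (hθ.wder a).fourier_wder, hθ.fourier_wder]
    simp only [map_mul, map_pow]
    ring
  have h1 : ∀ᵐ ξ : ℝ, (starRingEnd ℂ) ((2 * Real.pi * Complex.I * ξ + a : ℂ) ^ 3) * (𝓕 B : Ltwo) ξ = 0 := by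
    refine ae_eq_zero_of_forall_test (fun θ hθ => ?_) (fun θ hθ => ?_) (fun θ hθ => ?_)
    · simp only [e θ hθ]
      exact integrable_conj_mul ((((hθ.wder a).wder a).wder a).fourier_memLp 2) (Lp.memLp _)
    · simp only [e θ hθ]
      exact memLp_conj_mul ((((hθ.wder a).wder a).wder a).fourier_memLp ∞) (Lp.memLp _)
    · simp only [e θ hθ]
      rw [← h θ hθ, inner_eq_fourier_integral (((hθ.wder a).wder a).wder a)]
  apply fourier_injective
  rw [show 𝓕 (0 : Ltwo) = 0 from map_zero (Lp.fourierTransformₗᵢ ℝ ℂ)]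
  ext1
  filter_upwards [h1, Lp.coeFn_zero ℂ 2 (volume : Measure ℝ)] with ξ k1 k2
  rw [k2, Pi.zero_apply]
  refine (mul_eq_zero.1 k1).resolve_left ?_
  have := symbol_ne_zero (neg_ne_zero.2 ha) ξ
  rw [Complex.ofReal_neg, sub_neg_eq_add] at this
  rw [map_eq_zero]
  exact pow_ne_zero 3 this

/-- The graph of the linearized operator in terms of bounded operators. -/
theorem mem_fibreGraph_iff {a : ℝ} (ha : 0 < a) {η : ℝ} {u w : Ltwo} : (u, w) ∈ fibreGraph a η ↔
    resD a (resD a (resD a w)) = -u + (4 : ℂ) • resD a (resD a u) - (6 : ℂ) • resD a (resD a (pot • u))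
      + (3 * (η : ℂ) ^ 2) • resD a (resD a (resD a (resD a u))) := by
  have key : ∀ g, resD a (resD a (resD a (genMap a η g))) = -resD a (resD a (resD a g)) +
      (4 : ℂ) • resD a (resD a (resD a (resD a (resD a g)))) -
      (6 : ℂ) • resD a (resD a (pot • resD a (resD a (resD a g)))) +
      (3 * (η : ℂ) ^ 2) • resD a (resD a (resD a (resD a (resD a (resD a (resD a g)))))) := fun g => by
    have h1 := (isTower a g).isD_genMap (η := η) ha
    rw [IsD] at h1
    have h2 : (12 * 𝐓 ^ 2 - 8 : Polynomial ℂ) • resD a (resD a (resD a g)) =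
        (4 : ℂ) • resD a (resD a (resD a g)) - (6 : ℂ) • (pot • resD a (resD a (resD a g))) := by
      simp only [pot, csmul_eq]
      rw [show (Polynomial.C 4 : Polynomial ℂ) = 4 from rfl,
        show (Polynomial.C 6 : Polynomial ℂ) = 6 from rfl]
      module
    have h3 : (3 * ceta η ^ 2 : Polynomial ℂ) • resD a (resD a (resD a (resD a (resD a g)))) =
        (3 * (η : ℂ) ^ 2) • resD a (resD a (resD a (resD a (resD a g)))) := by
      rw [csmul_eq, Polynomial.C_mul, Polynomial.C_pow]
      rfl
    rw [h1, h2, h3]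
    simp only [map_add, map_neg, map_sub, map_smul]
    module
  rw [mem_fibreGraph]
  constructor
  · rintro ⟨g, rfl, rfl⟩
    exact key g
  · intro h
    -- The hypothesis reads u = J²h₁ for this h₁, so u is in the domain of D. Then φu is too, all
    -- terms of h₁ are in the range of J, and u is in the range of J³.
    obtain ⟨h₁, hh₁⟩ : ∃ z, z = (4 : ℂ) • u - (6 : ℂ) • (pot • u) +
      (3 * (η : ℂ) ^ 2) • resD a (resD a u) - resD a w := ⟨_, rfl⟩
    have hu : u = resD a (resD a h₁) := by
      rw [hh₁]
      simp only [map_add, map_sub, map_smul]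
      rw [h]
      module
    have hJ : IsD a (pot • u) (pot • resD a h₁ + pder pot • u) :=
      IsD.psmul ha pot hu.symm
    obtain ⟨g, hg⟩ : ∃ g, resD a g = h₁ := by
      refine ⟨(4 : ℂ) • resD a h₁ - (6 : ℂ) • (pot • resD a h₁ + pder pot • u) +
        (3 * (η : ℂ) ^ 2) • resD a u - w, ?_⟩
      rw [IsD] at hJ
      rw [map_sub, map_add, map_sub, map_smul, map_smul, map_smul, hJ, ← hu, hh₁]
    refine ⟨g, by rw [hg, hu], ?_⟩
    have ha' := ha.ne'
    refine resD_injective ha' (resD_injective ha' (resD_injective ha' ?_))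
    rw [key, h, hg, ← hu]

end KPII

namespace KPII

/-! ### Test functions on the plane -/

/-- Smooth compactly supported functions on the plane. -/
structure IsPlaneTest (ψ : ℝ × ℝ → ℂ) : Prop where
  smooth : ContDiff ℝ ((⊤ : ℕ∞) : WithTop ℕ∞) ψ
  supp : HasCompactSupport ψ

/-- The derivative in the first variable. -/
def derFst (ψ : ℝ × ℝ → ℂ) (z : ℝ × ℝ) : ℂ := deriv (fun s => ψ (s, z.2)) z.1

/-- The derivative in the second variable. -/
def derSnd (ψ : ℝ × ℝ → ℂ) (z : ℝ × ℝ) : ℂ := deriv (fun s => ψ (z.1, s)) z.2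

/-- The function `e^{-ax} conj ψ`. -/
def twist (a : ℝ) (ψ : ℝ × ℝ → ℂ) (z : ℝ × ℝ) : ℂ := wt (-a) z * (starRingEnd ℂ) (ψ z)

namespace IsPlaneTest
variable {ψ : ℝ × ℝ → ℂ}

theorem differentiable (h : IsPlaneTest ψ) : Differentiable ℝ ψ :=
  (contDiff_infty_iff_fderiv.1 h.smooth).1

theorem fst (h : IsPlaneTest ψ) (y : ℝ) : IsTest fun x => ψ (x, y) where
  smooth := h.smooth.comp (contDiff_id.prodMk contDiff_const)
  supp := HasCompactSupport.intro (h.supp.isCompact.image continuous_fst) fun x hx => by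
    by_contra h0
    exact hx ⟨(x, y), subset_tsupport _ h0, rfl⟩

theorem snd (h : IsPlaneTest ψ) (x : ℝ) : IsTest fun y => ψ (x, y) where
  smooth := h.smooth.comp (contDiff_const.prodMk contDiff_id)
  supp := HasCompactSupport.intro (h.supp.isCompact.image continuous_snd) fun y hy => by
    by_contra h0
    exact hy ⟨(x, y), subset_tsupport _ h0, rfl⟩

theorem derFst_eq (h : IsPlaneTest ψ) : derFst ψ = fun z => fderiv ℝ ψ z (1, 0) := by
  funext z
  refine HasDerivAt.deriv ?_
  exact (h.differentiable (z.1, z.2)).hasFDerivAt.comp_hasDerivAt z.1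
    ((hasDerivAt_id z.1).prodMk (hasDerivAt_const z.1 z.2))

theorem derSnd_eq (h : IsPlaneTest ψ) : derSnd ψ = fun z => fderiv ℝ ψ z (0, 1) := by
  funext z
  refine HasDerivAt.deriv ?_
  exact (h.differentiable (z.1, z.2)).hasFDerivAt.comp_hasDerivAt z.2
    ((hasDerivAt_const z.2 z.1).prodMk (hasDerivAt_id z.2))

theorem derFst (h : IsPlaneTest ψ) : IsPlaneTest (derFst ψ) := by
  rw [h.derFst_eq]
  exact ⟨(contDiff_infty_iff_fderiv.1 h.smooth).2.clm_apply contDiff_const, h.supp.fderiv_apply ℝ _⟩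

theorem derSnd (h : IsPlaneTest ψ) : IsPlaneTest (derSnd ψ) := by
  rw [h.derSnd_eq]
  exact ⟨(contDiff_infty_iff_fderiv.1 h.smooth).2.clm_apply contDiff_const, h.supp.fderiv_apply ℝ _⟩

theorem twist (h : IsPlaneTest ψ) (a : ℝ) : IsPlaneTest (twist a ψ) where
  smooth := by
    refine ContDiff.mul ?_ (Complex.conjCLE.contDiff.comp h.smooth)
    exact Complex.ofRealCLM.contDiff.comp (Real.contDiff_exp.comp (contDiff_const.mul contDiff_fst))
  supp := (h.supp.comp_left (map_zero (starRingEnd ℂ))).mul_left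

theorem memLp (h : IsPlaneTest ψ) : MemLp ψ 2 volume :=
  h.smooth.continuous.memLp_of_hasCompactSupport h.supp

/-- The class of a test function in `L²`. -/
def vec (h : IsPlaneTest ψ) : LtwoPlane := h.memLp.toLp ψ

theorem vec_coe (h : IsPlaneTest ψ) : h.vec =ᵐ[volume] ψ := h.memLp.coeFn_toLp

end IsPlaneTest

/-! ### The transverse Fourier transform -/

/-- The decomposition into transverse frequencies. -/
def planeFreq : LtwoPlane →ₗᵢ[ℂ] LtwoLtwo where
  toFun f := curryL (swapL (actSnd fourierL f))
  map_add' f g := by rw [actSnd_add, map_add, map_add]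
  map_smul' c f := by simp only [actSnd, map_smul, RingHom.id_apply]
  norm_map' f := by
    change ‖curryL (swapL (actSnd fourierL f))‖ = _
    rw [LinearIsometryEquiv.norm_map, LinearIsometry.norm_map, norm_actSnd_fourierL]

theorem planeFreq_apply (f : LtwoPlane) : planeFreq f = curryL (swapL (actSnd fourierL f)) := rfl

theorem planeFreq_wtLI {a : ℝ} (f : X a) : planeFreq (wtLI a f) = freqL a f := rfl

theorem planeFreq_actFst (A : Ltwo →L[ℂ] Ltwo) (f : LtwoPlane) :
    ∀ᵐ ξ, planeFreq (actFst A f) ξ = A (planeFreq f ξ) := curryL_swapL_actFst A f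

theorem curryL_swapL_coe (f : LtwoPlane) :
    ∀ᵐ y, curryL (swapL f) y =ᵐ[volume] fun x => f (x, y) := by
  filter_upwards [curryL_coe (swapL f), Measure.ae_ae_of_ae_prod (swapL_coe f)] with y h1 h2
  filter_upwards [h1, h2] with x k1 k2
  rw [k1, k2, Prod.swap_prod_mk]

theorem ae_swap {p : ℝ × ℝ → Prop} (h : ∀ᵐ z : ℝ × ℝ, p z) : ∀ᵐ z : ℝ × ℝ, p z.swap :=
  Measure.measurePreserving_swap.quasiMeasurePreserving.ae h

theorem ae_eq_of_ae_ae_eq' {f g : ℝ × ℝ → ℂ} (hf : AEStronglyMeasurable f volume)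
    (hg : AEStronglyMeasurable g volume) (h : ∀ᵐ y, ∀ᵐ x, f (x, y) = g (x, y)) :
    f =ᵐ[volume] g := by
  have h1 := ae_eq_of_ae_ae_eq (f := f ∘ Prod.swap) (g := g ∘ Prod.swap)
    (hf.comp_measurePreserving Measure.measurePreserving_swap)
    (hg.comp_measurePreserving Measure.measurePreserving_swap) h
  filter_upwards [ae_swap h1] with z hz
  simpa using hz

theorem actFst_coe (A : Ltwo →L[ℂ] Ltwo) (f : LtwoPlane) :
    ∀ᵐ y, (fun x => actFst A f (x, y)) =ᵐ[volume] A (curryL (swapL f) y) := by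
  have h := curryL_actSnd A (swapL f)
  filter_upwards [curryL_swapL_coe (actFst A f), h] with y h1 h2
  rw [actFst, swapL_swapL, h2] at h1
  exact h1.symm

namespace IsPlaneTest
variable {ψ : ℝ × ℝ → ℂ}

theorem curryL_vec (h : IsPlaneTest ψ) : ∀ᵐ x, curryL h.vec x = ((h.snd x).memLp 2).toLp _ := by
  filter_upwards [curryL_coe h.vec, Measure.ae_ae_of_ae_prod h.vec_coe] with x h1 h2
  ext1
  filter_upwards [h1, h2, ((h.snd x).memLp 2).coeFn_toLp] with y k1 k2 k3
  rw [k1, k2, k3]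

theorem curryL_swapL_vec (h : IsPlaneTest ψ) :
    ∀ᵐ y, curryL (swapL h.vec) y = ((h.fst y).memLp 2).toLp _ := by
  filter_upwards [curryL_swapL_coe h.vec, Measure.ae_ae_of_ae_prod (ae_swap h.vec_coe)] with y h1 h2
  ext1
  filter_upwards [h1, h2, ((h.fst y).memLp 2).coeFn_toLp] with x k1 k2 k3
  rw [k1, k3]
  exact k2

/-- Integration of `(∂ₓ + a)` on twisted test functions. -/
theorem actFst_vec (h : IsPlaneTest ψ) {a : ℝ} (ha : a ≠ 0) :
    actFst (resD (-a)) (h.derFst.twist a).vec = (h.twist a).vec := by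
  ext1
  refine ae_eq_of_ae_ae_eq' (Lp.aestronglyMeasurable _) (Lp.aestronglyMeasurable _) ?_
  filter_upwards [actFst_coe (resD (-a)) (h.derFst.twist a).vec, (h.derFst.twist a).curryL_swapL_vec,
    Measure.ae_ae_of_ae_prod (ae_swap (h.twist a).vec_coe)] with y h1 h2 h3
  have hf := (h.twist a).fst y
  have e : resD (-a) (curryL (swapL (h.derFst.twist a).vec) y) = (hf.memLp 2).toLp _ := by
    refine resD_classical (neg_ne_zero.2 ha) hf.hasDerivAt hf.integrable hf.deriv.integrable
      (hf.memLp 2) (hf.deriv.memLp 2) ?_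
    rw [h2]
    filter_upwards [(((h.derFst.twist a).fst y).memLp 2).coeFn_toLp] with x hx
    rw [hx]
    have hd : HasDerivAt (fun x => KPII.twist a ψ (x, y))
        (-a * KPII.twist a ψ (x, y) + KPII.twist a (KPII.derFst ψ) (x, y)) x := by
      have h4 : HasDerivAt (fun x : ℝ => (Real.exp (-a * x) : ℂ)) ((Real.exp (-a * x) * -a : ℝ) : ℂ) x := by
        refine HasDerivAt.ofReal_comp ?_
        simpa using ((hasDerivAt_id x).const_mul (-a)).exp
      have h5 := (Complex.conjCLE : ℂ →L[ℝ] ℂ).hasFDerivAt.comp_hasDerivAt x ((h.fst y).hasDerivAt x)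
      refine (h4.mul h5).congr_deriv ?_
      simp only [KPII.twist, wt, KPII.derFst]
      push_cast
      simp
      ring
    rw [hd.deriv]
    push_cast
    ring
  rw [e] at h1
  filter_upwards [h1, h3, (hf.memLp 2).coeFn_toLp] with x k1 k2 k3
  rw [k1, k3]
  exact k2.symm

theorem actSnd_fourierL_vec (h : IsPlaneTest ψ) :
    ∀ᵐ x, (fun ξ => actSnd fourierL h.vec (x, ξ)) =ᵐ[volume] 𝓕 fun y => ψ (x, y) := by
  filter_upwards [curryL_coe (actSnd fourierL h.vec), curryL_actSnd fourierL h.vec, h.curryL_vec]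
    with x h1 h2 h3
  refine h1.symm.trans ?_
  rw [h2, h3, fourierL_apply]
  exact fourier_toLp_ae (h.snd x).integrable _

theorem planeFreq_derSnd (h : IsPlaneTest ψ) : ∀ᵐ ξ : ℝ,
    planeFreq h.derSnd.derSnd.vec ξ = (-(2 * Real.pi * ξ) ^ 2 : ℂ) • planeFreq h.vec ξ := by
  have h1 : actSnd fourierL h.derSnd.derSnd.vec =ᵐ[volume]
      fun z => (-(2 * Real.pi * z.2) ^ 2 : ℂ) * actSnd fourierL h.vec z := by
    refine ae_eq_of_ae_ae_eq (Lp.aestronglyMeasurable _) ?_ ?_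
    · exact (Continuous.aestronglyMeasurable (by fun_prop)).mul (Lp.aestronglyMeasurable _)
    · filter_upwards [h.actSnd_fourierL_vec, h.derSnd.derSnd.actSnd_fourierL_vec] with x k1 k2
      filter_upwards [k1, k2] with ξ l1 l2
      rw [l1, l2]
      have e : (fun y => KPII.derSnd (KPII.derSnd ψ) (x, y)) = deriv (deriv fun y => ψ (x, y)) := rfl
      rw [e, (h.snd x).deriv.fourier_deriv, (h.snd x).fourier_deriv]
      linear_combination (2 * Real.pi * ξ : ℂ) ^ 2 * 𝓕 (fun y => ψ (x, y)) ξ * Complex.I_sq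
  filter_upwards [curryL_swapL_coe (actSnd fourierL h.vec),
    curryL_swapL_coe (actSnd fourierL h.derSnd.derSnd.vec),
    Measure.ae_ae_of_ae_prod (ae_swap h1)] with ξ k1 k2 k3
  rw [planeFreq_apply, planeFreq_apply]
  ext1
  filter_upwards [k1, k2, k3, Lp.coeFn_smul (-(2 * Real.pi * ξ) ^ 2 : ℂ)
    (curryL (swapL (actSnd fourierL h.vec)) ξ)] with x l1 l2 l3 l4
  rw [l2, l4, Pi.smul_apply, l1, smul_eq_mul]
  exact l3

end IsPlaneTest

end KPII

namespace KPII

/-! ### The weak formulation -/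

variable {a : ℝ}

theorem ae_eq_wtLI (u : X a) : ∀ᵐ z, u z = wt (-a) z * wtLI a u z := by
  filter_upwards [wtLI_coe u] with z hz
  rw [hz, ← mul_assoc, wt_neg_mul, one_mul]

theorem twist_mul {ψ : ℝ × ℝ → ℂ} (z : ℝ × ℝ) (c : ℂ) :
    wt (-a) z * c * ψ z = c * (starRingEnd ℂ) (twist a ψ z) := by
  rw [twist, map_mul, Complex.conj_conj, wt, Complex.conj_ofReal]
  ring

theorem inner_vec_twist {ψ : ℝ × ℝ → ℂ} (h : IsPlaneTest ψ) (F : LtwoPlane) :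
    (fun z => inner ℂ ((h.twist a).vec z) (F z)) =ᵐ[volume] fun z => wt (-a) z * F z * ψ z := by
  filter_upwards [(h.twist a).vec_coe] with z hz
  rw [RCLike.inner_apply, hz, twist_mul]

theorem actFst_pot_coe (F : LtwoPlane) :
    actFst (polyOp pot) F =ᵐ[volume] fun z => (soliton 2 z.1 : ℂ) * F z := by
  have hs : ∀ x : ℝ, polyFun pot x = (soliton 2 x : ℂ) := fun x => by
    have h := one_sub_th_sq x
    simp only [polyFun, pot, soliton, Polynomial.eval_mul, Polynomial.eval_sub, Polynomial.eval_pow,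
      Polynomial.eval_X, Polynomial.eval_one, Polynomial.eval_ofNat, div_self (two_ne_zero' ℝ),
      Real.sqrt_one, one_mul]
    rw [div_eq_mul_inv, ← h]
    push_cast
    ring
  have hc : Continuous fun x : ℝ => (soliton 2 x : ℂ) := by
    simp only [← hs]
    exact continuous_polyFun pot
  refine ae_eq_of_ae_ae_eq' (Lp.aestronglyMeasurable _)
    ((hc.comp continuous_fst).aestronglyMeasurable.mul (Lp.aestronglyMeasurable _)) ?_
  filter_upwards [actFst_coe (polyOp pot) F, curryL_swapL_coe F] with y h1 h2
  filter_upwards [h1, h2, mulOp_coe (isBddMul_polyFun pot) (curryL (swapL F) y)] with x k1 k2 k3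
  rw [k1, ← k2, ← hs]
  exact k3

/-- The tail integral in terms of the resolvent. -/
theorem tail_eq (ha : 0 < a) (u : X a) : ∀ᵐ z : ℝ × ℝ,
    ∫ x₁ in Set.Ioi z.1, u (x₁, z.2) = -(wt (-a) z * actFst (resD a) (wtLI a u) z) := by
  have hm : StronglyMeasurable fun z : ℝ × ℝ => ∫ x₁ in Set.Ioi z.1, u (x₁, z.2) := by
    have e : (fun z : ℝ × ℝ => ∫ x₁ in Set.Ioi z.1, u (x₁, z.2)) =
        fun z => ∫ s, Set.indicator {p : (ℝ × ℝ) × ℝ | p.1.1 < p.2} (fun p => u (p.2, p.1.2)) (z, s) := by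
      funext z
      rw [← integral_indicator measurableSet_Ioi]
      rfl
    rw [e]
    refine StronglyMeasurable.integral_prod_right' (f := Set.indicator _ _) ?_
    refine StronglyMeasurable.indicator ?_ (measurableSet_lt (by fun_prop) (by fun_prop))
    exact (Lp.stronglyMeasurable u).comp_measurable (by fun_prop)
  refine ae_eq_of_ae_ae_eq' hm.aestronglyMeasurable
    (((continuous_wt (-a)).aestronglyMeasurable.mul (Lp.aestronglyMeasurable _)).neg) ?_
  filter_upwards [actFst_coe (resD a) (wtLI a u), curryL_swapL_coe (wtLI a u),
    Measure.ae_ae_of_ae_prod (ae_swap (ae_eq_wtLI u))] with y h1 h2 h3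
  filter_upwards [h1, resD_coe ha (curryL (swapL (wtLI a u)) y)] with x k1 k2
  rw [k1, k2, prim_congr h2, prim, mul_neg, neg_neg, ← integral_const_mul]
  refine integral_congr_ae (ae_restrict_of_ae ?_)
  filter_upwards [h3] with s hs
  rw [show u (s, y) = _ from hs, Prod.swap_prod_mk]
  simp only [wt]
  rw [← mul_assoc, ← Complex.ofReal_mul, ← Real.exp_add]
  congr 4
  ring

theorem integral_add_const_mul {α : Type*} [MeasurableSpace α] {μ : Measure α} {f g : α → ℂ} {v w : ℂ}
    (hf : Integrable f μ ∧ ∫ x, f x ∂μ = v) (c : ℂ) (hg : Integrable g μ ∧ ∫ x, g x ∂μ = w) :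
    Integrable (fun x => f x + c * g x) μ ∧ ∫ x, f x + c * g x ∂μ = v + c * w :=
  ⟨hf.1.add (hg.1.const_mul c), by
    rw [integral_add hf.1 (hg.1.const_mul c), integral_const_mul, hf.2, hg.2]⟩

theorem derSnd_twist {ψ : ℝ × ℝ → ℂ} (h : IsPlaneTest ψ) (a : ℝ) :
    derSnd (twist a ψ) = twist a (derSnd ψ) := by
  funext z
  refine HasDerivAt.deriv ?_
  have h5 := (Complex.conjCLE : ℂ →L[ℝ] ℂ).hasFDerivAt.comp_hasDerivAt z.2 ((h.snd z.1).hasDerivAt z.2)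
  exact h5.const_mul (wt (-a) z)

theorem IsPlaneTest.vec_congr {ψ ψ' : ℝ × ℝ → ℂ} (h : IsPlaneTest ψ) (h' : IsPlaneTest ψ')
    (e : ψ = ψ') : h.vec = h'.vec := by
  subst e
  rfl

/-- Each pairing ∫ Fψ is the unweighted inner product of e^{−ax}ψ̄ with e^{ax}F. In this form
multiplication by φ and the tail integral are the bounded operators `polyOp pot` and, up to sign, J.
-/
theorem isLinearizedKP_iff_inner (ha : 0 < a) (u w : X a) : IsLinearizedKP u w ↔
    ∀ ψ (h : IsPlaneTest ψ), inner ℂ (h.twist a).vec (wtLI a w) =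
      inner ℂ (h.derFst.derFst.derFst.twist a).vec (wtLI a u)
      - 4 * inner ℂ (h.derFst.twist a).vec (wtLI a u)
      + 6 * inner ℂ (h.derFst.twist a).vec (actFst (polyOp pot) (wtLI a u))
      - 3 * inner ℂ (h.derSnd.derSnd.twist a).vec (actFst (resD a) (wtLI a u)) := by
  have I : ∀ F G : LtwoPlane, Integrable (fun z => inner ℂ (F z) (G z)) ∧
      ∫ z, inner ℂ (F z) (G z) = inner ℂ F G := fun F G => ⟨L2.integrable_inner F G, rfl⟩
  have e : ∀ ψ (h : IsPlaneTest ψ),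
      ((∫ z, w z * ψ z) = inner ℂ (h.twist a).vec (wtLI a w)) ∧
      (∫ z : ℝ × ℝ, u z * (iteratedDeriv 3 (fun s : ℝ => ψ (s, z.2)) z.1
          - 4 * deriv (fun s : ℝ => ψ (s, z.2)) z.1
          + 6 * (soliton 2 z.1 : ℂ) * deriv (fun s : ℝ => ψ (s, z.2)) z.1)) =
        inner ℂ (h.derFst.derFst.derFst.twist a).vec (wtLI a u)
        - 4 * inner ℂ (h.derFst.twist a).vec (wtLI a u)
        + 6 * inner ℂ (h.derFst.twist a).vec (actFst (polyOp pot) (wtLI a u)) ∧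
      (∫ z : ℝ × ℝ, (∫ x₁ in Set.Ioi z.1, u (x₁, z.2)) * iteratedDeriv 2 (fun s : ℝ => ψ (z.1, s)) z.2) =
        - inner ℂ (h.derSnd.derSnd.twist a).vec (actFst (resD a) (wtLI a u)) := by
    intro ψ h
    refine ⟨?_, ?_, ?_⟩
    · rw [L2.inner_def]
      refine integral_congr_ae ?_
      filter_upwards [inner_vec_twist (a := a) h (wtLI a w), ae_eq_wtLI w] with z h1 h2
      rw [h1, h2]
    · have k := (integral_add_const_mul (integral_add_const_mul
        (I (h.derFst.derFst.derFst.twist a).vec (wtLI a u)) (-4) (I (h.derFst.twist a).vec (wtLI a u)))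
        6 (I (h.derFst.twist a).vec (actFst (polyOp pot) (wtLI a u)))).2
      rw [neg_mul, ← sub_eq_add_neg] at k
      rw [← k]
      refine integral_congr_ae ?_
      filter_upwards [inner_vec_twist (a := a) h.derFst (wtLI a u),
        inner_vec_twist (a := a) h.derFst.derFst.derFst (wtLI a u),
        inner_vec_twist (a := a) h.derFst (actFst (polyOp pot) (wtLI a u)),
        actFst_pot_coe (wtLI a u), ae_eq_wtLI u] with z h1 h2 h3 h4 h5
      have h6 : iteratedDeriv 3 (fun s : ℝ => ψ (s, z.2)) z.1 = derFst (derFst (derFst ψ)) z := by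
        simp only [iteratedDeriv_succ, iteratedDeriv_zero]
        rfl
      rw [h1, h2, h3, h4, h5, h6]
      simp only [derFst]
      ring
    · rw [L2.inner_def, ← integral_neg]
      refine integral_congr_ae ?_
      filter_upwards [inner_vec_twist (a := a) h.derSnd.derSnd (actFst (resD a) (wtLI a u)),
        tail_eq ha u] with z h1 h2
      have h6 : iteratedDeriv 2 (fun s : ℝ => ψ (z.1, s)) z.2 = derSnd (derSnd ψ) z := by
        simp only [iteratedDeriv_succ, iteratedDeriv_zero]
        rfl
      rw [h1, h2, h6, neg_mul]
  constructor
  · intro H ψ h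
    obtain ⟨e1, e2, e3⟩ := e ψ h
    have := H ψ h.smooth h.supp
    rw [e1, e2, e3] at this
    rw [this]
    ring
  · intro H ψ hs hc
    obtain ⟨e1, e2, e3⟩ := e ψ ⟨hs, hc⟩
    rw [e1, e2, e3, H ψ ⟨hs, hc⟩]
    ring

/-- The defect of the equation `w = 𝓛(η) u`, integrated three times. -/
def defect (a η : ℝ) (u w : Ltwo) : Ltwo :=
  (resD a (resD a (resD a w)) + u - (4 : ℂ) • resD a (resD a u)
    + (6 : ℂ) • resD a (resD a (polyOp pot u)))
    - (3 * (η : ℂ) ^ 2) • resD a (resD a (resD a (resD a u)))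

theorem mem_fibreGraph_iff_defect (ha : 0 < a) {η : ℝ} {u w : Ltwo} :
    (u, w) ∈ fibreGraph a η ↔ defect a η u w = 0 := by
  rw [mem_fibreGraph_iff ha, defect, polyOp_apply]
  constructor
  · intro h
    rw [h]
    module
  · intro h
    rw [← sub_eq_zero, ← h]
    module

/-- All primitives move to the left factor, since the adjoint of J is −`resD (-a)`. With q a twisted
third derivative of a test function, each `resD (-a)` takes one derivative off. -/
theorem inner_defect (ha : 0 < a) (η : ℝ) (q u w : Ltwo) : inner ℂ q (defect a η u w) =
    -(inner ℂ (resD (-a) (resD (-a) (resD (-a) q))) w) + inner ℂ q u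
      - 4 * inner ℂ (resD (-a) (resD (-a) q)) u + 6 * inner ℂ (resD (-a) (resD (-a) q)) (polyOp pot u)
      - 3 * inner ℂ ((-η ^ 2 : ℂ) • resD (-a) (resD (-a) (resD (-a) q))) (resD a u) := by
  have e : ∀ f g : Ltwo, inner ℂ (resD (-a) f) g = -inner ℂ f (resD a g) := fun f g => by
    rw [inner_resD_left (neg_ne_zero.2 ha.ne'), neg_neg]
  simp only [defect, e, inner_sub_right, inner_add_right, inner_smul_right, inner_smul_left, map_neg,
    map_pow, Complex.conj_ofReal]
  ring

/-- By Plancherel in y, the four pairings of the weak equation assemble into the pairing of the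
twisted ∂ₓ³ψ with the thrice integrated equation, in which only bounded operators act on each fibre.
-/
theorem isLinearizedKP_iff_defect (ha : 0 < a) (u w : X a) : IsLinearizedKP u w ↔
    ∀ ψ (h : IsPlaneTest ψ), ∫ ξ : ℝ, inner ℂ (planeFreq (h.derFst.derFst.derFst.twist a).vec ξ)
      (defect a (2 * Real.pi * ξ) (freqL a u ξ) (freqL a w ξ)) = 0 := by
  rw [isLinearizedKP_iff_inner ha]
  refine forall_congr' fun ψ => forall_congr' fun h => ?_
  have I : ∀ F G : LtwoPlane, Integrable (fun ξ => inner ℂ (planeFreq F ξ) (planeFreq G ξ)) ∧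
      ∫ ξ, inner ℂ (planeFreq F ξ) (planeFreq G ξ) = inner ℂ F G := fun F G =>
    ⟨L2.integrable_inner (planeFreq F) (planeFreq G), by rw [← planeFreq.inner_map_map, L2.inner_def]⟩
  have e : ∫ ξ : ℝ, inner ℂ (planeFreq (h.derFst.derFst.derFst.twist a).vec ξ)
      (defect a (2 * Real.pi * ξ) (freqL a u ξ) (freqL a w ξ)) =
      inner ℂ (h.derFst.derFst.derFst.twist a).vec (wtLI a u)
      + (-1) * inner ℂ (h.twist a).vec (wtLI a w)
      + (-4) * inner ℂ (h.derFst.twist a).vec (wtLI a u)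
      + 6 * inner ℂ (h.derFst.twist a).vec (actFst (polyOp pot) (wtLI a u))
      + (-3) * inner ℂ (h.derSnd.derSnd.twist a).vec (actFst (resD a) (wtLI a u)) := by
    rw [← (integral_add_const_mul (integral_add_const_mul (integral_add_const_mul
      (integral_add_const_mul (I (h.derFst.derFst.derFst.twist a).vec (wtLI a u))
      (-1) (I (h.twist a).vec (wtLI a w))) (-4) (I (h.derFst.twist a).vec (wtLI a u)))
      6 (I (h.derFst.twist a).vec (actFst (polyOp pot) (wtLI a u))))
      (-3) (I (h.derSnd.derSnd.twist a).vec (actFst (resD a) (wtLI a u)))).2]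
    refine integral_congr_ae ?_
    have k1 := planeFreq_actFst (resD (-a)) (h.derFst.twist a).vec
    have k2 := planeFreq_actFst (resD (-a)) (h.derFst.derFst.twist a).vec
    have k3 := planeFreq_actFst (resD (-a)) (h.derFst.derFst.derFst.twist a).vec
    rw [h.actFst_vec ha.ne'] at k1
    rw [h.derFst.actFst_vec ha.ne'] at k2
    rw [h.derFst.derFst.actFst_vec ha.ne'] at k3
    have k4 : ∀ᵐ ξ : ℝ, planeFreq (h.derSnd.derSnd.twist a).vec ξ =
        (-(2 * Real.pi * ξ) ^ 2 : ℂ) • planeFreq (h.twist a).vec ξ := by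
      have := (h.twist a).planeFreq_derSnd
      rwa [(h.twist a).derSnd.derSnd.vec_congr (h.derSnd.derSnd.twist a)
        (by rw [derSnd_twist h, derSnd_twist h.derSnd])] at this
    filter_upwards [k1, k2, k3, k4, planeFreq_actFst (polyOp pot) (wtLI a u),
      planeFreq_actFst (resD a) (wtLI a u)] with ξ l1 l2 l3 l4 l5 l6
    rw [inner_defect ha, ← l3, ← l2, ← l1, l5, l6, l4, planeFreq_wtLI]
    push_cast
    rw [planeFreq_wtLI]
    ring
  rw [e]
  constructor
  · intro H
    linear_combination -H
  · intro H
    linear_combination -H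

end KPII

namespace KPII

/-! ### The weak formulation and the fibres -/

variable {a : ℝ}

/-- Products of test functions, multiplied by the weight. -/
def prodTest (a : ℝ) (θ θ' : ℝ → ℂ) (z : ℝ × ℝ) : ℂ := wt a z * (starRingEnd ℂ) (θ z.1 * θ' z.2)

theorem isPlaneTest_prodTest {θ θ' : ℝ → ℂ} (h : IsTest θ) (h' : IsTest θ') :
    IsPlaneTest (prodTest a θ θ') where
  smooth := by
    refine ContDiff.mul ?_ (Complex.conjCLE.contDiff.comp
      ((h.smooth.comp contDiff_fst).mul (h'.smooth.comp contDiff_snd)))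
    exact Complex.ofRealCLM.contDiff.comp (Real.contDiff_exp.comp (contDiff_const.mul contDiff_fst))
  supp := by
    refine HasCompactSupport.intro (h.supp.isCompact.prod h'.supp.isCompact) fun z hz => ?_
    rw [Set.mem_prod, not_and_or] at hz
    rcases hz with hz | hz <;> simp [prodTest, image_eq_zero_of_notMem_tsupport hz]

theorem derFst_prodTest {θ θ' : ℝ → ℂ} (h : IsTest θ) :
    derFst (prodTest a θ θ') = prodTest a (wder a θ) θ' := by
  funext z
  refine HasDerivAt.deriv ?_
  have h4 : HasDerivAt (fun x : ℝ => (Real.exp (a * x) : ℂ)) ((Real.exp (a * z.1) * a : ℝ) : ℂ) z.1 := by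
    refine HasDerivAt.ofReal_comp ?_
    simpa using ((hasDerivAt_id z.1).const_mul a).exp
  have h5 := (Complex.conjCLE : ℂ →L[ℝ] ℂ).hasFDerivAt.comp_hasDerivAt z.1
    ((h.hasDerivAt z.1).mul_const (θ' z.2))
  refine (h4.mul h5).congr_deriv ?_
  simp only [prodTest, wt, wder]
  push_cast
  simp
  ring

theorem twist_prodTest (a : ℝ) (θ θ' : ℝ → ℂ) (z : ℝ × ℝ) :
    twist a (prodTest a θ θ') z = θ z.1 * θ' z.2 := by
  rw [twist, prodTest, map_mul, Complex.conj_conj, wt, wt, Complex.conj_ofReal, ← mul_assoc,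
    ← Complex.ofReal_mul, ← Real.exp_add]
  simp

theorem vec_twist_prodTest {θ θ' : ℝ → ℂ} (h : IsTest θ) (h' : IsTest θ') :
    ((isPlaneTest_prodTest (a := a) h h').twist a).vec =
      tensor ((h.memLp 2).toLp θ) ((h'.memLp 2).toLp θ') := by
  ext1
  have h1 := Measure.quasiMeasurePreserving_fst (μ := (volume : Measure ℝ)) (ν := (volume : Measure ℝ))
  have h2 := Measure.quasiMeasurePreserving_snd (μ := (volume : Measure ℝ)) (ν := (volume : Measure ℝ))
  filter_upwards [IsPlaneTest.vec_coe ((isPlaneTest_prodTest (a := a) h h').twist a),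
    tensor_coe ((h.memLp 2).toLp θ) ((h'.memLp 2).toLp θ'), h1.ae (h.memLp 2).coeFn_toLp,
    h2.ae (h'.memLp 2).coeFn_toLp] with z k1 k2 k3 k4
  rw [k1, k2, k3, k4, twist_prodTest]

theorem planeFreq_tensor (g h : Ltwo) :
    ∀ᵐ ξ, planeFreq (tensor g h) ξ = (𝓕 h : Ltwo) ξ • g := by
  rw [planeFreq_apply, actSnd_tensor, swapL_tensor]
  exact curryLI_tensor _ _

theorem memLp_inner_apply (p : Ltwo) (A : Ltwo →L[ℂ] Ltwo) (F : LtwoLtwo) :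
    MemLp (fun ξ => inner ℂ p (A (F ξ))) 2 volume :=
  ((innerSL ℂ p).comp A).comp_memLp' (Lp.memLp F)

/-- The factor η² in the defect spoils square integrability in ξ. It is transferred to the test
function as a second derivative, after which both summands are products with L² functions. -/
theorem ae_inner_defect_eq_zero (u w : LtwoLtwo) (p : Ltwo)
    (h : ∀ θ, IsTest θ → ∫ ξ : ℝ, (starRingEnd ℂ) (𝓕 θ ξ) *
      inner ℂ p (defect a (2 * Real.pi * ξ) (u ξ) (w ξ)) = 0) :
    ∀ᵐ ξ : ℝ, inner ℂ p (defect a (2 * Real.pi * ξ) (u ξ) (w ξ)) = 0 := by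
  obtain ⟨A, hA⟩ : ∃ A : Ltwo →L[ℂ] Ltwo, A = 1 - (4 : ℂ) • (resD a * resD a) +
    (6 : ℂ) • (resD a * resD a * polyOp pot) := ⟨_, rfl⟩
  obtain ⟨b₀, hb₀⟩ : ∃ b₀ : ℝ → ℂ, b₀ = fun ξ => inner ℂ p ((resD a ^ 3) (w ξ)) +
    inner ℂ p (A (u ξ)) := ⟨_, rfl⟩
  obtain ⟨b₁, hb₁⟩ : ∃ b₁ : ℝ → ℂ, b₁ = fun ξ => 3 * inner ℂ p ((resD a ^ 4) (u ξ)) := ⟨_, rfl⟩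
  have m0 : MemLp b₀ 2 volume := by
    rw [hb₀]
    exact (memLp_inner_apply p _ w).add (memLp_inner_apply p _ u)
  have m1 : MemLp b₁ 2 volume := by
    rw [hb₁]
    exact (memLp_inner_apply p _ u).const_mul 3
  have e1 : ∀ ξ : ℝ, inner ℂ p (defect a (2 * Real.pi * ξ) (u ξ) (w ξ)) =
      b₀ ξ - (2 * Real.pi * ξ) ^ 2 * b₁ ξ := fun ξ => by
    have : defect a (2 * Real.pi * ξ) (u ξ) (w ξ) = (resD a ^ 3) (w ξ) + A (u ξ) -
        (3 * (2 * Real.pi * ξ : ℂ) ^ 2) • (resD a ^ 4) (u ξ) := by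
      have e3 : (resD a ^ 3) (w ξ) = resD a (resD a (resD a (w ξ))) := rfl
      have e4 : (resD a ^ 4) (u ξ) = resD a (resD a (resD a (resD a (u ξ)))) := rfl
      have e5 : A (u ξ) = u ξ - (4 : ℂ) • resD a (resD a (u ξ)) +
        (6 : ℂ) • resD a (resD a (polyOp pot (u ξ))) := by rw [hA]; rfl
      rw [defect, e3, e4, e5]
      push_cast
      abel
    rw [this, inner_sub_right, inner_add_right, inner_smul_right, hb₀, hb₁]
    ring
  have e2 : ∀ θ, IsTest θ → ∀ ξ : ℝ, (starRingEnd ℂ) (𝓕 θ ξ) *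
      inner ℂ p (defect a (2 * Real.pi * ξ) (u ξ) (w ξ)) =
      (starRingEnd ℂ) (𝓕 θ ξ) * b₀ ξ + (starRingEnd ℂ) (𝓕 (deriv (deriv θ)) ξ) * b₁ ξ := fun θ hθ ξ => by
    rw [e1, hθ.deriv.fourier_deriv, hθ.fourier_deriv]
    simp only [map_mul, Complex.conj_I, Complex.conj_ofReal, map_ofNat]
    linear_combination (-(2 * Real.pi * ξ : ℂ) ^ 2 * (starRingEnd ℂ) (𝓕 θ ξ) * b₁ ξ) * Complex.I_sq
  refine ae_eq_zero_of_forall_test (fun θ hθ => ?_) (fun θ hθ => ?_) h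
  · simp only [e2 θ hθ]
    exact (integrable_conj_mul (hθ.fourier_memLp 2) m0).add
      (integrable_conj_mul (hθ.deriv.deriv.fourier_memLp 2) m1)
  · simp only [e2 θ hθ]
    exact (memLp_conj_mul (hθ.fourier_memLp ∞) m0).add
      (memLp_conj_mul (hθ.deriv.deriv.fourier_memLp ∞) m1)

/-- The linearized equation in the sense of distributions, in terms of transverse frequencies. -/
theorem isLinearizedKP_iff (ha : 0 < a) (u w : X a) : IsLinearizedKP u w ↔
    ∀ᵐ ξ, (freqL a u ξ, freqL a w ξ) ∈ fibreGraph a (2 * Real.pi * ξ) := by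
  simp only [mem_fibreGraph_iff_defect ha]
  rw [isLinearizedKP_iff_defect ha]
  constructor
  · intro H
    obtain ⟨S, hS⟩ : ∃ S : Set Ltwo, S = {p | ∃ (θ : ℝ → ℂ) (hθ : IsTest θ),
      p = ((((hθ.wder a).wder a).wder a).memLp 2).toLp _} := ⟨_, rfl⟩
    -- The exceptional null set depends on the test vector; a countable dense set of test vectors
    -- gives a common one.
    obtain ⟨D, hDS, hDc, hD⟩ :=
      (TopologicalSpace.IsSeparable.of_separableSpace S).exists_countable_dense_subset
    have h1 : ∀ p ∈ S, ∀ᵐ ξ : ℝ,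
        inner ℂ p (defect a (2 * Real.pi * ξ) (freqL a u ξ) (freqL a w ξ)) = 0 := by
      intro p hp
      rw [hS] at hp
      obtain ⟨θ, hθ, rfl⟩ := hp
      refine ae_inner_defect_eq_zero _ _ _ fun θ' hθ' => ?_
      have hd := ((hθ.wder a).wder a).wder a
      rw [← H _ (isPlaneTest_prodTest (a := a) hθ hθ')]
      have e : derFst (derFst (derFst (prodTest a θ θ'))) =
          prodTest a (wder a (wder a (wder a θ))) θ' := by
        rw [derFst_prodTest hθ, derFst_prodTest (hθ.wder a), derFst_prodTest ((hθ.wder a).wder a)]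
      rw [IsPlaneTest.vec_congr _ ((isPlaneTest_prodTest (a := a) hd hθ').twist a)
        (congrArg (twist a) e), vec_twist_prodTest hd hθ']
      refine integral_congr_ae ?_
      filter_upwards [planeFreq_tensor ((hd.memLp 2).toLp _) ((hθ'.memLp 2).toLp θ'),
        fourier_toLp_ae hθ'.integrable (hθ'.memLp 2)] with ξ k1 k2
      rw [k1, k2, inner_smul_left]
    filter_upwards [(ae_ball_iff hDc).2 fun p hp => h1 p (hDS hp)] with ξ hξ
    refine eq_zero_of_inner_wder ha.ne' fun θ hθ => ?_
    have hcl : IsClosed {p : Ltwo |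
        inner ℂ p (defect a (2 * Real.pi * ξ) (freqL a u ξ) (freqL a w ξ)) = 0} :=
      isClosed_eq (by fun_prop) continuous_const
    exact hcl.closure_subset_iff.2 hξ (hD (by rw [hS]; exact ⟨θ, hθ, rfl⟩))
  · intro H ψ h
    refine integral_eq_zero_of_ae ?_
    filter_upwards [H] with ξ hξ
    rw [hξ, inner_zero_right, Pi.zero_apply]

theorem isLinearizedKPSemigroup (ha : 0 < a) (ha2 : a < 2) :
    IsLinearizedKPSemigroup a (kpSemigroup ha ha2) :=
  isLinearizedKPSemigroup_of ha ha2 (isLinearizedKP_iff ha)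

end KPII

namespace KPII

/-! ### Reconstruction from the transverse Fourier transform -/

theorem conj_fourier_of_real {θ : ℝ → ℂ} (h : ∀ x, (starRingEnd ℂ) (θ x) = θ x) (ξ : ℝ) :
    (starRingEnd ℂ) (𝓕 θ ξ) = 𝓕 θ (-ξ) := by
  rw [fourier_eq_integral, fourier_eq_integral, ← integral_conj]
  refine integral_congr_ae (Eventually.of_forall fun x => ?_)
  simp only
  rw [map_mul, h, ← Complex.exp_conj]
  congr 2
  simp only [map_mul, map_neg, Complex.conj_I, Complex.conj_ofReal, map_ofNat]
  push_cast
  ring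

theorem fourier_comp_neg (G : ℝ → ℂ) (y : ℝ) : 𝓕 (fun ξ => G (-ξ)) y =
    ∫ ξ : ℝ, Complex.exp (2 * Real.pi * y * ξ * Complex.I) * G ξ := by
  rw [fourier_eq_integral, ← integral_neg_eq_self]
  refine integral_congr_ae (Eventually.of_forall fun ξ => ?_)
  simp only [neg_neg]
  congr 2
  push_cast
  ring

/-- Fourier inversion for `L²` functions with integrable Fourier transform. -/
theorem eq_integral_of_fourier {h : Ltwo} {G : ℝ → ℂ} (hG : Integrable G)
    (he : (𝓕 h : Ltwo) =ᵐ[volume] G) :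
    h =ᵐ[volume] fun y => ∫ ξ : ℝ, Complex.exp (2 * Real.pi * y * ξ * Complex.I) * G ξ := by
  have hG' : Integrable fun ξ => G (-ξ) := hG.comp_neg
  have hc : Continuous (𝓕 fun ξ => G (-ξ)) :=
    VectorFourier.fourierIntegral_continuous Real.continuous_fourierChar
      (by exact continuous_inner) hG'
  simp only [← fourier_comp_neg]
  refine ae_eq_of_integral_contDiff_smul_eq ((Lp.memLp h).locallyIntegrable (by norm_num))
    hc.locallyIntegrable fun g hg hgc => ?_
  have ht : IsTest fun x => (g x : ℂ) :=
    ⟨Complex.ofRealCLM.contDiff.comp hg, hgc.comp_left (g := fun r : ℝ => (r : ℂ)) rfl⟩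
  have e1 := inner_eq_fourier_integral ht h
  have e2 : inner ℂ ((ht.memLp 2).toLp _) h = ∫ x, g x • h x := by
    rw [L2.inner_def]
    refine integral_congr_ae ?_
    filter_upwards [(ht.memLp 2).coeFn_toLp] with x hx
    rw [RCLike.inner_apply, hx, Complex.conj_ofReal, Complex.real_smul, mul_comm]
  have e3 : ∫ ξ, (starRingEnd ℂ) (𝓕 (fun x => (g x : ℂ)) ξ) * (𝓕 h : Ltwo) ξ =
      ∫ ξ, 𝓕 (fun x => (g x : ℂ)) ξ * G (-ξ) := by
    rw [← integral_neg_eq_self]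
    have := (Measure.measurePreserving_neg (volume : Measure ℝ)).quasiMeasurePreserving.ae he
    refine integral_congr_ae ?_
    filter_upwards [this] with ξ hξ
    rw [conj_fourier_of_real (fun x => Complex.conj_ofReal _), neg_neg]
    exact congrArg _ hξ
  have e4 : ∫ ξ, 𝓕 (fun x => (g x : ℂ)) ξ * G (-ξ) =
      ∫ x, g x • 𝓕 (fun ξ => G (-ξ)) x := by
    have := VectorFourier.integral_fourierIntegral_smul_eq_flip (L := innerₗ ℝ)
      (μ := (volume : Measure ℝ)) (ν := (volume : Measure ℝ)) Real.continuous_fourierChar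
      (by exact continuous_inner) ht.integrable hG'
    simpa [Real.fourier_eq, flip_innerₗ] using! this
  rw [← e2, e1, e3, e4]

/-- An element of `L²` of the plane whose transverse Fourier transform has compact support is given
by the inversion formula. -/
theorem eq_integral_of_planeFreq {H : LtwoPlane} {k : ℝ × ℝ → ℂ} {r : ℝ} (hk : StronglyMeasurable k)
    (he : ∀ᵐ ξ, planeFreq H ξ =ᵐ[volume] fun x => k (x, ξ)) (hs : ∀ x ξ, r < |ξ| → k (x, ξ) = 0) :
    ∀ᵐ z : ℝ × ℝ, H z = ∫ ξ : ℝ, Complex.exp (2 * Real.pi * z.2 * ξ * Complex.I) * k (z.1, ξ) := by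
  have h1 : actSnd fourierL H =ᵐ[volume] k := by
    refine ae_eq_of_ae_ae_eq' (Lp.aestronglyMeasurable _) hk.aestronglyMeasurable ?_
    filter_upwards [he, curryL_swapL_coe (actSnd fourierL H)] with ξ l1 l2
    rw [planeFreq_apply] at l1
    exact l2.symm.trans l1
  have hm : StronglyMeasurable fun z : ℝ × ℝ =>
      ∫ ξ : ℝ, Complex.exp (2 * Real.pi * z.2 * ξ * Complex.I) * k (z.1, ξ) := by
    refine StronglyMeasurable.integral_prod_right'
      (f := fun p : (ℝ × ℝ) × ℝ => Complex.exp (2 * Real.pi * p.1.2 * p.2 * Complex.I) * k (p.1.1, p.2)) ?_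
    refine StronglyMeasurable.mul (Continuous.stronglyMeasurable (by fun_prop)) ?_
    exact hk.comp_measurable (by fun_prop)
  refine ae_eq_of_ae_ae_eq (Lp.aestronglyMeasurable _) hm.aestronglyMeasurable ?_
  have hmem : MemLp k 2 volume := (memLp_congr_ae h1).1 (Lp.memLp _)
  filter_upwards [Measure.ae_ae_of_ae_prod h1, curryL_coe (actSnd fourierL H),
    curryL_actSnd fourierL H, curryL_coe H, ae_memLp_sec hmem] with x k1 k2 k3 k4 k5
  -- Square integrability on a bounded set of frequencies gives integrability, so the pointwise
  -- inversion formula applies.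
  have hi : Integrable fun ξ => k (x, ξ) := by
    have h2 : Set.indicator (Set.Icc (-r) r) (fun ξ => k (x, ξ)) = fun ξ => k (x, ξ) := by
      rw [Set.indicator_eq_self]
      intro ξ hξ
      by_contra h0
      exact hξ (hs x ξ (not_le.1 fun h => h0 (abs_le.1 h)))
    rw [← h2, integrable_indicator_iff measurableSet_Icc]
    have h3 := k5.restrict (Set.Icc (-r) r)
    exact h3.integrable (by norm_num)
  have h4 := eq_integral_of_fourier (h := curryL H x) hi (by
    rw [k3, fourierL_apply] at k2
    exact k2.trans k1)
  exact k4.symm.trans h4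

end KPII

namespace KPII

/-! ### Formulas and measurability for the resonant modes -/

variable {a : ℝ}

theorem continuous_beta : Continuous beta := by
  refine Continuous.cpow (by fun_prop) continuous_const fun η => Complex.mem_slitPlane_iff.2 (Or.inl ?_)
  simp

theorem beta_ne_zero (η : ℝ) : beta η ≠ 0 := fun h => by
  have := beta_re_pos η
  rw [h] at this
  exact lt_irrefl _ this

theorem adjMode_eq (x η : ℝ) :
    adjMode x η = (beta (-η) - th x) * sechExp (beta (-η)) x := (hasDerivAt_sechExp _ x).deriv

theorem mode_eq (x η : ℝ) : mode x η = -Complex.I / (2 * η * beta η) *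
    ((beta η ^ 2 + 2 * beta η * th x + 2 * th x ^ 2 - 1) * sechExp (-beta η) x) := by
  have h1 : deriv (sechExp (-beta η)) = fun x => (-beta η - th x) * sechExp (-beta η) x :=
    funext fun x => (hasDerivAt_sechExp _ x).deriv
  have h2 : HasDerivAt (fun x : ℝ => (-beta η - (th x : ℂ)) * sechExp (-beta η) x)
      ((beta η ^ 2 + 2 * beta η * th x + 2 * th x ^ 2 - 1) * sechExp (-beta η) x) x := by
    refine (((hasDerivAt_th x).ofReal_comp.const_sub (-beta η)).mul
      (hasDerivAt_sechExp (-beta η) x)).congr_deriv ?_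
    push_cast
    ring
  have h3 : iteratedDeriv 2 (fun s : ℝ => Complex.exp (-beta η * (s : ℂ)) / (Real.cosh s : ℂ)) x =
      deriv (deriv (sechExp (-beta η))) x := by
    simp only [iteratedDeriv_succ, iteratedDeriv_zero]
    rfl
  rw [mode, h3, h1, h2.deriv]

theorem exp_mul_sechExp (c : ℂ) (r x : ℝ) :
    (Real.exp (r * x) : ℂ) * sechExp c x = sechExp (r + c) x := by
  rw [sechExp, sechExp, Complex.ofReal_exp, mul_div_assoc', ← Complex.exp_add]
  congr 2
  push_cast
  ring

theorem measurable_sechExp {α : Type*} [MeasurableSpace α] {c : α → ℂ} {f : α → ℝ} (hc : Measurable c)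
    (hf : Measurable f) : Measurable fun p => sechExp (c p) (f p) := by
  unfold sechExp
  have h1 : Measurable fun p => (Real.cosh (f p) : ℂ) :=
    Complex.measurable_ofReal.comp (Real.continuous_cosh.measurable.comp hf)
  exact ((hc.mul (Complex.measurable_ofReal.comp hf)).cexp).div h1

section
variable {α : Type*} [MeasurableSpace α] {f g : α → ℝ} (hf : Measurable f) (hg : Measurable g)
include hf hg

theorem measurable_mode : Measurable fun p => mode (f p) (g p) := by
  have hb : Measurable fun p => beta (g p) := continuous_beta.measurable.comp hg
  have ht : Measurable fun p => (th (f p) : ℂ) :=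
    Complex.measurable_ofReal.comp (continuous_th.measurable.comp hf)
  have hη : Measurable fun p => (g p : ℂ) := Complex.measurable_ofReal.comp hg
  simp only [mode_eq]
  exact (measurable_const.div ((hη.const_mul 2).mul hb)).mul
    (((((hb.pow_const 2).add ((hb.const_mul 2).mul ht)).add ((ht.pow_const 2).const_mul 2)).sub_const 1).mul
      (measurable_sechExp hb.neg hf))

theorem measurable_adjMode : Measurable fun p => adjMode (f p) (g p) := by
  have hb : Measurable fun p => beta (-g p) := continuous_beta.measurable.comp hg.neg
  have ht : Measurable fun p => (th (f p) : ℂ) :=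
    Complex.measurable_ofReal.comp (continuous_th.measurable.comp hf)
  simp only [adjMode_eq]
  exact (hb.sub ht).mul (measurable_sechExp hb hf)

end

section
variable {η₁ η : ℝ} (ha2 : a < 2) (hν : nu η₁ < a) (hη : |η| ≤ |η₁|)
include ha2 hν hη

theorem resMode_coe : resMode a η =ᵐ[volume] fun x => (Real.exp (a * x) : ℂ) * mode x η := by
  have h := abs_re_sub_beta_lt ha2 hν hη
  filter_upwards [Lp.coeFn_smul (-Complex.I / (2 * η) : ℂ) (normMode a (beta η)),
    psmul_coe (Polynomial.C (beta η)⁻¹ * (2 * 𝐓 ^ 2 - 1) + 2 * 𝐓 + Polynomial.C (beta η))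
      (sechTot (a - beta η)), sechTot_coe h] with x k1 k2 k3
  have hb := inv_mul_cancel₀ (beta_ne_zero η)
  have e : (-Complex.I / (2 * η * beta η) : ℂ) = -Complex.I / (2 * η) * (beta η)⁻¹ := by
    rw [← div_div, div_eq_mul_inv]
  rw [resMode, k1, Pi.smul_apply, normMode, k2, k3, mode_eq, smul_eq_mul,
    sub_eq_add_neg (a : ℂ), ← exp_mul_sechExp, e]
  simp only [polyFun, Polynomial.eval_add, Polynomial.eval_mul, Polynomial.eval_sub, Polynomial.eval_C,
    Polynomial.eval_pow, Polynomial.eval_X, Polynomial.eval_one, Polynomial.eval_ofNat]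
  linear_combination (-(-Complex.I / (2 * η)) * (Real.exp (a * x)) * sechExp (-beta η) x *
    (beta η + 2 * th x)) * hb

theorem adjRes_coe : adjRes a η =ᵐ[volume] fun x => (Real.exp (-a * x) : ℂ) * adjMode x η := by
  have h := abs_re_beta_neg_sub_lt ha2 hν hη
  filter_upwards [psmul_coe (Polynomial.C (beta (-η)) - 𝐓) (sechTot (beta (-η) - a)),
    sechTot_coe h] with x k1 k2
  rw [adjRes, k1, k2, adjMode_eq, mul_left_comm, exp_mul_sechExp]
  congr 1
  · simp [polyFun]
  · congr 1
    push_cast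
    ring

end

theorem secLp_eq {f : ℝ × ℝ → ℂ} {x : ℝ} {u : Ltwo} (h : u =ᵐ[volume] fun y => f (x, y)) :
    secLp f x = u := by
  have hm : MemLp (fun y => f (x, y)) 2 volume := (memLp_congr_ae h).1 (Lp.memLp u)
  ext1
  exact (secLp_coe hm).trans h.symm

/-- Below the cutoff the vector is the section of an explicit jointly measurable function, so
measurability of sections applies; above it the modes need not be in L². -/
theorem stronglyMeasurable_cutoff {f : ℝ × ℝ → ℂ} (hf : StronglyMeasurable f) {u : ℝ → Ltwo} {r : ℝ}
    (h : ∀ η, |η| ≤ r → u η =ᵐ[volume] fun y => f (η, y)) :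
    StronglyMeasurable fun η => if |η| ≤ r then u η else 0 := by
  have hs : MeasurableSet {η : ℝ | |η| ≤ r} := measurableSet_le measurable_norm measurable_const
  have e : (fun η => if |η| ≤ r then u η else 0) = Set.indicator {η : ℝ | |η| ≤ r} (secLp f) := by
    funext η
    by_cases hη : |η| ≤ r
    · rw [if_pos hη, Set.indicator_of_mem (by exact hη), secLp_eq (h η hη)]
    · rw [if_neg hη, Set.indicator_of_notMem (by exact hη)]
  rw [e]
  exact (stronglyMeasurable_secLp hf).indicator hs

section
variable {η₁ η₀ : ℝ} (ha2 : a < 2) (hν : nu η₁ < a) (h₀ : η₀ ≤ |η₁|)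
include ha2 hν h₀

theorem stronglyMeasurable_resMode :
    StronglyMeasurable fun η => if |η| ≤ η₀ then resMode a η else 0 := by
  have h1 : Measurable fun z : ℝ × ℝ => (Real.exp (a * z.2) : ℂ) * mode z.2 z.1 :=
    (Continuous.measurable (by fun_prop)).mul (measurable_mode measurable_snd measurable_fst)
  refine stronglyMeasurable_cutoff h1.stronglyMeasurable fun η hη => ?_
  exact resMode_coe ha2 hν (hη.trans h₀)

theorem stronglyMeasurable_adjRes :
    StronglyMeasurable fun η => if |η| ≤ η₀ then adjRes a η else 0 := by
  have h1 : Measurable fun z : ℝ × ℝ => (Real.exp (-a * z.2) : ℂ) * adjMode z.2 z.1 :=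
    (Continuous.measurable (by fun_prop)).mul (measurable_adjMode measurable_snd measurable_fst)
  refine stronglyMeasurable_cutoff h1.stronglyMeasurable fun η hη => ?_
  exact adjRes_coe ha2 hν (hη.trans h₀)

end

/-- The even (`σ = 1`) and the odd (`σ = -1`) part of the adjoint resonant modes. -/
def adjBlock (a σ η : ℝ) : Ltwo := (1 / 2 : ℂ) • (adjRes a η + (σ : ℂ) • adjRes a (-η))

/-- The even (`σ = 1`) and the odd (`σ = -1`) part of the resonant modes. -/
def modeBlock (a σ η : ℝ) : Ltwo := resMode a η + (σ : ℂ) • resMode a (-η)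

/-- The even and the odd part of the resonant projection, cut off at the frequency `η₀`. -/
def resBlock (a η₀ σ η : ℝ) : Ltwo →L[ℂ] Ltwo :=
  if |η| ≤ η₀ then (innerSL ℂ (adjBlock a σ η)).smulRight (modeBlock a σ η) else 0

theorem resBlock_of_le {η₀ η : ℝ} (h : |η| ≤ η₀) (σ : ℝ) (x : Ltwo) :
    resBlock a η₀ σ η x = (inner ℂ (adjBlock a σ η) x : ℂ) • modeBlock a σ η := by
  rw [resBlock, if_pos h]
  rfl

theorem resBlock_of_not_le {η₀ η : ℝ} (h : ¬ |η| ≤ η₀) (σ : ℝ) (x : Ltwo) :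
    resBlock a η₀ σ η x = 0 := by
  rw [resBlock, if_neg h]
  rfl

/-- The spectral projection h⊗g + h'⊗g' splits as ½(h + h')⊗(g + g') + ½(h − h')⊗(g − g'). These are
the summands k = 1 and k = 2 of P₀. -/
theorem nonresFibre_eq (a η₀ η : ℝ) (x : Ltwo) :
    nonresFibre a η₀ η x = x - (resBlock a η₀ 1 η x + resBlock a η₀ (-1) η x) := by
  by_cases h : |η| ≤ η₀
  · rw [nonresFibre, if_pos h, resBlock_of_le h, resBlock_of_le h, sub_apply, one_apply_eq_self,
      resProj_apply]
    congr 1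
    simp only [adjBlock, modeBlock, inner_smul_left, inner_add_left, Complex.conj_ofReal]
    push_cast
    simp only [map_div₀, map_one, map_ofNat]
    module
  · rw [nonresFibre, if_neg h, resBlock_of_not_le h, resBlock_of_not_le h, one_apply_eq_self,
      add_zero, sub_zero]

section
variable {η₁ : ℝ} (ha2 : a < 2) (hν : nu η₁ < a)
include ha2 hν

theorem stronglyMeasurable_adjBlock {η₀ : ℝ} (h₀ : η₀ ≤ |η₁|) (σ : ℝ) :
    StronglyMeasurable fun ξ : ℝ => if |2 * Real.pi * ξ| ≤ η₀ then adjBlock a σ (2 * Real.pi * ξ) else 0 := by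
  have h := stronglyMeasurable_adjRes ha2 hν h₀
  have h1 := h.comp_measurable (g := fun ξ : ℝ => 2 * Real.pi * ξ) (by fun_prop)
  have h2 := h.comp_measurable (g := fun ξ : ℝ => -(2 * Real.pi * ξ)) (by fun_prop)
  convert ((h1.add (h2.const_smul (σ : ℂ))).const_smul (1 / 2 : ℂ)) using 1
  funext ξ
  by_cases hξ : |2 * Real.pi * ξ| ≤ η₀
  · simp only [Pi.add_apply, Pi.smul_apply, Function.comp_apply, abs_neg, if_pos hξ, adjBlock]
  · simp only [Pi.add_apply, Pi.smul_apply, Function.comp_apply, abs_neg, if_neg hξ, smul_zero, add_zero]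

theorem stronglyMeasurable_modeBlock {η₀ : ℝ} (h₀ : η₀ ≤ |η₁|) (σ : ℝ) :
    StronglyMeasurable fun ξ : ℝ => if |2 * Real.pi * ξ| ≤ η₀ then modeBlock a σ (2 * Real.pi * ξ) else 0 := by
  have h := stronglyMeasurable_resMode ha2 hν h₀
  have h1 := h.comp_measurable (g := fun ξ : ℝ => 2 * Real.pi * ξ) (by fun_prop)
  have h2 := h.comp_measurable (g := fun ξ : ℝ => -(2 * Real.pi * ξ)) (by fun_prop)
  convert (h1.add (h2.const_smul (σ : ℂ))) using 1
  funext ξ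
  by_cases hξ : |2 * Real.pi * ξ| ≤ η₀
  · simp only [Pi.add_apply, Pi.smul_apply, Function.comp_apply, abs_neg, if_pos hξ, modeBlock]
  · simp only [Pi.add_apply, Pi.smul_apply, Function.comp_apply, abs_neg, if_neg hξ, smul_zero, add_zero]

/-- In the even block both factors are bounded. In the odd block the adjoint factor is O(|η|),
against O(|η|⁻¹) for the mode factor. Frequency zero is a null set. -/
theorem exists_isBddFamily_resBlock {η₀ : ℝ} (h₀ : η₀ ≤ |η₁|) {σ : ℝ} (hσ : σ = 1 ∨ σ = -1) :
    ∃ C, IsBddFamily (fun ξ => resBlock a η₀ σ (2 * Real.pi * ξ)) C := by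
  obtain ⟨C, hC, hb⟩ := exists_res_bounds ha2 hν
  have key : ∀ η : ℝ, η ≠ 0 → |η| ≤ |η₁| → ‖adjBlock a σ η‖ * ‖modeBlock a σ η‖ ≤ C * C := by
    intro η hη hη1
    obtain ⟨b1, b2, b3, b4⟩ := hb η hη hη1
    obtain ⟨c1, c2, c3, c4⟩ := hb (-η) (neg_ne_zero.2 hη) (by rwa [abs_neg])
    have hpos : 0 < |η| := abs_pos.2 hη
    have hn : ∀ z : Ltwo, ‖(1 / 2 : ℂ) • z‖ = 1 / 2 * ‖z‖ := fun z => by rw [norm_smul]; norm_num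
    rcases hσ with rfl | rfl
    · rw [adjBlock, modeBlock, hn]
      simp only [Complex.ofReal_one, one_smul]
      refine mul_le_mul ?_ b3 (norm_nonneg _) hC
      have := norm_add_le (adjRes a η) (adjRes a (-η))
      linarith
    · rw [adjBlock, modeBlock, hn]
      simp only [Complex.ofReal_neg, Complex.ofReal_one, neg_smul, one_smul, ← sub_eq_add_neg]
      have h1 := norm_sub_le (resMode a η) (resMode a (-η))
      rw [abs_neg] at c1
      have h2 : |η| * ‖resMode a η - resMode a (-η)‖ ≤ 2 * C := by
        have := mul_le_mul_of_nonneg_left h1 hpos.le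
        linarith
      calc 1 / 2 * ‖adjRes a η - adjRes a (-η)‖ * ‖resMode a η - resMode a (-η)‖
          ≤ 1 / 2 * (C * |η|) * ‖resMode a η - resMode a (-η)‖ := by gcongr
        _ = 1 / 2 * C * (|η| * ‖resMode a η - resMode a (-η)‖) := by ring
        _ ≤ 1 / 2 * C * (2 * C) := by gcongr
        _ = C * C := by ring
  refine ⟨C * C, fun x => ?_, ?_⟩
  · have h := ((stronglyMeasurable_adjBlock ha2 hν h₀ σ).inner (𝕜 := ℂ)
      (stronglyMeasurable_const (b := x))).smul (stronglyMeasurable_modeBlock ha2 hν h₀ σ)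
    convert h using 1
    funext ξ
    by_cases hξ : |2 * Real.pi * ξ| ≤ η₀
    · rw [resBlock_of_le hξ, Pi.smul_apply', if_pos hξ, if_pos hξ]
    · rw [resBlock_of_not_le hξ, Pi.smul_apply', if_neg hξ, if_neg hξ, smul_zero]
  · have h0 : ∀ᵐ ξ : ℝ, ξ ≠ 0 := by simp [ae_iff]
    filter_upwards [h0] with ξ hξ0 x
    by_cases hξ : |2 * Real.pi * ξ| ≤ η₀
    · rw [resBlock_of_le hξ, norm_smul]
      have := key (2 * Real.pi * ξ) (by have := Real.pi_ne_zero; positivity) (hξ.trans h₀)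
      calc _ ≤ ‖adjBlock a σ (2 * Real.pi * ξ)‖ * ‖x‖ * ‖modeBlock a σ (2 * Real.pi * ξ)‖ := by
            gcongr
            exact norm_inner_le_norm _ _
        _ = ‖adjBlock a σ (2 * Real.pi * ξ)‖ * ‖modeBlock a σ (2 * Real.pi * ξ)‖ * ‖x‖ := by ring
        _ ≤ _ := by gcongr
    · rw [resBlock_of_not_le hξ, norm_zero]
      positivity

end

end KPII

namespace KPII

/-! ### The spectral projections -/

variable {a : ℝ}

theorem ae_comp_div_two_pi {p : ℝ → Prop} (h : ∀ᵐ ξ, p ξ) : ∀ᵐ η : ℝ, p (η / (2 * Real.pi)) := by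
  have h2 : (2 * Real.pi)⁻¹ ≠ 0 := by have := Real.pi_ne_zero; positivity
  have hq : Measure.QuasiMeasurePreserving (fun η : ℝ => η * (2 * Real.pi)⁻¹) volume volume :=
    ⟨by fun_prop, by rw [Real.map_volume_mul_right h2]; exact Measure.smul_absolutelyContinuous⟩
  exact hq.ae h

/-- The partial Fourier transform. -/
def partialFourier (f : X a) (z : ℝ × ℝ) : ℂ := (Real.sqrt (2 * Real.pi) : ℂ)⁻¹ *
  (wt (-a) z * actSnd fourierL (wtLI a f) (z.1, z.2 / (2 * Real.pi)))

theorem isPartialFourier_partialFourier (f : X a) : IsPartialFourier f (partialFourier f) := by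
  refine ⟨?_, ?_⟩
  · refine (StronglyMeasurable.mul (continuous_wt (-a)).stronglyMeasurable ?_).aestronglyMeasurable.const_mul _
    exact (Lp.stronglyMeasurable _).comp_measurable (by fun_prop)
  · filter_upwards [Measure.ae_ae_of_ae_prod (ae_eq_wtLI f), curryL_coe (wtLI a f),
      curryL_coe (actSnd fourierL (wtLI a f)), curryL_actSnd fourierL (wtLI a f)] with x h1 h2 h3 h4
    obtain ⟨c, hc⟩ : ∃ c : ℂ, c = (Real.exp (-a * x) : ℂ) := ⟨_, rfl⟩
    have e : (fun y => f (x, y)) =ᵐ[volume] (c • curryL (wtLI a f) x : Ltwo) := by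
      filter_upwards [h1, h2, Lp.coeFn_smul c (curryL (wtLI a f) x)] with y k1 k2 k3
      rw [k1, k3, Pi.smul_apply, k2, hc, smul_eq_mul]
      rfl
    have hm : MemLp (fun y => f (x, y)) 2 volume := (memLp_congr_ae e).2 (Lp.memLp _)
    refine ⟨hm, ?_⟩
    have e2 : hm.toLp _ = c • curryL (wtLI a f) x := by
      ext1
      exact hm.coeFn_toLp.trans e
    rw [e2, show 𝓕 (c • curryL (wtLI a f) x) = c • 𝓕 (curryL (wtLI a f) x) from
      map_smul (Lp.fourierTransformₗᵢ ℝ ℂ) c _]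
    rw [h4, fourierL_apply] at h3
    refine (ae_comp_div_two_pi ((Lp.coeFn_smul c (𝓕 (curryL (wtLI a f) x))).and h3)).mono fun η hη => ?_
    rw [hη.1, Pi.smul_apply, hη.2, partialFourier, hc]
    rfl

theorem isBandProjection_id : IsBandProjection a 0 ⊤ (ContinuousLinearMap.id ℂ (X a)) := fun f =>
  ⟨partialFourier f, partialFourier f, isPartialFourier_partialFourier f,
    isPartialFourier_partialFourier f, Eventually.of_forall fun z => by
      rw [Set.indicator_of_mem]
      exact ⟨abs_nonneg _, le_top⟩⟩

/-- The operator on the weighted space with the given fibres. -/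
def ofFibres {T : ℝ → Ltwo →L[ℂ] Ltwo} {C : ℝ} (hT : IsBddFamily T C) : X a →L[ℂ] X a :=
  (freqL a).symm.toContinuousLinearEquiv.toContinuousLinearMap ∘L decomp hT ∘L
    (freqL a).toContinuousLinearEquiv.toContinuousLinearMap

theorem freqL_ofFibres {T : ℝ → Ltwo →L[ℂ] Ltwo} {C : ℝ} (hT : IsBddFamily T C) (f : X a) :
    freqL a (ofFibres hT f) = decomp hT (freqL a f) := (freqL a).apply_symm_apply _

section
variable {η₁ : ℝ} (ha2 : a < 2) (hν : nu η₁ < a)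
include ha2 hν

theorem adjBlock_coe {η : ℝ} (hη : |η| ≤ |η₁|) (σ : ℝ) : adjBlock a σ η =ᵐ[volume] fun x =>
    1 / 2 * ((Real.exp (-a * x) : ℂ) * (adjMode x η + σ * adjMode x (-η))) := by
  filter_upwards [Lp.coeFn_smul (1 / 2 : ℂ) (adjRes a η + (σ : ℂ) • adjRes a (-η)),
    Lp.coeFn_add (adjRes a η) ((σ : ℂ) • adjRes a (-η)), Lp.coeFn_smul (σ : ℂ) (adjRes a (-η)),
    adjRes_coe ha2 hν hη, adjRes_coe ha2 hν (η := -η) (by rwa [abs_neg])] with x k1 k2 k3 k4 k5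
  rw [adjBlock, k1, Pi.smul_apply, k2, Pi.add_apply, k3, Pi.smul_apply, k4, k5, smul_eq_mul, smul_eq_mul]
  ring

theorem modeBlock_coe {η : ℝ} (hη : |η| ≤ |η₁|) (σ : ℝ) : modeBlock a σ η =ᵐ[volume] fun x =>
    (Real.exp (a * x) : ℂ) * (mode x η + σ * mode x (-η)) := by
  filter_upwards [Lp.coeFn_add (resMode a η) ((σ : ℂ) • resMode a (-η)),
    Lp.coeFn_smul (σ : ℂ) (resMode a (-η)), resMode_coe ha2 hν hη,
    resMode_coe ha2 hν (η := -η) (by rwa [abs_neg])] with x k2 k3 k4 k5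
  rw [modeBlock, k2, Pi.add_apply, k3, Pi.smul_apply, k4, k5, smul_eq_mul]
  ring

/-- The weights e^{ax} and e^{−ax} cancel, √(2π) cancels the normalization of the transform, and the
2 undoes the ½ in `adjBlock`. -/
theorem coeff_eq (f : X a) : ∀ᵐ η : ℝ, |η| ≤ |η₁| → ∀ (gs : ℝ → ℝ → ℂ) (s : ℂ) (σ : ℝ),
    (∀ x, gs x η = s * (adjMode x η + σ * adjMode x (-η))) →
    coeff gs (partialFourier f) η =
      (starRingEnd ℂ) s * 2 * inner ℂ (adjBlock a σ η) (freqL a f (η / (2 * Real.pi))) := by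
  filter_upwards [ae_comp_div_two_pi (freqL_coe f)] with η hf hη gs s σ hgs
  rw [coeff, L2.inner_def, ← integral_const_mul, ← integral_const_mul]
  refine integral_congr_ae ?_
  filter_upwards [hf, adjBlock_coe ha2 hν hη σ] with x k1 k2
  have hpi : (Real.sqrt (2 * Real.pi) : ℂ) ≠ 0 :=
    Complex.ofReal_ne_zero.2 (Real.sqrt_ne_zero'.2 (by have := Real.pi_pos; positivity))
  rw [RCLike.inner_apply, k1, k2, hgs, partialFourier, ← mul_assoc, ← mul_assoc, mul_inv_cancel₀ hpi]
  simp only [map_mul, Complex.conj_ofReal, map_div₀, map_one, map_ofNat, wt]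
  ring

/-- Fourier inversion in y for a function with compactly supported transverse transform; the
substitution η = 2πξ gives the prefactor 1/(2π). -/
theorem ofFibres_resBlock {η₀ : ℝ} (hη₀ : 0 ≤ η₀) (h₀ : η₀ ≤ |η₁|) {σ C : ℝ}
    (hB : IsBddFamily (fun ξ => resBlock a η₀ σ (2 * Real.pi * ξ)) C) (f : X a) :
    ∀ᵐ z : ℝ × ℝ, ofFibres hB f z = ((2 * Real.pi : ℝ) : ℂ)⁻¹ * ∫ η in (-η₀)..η₀,
      inner ℂ (adjBlock a σ η) (freqL a f (η / (2 * Real.pi))) * (mode z.1 η + σ * mode z.1 (-η)) *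
        Complex.exp (Complex.I * (z.2 : ℂ) * (η : ℂ)) := by
  have hpi := Real.pi_pos
  have h2pi : 0 < 2 * Real.pi := by positivity
  obtain ⟨k, hkdef⟩ : ∃ k : ℝ × ℝ → ℂ, k = fun z => inner ℂ
    (if |2 * Real.pi * z.2| ≤ η₀ then adjBlock a σ (2 * Real.pi * z.2) else 0) (freqL a f z.2) *
      ((Real.exp (a * z.1) : ℂ) *
        (mode z.1 (2 * Real.pi * z.2) + σ * mode z.1 (-(2 * Real.pi * z.2)))) := ⟨_, rfl⟩
  have hk : StronglyMeasurable k := by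
    rw [hkdef]
    refine StronglyMeasurable.mul ?_ (Measurable.stronglyMeasurable ?_)
    · exact ((stronglyMeasurable_adjBlock ha2 hν h₀ σ).inner (𝕜 := ℂ)
        (Lp.stronglyMeasurable (freqL a f))).comp_measurable measurable_snd
    · exact (Continuous.measurable (by fun_prop)).mul ((measurable_mode measurable_fst (by fun_prop)).add
        ((measurable_mode measurable_fst (by fun_prop)).const_mul _))
  have he : ∀ᵐ ξ, planeFreq (wtLI a (ofFibres hB f)) ξ =ᵐ[volume] fun x => k (x, ξ) := by
    rw [planeFreq_wtLI, freqL_ofFibres]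
    filter_upwards [decomp_coe hB (freqL a f)] with ξ hξ
    rw [hξ]
    by_cases h : |2 * Real.pi * ξ| ≤ η₀
    · rw [resBlock_of_le h]
      filter_upwards [Lp.coeFn_smul (inner ℂ (adjBlock a σ (2 * Real.pi * ξ)) (freqL a f ξ))
        (modeBlock a σ (2 * Real.pi * ξ)), modeBlock_coe ha2 hν (h.trans h₀) σ] with x k1 k2
      rw [k1, Pi.smul_apply, k2, hkdef, smul_eq_mul]
      simp only [if_pos h]
    · rw [resBlock_of_not_le h]
      filter_upwards [Lp.coeFn_zero ℂ 2 (volume : Measure ℝ)] with x k1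
      rw [k1, hkdef]
      simp only [if_neg h, inner_zero_left, zero_mul, Pi.zero_apply]
  have hs : ∀ x ξ, η₀ / (2 * Real.pi) < |ξ| → k (x, ξ) = 0 := fun x ξ h => by
    have : ¬ |2 * Real.pi * ξ| ≤ η₀ := by
      rw [abs_mul, abs_of_pos h2pi, not_le, mul_comm]
      exact (div_lt_iff₀ h2pi).1 h
    rw [hkdef]
    simp only [if_neg this, inner_zero_left, zero_mul]
  filter_upwards [eq_integral_of_planeFreq hk he hs, ae_eq_wtLI (ofFibres hB f)] with z k1 k2
  rw [k2, k1, ← integral_const_mul]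
  obtain ⟨G, hG⟩ : ∃ G : ℝ → ℂ, G = fun η => inner ℂ (adjBlock a σ η) (freqL a f (η / (2 * Real.pi))) *
    (mode z.1 η + σ * mode z.1 (-η)) * Complex.exp (Complex.I * (z.2 : ℂ) * (η : ℂ)) := ⟨_, rfl⟩
  have e : ∀ ξ : ℝ, wt (-a) z * (Complex.exp (2 * Real.pi * z.2 * ξ * Complex.I) * k (z.1, ξ)) =
      Set.indicator (Set.Icc (-η₀) η₀) G (2 * Real.pi * ξ) := fun ξ => by
    by_cases h : |2 * Real.pi * ξ| ≤ η₀
    · have hmem : 2 * Real.pi * ξ ∈ Set.Icc (-η₀) η₀ := abs_le.1 h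
      rw [Set.indicator_of_mem hmem, hG, hkdef]
      have hw : (Real.exp (-a * z.1) : ℂ) * (Real.exp (a * z.1) : ℂ) = 1 := by
        rw [← Complex.ofReal_mul, ← Real.exp_add]
        simp
      have hx : (2 * Real.pi * z.2 * ξ * Complex.I : ℂ) =
          Complex.I * (z.2 : ℂ) * ((2 * Real.pi * ξ : ℝ) : ℂ) := by
        push_cast
        ring
      simp only [if_pos h, wt, hx, mul_div_cancel_left₀ ξ h2pi.ne']
      linear_combination (Complex.exp (Complex.I * (z.2 : ℂ) * ((2 * Real.pi * ξ : ℝ) : ℂ)) *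
        inner ℂ (adjBlock a σ (2 * Real.pi * ξ)) (freqL a f ξ) *
        (mode z.1 (2 * Real.pi * ξ) + σ * mode z.1 (-(2 * Real.pi * ξ)))) * hw
    · have hmem : 2 * Real.pi * ξ ∉ Set.Icc (-η₀) η₀ := fun h' => h (abs_le.2 h')
      rw [Set.indicator_of_notMem hmem, hkdef]
      simp only [if_neg h, inner_zero_left, zero_mul, mul_zero]
  simp only [e]
  rw [Measure.integral_comp_mul_left, integral_indicator measurableSet_Icc, integral_Icc_eq_integral_Ioc,
    intervalIntegral.integral_of_le (by linarith), abs_of_pos (inv_pos.2 h2pi), Complex.real_smul,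
    Complex.ofReal_inv, hG]

/-- The two parts of the resonant projection add up to the operator `P₀(η₀)`. -/
theorem isResonantProjection_ofFibres {η₀ : ℝ} (hη₀ : 0 ≤ η₀) (h₀ : η₀ ≤ |η₁|) {C C' : ℝ}
    (hB : IsBddFamily (fun ξ => resBlock a η₀ 1 (2 * Real.pi * ξ)) C)
    (hB' : IsBddFamily (fun ξ => resBlock a η₀ (-1) (2 * Real.pi * ξ)) C') :
    IsResonantProjection a η₀ (ofFibres hB + ofFibres hB') := by
  intro f
  refine ⟨partialFourier f, isPartialFourier_partialFourier f, ?_⟩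
  filter_upwards [ofFibres_resBlock ha2 hν hη₀ h₀ hB f, ofFibres_resBlock ha2 hν hη₀ h₀ hB' f,
    ae_weight_iff.1 (Lp.coeFn_add (ofFibres hB f) (ofFibres hB' f))] with z k1 k2 k3
  have hle : -η₀ ≤ η₀ := by linarith
  rw [add_apply, k3, Pi.add_apply, k1, k2, ← mul_add]
  congr 2
  · refine intervalIntegral.integral_congr_ae ?_
    filter_upwards [coeff_eq ha2 hν f] with η hη hmem
    rw [Set.uIoc_of_le hle] at hmem
    rw [hη ((abs_le.2 ⟨hmem.1.le, hmem.2⟩).trans h₀) g1star (1 / 2) 1 (fun x => by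
      rw [g1star, Complex.ofReal_one, one_mul]), g1, Complex.ofReal_one, one_mul]
    simp only [map_div₀, map_one, map_ofNat]
    norm_num
  · refine intervalIntegral.integral_congr_ae ?_
    have h0 : ∀ᵐ η : ℝ, η ≠ 0 := by simp [ae_iff]
    filter_upwards [coeff_eq ha2 hν f, h0] with η hη hne hmem
    rw [Set.uIoc_of_le hle] at hmem
    have hne' : (η : ℂ) ≠ 0 := Complex.ofReal_ne_zero.2 hne
    -- The conjugate of i/(2η), the factor 2 and the iη contained in g₂ multiply to 1.
    rw [hη ((abs_le.2 ⟨hmem.1.le, hmem.2⟩).trans h₀) g2star (Complex.I / (2 * η)) (-1) (fun x => by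
      rw [g2star]
      push_cast
      ring), g2]
    simp only [map_div₀, map_mul, Complex.conj_I, Complex.conj_ofReal, map_ofNat]
    push_cast
    field_simp
    linear_combination (inner ℂ (adjBlock a (-1) η) (freqL a f (η / (2 * Real.pi))) *
      (mode z.1 η - mode z.1 (-η))) * Complex.I_sq

end

theorem norm_le_of_ae_norm_le {F G : LtwoLtwo} {c : ℝ} (h : ∀ᵐ ξ, ‖F ξ‖ ≤ c * ‖G ξ‖) :
    ‖F‖ ≤ c * ‖G‖ := Lp.norm_le_mul_norm_of_ae_le_mul h

/-- Semigroup estimate for the linearized KP-II equation. -/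
theorem exists_semigroup_decay (a : ℝ) (ha : 0 < a) (ha2 : a < 2)
    (η₁ : ℝ) (hη₁ : 0 < η₁) (hν : nu η₁ < a) :
    ∃ S : ℝ≥0 → X a →L[ℂ] X a, IsLinearizedKPSemigroup a S ∧
      ∃ K b : ℝ, 0 < K ∧ 0 < b ∧
        ∀ η₀ : ℝ, 0 < η₀ → η₀ ≤ η₁ →
          ∃ P₂ : X a →L[ℂ] X a, IsNonresonantProjection a η₀ ⊤ P₂ ∧
            ∀ (f : X a) (t : ℝ≥0),
              ‖S t (P₂ f)‖ ≤
                K * (η₀⁻¹ * Real.exp ((lam η₀).re * (t : ℝ)) + Real.exp (-b * (t : ℝ))) *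
                  ‖f‖ := by
  refine ⟨kpSemigroup ha ha2, isLinearizedKPSemigroup ha ha2, ?_⟩
  obtain ⟨K, b, hK, hb, hdecay⟩ := exists_fibre_decay ha ha2 hη₁ hν
  refine ⟨K, b, hK, hb, fun η₀ hη₀ hle => ?_⟩
  have h₀ : η₀ ≤ |η₁| := hle.trans (le_abs_self η₁)
  obtain ⟨C, hB⟩ := exists_isBddFamily_resBlock ha2 hν h₀ (Or.inl rfl)
  obtain ⟨C', hB'⟩ := exists_isBddFamily_resBlock ha2 hν h₀ (Or.inr rfl)
  -- The band of all frequencies is the identity, so P₂ acts on each fibre as `nonresFibre` and the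
  -- norm estimate is fibrewise.
  refine ⟨ContinuousLinearMap.id ℂ _ - (ofFibres hB + ofFibres hB'), ⟨_, _, isBandProjection_id,
    isResonantProjection_ofFibres ha2 hν hη₀.le h₀ hB hB', rfl⟩, fun f t => ?_⟩
  rw [← (freqL a).norm_map, ← (freqL a).norm_map f, freqL_kpSemigroup]
  refine norm_le_of_ae_norm_le ?_
  have e : freqL a (((ContinuousLinearMap.id ℂ (X a) - (ofFibres hB + ofFibres hB')) : X a →L[ℂ] X a) f) =
      freqL a f - (decomp hB (freqL a f) + decomp hB' (freqL a f)) := by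
    rw [sub_apply, add_apply, map_sub, map_add, freqL_ofFibres, freqL_ofFibres]
    rfl
  rw [e]
  have h0 : ∀ᵐ ξ : ℝ, ξ ≠ 0 := by simp [ae_iff]
  filter_upwards [freqSemigroup_coe ha ha2 t (freqL a f - (decomp hB (freqL a f) + decomp hB' (freqL a f))),
    Lp.coeFn_sub (freqL a f) (decomp hB (freqL a f) + decomp hB' (freqL a f)),
    Lp.coeFn_add (decomp hB (freqL a f)) (decomp hB' (freqL a f)), decomp_coe hB (freqL a f),
    decomp_coe hB' (freqL a f), h0] with ξ k1 k2 k3 k4 k5 k6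
  rw [k1, k2, Pi.sub_apply, k3, Pi.add_apply, k4, k5, ← nonresFibre_eq]
  exact hdecay η₀ hη₀ hle _ (by have := Real.pi_ne_zero; positivity) t t.coe_nonneg _

end KPII

end

theorem proposition3p1 (a : ℝ) (ha : 0 < a) (ha2 : a < 2)
    (η₁ : ℝ) (hη₁ : 0 < η₁) (hν : KPII.nu η₁ < a) :
    ∃ S : ℝ≥0 → KPII.X a →L[ℂ] KPII.X a, KPII.IsLinearizedKPSemigroup a S ∧
      ∃ K b : ℝ, 0 < K ∧ 0 < b ∧
        ∀ η₀ : ℝ, 0 < η₀ → η₀ ≤ η₁ →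
          ∃ P₂ : KPII.X a →L[ℂ] KPII.X a, KPII.IsNonresonantProjection a η₀ ⊤ P₂ ∧
            ∀ (f : KPII.X a) (t : ℝ≥0),
              ‖S t (P₂ f)‖ ≤
                K * (η₀⁻¹ * Real.exp ((KPII.lam η₀).re * (t : ℝ)) + Real.exp (-b * (t : ℝ))) *
                  ‖f‖ :=
  KPII.exists_semigroup_decay a ha ha2 η₁ hη₁ hν
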